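/- Let $k$ be an algebraically closed field of characteristic $p>0$ and let $\mathbb F$ be an algebraically closed field of characteristic $0$. A $p$-permutation $kG$-module, for a finite group $G$, is a direct summand of a permutation module $kX$, with $X$ a finite $G$-set; $T(G)$ denotes the Grothendieck group of these modules with respect to direct sums. For finite groups $G,H$, let $T^\Delta(G,H)$ be the Grothendieck group (with respect to direct sums) of diagonal $p$-permutation $(kG,kH)$-bimodules, that is, of $p$-permutation $(kG,kH)$-bimodules which are projective as left $kG$-modules and as right $kH$-modules. Write $\mathbb FT(G)=\mathbb F\otimes_{\mathbb Z}T(G)$ and $\mathbb FT^\Delta(G,H)=\mathbb F\otimes_{\mathbb Z}T^\Delta(G,H)$. Let $\mathbb Fpp_k^\Delta$ be the $\mathbb F$-linear category whose objects are the finite groups, in which the morphisms from $G$ to $H$ are the elements of $\mathbb FT^\Delta(H,G)$, and composition is induced by the tensor product of bimodules. A diagonal $p$-permutation functor over $\mathbb F$ is an $\mathbb F$-linear functor from $\mathbb Fpp_k^\Delta$ to the category of $\mathbb F$-vector spaces; with natural transformations, these form a category $\mathcal F$. A $D^\Delta$-pair $(L,u)$ consists of a finite $p$-group $L$ and a generator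 $u$ of a cyclic $p'$-group $\langle u\rangle$ acting faithfully on $L$. Put $L\langle u\rangle=L\rtimes\langle u\rangle$, let $\mathrm{Aut}(L,u)$ be the group of automorphisms of $L\langle u\rangle$ sending $u$ to a conjugate of $u$, and let $\mathrm{Out}(L,u)=\mathrm{Aut}(L,u)/\mathrm{Inn}(L\langle u\rangle)$. Consider triples $(L,u,V)$, where $(L,u)$ is a $D^\Delta$-pair and $V$ is a simple $\mathbb F\mathrm{Out}(L,u)$-module. An isomorphism $(L,u,V)\to(M,v,W)$ is a group isomorphism $f:L\langle u\rangle\to M\langle v\rangle$ sending $u$ to a conjugate of $v$, together with a linear isomorphism $V\to W$ compatible with the induced isomorphism $\mathrm{Out}(L,u)\to\mathrm{Out}(M,v)$, $\gamma\mapsto f\gamma f^{-1}$. Fix an embedding $\theta$ of the group of roots of unity of $k$ into $\mathbb F^\times$, with respect to which Brauer characters are formed. For a $p$-subgroup $Q$ of a finite group $G$ and a $p'$-element $t$ of $N_G(Q)$, let $\tau_{Q,t}:\mathbb FT(G)\to\mathbb F$ be the linear map sending a $p$-permutation module $M$ to the value at $t$ of the Brauer character of the Brauer quotient $M[Q]$.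 For a $p$-subgroup $P$ and a $p'$-element $s\in N_G(P)$, let $F^G_{P,s}\in\mathbb FT(G)$ be the idempotent with $\tau_{Q,t}(F^G_{P,s})=1$ if $(Q,t)$ is $G$-conjugate to $(P,s)$, and $0$ otherwise; let $\widetilde{F^G_{P,s}}\in\mathbb FT^\Delta(G,G)$ be its image under the linear map induced by $W\mapsto\mathrm{Ind}_{\Delta G}^{G\times G}W$, where $\Delta G\cong G$ is the diagonal subgroup of $G\times G$. For an automorphism $\gamma$ of $G$, let $kG_\gamma$ be the $(kG,kG)$-bimodule $kG$ with $a\cdot x\cdot b=a\,x\,\gamma(b)$. Theorem. (1) The category $\mathcal F$ of diagonal $p$-permutation functors over $\mathbb F$ is semisimple: it is abelian and each of its objects is a (possibly infinite) direct sum of simple objects. (2) The simple diagonal $p$-permutation functors, up to isomorphism, are parametrized by the isomorphism classes of triples $(L,u,V)$. More precisely, for every $\theta$ there is a bijection from the set of isomorphism classes of triples to the set of isomorphism classes of simple diagonal $p$-permutation functors under which $(L,u,V)$ corresponds to a simple functor $S$ if and only if the subspace $S\big(\widetilde{F^{L\langle u\rangle}_{L,u}}\big)\big(S(L\langle u\rangle)\big)$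 of $S(L\langle u\rangle)$, on which the class in $\mathrm{Out}(L,u)$ of $\gamma\in\mathrm{Aut}(L,u)$ acts as the map $S(k(L\langle u\rangle)_\gamma)$, is isomorphic to $V$ as an $\mathbb F\mathrm{Out}(L,u)$-module. -/

import Mathlib

open CategoryTheory
open scoped TensorProduct MonoidAlgebra

universe u v w w'

noncomputable section

namespace DiagPPerm

/-! ## Isomorphism classes of finite dimensional representations -/

section IsoClasses

variable (k : Type u) [Field k] (Γ : Type) [Group Γ]

/-- Finite dimensional representations of `Γ` over `k`, on the coordinate spaces `k ^ n`. -/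
abbrev CoordRep : Type u := Σ n : ℕ, Representation k Γ (Fin n → k)

/-- Isomorphism of representations, as an equivalence relation. -/
instance coordRepSetoid : Setoid (CoordRep k Γ) where
  r x y := Nonempty (x.2.Equiv y.2)
  iseqv := ⟨fun x => ⟨.refl x.2⟩, fun ⟨e⟩ => ⟨e.symm⟩, fun ⟨e⟩ ⟨f⟩ => ⟨e.trans f⟩⟩

/-- The set of isomorphism classes of finite dimensional `kΓ`-modules. -/
def IsoClass : Type u := Quotient (coordRepSetoid k Γ)

variable {k Γ}

/-- Transport of a representation along a linear isomorphism. -/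
def transport {V : Type w} {W : Type w'} [AddCommGroup V] [Module k V] [AddCommGroup W]
    [Module k W] (e : V ≃ₗ[k] W) (ρ : Representation k Γ V) : Representation k Γ W where
  toFun g := e.conj (ρ g)
  map_one' := by ext; simp [LinearEquiv.conj_apply]
  map_mul' g h := by ext; simp [LinearEquiv.conj_apply]

/-- A representation is isomorphic to its transports. -/
def transportEquiv {V : Type w} {W : Type w'} [AddCommGroup V] [Module k V] [AddCommGroup W]
    [Module k W] (e : V ≃ₗ[k] W) (ρ : Representation k Γ V) : ρ.Equiv (transport e ρ) :=
  .mk e fun g => by ext; simp [transport, LinearEquiv.conj_apply]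

/-- The isomorphism class of a finite dimensional representation. -/
def cls {V : Type w} [AddCommGroup V] [Module k V] [Module.Finite k V]
    (ρ : Representation k Γ V) : IsoClass k Γ :=
  Quotient.mk _ ⟨Module.finrank k V, transport (Module.finBasis k V).equivFun ρ⟩

theorem cls_eq_iff {V : Type w} {W : Type w'} [AddCommGroup V] [Module k V] [Module.Finite k V]
    [AddCommGroup W] [Module k W] [Module.Finite k W]
    (ρ : Representation k Γ V) (σ : Representation k Γ W) :
    cls ρ = cls σ ↔ Nonempty (ρ.Equiv σ) := by
  refine Quotient.eq.trans ⟨fun ⟨e⟩ => ?_, fun ⟨e⟩ => ?_⟩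
  · exact ⟨((transportEquiv _ ρ).trans e).trans (transportEquiv _ σ).symm⟩
  · exact ⟨((transportEquiv _ ρ).symm.trans e).trans (transportEquiv _ σ)⟩

theorem mk_eq_cls (x : CoordRep k Γ) : (Quotient.mk _ x : IsoClass k Γ) = cls x.2 :=
  Quotient.sound ⟨transportEquiv _ x.2⟩

theorem IsoClass.ind {motive : IsoClass k Γ → Prop}
    (h : ∀ (n : ℕ) (ρ : Representation k Γ (Fin n → k)), motive (cls ρ)) (x : IsoClass k Γ) :
    motive x := by
  induction x using Quotient.inductionOn with
  | h x => rw [mk_eq_cls]; exact h _ _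

/-- The product of isomorphisms. -/
def prodEquiv {V V' W W' : Type*}
    [AddCommGroup V] [Module k V] [AddCommGroup V'] [Module k V']
    [AddCommGroup W] [Module k W] [AddCommGroup W'] [Module k W']
    {ρ : Representation k Γ V} {ρ' : Representation k Γ V'}
    {σ : Representation k Γ W} {σ' : Representation k Γ W'}
    (e : ρ.Equiv ρ') (f : σ.Equiv σ') : (ρ.prod σ).Equiv (ρ'.prod σ') :=
  .mk (e.toLinearEquiv.prodCongr f.toLinearEquiv) fun g => by
    refine LinearMap.ext fun x => Prod.ext ?_ ?_
    · exact e.toIntertwiningMap.isIntertwining _ _ g x.1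
    · exact f.toIntertwiningMap.isIntertwining _ _ g x.2

/-- Direct sum of isomorphism classes. -/
instance : Add (IsoClass k Γ) where
  add := Quotient.lift₂ (fun x y => cls (x.2.prod y.2)) fun _ _ _ _ ⟨e⟩ ⟨f⟩ =>
    (cls_eq_iff _ _).2 ⟨prodEquiv e f⟩

theorem cls_add {V : Type w} {W : Type w'} [AddCommGroup V] [Module k V] [Module.Finite k V]
    [AddCommGroup W] [Module k W] [Module.Finite k W]
    (ρ : Representation k Γ V) (σ : Representation k Γ W) :
    cls ρ + cls σ = cls (ρ.prod σ) :=
  (cls_eq_iff _ _).2 ⟨prodEquiv (transportEquiv _ ρ).symm (transportEquiv _ σ).symm⟩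

instance : Zero (IsoClass k Γ) where
  zero := cls (1 : Representation k Γ (Fin 0 → k))

theorem cls_eq_zero {V : Type w} [AddCommGroup V] [Module k V] [Module.Finite k V]
    [Subsingleton V] (ρ : Representation k Γ V) : cls ρ = 0 :=
  (cls_eq_iff _ _).2 ⟨.mk (0 : V ≃ₗ[k] (Fin 0 → k)) fun _ => Subsingleton.elim _ _⟩

/-- Isomorphism classes form a commutative monoid under direct sum. -/
instance : AddCommMonoid (IsoClass k Γ) where
  add_assoc x y z := by
    induction x using IsoClass.ind with | h _ ρ
    induction y using IsoClass.ind with | h _ σ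
    induction z using IsoClass.ind with | h _ τ
    rw [cls_add, cls_add, cls_add, cls_add]
    exact (cls_eq_iff _ _).2 ⟨.mk (LinearEquiv.prodAssoc k _ _ _) fun g => rfl⟩
  zero_add x := by
    induction x using IsoClass.ind with | h _ ρ
    rw [← cls_eq_zero (1 : Representation k Γ (Fin 0 → k)), cls_add]
    exact (cls_eq_iff _ _).2 ⟨.mk LinearEquiv.uniqueProd fun g => rfl⟩
  add_zero x := by
    induction x using IsoClass.ind with | h _ ρ
    rw [← cls_eq_zero (1 : Representation k Γ (Fin 0 → k)), cls_add]
    exact (cls_eq_iff _ _).2 ⟨.mk LinearEquiv.prodUnique fun g => rfl⟩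
  add_comm x y := by
    induction x using IsoClass.ind with | h _ ρ
    induction y using IsoClass.ind with | h _ σ
    rw [cls_add, cls_add]
    exact (cls_eq_iff _ _).2 ⟨.mk (LinearEquiv.prodComm k _ _) fun g => rfl⟩
  nsmul := nsmulRec

end IsoClasses

/-! ## p-permutation modules -/

section PPermutation

variable {k : Type u} [Field k] {Γ : Type} [Group Γ]

/-- A `kΓ`-module is a `p`-permutation module if it is (isomorphic to) a direct summand of the
permutation module `kX` of some finite `Γ`-set `X`. -/
def IsPPermutation {V : Type w} [AddCommGroup V] [Module k V] (ρ : Representation k Γ V) : Prop :=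
  ∃ (X : Type) (_ : Finite X) (_ : MulAction Γ X)
    (i : ρ.IntertwiningMap (Representation.ofMulAction k Γ X))
    (r : (Representation.ofMulAction k Γ X).IntertwiningMap ρ),
    r.comp i = .id ρ

/-- Reformulation by dual systems indexed by a finite `Γ`-set. -/
theorem isPPermutation_iff {V : Type w} [AddCommGroup V] [Module k V]
    (ρ : Representation k Γ V) :
    IsPPermutation ρ ↔ ∃ (X : Type) (_ : Fintype X) (_ : MulAction Γ X)
      (i : X → V →ₗ[k] k) (r : X → V), (∀ g x v, i (g • x) (ρ g v) = i x v) ∧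
        (∀ g x, r (g • x) = ρ g (r x)) ∧ ∀ v, ∑ x, i x v • r x = v := by
  constructor
  · rintro ⟨X, _, _, i, r, h⟩
    have := Fintype.ofFinite X
    refine ⟨X, inferInstance, inferInstance, fun x => (Finsupp.lapply x) ∘ₗ
      (MonoidAlgebra.coeffLinearEquiv k).toLinearMap ∘ₗ i.toLinearMap,
      fun x => r (MonoidAlgebra.single x 1), fun g x v => ?_, fun g x => ?_, fun v => ?_⟩
    · have := i.isIntertwining _ _ g v
      simp [this, Representation.coeff_ofMulAction]
    · rw [← r.isIntertwining]; simp
    · have h1 : r (i v) = v := by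
        have := congrArg (fun f => f v) h
        simpa using this
      conv_rhs => rw [← h1]
      have h2 : i v = ∑ x, (i v).coeff x • (MonoidAlgebra.single x 1 : k[X]) := by
        ext y; simp
      conv_rhs => rw [h2, map_sum]
      simp only [map_smul]
      rfl
  · rintro ⟨X, _, _, i, r, hi, hr, h⟩
    refine ⟨X, inferInstance, inferInstance,
      ⟨∑ x, (i x).smulRight (MonoidAlgebra.single x 1 : k[X]), fun g => ?_⟩,
      ⟨(Finsupp.linearCombination k r) ∘ₗ (MonoidAlgebra.coeffLinearEquiv k).toLinearMap,
        fun g => ?_⟩, ?_⟩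
    · ext v : 1
      simp only [LinearMap.comp_apply, LinearMap.sum_apply, LinearMap.smulRight_apply, map_sum,
        map_smul, Representation.ofMulAction_single]
      rw [← Equiv.sum_comp (MulAction.toPerm g)]
      simp [hi]
    · ext x
      simp [hr]
    · ext v
      simp [h]

theorem IsPPermutation.of_equiv {V : Type w} {W : Type w'} [AddCommGroup V] [Module k V]
    [AddCommGroup W] [Module k W] {ρ : Representation k Γ V} {σ : Representation k Γ W}
    (e : ρ.Equiv σ) (h : IsPPermutation ρ) : IsPPermutation σ := by
  obtain ⟨X, h1, h2, i, r, h⟩ := h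
  refine ⟨X, h1, h2, i.comp e.symm.toIntertwiningMap, e.toIntertwiningMap.comp r, ?_⟩
  ext w
  have := congrArg (fun f => f (e.symm w)) h
  simp at this
  simp [this]

theorem IsPPermutation.prod {V : Type w} {W : Type w'} [AddCommGroup V] [Module k V]
    [AddCommGroup W] [Module k W] {ρ : Representation k Γ V} {σ : Representation k Γ W}
    (h : IsPPermutation ρ) (h' : IsPPermutation σ) : IsPPermutation (ρ.prod σ) := by
  rw [isPPermutation_iff] at h h' ⊢
  obtain ⟨X, _, _, i, r, hi, hr, h⟩ := h
  obtain ⟨Y, _, _, j, s, hj, hs, h'⟩ := h'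
  refine ⟨X ⊕ Y, inferInstance, inferInstance,
    Sum.elim (fun x => i x ∘ₗ LinearMap.fst k V W) (fun y => j y ∘ₗ LinearMap.snd k V W),
    Sum.elim (fun x => (r x, 0)) (fun y => (0, s y)), ?_, ?_, ?_⟩
  · rintro g (x | y) v
    · exact hi _ _ _
    · exact hj _ _ _
  · rintro g (x | y)
    · exact Prod.ext (hr _ _) (map_zero (σ g)).symm
    · exact Prod.ext (map_zero (ρ g)).symm (hs _ _)
  · rintro ⟨v, w⟩
    refine Prod.ext ?_ ?_
    · simpa [Prod.fst_sum] using h v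
    · simpa [Prod.snd_sum] using h' w

theorem isPPermutation_of_subsingleton [Finite Γ] {V : Type w} [AddCommGroup V] [Module k V]
    [Subsingleton V] (ρ : Representation k Γ V) : IsPPermutation ρ :=
  ⟨Γ, inferInstance, inferInstance, 0, 0, by ext v; exact Subsingleton.elim _ _⟩

variable (k Γ) in
/-- The monoid of isomorphism classes of `p`-permutation `kΓ`-modules. -/
def ppermClasses [Finite Γ] : AddSubmonoid (IsoClass k Γ) where
  carrier := {x | ∃ (n : ℕ) (ρ : Representation k Γ (Fin n → k)), cls ρ = x ∧ IsPPermutation ρ}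
  zero_mem' := ⟨0, 1, rfl, isPPermutation_of_subsingleton _⟩
  add_mem' := by
    rintro _ _ ⟨n, ρ, rfl, h⟩ ⟨m, σ, rfl, h'⟩
    rw [cls_add]
    exact ⟨_, _, (cls_eq_iff _ _).2 ⟨(transportEquiv (Module.finBasis k _).equivFun _).symm⟩,
      (h.prod h').of_equiv (transportEquiv _ _)⟩

theorem cls_mem_ppermClasses [Finite Γ] {V : Type w} [AddCommGroup V] [Module k V]
    [Module.Finite k V] (ρ : Representation k Γ V) :
    cls ρ ∈ ppermClasses k Γ ↔ IsPPermutation ρ := by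
  constructor
  · rintro ⟨n, σ, e, h⟩
    obtain ⟨e⟩ := (cls_eq_iff _ _).1 e
    exact h.of_equiv e
  · intro h
    exact ⟨_, _, (cls_eq_iff _ _).2 ⟨(transportEquiv (Module.finBasis k _).equivFun _).symm⟩,
      h.of_equiv (transportEquiv _ _)⟩

/-- Higman's criterion for projectivity. -/
theorem projective_iff [Fintype Γ] {V : Type w} [AddCommGroup V] [Module k V]
    (ρ : Representation k Γ V) :
    Module.Projective k[Γ] ρ.asModule ↔
      ∃ θ : V →ₗ[k] V, ∀ v, ∑ g : Γ, ρ g (θ (ρ g⁻¹ v)) = v := by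
  constructor
  · intro h
    obtain ⟨s, hs⟩ := Module.projective_def'.1 h
    let c : k[Γ] →ₗ[k] k := Finsupp.lapply 1 ∘ₗ (MonoidAlgebra.coeffLinearEquiv k).toLinearMap
    let Θ : (ρ.asModule →₀ k[Γ]) →ₗ[k] V :=
      Finsupp.lsum k (fun x : ρ.asModule => c.smulRight (ρ.asModuleEquiv x))
    have key : ∀ y : ρ.asModule →₀ k[Γ],
        ∑ g : Γ, ρ g (Θ ((MonoidAlgebra.single g⁻¹ (1 : k)) • y)) =
          ρ.asModuleEquiv (Finsupp.linearCombination k[Γ] id y) := by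
      intro y
      induction y using Finsupp.induction_linear with
      | zero => simp
      | add y z hy hz => simp only [smul_add, map_add, Finset.sum_add_distrib, hy, hz]
      | single x a =>
        induction a using MonoidAlgebra.induction_linear with
        | zero => simp
        | add a b ha hb =>
          simp only [Finsupp.single_add, smul_add, map_add, Finset.sum_add_distrib, ha, hb]
        | single h t =>
          classical
          have : ∀ g : Γ, (g⁻¹ * h = 1) ↔ g = h := fun g => by
            rw [inv_mul_eq_one]
          simp only [Finsupp.smul_single, smul_eq_mul, MonoidAlgebra.single_mul_single, one_mul]
          rw [Finset.sum_eq_single h]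
          · simp [Θ, c]
            rfl
          · intro g _ hg
            simp [Θ, c, this, hg]
          · simp
    refine ⟨Θ ∘ₗ s.restrictScalars k ∘ₗ ρ.asModuleEquiv.symm.toLinearMap, fun v => ?_⟩
    have h2 := key (s (ρ.asModuleEquiv.symm v))
    have h3 := congrArg (fun f => f (ρ.asModuleEquiv.symm v)) hs
    simp only [LinearMap.comp_apply, LinearMap.id_apply] at h3
    rw [h3] at h2
    simp only [LinearEquiv.apply_symm_apply] at h2
    conv_rhs => rw [← h2]
    refine Finset.sum_congr rfl fun g _ => ?_
    rw [← map_smul, Representation.single_smul, one_smul]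
    rfl
  · rintro ⟨θ, hθ⟩
    refine Module.Projective.of_lifting_property'' fun f hf => ?_
    obtain ⟨s, hs⟩ := (f.restrictScalars k).exists_rightInverse_of_surjective
      (LinearMap.range_eq_top.2 hf)
    let t : ρ.asModule →ₗ[k] (ρ.asModule →₀ k[Γ]) :=
      ∑ g : Γ, Algebra.lsmul k k (ρ.asModule →₀ k[Γ]) (MonoidAlgebra.single g (1 : k)) ∘ₗ
        s ∘ₗ ρ.asModuleEquiv.symm.toLinearMap ∘ₗ θ ∘ₗ ρ g⁻¹ ∘ₗ ρ.asModuleEquiv.toLinearMap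
    refine ⟨MonoidAlgebra.equivariantOfLinearOfComm t fun h v => ?_, ?_⟩
    · simp only [t, LinearMap.sum_apply, LinearMap.comp_apply, Finset.smul_sum]
      rw [← Equiv.sum_comp (Equiv.mulLeft h)]
      refine Finset.sum_congr rfl fun g _ => ?_
      simp only [Equiv.coe_mulLeft, LinearEquiv.coe_coe, Algebra.lsmul_coe,
        Representation.single_smul, one_smul, smul_smul, MonoidAlgebra.single_mul_single, one_mul]
      have h1 : ρ (h * g)⁻¹ (ρ h (ρ.asModuleEquiv v)) = ρ g⁻¹ (ρ.asModuleEquiv v) := by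
        rw [← Module.End.mul_apply, ← map_mul]
        simp
      exact congrArg (fun y => (MonoidAlgebra.single (h * g) (1 : k)) •
        s (ρ.asModuleEquiv.symm (θ y))) h1
    · ext v
      have h1 : ∀ x, f (s x) = x := fun x => congrArg (fun q => q x) hs
      simp only [t, LinearMap.comp_apply, LinearMap.sum_apply,
        MonoidAlgebra.equivariantOfLinearOfComm_apply, map_sum, Algebra.lsmul_coe, map_smul, h1,
        Representation.single_smul, one_smul, LinearMap.id_apply]
      exact hθ v

end PPermutation
/-! ## Diagonal p-permutation bimodules

A `(kG, kH)`-bimodule is regarded as a `k[G × H]`-module, where `(g, h)` acts by `m ↦ g m h⁻¹`. -/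

section Diagonal

variable {k : Type u} [Field k] {G H K L : Type} [Group G] [Group H] [Group K] [Group L]

/-- The underlying left `kG`-module of a `(kG, kH)`-bimodule. -/
def leftRep {V : Type w} [AddCommGroup V] [Module k V] (ρ : Representation k (G × H) V) :
    Representation k G V :=
  ρ.comp (MonoidHom.inl G H)

/-- The underlying right `kH`-module of a `(kG, kH)`-bimodule, as a left module via `h ↦ h⁻¹`. -/
def rightRep {V : Type w} [AddCommGroup V] [Module k V] (ρ : Representation k (G × H) V) :
    Representation k H V :=
  ρ.comp (MonoidHom.inr G H)

/-- A diagonal `p`-permutation `(kG, kH)`-bimodule: a `p`-permutation bimodule which is projective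
as a left `kG`-module and as a right `kH`-module. -/
structure IsDiagonalPPermutation {V : Type w} [AddCommGroup V] [Module k V]
    (ρ : Representation k (G × H) V) : Prop where
  pperm : IsPPermutation ρ
  projective_left : Module.Projective k[G] (leftRep ρ).asModule
  projective_right : Module.Projective k[H] (rightRep ρ).asModule

theorem isDiagonalPPermutation_iff [Fintype G] [Fintype H] {V : Type w} [AddCommGroup V]
    [Module k V] (ρ : Representation k (G × H) V) :
    IsDiagonalPPermutation ρ ↔ IsPPermutation ρ ∧
      (∃ θ : V →ₗ[k] V, ∀ v, ∑ g : G, ρ (g, 1) (θ (ρ (g⁻¹, 1) v)) = v) ∧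
      (∃ θ : V →ₗ[k] V, ∀ v, ∑ h : H, ρ (1, h) (θ (ρ (1, h⁻¹) v)) = v) :=
  ⟨fun h => ⟨h.1, (projective_iff (leftRep ρ)).1 h.2, (projective_iff (rightRep ρ)).1 h.3⟩,
    fun h => ⟨h.1, (projective_iff (leftRep ρ)).2 h.2.1, (projective_iff (rightRep ρ)).2 h.2.2⟩⟩

variable [Finite G] [Finite H] [Finite K] [Finite L]

theorem IsDiagonalPPermutation.of_equiv {V : Type w} {W : Type w'} [AddCommGroup V] [Module k V]
    [AddCommGroup W] [Module k W] {ρ : Representation k (G × H) V}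
    {σ : Representation k (G × H) W} (e : ρ.Equiv σ) (h : IsDiagonalPPermutation ρ) :
    IsDiagonalPPermutation σ := by
  have := Fintype.ofFinite G
  have := Fintype.ofFinite H
  rw [isDiagonalPPermutation_iff] at h ⊢
  obtain ⟨h, ⟨θ, hθ⟩, η, hη⟩ := h
  have e1 : ∀ x w, e.symm (σ x w) = ρ x (e.symm w) := fun x w =>
    e.symm.toIntertwiningMap.isIntertwining _ _ x w
  have e2 : ∀ x v, e (ρ x v) = σ x (e v) := fun x v => e.toIntertwiningMap.isIntertwining _ _ x v
  refine ⟨h.of_equiv e, ⟨e.toLinearMap ∘ₗ θ ∘ₗ e.symm.toLinearMap, fun w => ?_⟩,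
    ⟨e.toLinearMap ∘ₗ η ∘ₗ e.symm.toLinearMap, fun w => ?_⟩⟩
  · have := congrArg e (hθ (e.symm w))
    rw [map_sum] at this
    simpa [e1, e2] using this
  · have := congrArg e (hη (e.symm w))
    rw [map_sum] at this
    simpa [e1, e2] using this

theorem IsDiagonalPPermutation.prod {V : Type w} {W : Type w'} [AddCommGroup V] [Module k V]
    [AddCommGroup W] [Module k W] {ρ : Representation k (G × H) V}
    {σ : Representation k (G × H) W} (h : IsDiagonalPPermutation ρ)
    (h' : IsDiagonalPPermutation σ) : IsDiagonalPPermutation (ρ.prod σ) := by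
  have := Fintype.ofFinite G
  have := Fintype.ofFinite H
  rw [isDiagonalPPermutation_iff] at h h' ⊢
  obtain ⟨h, ⟨θ, hθ⟩, η, hη⟩ := h
  obtain ⟨h', ⟨θ', hθ'⟩, η', hη'⟩ := h'
  refine ⟨h.prod h', ⟨θ.prodMap θ', fun v => Prod.ext ?_ ?_⟩,
    ⟨η.prodMap η', fun v => Prod.ext ?_ ?_⟩⟩
  · rw [Prod.fst_sum]; exact hθ v.1
  · rw [Prod.snd_sum]; exact hθ' v.2
  · rw [Prod.fst_sum]; exact hη v.1
  · rw [Prod.snd_sum]; exact hη' v.2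

theorem isDiagonalPPermutation_of_subsingleton {V : Type w} [AddCommGroup V] [Module k V]
    [Subsingleton V] (ρ : Representation k (G × H) V) : IsDiagonalPPermutation ρ := by
  have := Fintype.ofFinite G
  have := Fintype.ofFinite H
  exact (isDiagonalPPermutation_iff ρ).2 ⟨isPPermutation_of_subsingleton ρ,
    ⟨0, fun _ => Subsingleton.elim _ _⟩, ⟨0, fun _ => Subsingleton.elim _ _⟩⟩

variable (k G H) in
/-- The monoid of isomorphism classes of diagonal `p`-permutation `(kG, kH)`-bimodules. -/
def diagClasses : AddSubmonoid (IsoClass k (G × H)) where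
  carrier := {x | ∃ (n : ℕ) (ρ : Representation k (G × H) (Fin n → k)),
    cls ρ = x ∧ IsDiagonalPPermutation ρ}
  zero_mem' := ⟨0, 1, rfl, isDiagonalPPermutation_of_subsingleton _⟩
  add_mem' := by
    rintro _ _ ⟨n, ρ, rfl, h⟩ ⟨m, σ, rfl, h'⟩
    rw [cls_add]
    exact ⟨_, _, (cls_eq_iff _ _).2 ⟨(transportEquiv (Module.finBasis k _).equivFun _).symm⟩,
      (h.prod h').of_equiv (transportEquiv _ _)⟩

theorem cls_mem_diagClasses {V : Type w} [AddCommGroup V] [Module k V]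
    [Module.Finite k V] (ρ : Representation k (G × H) V) :
    cls ρ ∈ diagClasses k G H ↔ IsDiagonalPPermutation ρ := by
  constructor
  · rintro ⟨n, σ, e, h⟩
    obtain ⟨e⟩ := (cls_eq_iff _ _).1 e
    exact h.of_equiv e
  · intro h
    exact ⟨_, _, (cls_eq_iff _ _).2 ⟨(transportEquiv (Module.finBasis k _).equivFun _).symm⟩,
      h.of_equiv (transportEquiv _ _)⟩

end Diagonal

/-! ## Tensor products of bimodules -/

section Tensor

variable {k : Type u} [Field k] {G H K L : Type} [Group G] [Group H] [Group K] [Group L]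

/-- The action of `H` on `V ⊗ W` with `h (v ⊗ w) = v h⁻¹ ⊗ h w`, for a `(kG, kH)`-bimodule `V` and
a `(kH, kK)`-bimodule `W`. -/
def midRep {V : Type w} {W : Type w'} [AddCommGroup V] [Module k V] [AddCommGroup W] [Module k W]
    (ρ : Representation k (G × H) V) (σ : Representation k (H × K) W) :
    Representation k H (V ⊗[k] W) :=
  Representation.tprod (ρ.comp (MonoidHom.inr G H)) (σ.comp (MonoidHom.inl H K))

/-- The tensor product `V ⊗_{kH} W`, as the coinvariants of `V ⊗ W` under `H`. -/
abbrev BalTensor {V : Type w} {W : Type w'} [AddCommGroup V] [Module k V] [AddCommGroup W]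
    [Module k W] (ρ : Representation k (G × H) V) (σ : Representation k (H × K) W) :
    Type (max w w') :=
  Representation.Coinvariants (midRep ρ σ)

variable {V V' W W' : Type*} [AddCommGroup V] [Module k V] [AddCommGroup W]
  [Module k W] [AddCommGroup V'] [Module k V'] [AddCommGroup W'] [Module k W']
  (ρ : Representation k (G × H) V) (σ : Representation k (H × K) W)
  (ρ' : Representation k (G × H) V') (σ' : Representation k (H × K) W')

/-- The class `v ⊗ w` in `V ⊗_{kH} W`. -/
def btmul (v : V) (w : W) : BalTensor ρ σ :=
  Representation.Coinvariants.mk (midRep ρ σ) (v ⊗ₜ w)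

theorem btmul_balanced (h : H) (v : V) (w : W) :
    btmul ρ σ (ρ (1, h) v) (σ (h, 1) w) = btmul ρ σ v w :=
  Representation.Coinvariants.mk_self_apply (midRep ρ σ) h (v ⊗ₜ w)

/-- Linear maps out of `V ⊗_{kH} W`. -/
def btlift {X : Type*} [AddCommGroup X] [Module k X] (f : V →ₗ[k] W →ₗ[k] X)
    (hf : ∀ h v w, f (ρ (1, h) v) (σ (h, 1) w) = f v w) : BalTensor ρ σ →ₗ[k] X :=
  Representation.Coinvariants.lift (midRep ρ σ) (TensorProduct.lift f) fun h =>
    TensorProduct.ext' fun v w => hf h v w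

@[simp]
theorem btlift_btmul {X : Type*} [AddCommGroup X] [Module k X] (f : V →ₗ[k] W →ₗ[k] X)
    (hf : ∀ h v w, f (ρ (1, h) v) (σ (h, 1) w) = f v w) (v : V) (w : W) :
    btlift ρ σ f hf (btmul ρ σ v w) = f v w := rfl

/-- The bilinear map `(v, w) ↦ v ⊗ w` to `V ⊗_{kH} W`. -/
def btmk : V →ₗ[k] W →ₗ[k] BalTensor ρ σ :=
  (TensorProduct.mk k V W).compr₂ (Representation.Coinvariants.mk (midRep ρ σ))

@[simp]
theorem btmk_apply (v : V) (w : W) : btmk ρ σ v w = btmul ρ σ v w := rfl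

variable {ρ σ} in
theorem bt_hom_ext {X : Type*} [AddCommGroup X] [Module k X] {f g : BalTensor ρ σ →ₗ[k] X}
    (h : ∀ v w, f (btmul ρ σ v w) = g (btmul ρ σ v w)) : f = g :=
  Representation.Coinvariants.hom_ext (TensorProduct.ext' h)

variable {ρ σ} in
theorem bt_eq_iff {X : Type*} [AddCommGroup X] [Module k X] {f g : BalTensor ρ σ →ₗ[k] X}
    (h : ∀ v w, f (btmul ρ σ v w) = g (btmul ρ σ v w)) (x : BalTensor ρ σ) : f x = g x := by
  rw [bt_hom_ext h]

variable {ρ σ} in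
theorem bt_induction {motive : BalTensor ρ σ → Prop} (zero : motive 0)
    (btmul : ∀ v w, motive (btmul ρ σ v w)) (add : ∀ x y, motive x → motive y → motive (x + y))
    (x : BalTensor ρ σ) : motive x := by
  induction x using Representation.Coinvariants.induction_on with | h x
  induction x using TensorProduct.induction_on with
  | zero => simpa using zero
  | tmul v w => exact btmul v w
  | add x y hx hy => rw [map_add]; exact add _ _ hx hy

@[simp]
theorem btmul_add (v : V) (w w' : W) :
    btmul ρ σ v (w + w') = btmul ρ σ v w + btmul ρ σ v w' := (btmk ρ σ v).map_add w w'

@[simp]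
theorem add_btmul (v v' : V) (w : W) :
    btmul ρ σ (v + v') w = btmul ρ σ v w + btmul ρ σ v' w := (btmk ρ σ).map_add₂ v v' w

@[simp]
theorem btmul_zero (v : V) : btmul ρ σ v 0 = 0 := (btmk ρ σ v).map_zero

@[simp]
theorem zero_btmul (w : W) : btmul ρ σ 0 w = 0 := (btmk ρ σ).map_zero₂ w

@[simp]
theorem smul_btmul (c : k) (v : V) (w : W) : btmul ρ σ (c • v) w = c • btmul ρ σ v w :=
  (btmk ρ σ).map_smul₂ c v w

@[simp]
theorem btmul_smul (c : k) (v : V) (w : W) : btmul ρ σ v (c • w) = c • btmul ρ σ v w :=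
  (btmk ρ σ v).map_smul c w

/-- The `(kG, kK)`-bimodule structure on `V ⊗_{kH} W`: `(g, l)` acts by `v ⊗ w ↦ g v ⊗ w l⁻¹`. -/
def btRep : Representation k (G × K) (BalTensor ρ σ) where
  toFun x := btlift ρ σ ((btmk ρ σ).compl₁₂ (ρ (x.1, 1)) (σ (1, x.2))) fun h v w => by
    have h1 : ρ (x.1, 1) (ρ (1, h) v) = ρ (1, h) (ρ (x.1, 1) v) := by
      simp [← Module.End.mul_apply, ← map_mul]
    have h2 : σ (1, x.2) (σ (h, 1) w) = σ (h, 1) (σ (1, x.2) w) := by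
      simp [← Module.End.mul_apply, ← map_mul]
    simp [h1, h2, btmul_balanced]
  map_one' := bt_hom_ext fun v w => by
    simp [← Prod.one_eq_mk]
  map_mul' x y := bt_hom_ext fun v w => by
    have h1 : ρ (x.1 * y.1, 1) v = ρ (x.1, 1) (ρ (y.1, 1) v) := by
      simp [← Module.End.mul_apply, ← map_mul]
    have h2 : σ (1, x.2 * y.2) w = σ (1, x.2) (σ (1, y.2) w) := by
      simp [← Module.End.mul_apply, ← map_mul]
    change btmul ρ σ (ρ (x.1 * y.1, 1) v) (σ (1, x.2 * y.2) w) =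
      btmul ρ σ (ρ (x.1, 1) (ρ (y.1, 1) v)) (σ (1, x.2) (σ (1, y.2) w))
    rw [h1, h2]

@[simp]
theorem btRep_btmul (x : G × K) (v : V) (w : W) :
    btRep ρ σ x (btmul ρ σ v w) = btmul ρ σ (ρ (x.1, 1) v) (σ (1, x.2) w) := rfl

variable {ρ σ ρ' σ'} in
/-- Functoriality of the tensor product of bimodules. -/
def btmap (f : ρ.IntertwiningMap ρ') (g : σ.IntertwiningMap σ') :
    BalTensor ρ σ →ₗ[k] BalTensor ρ' σ' :=
  btlift ρ σ ((btmk ρ' σ').compl₁₂ f.toLinearMap g.toLinearMap) fun h v w => by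
    simp [f.isIntertwining, g.isIntertwining, btmul_balanced]

variable {ρ σ ρ' σ'} in
@[simp]
theorem btmap_btmul (f : ρ.IntertwiningMap ρ') (g : σ.IntertwiningMap σ') (v : V) (w : W) :
    btmap f g (btmul ρ σ v w) = btmul ρ' σ' (f v) (g w) := rfl

variable {ρ σ ρ' σ'} in
/-- Isomorphic bimodules have isomorphic tensor products. -/
def btcongr (e : ρ.Equiv ρ') (f : σ.Equiv σ') : (btRep ρ σ).Equiv (btRep ρ' σ') :=
  .mk (.ofLinearMap (btmap e.toIntertwiningMap f.toIntertwiningMap)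
      (btmap e.symm.toIntertwiningMap f.symm.toIntertwiningMap)
      (bt_hom_ext fun v w => by simp) (bt_hom_ext fun v w => by simp))
    fun x => bt_hom_ext fun v w => by
      simp [Representation.IntertwiningMap.isIntertwining]

theorem repInl_apply (v : V) : Representation.IntertwiningMap.inl k ρ ρ' v = (v, 0) := rfl

theorem repInr_apply (v : V') : Representation.IntertwiningMap.inr k ρ ρ' v = (0, v) := rfl

/-- Tensor products distribute over direct sums on the left. -/
def btprodLeft : (btRep (ρ.prod ρ') σ).Equiv ((btRep ρ σ).prod (btRep ρ' σ)) :=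
  .mk (.ofLinearMap
      ((btmap (.fst k ρ ρ') (.id σ)).prod (btmap (.snd k ρ ρ') (.id σ)))
      ((btmap (.inl k ρ ρ') (.id σ)).coprod (btmap (.inr k ρ ρ') (.id σ)))
      (by
        refine LinearMap.prod_ext (bt_hom_ext fun v w => ?_) (bt_hom_ext fun v w => ?_)
        · simp [repInl_apply]
        · simp [repInr_apply])
      (bt_hom_ext fun v w => by
        simp [repInl_apply, repInr_apply,
          ← add_btmul]))
    fun x => bt_hom_ext fun v w => by
      rfl

/-- Tensor products distribute over direct sums on the right. -/
def btprodRight : (btRep ρ (σ.prod σ')).Equiv ((btRep ρ σ).prod (btRep ρ σ')) :=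
  .mk (.ofLinearMap
      ((btmap (.id ρ) (.fst k σ σ')).prod (btmap (.id ρ) (.snd k σ σ')))
      ((btmap (.id ρ) (.inl k σ σ')).coprod (btmap (.id ρ) (.inr k σ σ')))
      (by
        refine LinearMap.prod_ext (bt_hom_ext fun v w => ?_) (bt_hom_ext fun v w => ?_)
        · simp [repInl_apply]
        · simp [repInr_apply])
      (bt_hom_ext fun v w => by
        simp [repInl_apply, repInr_apply,
          ← btmul_add]))
    fun x => bt_hom_ext fun v w => by
      rfl

/-- Associativity of the tensor product of bimodules. -/
def btassoc {U : Type*} [AddCommGroup U] [Module k U] (τ : Representation k (K × L) U) :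
    (btRep (btRep ρ σ) τ).Equiv (btRep ρ (btRep σ τ)) :=
  .mk (.ofLinearMap
      (btlift (btRep ρ σ) τ
        (btlift ρ σ
          ((LinearMap.llcomp k U (BalTensor σ τ) (BalTensor ρ (btRep σ τ)) ∘ₗ
            btmk ρ (btRep σ τ)).compl₂ (btmk σ τ))
          fun h v w => LinearMap.ext fun x => by
            have := btmul_balanced ρ (btRep σ τ) h v (btmul σ τ w x)
            simpa [← Prod.one_eq_mk] using this)
        fun h y x => by
          induction y using bt_induction with
          | zero => simp
          | add y z hy hz => simp only [map_add, LinearMap.add_apply, hy, hz]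
          | btmul v w =>
            have := btmul_balanced σ τ h w x
            simp [← Prod.one_eq_mk, this])
      (btlift ρ (btRep σ τ)
        (LinearMap.mk₂ k
          (fun v y => btlift σ τ (btmk (btRep ρ σ) τ ∘ₗ btmk ρ σ v)
            (fun h w x => by
              have := btmul_balanced (btRep ρ σ) τ h (btmul ρ σ v w) x
              simpa [← Prod.one_eq_mk] using this) y)
          (fun v v' y => by
            induction y using bt_induction with
            | zero => simp
            | add y z hy hz =>
              have e := fun (q : BalTensor σ τ →ₗ[k] BalTensor (btRep ρ σ) τ) => q.map_add y z
              rw [e, e, e, hy, hz]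
              abel
            | btmul w x => simp)
          (fun c v y => by
            induction y using bt_induction with
            | zero => simp
            | add y z hy hz => simp only [map_add, hy, hz, smul_add]
            | btmul w x => simp)
          (fun v y z => map_add _ _ _)
          (fun c v y => map_smul _ _ _))
        fun h v y => by
          induction y using bt_induction with
          | zero => simp
          | add y z hy hz => simp only [map_add, hy, hz]
          | btmul w x =>
            have := btmul_balanced ρ σ h v w
            simp [← Prod.one_eq_mk, this])
      (bt_hom_ext fun v y => by
        induction y using bt_induction with
        | zero => simp
        | add y z hy hz => simp only [btmul_add, map_add, hy, hz]
        | btmul w x => simp)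
      (bt_hom_ext fun y x => by
        induction y using bt_induction with
        | zero => simp
        | add y z hy hz => simp only [add_btmul, map_add, hy, hz]
        | btmul v w => simp))
    fun g => bt_hom_ext fun y x => by
      induction y using bt_induction with
      | zero => simp
      | add y z hy hz => simp only [add_btmul, map_add, hy, hz]
      | btmul v w => simp [← Prod.one_eq_mk]

end Tensor

section Tensor

variable {k : Type u} [Field k] {G H K L : Type} [Group G] [Group H] [Group K] [Group L]
variable {V V' W W' : Type*} [AddCommGroup V] [Module k V] [AddCommGroup W]
  [Module k W] [AddCommGroup V'] [Module k V'] [AddCommGroup W'] [Module k W']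
  (ρ : Representation k (G × H) V) (σ : Representation k (H × K) W)
  (ρ' : Representation k (G × H) V') (σ' : Representation k (H × K) W')

theorem IsPPermutation.bt [Finite G] [Finite H] [Finite K] (h : IsPPermutation ρ)
    (h' : IsPPermutation σ) : IsPPermutation (btRep ρ σ) := by
  classical
  rw [isPPermutation_iff] at h h' ⊢
  obtain ⟨X, _, _, i, r, hi, hr, h⟩ := h
  obtain ⟨Y, _, _, j, s, hj, hs, h'⟩ := h'
  let act (x : G × H × K) (z : X × Y) : X × Y :=
    ((x.1, x.2.1) • z.1, (x.2.1, x.2.2) • z.2)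
  have act_mul : ∀ x y z, act (x * y) z = act x (act y z) := fun x y z =>
    Prod.ext (mul_smul (x.1, x.2.1) (y.1, y.2.1) z.1) (mul_smul (x.2.1, x.2.2) (y.2.1, y.2.2) z.2)
  have act_one : ∀ z, act 1 z = z := fun z => Prod.ext (one_smul _ _) (one_smul _ _)
  let S : Setoid (X × Y) :=
    { r := fun z z' => ∃ h : H, act (1, h, 1) z = z'
      iseqv := ⟨fun z => ⟨1, act_one z⟩, fun {z z'} ⟨h, e⟩ => ⟨h⁻¹, by
          rw [← e, ← act_mul]; simpa [← Prod.one_eq_mk] using act_one z⟩, fun {z z' z''} ⟨h, e⟩ ⟨h', e'⟩ =>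
          ⟨h' * h, by rw [← e', ← e, ← act_mul]; simp⟩⟩ }
  have act_rel : ∀ (x : G × K) {z z' : X × Y}, S.r z z' →
      S.r (act (x.1, 1, x.2) z) (act (x.1, 1, x.2) z') := by
    rintro x z z' ⟨h, rfl⟩
    exact ⟨h, by rw [← act_mul, ← act_mul]; simp⟩
  have act_rel_iff : ∀ (x : G × K) (z z' : X × Y),
      (Quotient.mk S (act (x.1, 1, x.2) z) = Quotient.mk S (act (x.1, 1, x.2) z')) ↔
      Quotient.mk S z = Quotient.mk S z' := by
    intro x z z'
    rw [Quotient.eq, Quotient.eq]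
    refine ⟨fun h => ?_, act_rel x⟩
    have := act_rel x⁻¹ h
    rw [← act_mul, ← act_mul] at this
    simpa [← Prod.one_eq_mk, act_one] using this
  let A : MulAction (G × K) (Quotient S) :=
    { smul := fun x => Quotient.map (act (x.1, 1, x.2)) fun _ _ h => act_rel x h
      one_smul := fun q => by
        induction q using Quotient.inductionOn with
        | h z => exact congrArg (Quotient.mk S) (act_one z)
      mul_smul := fun x y q => by
        induction q using Quotient.inductionOn with
        | h z =>
          refine congrArg (Quotient.mk S) ?_
          rw [← act_mul]; simp }
  have A_mk : ∀ (x : G × K) z, x • Quotient.mk S z = Quotient.mk S (act (x.1, 1, x.2) z) :=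
    fun _ _ => rfl
  have : Fintype (Quotient S) := Fintype.ofFinite _
  -- the functional attached to a pair `z = (x, y)`
  let f (z : X × Y) : V →ₗ[k] W →ₗ[k] k := (LinearMap.mul k k).compl₁₂ (i z.1) (j z.2)
  have f_apply : ∀ z v w, f z v w = i z.1 v * j z.2 w := fun _ _ _ => rfl
  have hf : ∀ (x : G × H × K) z v w,
      f (act x z) (ρ (x.1, x.2.1) v) (σ (x.2.1, x.2.2) w) = f z v w := by
    intro x z v w
    simp [f_apply, act, hi, hj]
  have bij : ∀ x, Function.Bijective (act x) := fun x => Function.bijective_iff_has_inverse.2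
    ⟨act x⁻¹, fun z => by rw [← act_mul]; simpa using act_one z,
      fun z => by rw [← act_mul]; simpa using act_one z⟩
  let F (q : Quotient S) : V →ₗ[k] W →ₗ[k] k :=
    ∑ z : X × Y, if Quotient.mk S z = q then f z else 0
  have F_apply : ∀ q v w, F q v w = ∑ z, if Quotient.mk S z = q then f z v w else 0 := by
    intro q v w
    simp only [F, LinearMap.sum_apply]
    refine Finset.sum_congr rfl fun z _ => ?_
    split_ifs <;> rfl
  have hF : ∀ q h v w, F q (ρ (1, h) v) (σ (h, 1) w) = F q v w := by
    intro q h v w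
    rw [F_apply, F_apply, ← (bij (1, h, 1)).sum_comp]
    refine Finset.sum_congr rfl fun z _ => ?_
    have : Quotient.mk S (act (1, h, 1) z) = Quotient.mk S z :=
      (Quotient.sound (⟨h, rfl⟩ : S.r _ _)).symm
    rw [this]
    split_ifs
    · exact hf (1, h, 1) z v w
    · rfl
  have hR : ∀ z z' : X × Y, S.r z z' →
      btmul ρ σ (r z.1) (s z.2) = btmul ρ σ (r z'.1) (s z'.2) := by
    rintro z z' ⟨h, rfl⟩
    have := btmul_balanced ρ σ h (r z.1) (s z.2)
    rw [← hr, ← hs] at this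
    exact this.symm
  refine ⟨Quotient S, inferInstance, A, fun q => btlift ρ σ (F q) (hF q),
    Quotient.lift (fun z => btmul ρ σ (r z.1) (s z.2)) hR, ?_, ?_, ?_⟩
  · intro x q y
    induction q using Quotient.inductionOn with | h z0
    refine bt_eq_iff (f := btlift ρ σ _ (hF (x • Quotient.mk S z0)) ∘ₗ btRep ρ σ x) (fun v w => ?_) y
    simp only [LinearMap.comp_apply, btRep_btmul, btlift_btmul, A_mk, F_apply]
    rw [← (bij (x.1, 1, x.2)).sum_comp]
    refine Finset.sum_congr rfl fun z _ => ?_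
    rw [if_congr (act_rel_iff x z z0) rfl rfl]
    split_ifs
    · exact hf (x.1, 1, x.2) z v w
    · rfl
  · intro x q
    induction q using Quotient.inductionOn with | h z
    rw [A_mk]
    simp only [Quotient.lift_mk, btRep_btmul, act]
    rw [hr, hs]
  · intro y
    have := bt_eq_iff (f := ∑ q : Quotient S, (btlift ρ σ (F q) (hF q)).smulRight
      (Quotient.lift (fun z => btmul ρ σ (r z.1) (s z.2)) hR q)) (g := LinearMap.id)
      (fun v w => ?_) y
    · simpa using this
    · simp only [LinearMap.sum_apply, LinearMap.smulRight_apply, btlift_btmul, F_apply,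
        Finset.sum_smul, LinearMap.id_apply, ite_smul, zero_smul]
      rw [Finset.sum_comm]
      simp only [Finset.sum_ite_eq, Finset.mem_univ, if_true, Quotient.lift_mk, f_apply]
      rw [Fintype.sum_prod_type]
      conv_rhs => rw [← h v, ← h' w, ← btmk_apply, map_sum (btmk ρ σ), LinearMap.sum_apply]
      refine Finset.sum_congr rfl fun x _ => ?_
      rw [map_sum]
      refine Finset.sum_congr rfl fun y _ => ?_
      simp [mul_comm (i x v), mul_smul]

theorem IsDiagonalPPermutation.bt [Finite G] [Finite H] [Finite K]
    (h : IsDiagonalPPermutation ρ) (h' : IsDiagonalPPermutation σ) :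
    IsDiagonalPPermutation (btRep ρ σ) := by
  have := Fintype.ofFinite G
  have := Fintype.ofFinite H
  have := Fintype.ofFinite K
  rw [isDiagonalPPermutation_iff] at h h' ⊢
  obtain ⟨h, ⟨θ, hθ⟩, η, hη⟩ := h
  obtain ⟨h', ⟨θ', hθ'⟩, η', hη'⟩ := h'
  have hinv : ∀ (α : V →ₗ[k] V) (β : W →ₗ[k] W) (x : H) (v : V) (w : W),
      (∑ y : H, (btmk ρ σ).compl₁₂ (α ∘ₗ ρ (1, y)) (β ∘ₗ σ (y, 1))) (ρ (1, x) v) (σ (x, 1) w) =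
      (∑ y : H, (btmk ρ σ).compl₁₂ (α ∘ₗ ρ (1, y)) (β ∘ₗ σ (y, 1))) v w := by
    intro α β x v w
    simp only [LinearMap.sum_apply]
    rw [← Equiv.sum_comp (Equiv.mulRight x⁻¹)]
    refine Finset.sum_congr rfl fun y _ => ?_
    have e1 : ρ (1, y * x⁻¹) (ρ (1, x) v) = ρ (1, y) v := by
      simp [← Module.End.mul_apply, ← map_mul]
    have e2 : σ (y * x⁻¹, 1) (σ (x, 1) w) = σ (y, 1) w := by
      simp [← Module.End.mul_apply, ← map_mul]
    simp [e1, e2]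
  refine ⟨h.bt _ _ h', ⟨btlift ρ σ _ (hinv θ θ'), fun y => ?_⟩,
    ⟨btlift ρ σ _ (hinv η η'), fun y => ?_⟩⟩
  · have := bt_eq_iff (f := ∑ g : G, btRep ρ σ (g, 1) ∘ₗ btlift ρ σ (∑ x : H,
      (btmk ρ σ).compl₁₂ (θ ∘ₗ ρ (1, x)) (θ' ∘ₗ σ (x, 1))) (hinv θ θ') ∘ₗ btRep ρ σ (g⁻¹, 1))
      (g := LinearMap.id) (fun v w => ?_) y
    · simpa using this
    · simp only [LinearMap.sum_apply, LinearMap.comp_apply, btRep_btmul, btlift_btmul,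
        LinearMap.compl₁₂_apply, btmk_apply, map_sum, LinearMap.id_apply, ← Prod.one_eq_mk, map_one,
        Module.End.one_apply]
      rw [Finset.sum_comm]
      have e1 : ∀ x : H, ∑ g : G, btmul ρ σ (ρ (g, 1) (θ (ρ (1, x) (ρ (g⁻¹, 1) v))))
          (θ' (σ (x, 1) w)) = btmul ρ σ v (σ (x⁻¹, 1) (θ' (σ (x, 1) w))) := by
        intro x
        have e2 : ∀ g : G, ρ (1, x) (ρ (g⁻¹, 1) v) = ρ (g⁻¹, 1) (ρ (1, x) v) := fun g => by
          simp [← Module.End.mul_apply, ← map_mul]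
        have e3 := congrArg (fun z => btmk ρ σ z (θ' (σ (x, 1) w))) (hθ (ρ (1, x) v))
        simp only [map_sum, LinearMap.sum_apply, btmk_apply] at e3
        simp only [e2, e3]
        rw [← btmul_balanced ρ σ x⁻¹]
        simp [← Module.End.mul_apply, ← map_mul, ← Prod.one_eq_mk]
      simp only [e1]
      rw [← Equiv.sum_comp (Equiv.inv H)]
      have e3 := congrArg (fun z => btmk ρ σ v z) (hθ' w)
      simp only [map_sum, btmk_apply] at e3
      simpa using e3
  · have := bt_eq_iff (f := ∑ g : K, btRep ρ σ (1, g) ∘ₗ btlift ρ σ (∑ x : H,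
      (btmk ρ σ).compl₁₂ (η ∘ₗ ρ (1, x)) (η' ∘ₗ σ (x, 1))) (hinv η η') ∘ₗ btRep ρ σ (1, g⁻¹))
      (g := LinearMap.id) (fun v w => ?_) y
    · simpa using this
    · simp only [LinearMap.sum_apply, LinearMap.comp_apply, btRep_btmul, btlift_btmul,
        LinearMap.compl₁₂_apply, btmk_apply, map_sum, LinearMap.id_apply, ← Prod.one_eq_mk, map_one,
        Module.End.one_apply]
      rw [Finset.sum_comm]
      have e1 : ∀ x : H, ∑ g : K, btmul ρ σ (η (ρ (1, x) v))
          (σ (1, g) (η' (σ (x, 1) (σ (1, g⁻¹) w)))) =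
          btmul ρ σ (ρ (1, x⁻¹) (η (ρ (1, x) v))) w := by
        intro x
        have e2 : ∀ g : K, σ (x, 1) (σ (1, g⁻¹) w) = σ (1, g⁻¹) (σ (x, 1) w) := fun g => by
          simp [← Module.End.mul_apply, ← map_mul]
        have e3 := congrArg (fun z => btmk ρ σ (η (ρ (1, x) v)) z) (hη' (σ (x, 1) w))
        simp only [map_sum, btmk_apply] at e3
        simp only [e2, e3]
        rw [← btmul_balanced ρ σ x⁻¹]
        simp [← Module.End.mul_apply, ← map_mul, ← Prod.one_eq_mk]
      simp only [e1]
      rw [← Equiv.sum_comp (Equiv.inv H)]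
      have e3 := congrArg (fun z => btmk ρ σ z w) (hη v)
      simp only [map_sum, LinearMap.sum_apply, btmk_apply] at e3
      simpa using e3

end Tensor

/-! ## Bimodules attached to automorphisms -/

section AutRep

variable {k : Type u} [Field k] {G : Type} [Group G]

variable (k) in
/-- The bimodule `kG_γ` attached to an automorphism `γ` of `G`: the space `kG`, on which `(a, b)`
acts by `x ↦ a x γ(b)⁻¹`. For `γ = 1` this is the regular `(kG, kG)`-bimodule `kG`. -/
def autRep (γ : MulAut G) : Representation k (G × G) k[G] where
  toFun x := LinearMap.mulLeft k (MonoidAlgebra.single x.1 (1 : k)) ∘ₗ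
    LinearMap.mulRight k (MonoidAlgebra.single (γ x.2)⁻¹ (1 : k))
  map_one' := by
    ext x : 1
    simp [← MonoidAlgebra.one_def]
    rfl
  map_mul' x y := by
    refine LinearMap.ext fun z => ?_
    simp only [LinearMap.comp_apply, LinearMap.mulRight_apply, LinearMap.mulLeft_apply,
      Module.End.mul_apply, Prod.fst_mul, Prod.snd_mul, map_mul, mul_inv_rev]
    have h1 : (MonoidAlgebra.single (x.1 * y.1) (1 : k) : k[G]) =
      MonoidAlgebra.single x.1 1 * MonoidAlgebra.single y.1 1 := by simp
    have h2 : (MonoidAlgebra.single ((γ y.2)⁻¹ * (γ x.2)⁻¹) (1 : k) : k[G]) =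
      MonoidAlgebra.single (γ y.2)⁻¹ 1 * MonoidAlgebra.single (γ x.2)⁻¹ 1 := by simp
    rw [h1, h2]
    simp only [mul_assoc]

@[simp]
theorem autRep_single (γ : MulAut G) (x : G × G) (g : G) (c : k) :
    autRep k γ x (MonoidAlgebra.single g c) = MonoidAlgebra.single (x.1 * g * (γ x.2)⁻¹) c := by
  simp [autRep, mul_assoc]

theorem isPPermutation_autRep [Finite G] (γ : MulAut G) : IsPPermutation (autRep k γ) := by
  let A : MulAction (G × G) G :=
    { smul := fun x g => x.1 * g * (γ x.2)⁻¹
      one_smul := fun g => by change 1 * g * (γ 1)⁻¹ = g; simp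
      mul_smul := fun x y g => by
        change (x * y).1 * g * (γ (x * y).2)⁻¹ = x.1 * (y.1 * g * (γ y.2)⁻¹) * (γ x.2)⁻¹
        simp [mul_assoc] }
  refine ⟨G, inferInstance, A, ⟨LinearMap.id, fun x => ?_⟩, ⟨LinearMap.id, fun x => ?_⟩, ?_⟩
  · refine MonoidAlgebra.lhom_ext' fun g => LinearMap.ext_ring ?_
    simp
    rfl
  · refine MonoidAlgebra.lhom_ext' fun g => LinearMap.ext_ring ?_
    simp
    rfl
  · rfl

theorem isDiagonalPPermutation_autRep [Finite G] (γ : MulAut G) :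
    IsDiagonalPPermutation (autRep k γ) := by
  classical
  have := Fintype.ofFinite G
  let θ : k[G] →ₗ[k] k[G] := (Finsupp.lapply 1 ∘ₗ
    (MonoidAlgebra.coeffLinearEquiv k).toLinearMap).smulRight (MonoidAlgebra.single 1 (1 : k))
  have hθ : ∀ g c, θ (MonoidAlgebra.single g c) = if g = 1 then MonoidAlgebra.single 1 c else 0 := by
    intro g c
    by_cases h : g = 1 <;> simp [θ, h]
  refine (isDiagonalPPermutation_iff _).2 ⟨isPPermutation_autRep γ, ⟨θ, fun v => ?_⟩,
    ⟨θ, fun v => ?_⟩⟩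
  · induction v using MonoidAlgebra.induction_linear with
    | zero => simp
    | add v w hv hw => simp only [map_add, Finset.sum_add_distrib, hv, hw]
    | single g c =>
      rw [Finset.sum_eq_single g]
      · simp [hθ]
      · intro h _ hh
        have : h⁻¹ * g ≠ 1 := by rwa [Ne, inv_mul_eq_one]
        simp [hθ, this]
      · simp
  · induction v using MonoidAlgebra.induction_linear with
    | zero => simp
    | add v w hv hw => simp only [map_add, Finset.sum_add_distrib, hv, hw]
    | single g c =>
      rw [Finset.sum_eq_single (γ⁻¹ g⁻¹)]
      · simp [hθ]
      · intro h _ hh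
        have : g * γ h ≠ 1 := by
          intro e
          apply hh
          rw [← eq_inv_of_mul_eq_one_right e]
          simp
        simp [hθ, this]
      · simp

end AutRep

section Unit

variable {k : Type u} [Field k] {G H : Type} [Group G] [Group H]
  {V : Type w} [AddCommGroup V] [Module k V] (ρ : Representation k (G × H) V)

/-- `kG ⊗_{kG} V ≅ V`. -/
def btUnitLeft : (btRep (autRep k (1 : MulAut G)) ρ).Equiv ρ :=
  .mk (.ofLinearMap
      (btlift _ ρ (Finsupp.linearCombination k (fun g => ρ (g, 1)) ∘ₗ
        (MonoidAlgebra.coeffLinearEquiv k).toLinearMap) fun h a v => by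
          induction a using MonoidAlgebra.induction_linear with
          | zero => simp
          | add a b ha hb => simp only [map_add, LinearMap.add_apply, ha, hb]
          | single g c => simp [← Module.End.mul_apply, ← map_mul])
      (btmk (autRep k (1 : MulAut G)) ρ (MonoidAlgebra.single 1 1))
      (LinearMap.ext fun v => by simp [← Prod.one_eq_mk])
      (bt_hom_ext fun a v => by
        induction a using MonoidAlgebra.induction_linear with
        | zero => simp
        | add a b ha hb => simp only [map_add, add_btmul, ha, hb]
        | single g c =>
          have := btmul_balanced (autRep k (1 : MulAut G)) ρ g (MonoidAlgebra.single g 1) v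
          have h2 : (MonoidAlgebra.single g c : k[G]) = c • MonoidAlgebra.single g 1 := by simp
          rw [h2, smul_btmul, map_smul]
          simpa using congrArg (c • ·) this))
    fun x => bt_hom_ext fun a v => by
      induction a using MonoidAlgebra.induction_linear with
      | zero => simp
      | add a b ha hb => simp only [map_add, add_btmul, ha, hb]
      | single g c =>
        obtain ⟨a, b⟩ := x
        simp [← Module.End.mul_apply, ← map_mul]

/-- `V ⊗_{kH} kH ≅ V`. -/
def btUnitRight : (btRep ρ (autRep k (1 : MulAut H))).Equiv ρ :=
  .mk (.ofLinearMap
      (btlift ρ _ (LinearMap.flip (Finsupp.linearCombination k (fun h => ρ (1, h⁻¹)) ∘ₗ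
        (MonoidAlgebra.coeffLinearEquiv k).toLinearMap)) fun h v a => by
          induction a using MonoidAlgebra.induction_linear with
          | zero => simp
          | add a b ha hb => simp only [map_add, ha, hb]
          | single g c => simp [← Module.End.mul_apply, ← map_mul])
      ((btmk ρ (autRep k (1 : MulAut H))).flip (MonoidAlgebra.single 1 1))
      (LinearMap.ext fun v => by simp [← Prod.one_eq_mk])
      (bt_hom_ext fun v a => by
        induction a using MonoidAlgebra.induction_linear with
        | zero => simp
        | add a b ha hb => simp only [map_add, btmul_add, ha, hb]
        | single g c =>
          have := btmul_balanced ρ (autRep k (1 : MulAut H)) g⁻¹ v (MonoidAlgebra.single g 1)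
          have h2 : (MonoidAlgebra.single g c : k[H]) = c • MonoidAlgebra.single g 1 := by simp
          rw [h2, btmul_smul, map_smul]
          simpa using congrArg (c • ·) this))
    fun x => bt_hom_ext fun v a => by
      induction a using MonoidAlgebra.induction_linear with
      | zero => simp
      | add a b ha hb => simp only [map_add, btmul_add, ha, hb]
      | single g c =>
        obtain ⟨a, b⟩ := x
        simp [← Module.End.mul_apply, ← map_mul]

end Unit

/-! ## Grothendieck groups and the category of diagonal p-permutation bimodules -/

section Grothendieck

variable (k : Type u) [Field k] (F : Type v) [Field F]
variable (G H K L : Type) [Group G] [Group H] [Group K] [Group L] [Finite G] [Finite H] [Finite K]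
  [Finite L]

/-- `F ⊗_ℤ M^gp`, where `M^gp` is the Grothendieck group of a commutative monoid `M`. -/
abbrev LinGroth (M : Type w) [AddCommMonoid M] : Type (max v w) :=
  F ⊗[ℤ] Algebra.GrothendieckAddGroup M

/-- The class of an element of `M` in `F ⊗_ℤ M^gp`. -/
def gcls {M : Type w} [AddCommMonoid M] (x : M) : LinGroth F M :=
  (1 : F) ⊗ₜ Algebra.GrothendieckAddGroup.of x

/-- `F T(G) = F ⊗_ℤ T(G)`, where `T(G)` is the Grothendieck group (with respect to direct sums) of
`p`-permutation `kG`-modules. -/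
abbrev PPermGroup : Type (max u v) := LinGroth F (ppermClasses k G)

/-- `F T^Δ(G, H) = F ⊗_ℤ T^Δ(G, H)`, where `T^Δ(G, H)` is the Grothendieck group (with respect to
direct sums) of diagonal `p`-permutation `(kG, kH)`-bimodules. -/
abbrev DiagGroup : Type (max u v) := LinGroth F (diagClasses k G H)

variable {k F G H K L} {M : Type w} [AddCommMonoid M] {A : Type w'} [AddCommGroup A] [Module F A]

@[simp]
theorem gcls_zero : gcls F (0 : M) = 0 := by simp [gcls]

@[simp]
theorem gcls_add (x y : M) : gcls F (x + y) = gcls F x + gcls F y := by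
  simp [gcls, TensorProduct.tmul_add]

/-- The linear extension to `F ⊗ M^gp` of an additive map on a commutative monoid `M`. -/
def extend (f : M →+ A) : LinGroth F M →ₗ[F] A :=
  LinearMap.liftBaseChange F (Algebra.GrothendieckAddGroup.lift f).toIntLinearMap

@[simp]
theorem extend_gcls (f : M →+ A) (x : M) : extend f (gcls F x) = f x := by
  simp only [extend, gcls, LinearMap.liftBaseChange_tmul, one_smul]
  exact DFunLike.congr_fun (Algebra.GrothendieckAddGroup.lift.symm_apply_apply f) x

theorem extend_ext {f g : LinGroth F M →ₗ[F] A} (h : ∀ x : M, f (gcls F x) = g (gcls F x)) :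
    f = g := by
  refine TensorProduct.AlgebraTensorModule.curry_injective ?_
  refine LinearMap.ext_ring ?_
  refine LinearMap.toAddMonoidHom_injective ?_
  refine Algebra.GrothendieckAddGroup.lift.symm.injective ?_
  ext x
  exact h x

/-- `F ⊗ M^gp` is spanned by the classes of the elements of `M`. -/
theorem gcls_induction {motive : LinGroth F M → Prop} (of : ∀ x, motive (gcls F x))
    (add : ∀ x y, motive x → motive y → motive (x + y))
    (smul : ∀ (c : F) x, motive x → motive (c • x)) (x : LinGroth F M) : motive x := by
  have h : x ∈ Submodule.span F (Set.range (gcls F : M → LinGroth F M)) := by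
    have h1 : (Submodule.span F (Set.range (gcls F : M → LinGroth F M))).mkQ = 0 :=
      extend_ext fun y => by
        simpa using Submodule.subset_span (Set.mem_range_self y)
    have h2 := congrArg (fun q => q x) h1
    simpa using h2
  induction h using Submodule.span_induction with
  | mem x hx => obtain ⟨y, rfl⟩ := hx; exact of y
  | zero => simpa using of 0
  | add x y _ _ hx hy => exact add _ _ hx hy
  | smul c x _ hx => exact smul c x hx

/-- The tensor product over `kH` on isomorphism classes of bimodules. -/
def clsTensor (x : IsoClass k (G × H)) (y : IsoClass k (H × K)) : IsoClass k (G × K) :=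
  Quotient.lift₂ (fun (x : CoordRep k (G × H)) (y : CoordRep k (H × K)) => cls (btRep x.2 y.2))
    (by
      rintro a b c d ⟨e⟩ ⟨f⟩
      exact (cls_eq_iff _ _).2 ⟨btcongr e f⟩) x y

theorem clsTensor_cls {V : Type w} {W : Type w'} [AddCommGroup V] [Module k V] [Module.Finite k V]
    [AddCommGroup W] [Module k W] [Module.Finite k W]
    (ρ : Representation k (G × H) V) (σ : Representation k (H × K) W) :
    clsTensor (cls ρ) (cls σ) = cls (btRep ρ σ) := by
  change cls (btRep (transport _ ρ) (transport _ σ)) = _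
  exact (cls_eq_iff _ _).2 ⟨(btcongr (transportEquiv _ ρ) (transportEquiv _ σ)).symm⟩

theorem clsTensor_mem {x : IsoClass k (G × H)} {y : IsoClass k (H × K)}
    (hx : x ∈ diagClasses k G H) (hy : y ∈ diagClasses k H K) :
    clsTensor x y ∈ diagClasses k G K := by
  induction x using IsoClass.ind with | h _ ρ
  induction y using IsoClass.ind with | h _ σ
  rw [clsTensor_cls, cls_mem_diagClasses]
  rw [cls_mem_diagClasses] at hx hy
  exact hx.bt _ _ hy

theorem clsTensor_add_left (x x' : IsoClass k (G × H)) (y : IsoClass k (H × K)) :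
    clsTensor (x + x') y = clsTensor x y + clsTensor x' y := by
  induction x using IsoClass.ind with | h _ ρ
  induction x' using IsoClass.ind with | h _ ρ'
  induction y using IsoClass.ind with | h _ σ
  simp only [cls_add, clsTensor_cls]
  exact (cls_eq_iff _ _).2 ⟨btprodLeft ρ σ ρ'⟩

theorem clsTensor_add_right (x : IsoClass k (G × H)) (y y' : IsoClass k (H × K)) :
    clsTensor x (y + y') = clsTensor x y + clsTensor x y' := by
  induction x using IsoClass.ind with | h _ ρ
  induction y using IsoClass.ind with | h _ σ
  induction y' using IsoClass.ind with | h _ σ'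
  simp only [cls_add, clsTensor_cls]
  exact (cls_eq_iff _ _).2 ⟨btprodRight ρ σ σ'⟩

theorem clsTensor_zero_left (y : IsoClass k (H × K)) :
    clsTensor (0 : IsoClass k (G × H)) y = 0 := by
  induction y using IsoClass.ind with | h _ σ
  rw [← cls_eq_zero (1 : Representation k (G × H) (Fin 0 → k)), clsTensor_cls]
  have : Subsingleton (BalTensor (1 : Representation k (G × H) (Fin 0 → k)) σ) :=
    ⟨fun a b => bt_eq_iff (f := LinearMap.id) (g := 0) (fun v w => by
      rw [Subsingleton.elim v 0, zero_btmul, map_zero, map_zero]) (a - b) |> sub_eq_zero.1⟩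
  exact cls_eq_zero _

theorem clsTensor_zero_right (x : IsoClass k (G × H)) :
    clsTensor x (0 : IsoClass k (H × K)) = 0 := by
  induction x using IsoClass.ind with | h _ σ
  rw [← cls_eq_zero (1 : Representation k (H × K) (Fin 0 → k)), clsTensor_cls]
  have : Subsingleton (BalTensor σ (1 : Representation k (H × K) (Fin 0 → k))) :=
    ⟨fun a b => bt_eq_iff (f := LinearMap.id) (g := 0) (fun v w => by
      rw [Subsingleton.elim w 0, btmul_zero, map_zero, map_zero]) (a - b) |> sub_eq_zero.1⟩
  exact cls_eq_zero _

theorem clsTensor_assoc (x : IsoClass k (G × H)) (y : IsoClass k (H × K))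
    (z : IsoClass k (K × L)) :
    clsTensor (clsTensor x y) z = clsTensor x (clsTensor y z) := by
  induction x using IsoClass.ind with | h _ ρ
  induction y using IsoClass.ind with | h _ σ
  induction z using IsoClass.ind with | h _ τ
  simp only [clsTensor_cls]
  exact (cls_eq_iff _ _).2 ⟨btassoc ρ σ τ⟩

theorem clsTensor_one_left (y : IsoClass k (G × H)) :
    clsTensor (cls (autRep k (1 : MulAut G))) y = y := by
  induction y using IsoClass.ind with | h _ σ
  rw [clsTensor_cls]
  exact (cls_eq_iff _ _).2 ⟨btUnitLeft σ⟩

theorem clsTensor_one_right (x : IsoClass k (G × H)) :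
    clsTensor x (cls (autRep k (1 : MulAut H))) = x := by
  induction x using IsoClass.ind with | h _ σ
  rw [clsTensor_cls]
  exact (cls_eq_iff _ _).2 ⟨btUnitRight σ⟩

variable (k G H K) in
/-- The tensor product over `kH` of classes of diagonal `p`-permutation bimodules. -/
def diagTensor : diagClasses k G H →+ diagClasses k H K →+ diagClasses k G K where
  toFun x :=
    { toFun := fun y : diagClasses k H K => ⟨clsTensor x.1 y.1, clsTensor_mem x.2 y.2⟩
      map_zero' := Subtype.ext (clsTensor_zero_right _)
      map_add' := fun _ _ => Subtype.ext (clsTensor_add_right _ _ _) }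
  map_zero' := AddMonoidHom.ext fun _ => Subtype.ext (clsTensor_zero_left _)
  map_add' _ _ := AddMonoidHom.ext fun _ => Subtype.ext (clsTensor_add_left _ _ _)

variable (k F G H K) in
/-- The `F`-bilinear map `F T^Δ(G, H) × F T^Δ(H, K) → F T^Δ(G, K)` induced by `- ⊗_{kH} -`. -/
def diagMul : DiagGroup k F G H →ₗ[F] DiagGroup k F H K →ₗ[F] DiagGroup k F G K :=
  extend
    { toFun := fun x => extend
        { toFun := fun y => gcls F (diagTensor k G H K x y)
          map_zero' := by simp
          map_add' := fun _ _ => by simp }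
      map_zero' := extend_ext fun y => by rw [extend_gcls]; simp
      map_add' := fun x x' => extend_ext fun y => by
        rw [LinearMap.add_apply, extend_gcls, extend_gcls, extend_gcls]; simp }

theorem diagMul_gcls (x : diagClasses k G H) (y : diagClasses k H K) :
    diagMul k F G H K (gcls F x) (gcls F y) = gcls F (diagTensor k G H K x y) := by
  rw [diagMul, extend_gcls, AddMonoidHom.coe_mk, ZeroHom.coe_mk, extend_gcls]
  rfl

theorem diagMul_assoc (x : DiagGroup k F G H) (y : DiagGroup k F H K) (z : DiagGroup k F K L) :
    diagMul k F G K L (diagMul k F G H K x y) z = diagMul k F G H L x (diagMul k F H K L y z) := by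
  induction x using gcls_induction with
  | add x x' hx hx' => simp only [map_add, LinearMap.add_apply, hx, hx']
  | smul c x hx => simp only [map_smul, LinearMap.smul_apply, hx]
  | of x =>
    induction y using gcls_induction with
    | add x x' hx hx' => simp only [map_add, LinearMap.add_apply, hx, hx']
    | smul c x hx => simp only [map_smul, LinearMap.smul_apply, hx]
    | of y =>
      induction z using gcls_induction with
      | add x x' hx hx' => simp only [map_add, hx, hx']
      | smul c x hx => simp only [map_smul, hx]
      | of z =>
        simp only [diagMul_gcls]
        exact congrArg _ (Subtype.ext (clsTensor_assoc _ _ _))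

variable (k F) in
/-- The class in `F T^Δ(G, G)` of the bimodule `kG_γ` attached to an automorphism `γ` of `G`. -/
def autClass (γ : MulAut G) : DiagGroup k F G G :=
  gcls F ⟨cls (autRep k γ), (cls_mem_diagClasses _).2 (isDiagonalPPermutation_autRep γ)⟩

theorem one_diagMul (x : DiagGroup k F G H) : diagMul k F G G H (autClass k F 1) x = x := by
  induction x using gcls_induction with
  | add x x' hx hx' => rw [map_add, hx, hx']
  | smul c x hx => rw [map_smul, hx]
  | of x =>
    rw [autClass, diagMul_gcls]
    exact congrArg _ (Subtype.ext (clsTensor_one_left _))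

theorem diagMul_one (x : DiagGroup k F G H) : diagMul k F G H H x (autClass k F 1) = x := by
  induction x using gcls_induction with
  | add x x' hx hx' => rw [map_add, LinearMap.add_apply, hx, hx']
  | smul c x hx => rw [map_smul, LinearMap.smul_apply, hx]
  | of x =>
    rw [autClass, diagMul_gcls]
    exact congrArg _ (Subtype.ext (clsTensor_one_right _))

end Grothendieck

section Cat

/-- The `F`-linear category `F pp_k^Δ`: its objects are the finite groups, and the morphisms from
`G` to `H` are the elements of `F T^Δ(H, G)`. -/
structure PPCat (k : Type u) (F : Type v) : Type 1 where
  /-- The underlying group. -/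
  carrier : Type
  [group : Group carrier]
  [finite : Finite carrier]

attribute [instance] PPCat.group PPCat.finite

variable (k : Type u) [Field k] (F : Type v) [Field F]

instance : Category.{max u v} (PPCat k F) where
  Hom G H := DiagGroup k F H.carrier G.carrier
  id G := autClass k F (1 : MulAut G.carrier)
  comp {G H K} f g := diagMul k F K.carrier H.carrier G.carrier g f
  id_comp _ := diagMul_one _
  comp_id _ := one_diagMul _
  assoc f g h := (diagMul_assoc h g f).symm

instance : Preadditive (PPCat k F) where
  homGroup G H := inferInstanceAs (AddCommGroup (DiagGroup k F H.carrier G.carrier))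
  add_comp _ _ _ f f' g := (diagMul k F _ _ _ g).map_add f f'
  comp_add _ _ _ f g g' := (diagMul k F _ _ _).map_add₂ g g' f

instance : Linear F (PPCat k F) where
  homModule G H := inferInstanceAs (Module F (DiagGroup k F H.carrier G.carrier))
  smul_comp _ _ _ c f g := (diagMul k F _ _ _ g).map_smul c f
  comp_smul _ _ _ f c g := (diagMul k F _ _ _).map_smul₂ c g f

/-- The `F`-linear functors from `F pp_k^Δ` to `F`-vector spaces. -/
def isLinearFunctor : ObjectProperty (PPCat k F ⥤ ModuleCat.{max u v} F) :=
  fun S => S.Additive ∧ S.Linear F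

/-- The category of diagonal `p`-permutation functors over `F`. -/
abbrev DiagPPermFunctor : Type _ := (isLinearFunctor k F).FullSubcategory

end Cat

/-! ## Brauer quotients and Brauer characters -/

section Brauer

variable {k : Type u} [Field k] {G : Type} [Group G]
  {V : Type w} {W : Type w'} [AddCommGroup V] [Module k V] [AddCommGroup W] [Module k W]
  (ρ : Representation k G V) (σ : Representation k G W)

/-- The subspace `V^P` of `P`-fixed points. -/
def fixedPoints (P : Subgroup G) : Submodule k V := Representation.invariants (ρ.comp P.subtype : Representation k P V)

theorem mem_fixedPoints (P : Subgroup G) (v : V) : v ∈ fixedPoints ρ P ↔ ∀ g ∈ P, ρ g v = v :=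
  ⟨fun h g hg => h ⟨g, hg⟩, fun h g => h g g.2⟩

/-- `T` is a set of representatives of the cosets `Q / R`. -/
def IsTransversal (T : Finset G) (R Q : Subgroup G) : Prop :=
  Set.BijOn (fun x : G × G => x.1 * x.2) ((T : Set G) ×ˢ (R : Set G)) Q

theorem IsTransversal.image_isTransversal {T : Finset G} {R Q : Subgroup G}
    (h : IsTransversal T R Q) (e : MulAut G) :
    IsTransversal (T.map e.toEquiv.toEmbedding) (R.map e.toMonoidHom) (Q.map e.toMonoidHom) := by
  refine ⟨?_, ?_, ?_⟩
  · rintro ⟨x, y⟩ ⟨hx, r, hr, rfl⟩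
    obtain ⟨x, hx0, rfl⟩ := Finset.mem_map.1 hx
    exact ⟨x * r, h.mapsTo (x := (x, r)) ⟨hx0, hr⟩, map_mul e x r⟩
  · rintro ⟨x, y⟩ ⟨hx, r, hr, rfl⟩ ⟨x', y'⟩ ⟨hx', r', hr', rfl⟩ hh
    obtain ⟨x, hx0, rfl⟩ := Finset.mem_map.1 hx
    obtain ⟨x', hx0', rfl⟩ := Finset.mem_map.1 hx'
    have h1 : x * r = x' * r' := e.injective ((map_mul e x r).trans (hh.trans (map_mul e x' r').symm))
    have h2 := h.injOn (x₁ := (x, r)) (x₂ := (x', r')) ⟨hx0, hr⟩ ⟨hx0', hr'⟩ h1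
    obtain ⟨rfl, rfl⟩ := Prod.ext_iff.1 h2
    rfl
  · rintro _ ⟨q, hq, rfl⟩
    obtain ⟨⟨x, r⟩, ⟨hx, hr⟩, rfl⟩ := h.surjOn hq
    exact ⟨(e x, e r), ⟨Finset.mem_map.2 ⟨x, hx, rfl⟩, r, hr, rfl⟩, (map_mul e x r).symm⟩

/-- The subspace `∑_{R < P} Tr_R^P (V^R)`, where `Tr_R^P v = ∑_{t ∈ P / R} t v` is the relative
trace and `R` runs over the proper subgroups of `P`. -/
def traceSpace (P : Subgroup G) : Submodule k V :=
  Submodule.span k {w | ∃ R : Subgroup G, R < P ∧ ∃ T : Finset G, IsTransversal T R P ∧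
    ∃ v ∈ fixedPoints ρ R, w = ∑ t ∈ T, ρ t v}

/-- The Brauer quotient `V[P] = V^P / ∑_{R < P} Tr_R^P (V^R)`. -/
abbrev BrauerQuotient (P : Subgroup G) : Type w :=
  fixedPoints ρ P ⧸ (traceSpace ρ P).submoduleOf (fixedPoints ρ P)

variable {ρ σ} in
/-- The map induced on Brauer quotients by a linear map which preserves fixed points and traces. -/
def brauerMap (P : Subgroup G) (f : V →ₗ[k] W) (h1 : ∀ v ∈ fixedPoints ρ P, f v ∈ fixedPoints σ P)
    (h2 : ∀ v ∈ traceSpace ρ P, f v ∈ traceSpace σ P) :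
    BrauerQuotient ρ P →ₗ[k] BrauerQuotient σ P :=
  Submodule.mapQ _ _ (f.restrict h1) fun v hv => h2 v hv

theorem fixedPoints_map_normalizer (P : Subgroup G) {t : G} (ht : t ∈ Subgroup.normalizer (P : Set G)) (v : V)
    (hv : v ∈ fixedPoints ρ P) : ρ t v ∈ fixedPoints ρ P := by
  rw [mem_fixedPoints] at hv ⊢
  intro g hg
  have h1 : t⁻¹ * g * t ∈ P := (Subgroup.mem_normalizer_iff''.1 ht g).1 hg
  have h2 := congrArg (ρ t) (hv _ h1)
  rw [← Module.End.mul_apply, ← map_mul] at h2 ⊢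
  rw [← h2]
  congr 2
  group

theorem traceSpace_map_normalizer (P : Subgroup G) {t : G} (ht : t ∈ Subgroup.normalizer (P : Set G)) (v : V)
    (hv : v ∈ traceSpace ρ P) : ρ t v ∈ traceSpace ρ P := by
  classical
  change v ∈ (traceSpace ρ P).comap (ρ t)
  revert v
  change traceSpace ρ P ≤ _
  refine Submodule.span_le.2 ?_
  rintro _ ⟨R, hR, T, hT, v, hv, rfl⟩
  refine Submodule.subset_span ⟨R.map (MulAut.conj t).toMonoidHom, ?_,
    T.map (MulAut.conj t).toEquiv.toEmbedding, ?_, ρ t v, ?_, ?_⟩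
  · have h1 : P.map (MulAut.conj t).toMonoidHom = P :=
      (Subgroup.mem_normalizer_iff_map_conj_eq (H := P)).1 ht
    conv_rhs => rw [← h1]
    exact (Subgroup.map_lt_map_iff_of_injective (MulAut.conj t).injective).2 hR
  · have h1 : P.map (MulAut.conj t).toMonoidHom = P :=
      (Subgroup.mem_normalizer_iff_map_conj_eq (H := P)).1 ht
    have h2 := hT.image_isTransversal (MulAut.conj t)
    rwa [h1] at h2
  · rw [mem_fixedPoints] at hv ⊢
    rintro _ ⟨r, hr, rfl⟩
    have h2 := congrArg (ρ t) (hv r hr)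
    simp only [← Module.End.mul_apply, ← map_mul] at h2 ⊢
    simpa using h2
  · rw [map_sum, Finset.sum_map]
    refine Finset.sum_congr rfl fun x _ => ?_
    simp [← Module.End.mul_apply, ← map_mul]

/-- The action of an element of the normalizer of `P` on the Brauer quotient `V[P]`. -/
def brauerAction (P : Subgroup G) (t : Subgroup.normalizer (P : Set G)) : Module.End k (BrauerQuotient ρ P) :=
  brauerMap P (ρ t) (fixedPoints_map_normalizer ρ P t.2) (traceSpace_map_normalizer ρ P t.2)

theorem fixedPoints_map (P : Subgroup G) (f : ρ.IntertwiningMap σ) (v : V)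
    (hv : v ∈ fixedPoints ρ P) : f v ∈ fixedPoints σ P := by
  rw [mem_fixedPoints] at hv ⊢
  intro g hg
  rw [← f.isIntertwining, hv g hg]

theorem traceSpace_map (P : Subgroup G) (f : ρ.IntertwiningMap σ) (v : V)
    (hv : v ∈ traceSpace ρ P) : f v ∈ traceSpace σ P := by
  change v ∈ (traceSpace σ P).comap f.toLinearMap
  revert v
  change traceSpace ρ P ≤ _
  refine Submodule.span_le.2 ?_
  rintro _ ⟨R, hR, T, hT, v, hv, rfl⟩
  refine Submodule.subset_span ⟨R, hR, T, hT, f v, fixedPoints_map ρ σ R f v hv, ?_⟩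
  rw [map_sum]
  exact Finset.sum_congr rfl fun x _ => f.isIntertwining _ _ _ _

variable {ρ σ} in
/-- Functoriality of Brauer quotients. -/
def brauerFunctor (P : Subgroup G) (f : ρ.IntertwiningMap σ) :
    BrauerQuotient ρ P →ₗ[k] BrauerQuotient σ P :=
  brauerMap P f.toLinearMap (fixedPoints_map ρ σ P f) (traceSpace_map ρ σ P f)

theorem brauer_charpoly_congr [Module.Finite k V] [Module.Finite k W] (e : ρ.Equiv σ)
    (P : Subgroup G) (t : Subgroup.normalizer (P : Set G)) :
    (brauerAction ρ P t).charpoly = (brauerAction σ P t).charpoly := by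
  let E : BrauerQuotient ρ P ≃ₗ[k] BrauerQuotient σ P :=
    .ofLinearMap (brauerFunctor P e.toIntertwiningMap) (brauerFunctor P e.symm.toIntertwiningMap)
      (by
        refine Submodule.linearMap_qext _ (LinearMap.ext fun v => ?_)
        refine congrArg (Submodule.Quotient.mk) (Subtype.ext (e.apply_symm_apply v.1)))
      (by
        refine Submodule.linearMap_qext _ (LinearMap.ext fun v => ?_)
        refine congrArg (Submodule.Quotient.mk) (Subtype.ext (e.symm_apply_apply v.1)))
  have h : brauerAction σ P t = E.conj (brauerAction ρ P t) := by
    refine Submodule.linearMap_qext _ (LinearMap.ext fun v => ?_)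
    refine congrArg (Submodule.Quotient.mk) (Subtype.ext ?_)
    change σ t v.1 = e (ρ t (e.symm v.1))
    exact ((e.toIntertwiningMap.isIntertwining _ _ _ _).trans
      (congrArg _ (e.apply_symm_apply v.1))).symm
  rw [h, E.charpoly_conj]

theorem brauer_charpoly_prod [Module.Finite k V] [Module.Finite k W]
    (P : Subgroup G) (t : Subgroup.normalizer (P : Set G)) :
    (brauerAction (ρ.prod σ) P t).charpoly =
      (brauerAction ρ P t).charpoly * (brauerAction σ P t).charpoly := by
  let E : BrauerQuotient (ρ.prod σ) P ≃ₗ[k] BrauerQuotient ρ P × BrauerQuotient σ P :=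
    .ofLinearMap ((brauerFunctor P (.fst k ρ σ)).prod (brauerFunctor P (.snd k ρ σ)))
      ((brauerFunctor P (.inl k ρ σ)).coprod (brauerFunctor P (.inr k ρ σ))) 
      (by
        refine LinearMap.prod_ext (Submodule.linearMap_qext _ (LinearMap.ext fun v => ?_))
          (Submodule.linearMap_qext _ (LinearMap.ext fun v => ?_))
        · refine Prod.ext ?_ ?_ <;> simp [brauerFunctor, brauerMap] <;> rfl
        · refine Prod.ext ?_ ?_ <;> simp [brauerFunctor, brauerMap] <;> rfl)
      (by
        refine Submodule.linearMap_qext _ (LinearMap.ext fun v => ?_)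
        refine congrArg (Submodule.Quotient.mk) (Subtype.ext ?_)
        exact Prod.ext (add_zero v.1.1) (zero_add v.1.2))
  have h : (brauerAction ρ P t).prodMap (brauerAction σ P t) =
      E.conj (brauerAction (ρ.prod σ) P t) := by
    refine LinearMap.ext fun x => ?_
    obtain ⟨y, rfl⟩ := E.surjective x
    rw [LinearEquiv.conj_apply_apply, E.symm_apply_apply]
    induction y using Submodule.Quotient.induction_on with | H y => rfl
  rw [← LinearMap.charpoly_prodMap, h, E.charpoly_conj]

end Brauer

section BrauerCharacter

variable {k : Type u} [Field k] {F : Type v} [Field F]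

/-- An embedding of the roots of unity of `k` into the roots of unity of `F`, as it is used in the
definition of Brauer characters. -/
structure BrauerLift (k : Type u) [Field k] (F : Type v) [Field F] where
  /-- The underlying group homomorphism. -/
  toHom : CommGroup.torsion kˣ →* Fˣ
  injective : Function.Injective toHom

/-- Such embeddings exist, for algebraically closed fields `k` of characteristic `p` and `F` of
characteristic `0`. -/
theorem BrauerLift.nonempty (k : Type u) [Field k] [IsAlgClosed k] (p : ℕ) [Fact p.Prime]
    [CharP k p] (F : Type v) [Field F] [IsAlgClosed F] [CharZero F] :
    Nonempty (BrauerLift k F) := by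
  let K := FractionRing (WittVector p k)
  have h0 : CharZero (WittVector p k) := by
    obtain ⟨q, hq⟩ := CharP.exists (WittVector p k)
    rcases CharP.char_is_prime_or_zero (WittVector p k) q with h | rfl
    · exfalso
      have h1 : (q : k) = 0 := by
        rw [← map_natCast (WittVector.constantCoeff (p := p) (R := k)) q, CharP.cast_eq_zero,
          map_zero]
      have h2 := (Nat.prime_dvd_prime_iff_eq (Fact.out : p.Prime) h).1
        ((CharP.cast_eq_zero_iff k p q).1 h1)
      subst h2
      exact WittVector.p_nonzero p k (CharP.cast_eq_zero _ _)
    · exact CharP.charP_to_charZero _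
  have : CharZero K := charZero_of_injective_algebraMap (IsFractionRing.injective (WittVector p k) K)
  let A := algebraicClosure ℚ K
  have : Algebra.IsAlgebraic ℚ A := algebraicClosure.isAlgebraic ℚ K
  let i : A →ₐ[ℚ] F := IsAlgClosed.lift
  let j : k →* K := (algebraMap (WittVector p k) K).toMonoidHom.comp (WittVector.teichmuller p)
  have hj : Function.Injective j :=
    (IsFractionRing.injective (WittVector p k) K).comp (fun x y h => by
      simpa using congrArg (fun w => WittVector.coeff w 0) h)
  have hA : ∀ x : CommGroup.torsion kˣ, j ((x : kˣ) : k) ∈ A := by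
    intro x
    obtain ⟨n, hn, h⟩ := isOfFinOrder_iff_pow_eq_one.1 x.2
    have h1 : j ((x : kˣ) : k) ^ n = 1 := by
      rw [← map_pow, ← Units.val_pow_eq_pow_val, h, Units.val_one, map_one]
    refine mem_algebraicClosure_iff.2 (IsIntegral.of_pow (R := ℚ) hn ?_).isAlgebraic
    rw [h1]
    exact isIntegral_one
  let f : CommGroup.torsion kˣ →* A :=
    { toFun := fun x => ⟨j ((x : kˣ) : k), hA x⟩
      map_one' := Subtype.ext (by simp)
      map_mul' := fun x y => Subtype.ext (by simp) }
  refine ⟨⟨(i.toMonoidHom.comp f).toHomUnits, fun x y h => ?_⟩⟩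
  have h1 : i (f x) = i (f y) := congrArg Units.val h
  have h2 := congrArg Subtype.val (i.toRingHom.injective h1)
  exact Subtype.ext (Units.ext (hj h2))

open Classical in
/-- The lift to `F` of an element of `k`; elements which are not roots of unity are sent to `0`. -/
def BrauerLift.lift (θ : BrauerLift k F) (x : k) : F :=
  if h : ∃ y : CommGroup.torsion kˣ, ((y : kˣ) : k) = x then (θ.toHom h.choose : F) else 0

/-- The sum of the lifts to `F` of the eigenvalues (with multiplicities) of the action of an element
`t` of the normalizer of `P` on the Brauer quotient `V[P]`. If `t` is of order prime to the
characteristic of `k`, and `k` is algebraically closed, this is the value at `t` of the Brauer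
character of `V[P]`. -/
def brauerValue (θ : BrauerLift k F) {G : Type} [Group G] {V : Type w} [AddCommGroup V]
    [Module k V] [Module.Finite k V] (ρ : Representation k G V) (P : Subgroup G)
    (t : Subgroup.normalizer (P : Set G)) : F :=
  ((brauerAction ρ P t).charpoly.roots.map θ.lift).sum

variable {G : Type} [Group G]

/-- The map induced by `brauerValue` on isomorphism classes. -/
def brauerValueHom (θ : BrauerLift k F) (P : Subgroup G) (t : Subgroup.normalizer (P : Set G)) :
    IsoClass k G →+ F where
  toFun := Quotient.lift (fun x => brauerValue θ x.2 P t) (by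
    rintro a b ⟨e⟩
    change Multiset.sum _ = Multiset.sum _
    rw [brauer_charpoly_congr _ _ e])
  map_zero' := by
    change brauerValue θ _ P t = 0
    have : Subsingleton (Fin (Module.finrank k (Fin 0 → k)) → k) := by
      rw [Module.finrank_fin_fun]; infer_instance
    have h : Subsingleton (BrauerQuotient
      (transport (Module.finBasis k (Fin 0 → k)).equivFun (1 : Representation k G (Fin 0 → k))) P) :=
      inferInstance
    have h2 := Subsingleton.elim (brauerAction
      (transport (Module.finBasis k (Fin 0 → k)).equivFun (1 : Representation k G (Fin 0 → k))) P t) 0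
    change (Multiset.map θ.lift (LinearMap.charpoly (brauerAction
      (transport (Module.finBasis k (Fin 0 → k)).equivFun _) P t)).roots).sum = 0
    rw [h2, LinearMap.charpoly_zero, Module.finrank_zero_of_subsingleton]
    simp
  map_add' x y := by
    induction x using Quotient.inductionOn with | h x
    induction y using Quotient.inductionOn with | h y
    change brauerValue θ (transport _ (x.2.prod y.2)) P t = brauerValue θ _ P t + brauerValue θ _ P t
    simp only [brauerValue]
    rw [← brauer_charpoly_congr _ _ (transportEquiv _ _), brauer_charpoly_prod,
      Polynomial.roots_mul, Multiset.map_add, Multiset.sum_add]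
    exact mul_ne_zero (LinearMap.charpoly_monic _).ne_zero (LinearMap.charpoly_monic _).ne_zero

/-- The linear map `τ_{P, t} : F T(G) → F`, whose value on (the class of) a `p`-permutation
`kG`-module `V` is the value at `t` of the Brauer character of the Brauer quotient `V[P]`. -/
def tau (θ : BrauerLift k F) [Finite G] (P : Subgroup G) (t : Subgroup.normalizer (P : Set G)) :
    PPermGroup k F G →ₗ[F] F :=
  extend ((brauerValueHom θ P t).comp (ppermClasses k G).subtype)

end BrauerCharacter

/-! ## Induction from the diagonal -/

section Tilde

variable {k : Type u} [Field k] {G : Type} [Group G]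
  {V : Type w} {W : Type w'} [AddCommGroup V] [Module k V] [AddCommGroup W] [Module k W]

/-- The bimodule `Ind_{ΔG}^{G × G} V`, realized on the space of functions `G → V`: the function with
value `v` at `x` and `0` elsewhere corresponds to `(x, 1) ⊗ x⁻¹ v`. See `indEquiv`. -/
def indDiag (ρ : Representation k G V) : Representation k (G × G) (G → V) where
  toFun a :=
    { toFun := fun f x => ρ a.1 (f (a.1⁻¹ * x * a.2))
      map_add' := fun f g => by ext; simp
      map_smul' := fun c f => by ext; simp }
  map_one' := by ext; simp
  map_mul' a b := by
    refine LinearMap.ext fun f => funext fun x => ?_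
    simp [mul_assoc]

theorem indDiag_apply (ρ : Representation k G V) (a : G × G) (f : G → V) (x : G) :
    indDiag ρ a f x = ρ a.1 (f (a.1⁻¹ * x * a.2)) := rfl

theorem indDiag_single [DecidableEq G] (ρ : Representation k G V) (a : G × G) (x : G) (v : V) :
    indDiag ρ a (Pi.single x v) = Pi.single (a.1 * x * a.2⁻¹) (ρ a.1 v) := by
  ext y
  rw [indDiag_apply]
  by_cases h : y = a.1 * x * a.2⁻¹
  · subst h
    simp [mul_assoc]
  · rw [Pi.single_eq_of_ne h, Pi.single_eq_of_ne, map_zero]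
    rintro rfl
    exact h (by group)

/-- `indDiag ρ` is isomorphic to the representation induced by `ρ` along the diagonal embedding of
`G` in `G × G`. -/
theorem indEquiv [Finite G] (ρ : Representation k G V) :
    Nonempty ((Representation.ind ((MonoidHom.id G).prod (MonoidHom.id G)) ρ).Equiv
      (indDiag ρ)) := by
  classical
  have := Fintype.ofFinite G
  let φ := (MonoidHom.id G).prod (MonoidHom.id G)
  let A : (G × G) → V →ₗ[k] (G → V) := fun a => LinearMap.single k (fun _ => V) (a.1⁻¹ * a.2) ∘ₗ ρ a.1⁻¹
  let B : k[G × G] →ₗ[k] V →ₗ[k] (G → V) :=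
    Finsupp.lsum k (fun a => LinearMap.toSpanSingleton k _ (A a)) ∘ₗ
      (MonoidAlgebra.coeffLinearEquiv k).toLinearMap
  have hB : ∀ a c v, B (MonoidAlgebra.single a c) v = c • A a v := by
    intro a c v
    simp [B]
  let f : Representation.IndV φ ρ →ₗ[k] (G → V) :=
    Representation.Coinvariants.lift _ (TensorProduct.lift B) fun g => by
      ext a v x
      simp [hB, A, φ]
  have hf : ∀ a v, f (Representation.IndV.mk φ ρ a v) = Pi.single (a.1⁻¹ * a.2) (ρ a.1⁻¹ v) :=
    fun a v => (hB a 1 v).trans (one_smul _ _)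
  let b : (G → V) →ₗ[k] Representation.IndV φ ρ :=
    ∑ x : G, Representation.IndV.mk φ ρ (1, x) ∘ₗ LinearMap.proj x
  have hb : ∀ x v, b (Pi.single x v) = Representation.IndV.mk φ ρ (1, x) v := by
    intro x v
    rw [LinearMap.sum_apply, Finset.sum_eq_single x]
    · simp
    · intro y _ hy
      simp [Pi.single_eq_of_ne hy]
    · simp
  refine ⟨.mk (.ofLinearMap f b ?_ ?_) ?_⟩
  · refine LinearMap.pi_ext fun x v => ?_
    rw [LinearMap.comp_apply, hb, hf]
    simp
  · refine Representation.IndV.hom_ext _ _ fun a => LinearMap.ext fun v => ?_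
    rw [LinearMap.comp_apply, LinearMap.comp_apply, hf, hb]
    have := Representation.Coinvariants.mk_self_apply
      (Representation.tprod ((Representation.leftRegular k (G × G)).comp φ) ρ) a.1⁻¹
      (MonoidAlgebra.single a 1 ⊗ₜ v)
    refine Eq.trans (congrArg (Representation.Coinvariants.mk _) ?_) this
    have h3 : ((1, a.1⁻¹ * a.2) : G × G) = φ a.1⁻¹ * a := by ext <;> simp [φ]
    rw [h3]
    simp
  · intro a
    refine Representation.IndV.hom_ext _ _ fun c => LinearMap.ext fun v => ?_
    change f (Representation.ind φ ρ a (Representation.IndV.mk φ ρ c v)) =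
      indDiag ρ a (f (Representation.IndV.mk φ ρ c v))
    rw [Representation.ind_mk, hf, hf, indDiag_single, ← Module.End.mul_apply, ← map_mul]
    simp [mul_assoc]

variable {σ : Representation k G W} {ρ : Representation k G V}

/-- Functoriality of `indDiag`. -/
def indDiagMap (f : ρ.IntertwiningMap σ) : (indDiag ρ).IntertwiningMap (indDiag σ) :=
  ⟨f.toLinearMap.compLeft G, fun a => by
    refine LinearMap.ext fun h => funext fun x => ?_
    exact f.isIntertwining _ _ _ _⟩

/-- Functoriality of `indDiag` for isomorphisms. -/
def indDiagCongr (e : ρ.Equiv σ) : (indDiag ρ).Equiv (indDiag σ) :=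
  .mk (.ofLinearMap (indDiagMap e.toIntertwiningMap).toLinearMap
      (indDiagMap e.symm.toIntertwiningMap).toLinearMap
      (LinearMap.ext fun f => funext fun x => e.apply_symm_apply (f x))
      (LinearMap.ext fun f => funext fun x => e.symm_apply_apply (f x)))
    (indDiagMap e.toIntertwiningMap).isIntertwining'

variable (ρ σ) in
/-- Compatibility of `indDiag` with direct sums. -/
def indDiagProd : (indDiag (ρ.prod σ)).Equiv ((indDiag ρ).prod (indDiag σ)) :=
  .mk (.ofLinearMap ((LinearMap.fst k V W).compLeft G |>.prod ((LinearMap.snd k V W).compLeft G))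
      ((LinearMap.inl k V W).compLeft G |>.coprod ((LinearMap.inr k V W).compLeft G))
      (LinearMap.ext fun f => by
        refine Prod.ext (funext fun x => ?_) (funext fun x => ?_)
        · exact add_zero (f.1 x)
        · exact zero_add (f.2 x))
      (LinearMap.ext fun f => funext fun x => Prod.ext (add_zero (f x).1) (zero_add (f x).2)))
    fun a => rfl

theorem IsPPermutation.indDiag [Finite G] (h : IsPPermutation ρ) :
    IsPPermutation (DiagPPerm.indDiag ρ) := by
  obtain ⟨X, hX, A, i, r, hi, hr, hir⟩ := (isPPermutation_iff _).1 h
  classical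
  have := Fintype.ofFinite G
  let A' : MulAction (G × G) (G × X) :=
    { smul := fun a y => (a.1 * y.1 * a.2⁻¹, a.1 • y.2)
      one_smul := fun y => by
        change (1 * y.1 * 1⁻¹, (1 : G) • y.2) = y
        simp
      mul_smul := fun a b y => by
        change ((a.1 * b.1) * y.1 * (a.2 * b.2)⁻¹, (a.1 * b.1) • y.2) =
          (a.1 * (b.1 * y.1 * b.2⁻¹) * a.2⁻¹, a.1 • b.1 • y.2)
        simp [mul_assoc, mul_smul] }
  refine (isPPermutation_iff _).2 ⟨G × X, inferInstance, A', fun y => i y.2 ∘ₗ LinearMap.proj y.1,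
    fun y => Pi.single y.1 (r y.2), ?_, ?_, ?_⟩
  · intro a y f
    change i (a.1 • y.2) (DiagPPerm.indDiag ρ a f (a.1 * y.1 * a.2⁻¹)) = i y.2 (f y.1)
    rw [indDiag_apply, hi]
    congr 2
    group
  · intro a y
    change (Pi.single (a.1 * y.1 * a.2⁻¹) (r (a.1 • y.2)) : G → V) = _
    rw [hr, indDiag_single]
  · intro f
    funext x
    rw [Fintype.sum_prod_type, Finset.sum_apply, Finset.sum_eq_single x]
    · rw [Finset.sum_apply]
      simpa using hir (f x)
    · intro y _ hy
      simp [Finset.sum_apply, Pi.single_eq_of_ne hy.symm]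
    · simp

theorem IsPPermutation.isDiagonal_indDiag [Finite G] (h : IsPPermutation ρ) :
    IsDiagonalPPermutation (DiagPPerm.indDiag ρ) := by
  classical
  have := Fintype.ofFinite G
  let θ : (G → V) →ₗ[k] (G → V) := LinearMap.single k (fun _ => V) 1 ∘ₗ LinearMap.proj 1
  have hθ : ∀ f, θ f = Pi.single 1 (f 1) := fun f => rfl
  refine (isDiagonalPPermutation_iff _).2 ⟨h.indDiag, ⟨θ, fun f => ?_⟩, ⟨θ, fun f => ?_⟩⟩
  · simp only [hθ, indDiag_single, indDiag_apply]
    funext x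
    rw [Finset.sum_apply, Finset.sum_eq_single x]
    · simp [← Module.End.mul_apply, ← map_mul]
    · intro b _ hb
      rw [Pi.single_eq_of_ne]
      simpa using hb.symm
    · simp
  · simp only [hθ, indDiag_single, indDiag_apply]
    funext x
    rw [Finset.sum_apply, Finset.sum_eq_single x⁻¹]
    · simp
    · intro b _ hb
      rw [Pi.single_eq_of_ne]
      rintro rfl
      simp at hb
    · simp

variable (k G) in
/-- The additive map on isomorphism classes given by induction from the diagonal. -/
def indClass [Finite G] : ppermClasses k G →+ diagClasses k G G where
  toFun x := ⟨Quotient.lift (fun y : CoordRep k G => cls (indDiag y.2))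
    (by
      rintro a b ⟨e⟩
      exact (cls_eq_iff _ _).2 ⟨indDiagCongr e⟩) x.1, by
    obtain ⟨_, n, ρ, rfl, h⟩ := x
    exact (cls_mem_diagClasses _).2 (h.of_equiv (transportEquiv _ _)).isDiagonal_indDiag⟩
  map_zero' := Subtype.ext <| by
    have : Subsingleton (Fin (Module.finrank k (Fin 0 → k)) → k) := by
      rw [Module.finrank_fin_fun]; infer_instance
    exact cls_eq_zero _
  map_add' x y := Subtype.ext <| by
    obtain ⟨_, n, ρ, rfl, h⟩ := x
    obtain ⟨_, m, σ, rfl, h'⟩ := y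
    refine Eq.trans ?_ (cls_add _ _).symm
    exact (cls_eq_iff _ _).2 ⟨(indDiagCongr (transportEquiv _ _).symm).trans (indDiagProd _ _)⟩

/-- The linear map `F T(G) → F T^Δ(G, G)`, `W ↦ Ind_{ΔG}^{G × G} W`. -/
def tilde (F : Type v) [Field F] [Finite G] : PPermGroup k F G →ₗ[F] DiagGroup k F G G :=
  extend
    { toFun := fun x => gcls F (indClass k G x)
      map_zero' := by simp
      map_add' := fun x y => by simp }

end Tilde

/-! ## The idempotents attached to pairs -/

section Idempotent

variable {k : Type u} [Field k] {F : Type v} [Field F] {G : Type} [Group G] [Finite G]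

/-- The pairs `(P, s)` and `(Q, t)`, consisting of a subgroup and an element of `G`, are conjugate
in `G`. -/
def PairConj (P : Subgroup G) (s : G) (Q : Subgroup G) (t : G) : Prop :=
  ∃ g : G, P.map (MulAut.conj g).toMonoidHom = Q ∧ g * s * g⁻¹ = t

/-- The defining property of the primitive idempotent `F^G_{P, s}` of `F T(G)`: for every
`p`-subgroup `Q` of `G` and every `p'`-element `t` of `N_G(Q)`, the value of `τ_{Q, t}` at it is `1`
if `(Q, t)` is conjugate to `(P, s)`, and `0` otherwise. -/
def IsPairIdempotent (p : ℕ) (θ : BrauerLift k F) (P : Subgroup G) (s : G)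
    (x : PPermGroup k F G) : Prop :=
  ∀ (Q : Subgroup G) (t : Subgroup.normalizer (Q : Set G)), IsPGroup p Q → (orderOf t).Coprime p →
    (PairConj Q (t : G) P s → tau θ Q t x = 1) ∧ (¬ PairConj Q (t : G) P s → tau θ Q t x = 0)

/-- The primitive idempotent `F^G_{P, s}` of `F T(G)`, for a `p`-subgroup `P` of `G` and a
`p'`-element `s` of `N_G(P)`. It is the unique element with the property `IsPairIdempotent`. -/
def pairIdempotent (p : ℕ) (θ : BrauerLift k F) (P : Subgroup G) (s : G) : PPermGroup k F G :=
  Classical.epsilon (IsPairIdempotent p θ P s)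

end Idempotent

/-! ## Pairs and triples -/

section Pairs

theorem isConj_map {A B : Type*} [Group A] [Group B] (f : A ≃* B) {a b : A} (h : IsConj a b) :
    IsConj (f a) (f b) :=
  f.toMonoidHom.map_isConj h

/-- A `D^Δ`-pair `(L, u)`: a finite `p`-group `L`, and a generator `u` of a cyclic `p'`-group
acting faithfully on `L`, that is, an automorphism `u` of `L` of order prime to `p`. -/
structure DPair (p : ℕ) : Type 1 where
  /-- The `p`-group. -/
  L : Type
  [group : Group L]
  [finite : Finite L]
  isPGroup : IsPGroup p L
  /-- The automorphism. -/
  u : MulAut L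
  coprime : (orderOf u).Coprime p

attribute [instance] DPair.group DPair.finite

namespace DPair

variable {p : ℕ} (D : DPair p)

/-- The semidirect product `L⟨u⟩ = L ⋊ ⟨u⟩`. -/
abbrev grp : Type := D.L ⋊[(Subgroup.zpowers D.u).subtype] Subgroup.zpowers D.u

instance : Finite D.grp := Finite.of_equiv _ SemidirectProduct.equivProd.symm

/-- The generator `u`, as an element of `L⟨u⟩`. -/
def gen : D.grp := SemidirectProduct.inr ⟨D.u, Subgroup.mem_zpowers D.u⟩

/-- The subgroup `L` of `L⟨u⟩`. -/
def sub : Subgroup D.grp := (SemidirectProduct.inl : D.L →* D.grp).range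

/-- The group `Aut(L, u)` of automorphisms of `L⟨u⟩` which send `u` to a conjugate of `u`. -/
def aut : Subgroup (MulAut D.grp) where
  carrier := {φ | IsConj D.gen (φ D.gen)}
  one_mem' := IsConj.refl _
  mul_mem' {φ ψ} hφ hψ := hφ.trans (isConj_map φ hψ)
  inv_mem' {φ} hφ := by
    have h := isConj_map (φ⁻¹ : MulAut D.grp) hφ
    simpa using h.symm

/-- The subgroup `Inn(L⟨u⟩)` of `Aut(L, u)`. -/
def inn : Subgroup D.aut := (MulAut.conj : D.grp →* MulAut D.grp).range.subgroupOf D.aut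

instance : D.inn.Normal := by
  refine ⟨?_⟩
  rintro ⟨φ, hφ⟩ ⟨g, hg⟩ ⟨ψ, hψ⟩
  refine ⟨ψ g, ?_⟩
  ext1 x
  have h := DFunLike.congr_fun hg (ψ⁻¹ x)
  simp at h
  simp [← h]

/-- The group `Out(L, u) = Aut(L, u) / Inn(L⟨u⟩)`. -/
abbrev Out : Type := D.aut ⧸ D.inn

end DPair

/-- A triple `(L, u, V)`, where `(L, u)` is a `D^Δ`-pair and `V` is a simple `F Out(L, u)`-module. -/
structure Triple (p : ℕ) (F : Type v) [Field F] : Type (max 1 (v + 1)) where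
  /-- The `D^Δ`-pair. -/
  pair : DPair p
  /-- The underlying vector space of the simple module. -/
  V : Type v
  [addCommGroup : AddCommGroup V]
  [module : Module F V]
  /-- The action of `Out(L, u)`. -/
  rep : Representation F pair.Out V
  simple : rep.IsIrreducible

attribute [instance] Triple.addCommGroup Triple.module

variable {p : ℕ} {F : Type v} [Field F]

/-- An isomorphism of triples from `(L, u, V)` to `(M, v, W)`: a group isomorphism
`f : L⟨u⟩ → M⟨v⟩` sending `u` to a conjugate of `v`, together with a linear isomorphism `e : V → W`
which is compatible with the isomorphism `Out(L, u) → Out(M, v)`, `γ ↦ f γ f⁻¹`. -/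
def Triple.Iso (t t' : Triple p F) : Prop :=
  ∃ (f : t.pair.grp ≃* t'.pair.grp) (e : t.V ≃ₗ[F] t'.V), IsConj (f t.pair.gen) t'.pair.gen ∧
    ∀ (γ : t.pair.aut) (γ' : t'.pair.aut), (∀ x, (γ' : MulAut t'.pair.grp) (f x) =
      f ((γ : MulAut t.pair.grp) x)) → ∀ x : t.V, e (t.rep γ x) = t'.rep γ' (e x)

theorem exists_conj {t t' : Triple p F} (f : t.pair.grp ≃* t'.pair.grp)
    (h : IsConj (f t.pair.gen) t'.pair.gen) (γ : t.pair.aut) :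
    ∃ γ' : t'.pair.aut, ∀ x, (γ' : MulAut t'.pair.grp) (f x) = f ((γ : MulAut t.pair.grp) x) := by
  refine ⟨⟨MulAut.congr f γ, ?_⟩, fun x => ?_⟩
  · change IsConj _ (f (γ.1 (f.symm t'.pair.gen)))
    have h1 : IsConj (t.pair.gen) (f.symm t'.pair.gen) := by
      simpa using isConj_map f.symm h
    have h2 : IsConj (γ.1 t.pair.gen) (γ.1 (f.symm t'.pair.gen)) := isConj_map γ.1 h1
    have h3 : IsConj t.pair.gen (γ.1 t.pair.gen) := γ.2
    exact h.symm.trans (isConj_map f (h3.trans h2))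
  · change f (γ.1 (f.symm (f x))) = _
    rw [f.symm_apply_apply]

instance tripleSetoid (p : ℕ) (F : Type v) [Field F] : Setoid (Triple p F) where
  r := Triple.Iso
  iseqv := by
    refine ⟨fun t => ⟨.refl _, .refl _ _, .refl _, ?_⟩, ?_, ?_⟩
    · intro γ γ' h x
      obtain rfl : γ' = γ := Subtype.ext (MulEquiv.ext h)
      rfl
    · rintro t t' ⟨f, e, h, he⟩
      refine ⟨f.symm, e.symm, ?_, fun γ γ' hγ x => ?_⟩
      · simpa using isConj_map f.symm h.symm
      · rw [LinearEquiv.symm_apply_eq, he γ' γ, e.apply_symm_apply]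
        intro y
        have := hγ (f y)
        rw [f.symm_apply_apply] at this
        rw [this, f.apply_symm_apply]
    · rintro t t' t'' ⟨f, e, h, he⟩ ⟨f', e', h', he'⟩
      refine ⟨f.trans f', e.trans e', (isConj_map f' h).trans h', fun γ γ'' hγ x => ?_⟩
      obtain ⟨γ', hγ'⟩ := exists_conj f h γ
      rw [LinearEquiv.trans_apply, LinearEquiv.trans_apply, he γ γ' hγ', he' γ' γ'']
      intro y
      obtain ⟨y, rfl⟩ := f.surjective y
      rw [hγ']
      exact hγ y

variable (p F) in
/-- Isomorphism classes of triples. -/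
abbrev TripleClass : Type _ := Quotient (tripleSetoid p F)

end Pairs

/-! ## Simple functors and semisimplicity -/

section Functors

variable (k : Type u) [Field k] (F : Type v) [Field F]

/-- Simple diagonal `p`-permutation functors. -/
abbrev SimpleFunctor : Type _ := {S : DiagPPermFunctor k F // Simple S}

/-- Isomorphism of simple functors, as an equivalence relation. -/
instance simpleSetoid : Setoid (SimpleFunctor k F) where
  r S T := Nonempty (S.1 ≅ T.1)
  iseqv := ⟨fun S => ⟨.refl S.1⟩, fun ⟨e⟩ => ⟨e.symm⟩, fun ⟨e⟩ ⟨f⟩ => ⟨e.trans f⟩⟩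

/-- Isomorphism classes of simple diagonal `p`-permutation functors. -/
abbrev SimpleClass : Type _ := Quotient (simpleSetoid k F)

/-- A preadditive category is semisimple if it is abelian and if every object is a (possibly
infinite) direct sum of simple objects, with index sets in a given universe. -/
def IsSemisimpleCat (C : Type*) [Category C] [h : Preadditive C] : Prop :=
  (∃ a : Abelian C, a.toPreadditive = h) ∧
    ∀ X : C, ∃ (ι : Type w) (S : ι → C) (c : Limits.Cofan S), (∀ i, Simple (S i)) ∧ c.pt = X ∧
      Nonempty (Limits.IsColimit c)

variable {k F} {p : ℕ}

/-- The linear map `S(G) → S(G)` given by an element of `F T^Δ(G, G)`, for a functor `S`. -/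
def functorEnd (S : DiagPPermFunctor k F) {G : Type} [Group G] [Finite G]
    (x : DiagGroup k F G G) : S.obj.obj ⟨G⟩ →ₗ[F] S.obj.obj ⟨G⟩ :=
  (S.obj.map (show (⟨G⟩ : PPCat k F) ⟶ ⟨G⟩ from x)).hom

/-- The direct summand `F̃_{L,u} S(L⟨u⟩)` of the value at `L⟨u⟩` of a functor `S`, where `F̃_{L,u}` is
the image under `tilde` of the primitive idempotent attached to the pair `(L, u)` of `L⟨u⟩`. -/
def component (θ : BrauerLift k F) (S : DiagPPermFunctor k F) (D : DPair p) :
    Submodule F (S.obj.obj ⟨D.grp⟩) :=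
  LinearMap.range (functorEnd S (tilde F (pairIdempotent p θ D.sub D.gen)))

/-- The functor `S` corresponds to the triple `(L, u, V)`: the component `F̃_{L,u} S(L⟨u⟩)`, on which
the class of an automorphism `γ ∈ Aut(L, u)` in `Out(L, u)` acts as the bimodule `k(L⟨u⟩)_γ`, is
isomorphic to `V`. -/
def Corresponds (θ : BrauerLift k F) (t : Triple p F) (S : DiagPPermFunctor k F) : Prop :=
  ∃ e : t.V ≃ₗ[F] component θ S t.pair, ∀ (γ : t.pair.aut) (x : t.V),
    (e (t.rep γ x) : S.obj.obj ⟨t.pair.grp⟩) = functorEnd S (autClass k F γ.1) (e x)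

end Functors

end DiagPPerm

end

noncomputable section

namespace DiagPPerm

/-! ## Finite dimensional algebras over algebraically closed fields -/

/-- A finite dimensional algebra over an algebraically closed field has finitely many matrix
representations which are jointly surjective, and whose joint kernel is nilpotent. -/
theorem exists_matrix_quotient (k : Type u) [Field k] [IsAlgClosed k] (A : Type w) [Ring A]
    [Algebra k A] [Module.Finite k A] :
    ∃ (n : ℕ) (d : Fin n → ℕ) (φ : ∀ j, A →ₐ[k] Module.End k (Fin (d j) → k)),
      (∀ j, d j ≠ 0) ∧ (∀ T : ∀ j, Module.End k (Fin (d j) → k), ∃ a, ∀ j, φ j a = T j) ∧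
      (∀ a, a ∈ Ring.jacobson A ↔ ∀ j, φ j a = 0) ∧ IsNilpotent (Ring.jacobson A) := by
  have := IsArtinianRing.of_finite k A
  obtain ⟨n, d, hd, ⟨e⟩⟩ :=
    IsSemisimpleRing.exists_algEquiv_pi_matrix_of_isAlgClosed k (A ⧸ Ring.jacobson A)
  let q : A →ₐ[k] A ⧸ Ring.jacobson A := Ideal.Quotient.mkₐ k (Ring.jacobson A)
  refine ⟨n, d, fun j => (Matrix.toLinAlgEquiv' (R := k) (n := Fin (d j))).toAlgHom.comp
    ((Pi.evalAlgHom k _ j).comp (e.toAlgHom.comp q)), fun j => (hd j).ne, fun T => ?_,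
    fun a => ?_, IsSemiprimaryRing.isNilpotent⟩
  · obtain ⟨a, ha⟩ := Ideal.Quotient.mk_surjective
      (e.symm fun j => (Matrix.toLinAlgEquiv' (R := k) (n := Fin (d j))).symm (T j))
    refine ⟨a, fun j => ?_⟩
    change Matrix.toLinAlgEquiv' (e (Ideal.Quotient.mk _ a) j) = T j
    rw [ha, e.apply_symm_apply, AlgEquiv.apply_symm_apply]
  · have h1 : a ∈ Ring.jacobson A ↔ e (q a) = 0 := by
      rw [EmbeddingLike.map_eq_zero_iff]
      exact Ideal.Quotient.eq_zero_iff_mem.symm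
    rw [h1, funext_iff]
    refine forall_congr' fun j => ?_
    exact (EmbeddingLike.map_eq_zero_iff (f := Matrix.toLinAlgEquiv' (R := k) (n := Fin (d j)))).symm

/-! ## Invariant matrices and presentations of modules -/

section Presentation

variable (k : Type u) [Field k] (Γ : Type) [Group Γ] (X : Type) [Fintype X]
  [DecidableEq X] [MulAction Γ X]

/-- The algebra of `Γ`-invariant matrices, that is, of endomorphisms of the permutation module
`k X`. -/
def invMat : Subalgebra k (Matrix X X k) where
  carrier := {M | ∀ (g : Γ) x y, M (g • x) (g • y) = M x y}
  mul_mem' {M N} hM hN g x y := by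
    rw [Matrix.mul_apply, Matrix.mul_apply, ← Equiv.sum_comp (MulAction.toPerm g)]
    exact Finset.sum_congr rfl fun z _ => by
      rw [MulAction.toPerm_apply, hM, hN]
  add_mem' {M N} hM hN g x y := by
    rw [Matrix.add_apply, Matrix.add_apply, hM, hN]
  algebraMap_mem' c g x y := by
    simp [Matrix.algebraMap_matrix_apply]

variable {k Γ}

/-- A presentation of a `kΓ`-module `V` as a direct summand of a power of `kX`, given by a dual
system. -/
structure Pres {V : Type w} [AddCommGroup V] [Module k V] (ρ : Representation k Γ V) where
  /-- The index set of the power. -/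
  ι : Type
  [fintype : Fintype ι]
  [decEq : DecidableEq ι]
  /-- The coordinate functionals. -/
  i : ι → X → V →ₗ[k] k
  /-- The generators. -/
  r : ι → X → V
  hi : ∀ l g x v, i l (g • x) (ρ g v) = i l x v
  hr : ∀ l g x, r l (g • x) = ρ g (r l x)
  sum_eq : ∀ v, ∑ l, ∑ x, i l x v • r l x = v

attribute [instance] Pres.fintype Pres.decEq

namespace Pres

variable {X} {V : Type w} [AddCommGroup V] [Module k V] {ρ : Representation k Γ V}
  {W : Type w'} [AddCommGroup W] [Module k W] {σ : Representation k Γ W}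
  {U : Type*} [AddCommGroup U] [Module k U] {τ : Representation k Γ U}
  (P : Pres X ρ) (Q : Pres X σ) (R : Pres X τ)

/-- The matrix of an intertwining map with respect to two presentations. -/
def mat (f : ρ.IntertwiningMap σ) : Matrix Q.ι P.ι (invMat k Γ X) := fun l m =>
  ⟨fun x y => Q.i l x (f (P.r m y)), fun g x y => by
    change Q.i l (g • x) (f (P.r m (g • y))) = Q.i l x (f (P.r m y))
    rw [P.hr, f.isIntertwining, Q.hi]⟩

theorem mat_apply (f : ρ.IntertwiningMap σ) (l : Q.ι) (m : P.ι) (x y : X) :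
    (P.mat Q f l m : Matrix X X k) x y = Q.i l x (f (P.r m y)) := rfl

theorem mat_add (f g : ρ.IntertwiningMap σ) : P.mat Q (f + g) = P.mat Q f + P.mat Q g := by
  ext l m x y
  simp [mat_apply]

theorem mat_sub (f g : ρ.IntertwiningMap σ) : P.mat Q (f - g) = P.mat Q f - P.mat Q g := by
  ext l m x y
  simp [mat_apply]

theorem coe_mul_apply {a b c : Type} [Fintype b] (M : Matrix a b (invMat k Γ X))
    (N : Matrix b c (invMat k Γ X)) (l : a) (m : c) (x y : X) :
    ((M * N) l m : Matrix X X k) x y =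
      ∑ j, ∑ z, (M l j : Matrix X X k) x z * (N j m : Matrix X X k) z y := by
  rw [Matrix.mul_apply, AddSubmonoidClass.coe_finsetSum, Matrix.sum_apply]
  refine Finset.sum_congr rfl fun j _ => ?_
  rw [MulMemClass.coe_mul, Matrix.mul_apply]

theorem mat_comp (g : σ.IntertwiningMap τ) (f : ρ.IntertwiningMap σ) :
    P.mat R (g.comp f) = Q.mat R g * P.mat Q f := by
  ext l m x y
  have h := congrArg (fun w => R.i l x (g w)) (Q.sum_eq (f (P.r m y)))
  simp only [map_sum, map_smul] at h
  rw [mat_apply, Representation.IntertwiningMap.comp_apply, ← h, coe_mul_apply]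
  exact Finset.sum_congr rfl fun j _ => Finset.sum_congr rfl fun z _ => mul_comm _ _

theorem eq_of_mat (f g : ρ.IntertwiningMap σ) (h : P.mat Q f = P.mat Q g) : f = g := by
  ext v
  have key : ∀ f : ρ.IntertwiningMap σ,
      f v = ∑ m, ∑ y, P.i m y v • ∑ l, ∑ x, (P.mat Q f l m : Matrix X X k) x y • Q.r l x := by
    intro f
    conv_lhs => rw [← P.sum_eq v]
    simp only [map_sum, map_smul]
    refine Finset.sum_congr rfl fun m _ => Finset.sum_congr rfl fun y _ => ?_
    simp only [mat_apply]
    rw [Q.sum_eq]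
  change f v = g v
  rw [key f, key g, h]

/-- The intertwining map with a given matrix, up to multiplication with the idempotents. -/
def ofMat (M : Matrix Q.ι P.ι (invMat k Γ X)) : ρ.IntertwiningMap σ :=
  ⟨∑ m, ∑ y, ∑ l, ∑ x, (M l m : Matrix X X k) x y • (P.i m y).smulRight (Q.r l x), fun g => by
    ext v
    simp only [LinearMap.comp_apply, LinearMap.sum_apply, LinearMap.smul_apply,
      LinearMap.smulRight_apply, map_sum, map_smul]
    refine Finset.sum_congr rfl fun m _ => ?_
    rw [← Equiv.sum_comp (MulAction.toPerm g)]
    refine Finset.sum_congr rfl fun y _ => Finset.sum_congr rfl fun l _ => ?_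
    rw [← Equiv.sum_comp (MulAction.toPerm g)]
    refine Finset.sum_congr rfl fun x _ => ?_
    simp only [MulAction.toPerm_apply]
    rw [(M l m).2, P.hi, Q.hr]⟩

theorem mat_ofMat (M : Matrix Q.ι P.ι (invMat k Γ X)) :
    P.mat Q (P.ofMat Q M) = Q.mat Q (.id σ) * M * P.mat P (.id ρ) := by
  ext l m x y
  have h : P.ofMat Q M (P.r m y) = ∑ m', ∑ y', ∑ l', ∑ x',
      (M l' m' : Matrix X X k) x' y' • P.i m' y' (P.r m y) • Q.r l' x' := by
    rw [← Representation.IntertwiningMap.toLinearMap_apply]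
    simp [ofMat, LinearMap.sum_apply]
  rw [mat_apply, h]
  simp only [map_sum, map_smul, coe_mul_apply, mat_apply, Finset.sum_mul,
    Representation.IntertwiningMap.id_apply, smul_eq_mul]
  refine Finset.sum_congr rfl fun m' _ => Finset.sum_congr rfl fun y' _ =>
    Finset.sum_congr rfl fun l' _ => Finset.sum_congr rfl fun x' _ => ?_
  ring

end Pres

end Presentation

section MatrixAction

variable {k : Type u} [Field k] {A : Type w} [Ring A] [Algebra k A] {W : Type w'} [AddCommGroup W]
  [Module k W] (φ : A →ₐ[k] Module.End k W) {a b c : Type} [Fintype a] [Fintype b] [Fintype c]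

/-- The action of a matrix over `A` on vectors with entries in an `A`-module. -/
def matAct (M : Matrix a b A) : (b → W) →ₗ[k] (a → W) :=
  LinearMap.pi fun l => ∑ m, φ (M l m) ∘ₗ LinearMap.proj m

theorem matAct_apply (M : Matrix a b A) (w : b → W) (l : a) :
    matAct φ M w l = ∑ m, φ (M l m) (w m) := by
  simp [matAct]

theorem matAct_mul (M : Matrix a b A) (N : Matrix b c A) :
    matAct φ (M * N) = matAct φ M ∘ₗ matAct φ N := by
  refine LinearMap.ext fun w => funext fun l => ?_
  simp only [matAct_apply, LinearMap.comp_apply, Matrix.mul_apply, map_sum, LinearMap.sum_apply,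
    map_mul, Module.End.mul_apply]
  exact Finset.sum_comm

theorem matAct_add (M N : Matrix a b A) : matAct φ (M + N) = matAct φ M + matAct φ N := by
  refine LinearMap.ext fun w => funext fun l => ?_
  simp [matAct_apply, Finset.sum_add_distrib]

theorem matAct_sub (M N : Matrix a b A) : matAct φ (M - N) = matAct φ M - matAct φ N := by
  refine LinearMap.ext fun w => funext fun l => ?_
  simp [matAct_apply, Finset.sum_sub_distrib]

theorem matAct_eq_zero [DecidableEq b] {M : Matrix a b A} (h : matAct φ M = 0) (l : a) (m : b) :
    φ (M l m) = 0 := by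
  refine LinearMap.ext fun w => ?_
  have := congrFun (LinearMap.congr_fun h (Pi.single m w)) l
  rw [matAct_apply, Finset.sum_eq_single m] at this
  · simpa using this
  · intro j _ hj
    simp [Pi.single_eq_of_ne hj]
  · simp

/-- Simultaneous lifting of linear maps to matrices. -/
theorem exists_matAct_eq [DecidableEq b] {n : ℕ} {d : Fin n → ℕ}
    (φ : ∀ j, A →ₐ[k] Module.End k (Fin (d j) → k))
    (hφ : ∀ T : ∀ j, Module.End k (Fin (d j) → k), ∃ a, ∀ j, φ j a = T j)
    (t : ∀ j, (b → Fin (d j) → k) →ₗ[k] (a → Fin (d j) → k)) :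
    ∃ M : Matrix a b A, ∀ j, matAct (φ j) M = t j := by
  choose M hM using fun l m => hφ fun j =>
    LinearMap.proj l ∘ₗ t j ∘ₗ LinearMap.single k (fun _ => Fin (d j) → k) m
  refine ⟨Matrix.of M, fun j => LinearMap.pi_ext fun m w => funext fun l => ?_⟩
  rw [matAct_apply, Finset.sum_eq_single m]
  · rw [Matrix.of_apply, hM]
    simp
  · intro i _ hi
    simp [Pi.single_eq_of_ne hi]
  · simp

theorem matrix_pow_mem [DecidableEq a] {J : Ideal A} [J.IsTwoSided] {M : Matrix a a A}
    (hM : ∀ l m, M l m ∈ J) (n : ℕ) (l m : a) : (M ^ n) l m ∈ J ^ n := by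
  induction n generalizing l m with
  | zero =>
    have h : J ^ 0 = ⊤ := by rw [Submodule.pow_zero, Ideal.one_eq_top]
    rw [h]
    trivial
  | succ n ih =>
    rw [pow_succ, Matrix.mul_apply]
    refine Ideal.sum_mem _ fun j _ => ?_
    have h : (M ^ n) l j * M j m ∈ J ^ n * J := Ideal.mul_mem_mul (ih _ _) (hM _ _)
    rwa [← Submodule.pow_succ] at h

end MatrixAction

section RankVector

variable {k : Type u} [Field k] {Γ : Type} [Group Γ] {X : Type} [Fintype X]
  [DecidableEq X] [MulAction Γ X]

namespace Pres

variable {V : Type w} [AddCommGroup V] [Module k V] {ρ : Representation k Γ V}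
  {W : Type w'} [AddCommGroup W] [Module k W] {σ : Representation k Γ W}
  {U : Type*} [AddCommGroup U] [Module k U] {τ : Representation k Γ U}
  (P : Pres X ρ) (Q : Pres X σ) (R : Pres X τ)
  {d : ℕ} (φ : invMat k Γ X →ₐ[k] Module.End k (Fin d → k))

/-- The value at a presented module of the functor attached to a representation of the algebra
of invariant matrices. -/
def fiber : Submodule k (P.ι → Fin d → k) := LinearMap.range (matAct φ (P.mat P (.id ρ)))

theorem mat_mul_id (f : ρ.IntertwiningMap σ) : P.mat Q f * P.mat P (.id ρ) = P.mat Q f := by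
  rw [← mat_comp]
  rfl

theorem id_mul_mat (f : ρ.IntertwiningMap σ) : Q.mat Q (.id σ) * P.mat Q f = P.mat Q f := by
  rw [← mat_comp]
  rfl

theorem fiber_apply_self {x : P.ι → Fin d → k} (hx : x ∈ P.fiber φ) :
    matAct φ (P.mat P (.id ρ)) x = x := by
  obtain ⟨y, rfl⟩ := hx
  rw [← LinearMap.comp_apply, ← matAct_mul, mat_mul_id]

/-- Functoriality of the fiber. -/
def fiberMap (f : ρ.IntertwiningMap σ) : P.fiber φ →ₗ[k] Q.fiber φ :=
  (matAct φ (P.mat Q f)).restrict fun x _ => ⟨matAct φ (P.mat Q f) x, by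
    rw [← LinearMap.comp_apply, ← matAct_mul, id_mul_mat]⟩

theorem fiberMap_coe (f : ρ.IntertwiningMap σ) (x : P.fiber φ) :
    (P.fiberMap Q φ f x : Q.ι → Fin d → k) = matAct φ (P.mat Q f) x := rfl

theorem fiberMap_id (x : P.fiber φ) : P.fiberMap P φ (.id ρ) x = x :=
  Subtype.ext (P.fiber_apply_self φ x.2)

theorem fiberMap_comp (g : σ.IntertwiningMap τ) (f : ρ.IntertwiningMap σ) (x : P.fiber φ) :
    Q.fiberMap R φ g (P.fiberMap Q φ f x) = P.fiberMap R φ (g.comp f) x := by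
  ext1
  rw [fiberMap_coe, fiberMap_coe, fiberMap_coe, P.mat_comp Q R, matAct_mul]
  rfl

theorem fiberMap_add (f g : ρ.IntertwiningMap σ) (x : P.fiber φ) :
    P.fiberMap Q φ (f + g) x = P.fiberMap Q φ f x + P.fiberMap Q φ g x := by
  ext1
  rw [fiberMap_coe, mat_add, matAct_add]
  rfl

theorem fiberMap_sub (f g : ρ.IntertwiningMap σ) (x : P.fiber φ) :
    P.fiberMap Q φ (f - g) x = P.fiberMap Q φ f x - P.fiberMap Q φ g x := by
  ext1
  rw [fiberMap_coe, mat_sub, matAct_sub]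
  rfl

theorem fiberMap_zero (x : P.fiber φ) : P.fiberMap Q φ 0 x = 0 := by
  simpa using P.fiberMap_sub Q φ 0 0 x

theorem finrank_fiber_congr (e : ρ.Equiv σ) :
    Module.finrank k (P.fiber φ) = Module.finrank k (Q.fiber φ) := by
  refine LinearEquiv.finrank_eq (.ofLinearMap (P.fiberMap Q φ e.toIntertwiningMap)
    (Q.fiberMap P φ e.symm.toIntertwiningMap) (LinearMap.ext fun x => ?_)
    (LinearMap.ext fun x => ?_))
  · rw [LinearMap.comp_apply, fiberMap_comp]
    refine Eq.trans ?_ (Q.fiberMap_id φ x)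
    congr
    ext y
    exact e.apply_symm_apply y
  · rw [LinearMap.comp_apply, fiberMap_comp]
    refine Eq.trans ?_ (P.fiberMap_id φ x)
    congr
    ext y
    exact e.symm_apply_apply y

theorem finrank_fiber_prod (S : Pres X (ρ.prod σ)) :
    Module.finrank k (S.fiber φ) = Module.finrank k (P.fiber φ) + Module.finrank k (Q.fiber φ) := by
  rw [← Module.finrank_prod]
  refine LinearEquiv.finrank_eq (.ofLinearMap
    ((S.fiberMap P φ (.fst k ρ σ)).prod (S.fiberMap Q φ (.snd k ρ σ)))
    ((P.fiberMap S φ (.inl k ρ σ)).coprod (Q.fiberMap S φ (.inr k ρ σ)))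
    (LinearMap.ext fun x => ?_) (LinearMap.ext fun x => ?_))
  · refine Prod.ext ?_ ?_
    · simp [fiberMap_comp, fiberMap_id, fiberMap_zero]
    · simp [fiberMap_comp, fiberMap_id, fiberMap_zero]
  · change P.fiberMap S φ _ (S.fiberMap P φ _ x) + Q.fiberMap S φ _ (S.fiberMap Q φ _ x) = x
    rw [fiberMap_comp, fiberMap_comp, ← fiberMap_add,
      Representation.IntertwiningMap.coprod_inl_inr]
    exact S.fiberMap_id φ x

section Lifting

variable {n : ℕ} {d : Fin n → ℕ} (φ : ∀ j, invMat k Γ X →ₐ[k] Module.End k (Fin (d j) → k))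
  (hφ : ∀ T : ∀ j, Module.End k (Fin (d j) → k), ∃ a, ∀ j, φ j a = T j)
  (hJ : ∀ a, a ∈ Ring.jacobson (invMat k Γ X) ↔ ∀ j, φ j a = 0)
  (hN : IsNilpotent (Ring.jacobson (invMat k Γ X)))

include hφ in
theorem exists_fiberMap_eq (t : ∀ j, P.fiber (φ j) →ₗ[k] Q.fiber (φ j)) :
    ∃ f : ρ.IntertwiningMap σ, ∀ j x, P.fiberMap Q (φ j) f x = t j x := by
  obtain ⟨M, hM⟩ := exists_matAct_eq φ hφ fun j =>
    (Q.fiber (φ j)).subtype ∘ₗ t j ∘ₗ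
      (show _ →ₗ[k] P.fiber (φ j) from (matAct (φ j) (P.mat P (.id ρ))).rangeRestrict)
  refine ⟨P.ofMat Q M, fun j x => Subtype.ext ?_⟩
  rw [fiberMap_coe, mat_ofMat, matAct_mul, matAct_mul, hM, LinearMap.comp_apply,
    P.fiber_apply_self _ x.2, LinearMap.comp_apply]
  have h : (show _ →ₗ[k] P.fiber (φ j) from (matAct (φ j) (P.mat P (.id ρ))).rangeRestrict) x =
    x := Subtype.ext (P.fiber_apply_self _ x.2)
  refine (Q.fiber_apply_self _ (t j _).2).trans ?_
  exact congrArg (fun y => (t j y : Q.ι → Fin (d j) → k)) h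

include hJ hN in
theorem isNilpotent_of_fiberMap (f : ρ.IntertwiningMap ρ)
    (h : ∀ j x, P.fiberMap P (φ j) f x = 0) : IsNilpotent f := by
  have h1 : ∀ l m, P.mat P f l m ∈ Ring.jacobson (invMat k Γ X) := fun l m => by
    refine (hJ _).2 fun j => matAct_eq_zero (φ j) (LinearMap.ext fun w => ?_) l m
    have := congrArg Subtype.val (h j ⟨_, w, rfl⟩)
    rw [fiberMap_coe] at this
    rw [← mat_mul_id, matAct_mul]
    exact this
  obtain ⟨N, hN⟩ := hN
  have h2 : ∀ m : ℕ, P.mat P (f ^ (m + 1)) = (P.mat P f) ^ (m + 1) := by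
    intro m
    induction m with
    | zero => simp
    | succ m ih =>
      rw [pow_succ f, pow_succ (P.mat P f), ← ih]
      exact P.mat_comp P P _ _
  refine ⟨N + 1, P.eq_of_mat P _ _ ?_⟩
  rw [h2]
  ext l m x y
  have h3 := matrix_pow_mem h1 (N + 1) l m
  rw [Submodule.pow_succ, hN, zero_mul] at h3
  rw [(Submodule.mem_bot _).1 h3]
  simp [mat_apply]

theorem bijective_of_isNilpotent_id_sub (q : ρ.IntertwiningMap ρ) (hq : IsNilpotent (.id ρ - q)) :
    Function.Bijective q := by
  have h3 : IsNilpotent (1 - q.toLinearMap) := by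
    obtain ⟨N, hN⟩ := hq
    refine ⟨N, ?_⟩
    have h4 : ∀ m : ℕ, (((.id ρ - q) ^ m : ρ.IntertwiningMap ρ)).toLinearMap =
        (1 - q.toLinearMap) ^ m := by
      intro m
      induction m with
      | zero => rfl
      | succ m ih => rw [pow_succ, pow_succ, ← ih]; rfl
    rw [← h4, hN]
    rfl
  have h5 := h3.isUnit_one_sub
  rw [sub_sub_cancel] at h5
  exact (Module.End.isUnit_iff _).1 h5

include hφ hJ hN in
theorem equiv_of_finrank_fiber
    (h : ∀ j, Module.finrank k (P.fiber (φ j)) = Module.finrank k (Q.fiber (φ j))) :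
    Nonempty (ρ.Equiv σ) := by
  let t : ∀ j, P.fiber (φ j) ≃ₗ[k] Q.fiber (φ j) := fun j => LinearEquiv.ofFinrankEq _ _ (h j)
  obtain ⟨f, hf⟩ := P.exists_fiberMap_eq Q φ hφ fun j => (t j).toLinearMap
  obtain ⟨g, hg⟩ := Q.exists_fiberMap_eq P φ hφ fun j => (t j).symm.toLinearMap
  have h1 := P.isNilpotent_of_fiberMap φ hJ hN (.id ρ - g.comp f) fun j x => by
    rw [fiberMap_sub, fiberMap_id, ← P.fiberMap_comp Q P, hf, hg]
    simp
  have h2 := Q.isNilpotent_of_fiberMap φ hJ hN (.id σ - f.comp g) fun j x => by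
    rw [fiberMap_sub, fiberMap_id, ← Q.fiberMap_comp P Q, hg, hf]
    simp
  have h3 := bijective_of_isNilpotent_id_sub _ h1
  have h4 := bijective_of_isNilpotent_id_sub _ h2
  refine ⟨f.ofBijective ⟨?_, ?_⟩⟩
  · exact Function.Injective.of_comp (f := g) h3.1
  · exact Function.Surjective.of_comp (g := g) h4.2

end Lifting

end Pres

end RankVector

section GrothendieckVectors

variable {F : Type v} [Field F] [CharZero F] {M : Type w} [AddCommMonoid M] {ι : Type}
  [Fintype ι]

/-- The linear extension of an additive invariant with values in vectors of natural numbers. -/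
def vecExtend (F : Type v) [Field F] (v : M →+ (ι → ℕ)) : LinGroth F M →ₗ[F] (ι → F) :=
  extend { toFun := fun x i => (v x i : F)
           map_zero' := by ext; simp
           map_add' := fun x y => by ext; simp }

theorem vecExtend_gcls (v : M →+ (ι → ℕ)) (x : M) :
    vecExtend F v (gcls F x) = fun i => (v x i : F) := by
  simp [vecExtend]

theorem exists_eq_of_sub_of (a : Algebra.GrothendieckAddGroup M) : ∃ x y : M,
    a = Algebra.GrothendieckAddGroup.of x - Algebra.GrothendieckAddGroup.of y := by
  induction a using AddLocalization.ind with
  | H z =>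
    refine ⟨z.1, z.2.1, ?_⟩
    rw [eq_sub_iff_add_eq]
    exact (congrArg (· + Algebra.GrothendieckAddGroup.of (z.2 : M))
      (AddLocalization.mk_eq_addMonoidOf_mk'_apply z.1 z.2)).trans
      ((AddLocalization.addMonoidOf ⊤).mk'_spec z.1 z.2)

theorem vecExtend_injective (v : M →+ (ι → ℕ)) (hv : Function.Injective v) :
    Function.Injective (vecExtend F v) := by
  classical
  let v' : M →+ (ι → ℤ) := { toFun := fun x i => (v x i : ℤ)
                             map_zero' := by ext; simp
                             map_add' := fun x y => by ext; simp }
  let f : Algebra.GrothendieckAddGroup M →+ (ι → ℤ) := Algebra.GrothendieckAddGroup.lift v'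
  have hf : ∀ x, f (Algebra.GrothendieckAddGroup.of x) = v' x := fun x =>
    DFunLike.congr_fun (Algebra.GrothendieckAddGroup.lift.symm_apply_apply v') x
  have hinj : Function.Injective f.toIntLinearMap := by
    refine (injective_iff_map_eq_zero f).2 fun a ha => ?_
    obtain ⟨x, y, rfl⟩ := exists_eq_of_sub_of a
    rw [map_sub, hf, hf, sub_eq_zero] at ha
    have : v x = v y := funext fun i => by
      have h : (v x i : ℤ) = v y i := congrFun ha i
      exact_mod_cast h
    rw [hv this, sub_self]
  have h1 := Module.Flat.lTensor_preserves_injective_linearMap (M := F) f.toIntLinearMap hinj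
  have h2 : ∀ x, vecExtend F v x =
      TensorProduct.piScalarRight ℤ F F ι (LinearMap.lTensor F f.toIntLinearMap x) := by
    intro x
    induction x using TensorProduct.induction_on with
    | zero => simp
    | add x y hx hy => rw [map_add, map_add, map_add, hx, hy]
    | tmul c a =>
      obtain ⟨a, b, rfl⟩ := exists_eq_of_sub_of a
      have h4 : ∀ x : M, c ⊗ₜ[ℤ] Algebra.GrothendieckAddGroup.of x = c • gcls F x := by
        intro x
        rw [gcls, TensorProduct.smul_tmul', smul_eq_mul, mul_one]
      simp only [TensorProduct.tmul_sub, map_sub, h4, map_smul, vecExtend_gcls]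
      simp only [← h4, LinearMap.lTensor_tmul, AddMonoidHom.coe_toIntLinearMap, hf]
      ext i
      simp [v', mul_comm c]
  intro x y h
  rw [h2, h2] at h
  exact h1 ((TensorProduct.piScalarRight ℤ F F ι).injective h)

theorem int_vector_eq_zero {p : ℕ} (hp : 1 < p) {Y : Set (ι → ℕ)}
    (hY : ∀ m : ι → ℤ, (∀ y ∈ Y, ∑ i, m i * y i = 0) → ∀ i, (p : ℤ) ∣ m i) (m : ι → ℤ)
    (hm : ∀ y ∈ Y, ∑ i, m i * y i = 0) : m = 0 := by
  have key : ∀ n : ℕ, ∀ m : ι → ℤ, (∀ y ∈ Y, ∑ i, m i * y i = 0) → ∀ i, (p : ℤ) ^ n ∣ m i := by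
    intro n
    induction n with
    | zero => simp
    | succ n ih =>
      intro m hm i
      choose q hq using hY m hm
      have h1 := ih q fun y hy => by
        have h2 := hm y hy
        simp only [hq, mul_assoc] at h2
        rw [← Finset.mul_sum] at h2
        exact (mul_eq_zero.1 h2).resolve_left (by positivity)
      rw [hq, pow_succ, mul_comm]
      exact mul_dvd_mul_left _ (h1 i)
  funext i
  by_contra h
  have h1 := Int.natAbs_dvd_natAbs.2 (key (m i).natAbs m hm i)
  have h2 := Nat.le_of_dvd (Int.natAbs_pos.2 h) h1
  rw [Int.natAbs_pow, Int.natAbs_natCast] at h2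
  exact absurd (Nat.lt_pow_self hp) (not_lt.2 h2)

theorem span_natCast_eq_top {p : ℕ} (hp : 1 < p) {Y : Set (ι → ℕ)}
    (hY : ∀ m : ι → ℤ, (∀ y ∈ Y, ∑ i, m i * y i = 0) → ∀ i, (p : ℤ) ∣ m i) :
    Submodule.span F ((fun (y : ι → ℕ) i => (y i : F)) '' Y) = ⊤ := by
  classical
  have hQ : Submodule.span ℚ ((fun (y : ι → ℕ) i => (y i : ℚ)) '' Y) = ⊤ := by
    by_contra h
    obtain ⟨f, hf, hle⟩ := Submodule.exists_le_ker_of_lt_top _ (lt_top_iff_ne_top.2 h)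
    obtain ⟨b, hb⟩ := IsLocalization.exist_integer_multiples_of_finite (nonZeroDivisors ℤ)
      (fun i => f (Pi.single i 1))
    choose m hm using hb
    have h0 : m = 0 := by
      refine int_vector_eq_zero hp hY m fun y hy => ?_
      have h1 : f (fun i => (y i : ℚ)) = 0 := hle (Submodule.subset_span ⟨y, hy, rfl⟩)
      rw [← LinearMap.sum_single_apply (fun _ => ℚ) (fun i => (y i : ℚ)), map_sum] at h1
      have h2 : ∑ i, (m i : ℚ) * y i = 0 := by
        rw [← smul_zero (b : ℤ), ← h1, Finset.smul_sum]
        refine Finset.sum_congr rfl fun i _ => ?_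
        have h3 : (Pi.single i (y i : ℚ) : ι → ℚ) = (y i : ℚ) • Pi.single i 1 := by
          rw [← Pi.single_smul, smul_eq_mul, mul_one]
        have h4 := hm i
        rw [eq_intCast] at h4
        rw [h4, h3, map_smul, smul_comm]
        simp [mul_comm]
      exact_mod_cast h2
    apply hf
    refine LinearMap.pi_ext' fun i => LinearMap.ext_ring ?_
    have h4 := hm i
    rw [h0] at h4
    have h5 : (b : ℤ) ≠ 0 := nonZeroDivisors.ne_zero b.2
    simp only [Pi.zero_apply, map_zero] at h4
    simpa [h5] using h4.symm
  let g : (ι → ℚ) →ₗ[ℚ] (ι → F) := LinearMap.compLeft (Algebra.linearMap ℚ F) ι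
  have key : ∀ q : ι → ℚ, g q ∈ Submodule.span F ((fun (y : ι → ℕ) i => (y i : F)) '' Y) := by
    intro q
    have hq : q ∈ Submodule.span ℚ ((fun (y : ι → ℕ) i => (y i : ℚ)) '' Y) := by rw [hQ]; trivial
    induction hq using Submodule.span_induction with
    | mem x hx =>
      obtain ⟨y, hy, rfl⟩ := hx
      refine Submodule.subset_span ⟨y, hy, ?_⟩
      ext i
      simp [g]
    | zero => simp
    | add x y _ _ hx hy => rw [map_add]; exact add_mem hx hy
    | smul c x _ hx =>
      rw [map_smul, ← algebraMap_smul F c]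
      exact Submodule.smul_mem _ _ hx
  rw [eq_top_iff]
  intro f _
  rw [← LinearMap.sum_single_apply (fun _ => F) f]
  refine Submodule.sum_mem _ fun i _ => ?_
  have h3 : (Pi.single i (f i) : ι → F) = f i • g (Pi.single i 1) := by
    ext j
    by_cases h : j = i
    · subst h; simp [g]
    · simp [g, h]
  rw [h3]
  exact Submodule.smul_mem _ _ (key _)

/-- A set of elements spans `F ⊗ M^gp` if integral functionals vanishing on it are divisible by
a prime. -/
theorem span_gcls_eq_top {p : ℕ} (hp : 1 < p) (v : M →+ (ι → ℕ)) (hv : Function.Injective v)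
    (Y : Set M) (hY : ∀ m : ι → ℤ, (∀ y ∈ Y, ∑ i, m i * v y i = 0) → ∀ i, (p : ℤ) ∣ m i) :
    Submodule.span F (gcls F '' Y) = ⊤ := by
  have h1 := span_natCast_eq_top (F := F) hp (Y := v '' Y) fun m hm => hY m fun y hy =>
    hm _ ⟨y, hy, rfl⟩
  have h2 : (Submodule.span F (gcls F '' Y)).map (vecExtend F v) = ⊤ := by
    rw [Submodule.map_span, ← h1]
    congr 1
    rw [Set.image_image, Set.image_image]
    simp only [vecExtend_gcls]
  rw [eq_top_iff]
  intro x _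
  have h3 : vecExtend F v x ∈ (Submodule.span F (gcls F '' Y)).map (vecExtend F v) := by
    rw [h2]; trivial
  obtain ⟨y, hy, e⟩ := h3
  rwa [← vecExtend_injective v hv e]

end GrothendieckVectors

section CosetPresentation

variable (p : ℕ) (Γ : Type) [Group Γ]

/-- The disjoint union of the `Γ`-sets `Γ / Q`, where `Q` runs over the `p`-subgroups of `Γ`. -/
abbrev PCosets : Type := Σ Q : {Q : Subgroup Γ // IsPGroup p Q}, Γ ⧸ Q.1

variable {p Γ}

theorem PCosets.smul_mk (g : Γ) (Q : {Q : Subgroup Γ // IsPGroup p Q}) (c : Γ ⧸ Q.1) :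
    g • (⟨Q, c⟩ : PCosets p Γ) = ⟨Q, g • c⟩ := rfl

variable {k : Type u} [Field k] [Finite Γ] {V : Type w} [AddCommGroup V] [Module k V]
  {ρ : Representation k Γ V}

/-- A `p`-permutation module is a direct summand of a permutation module with stabilizers which are
`p`-groups. -/
theorem IsPPermutation.exists_stabilizer_isPGroup [Fact p.Prime] [CharP k p]
    (h : IsPPermutation ρ) : ∃ (X : Type) (_ : Fintype X) (_ : MulAction Γ X)
      (i : X → V →ₗ[k] k) (r : X → V), (∀ g x v, i (g • x) (ρ g v) = i x v) ∧
        (∀ g x, r (g • x) = ρ g (r x)) ∧ (∀ v, ∑ x, i x v • r x = v) ∧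
        ∀ x : X, IsPGroup p (MulAction.stabilizer Γ x) := by
  obtain ⟨X, _, _, i, r, hi, hr, h⟩ := (isPPermutation_iff ρ).1 h
  let S : Sylow p Γ := default
  have : Fintype (Γ ⧸ (S : Subgroup Γ)) := Fintype.ofFinite _
  have h0 : ((S : Subgroup Γ).index : k) ≠ 0 := by
    rw [Ne, CharP.cast_eq_zero_iff k p]
    exact S.not_dvd_index
  refine ⟨X × (Γ ⧸ (S : Subgroup Γ)), inferInstance, inferInstance,
    fun z => ((S : Subgroup Γ).index : k)⁻¹ • i z.1, fun z => r z.1, ?_, ?_, ?_, ?_⟩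
  · intro g z v
    simp [hi]
  · intro g z
    simp [hr]
  · intro v
    rw [Fintype.sum_prod_type]
    simp only [LinearMap.smul_apply, Finset.sum_const, Finset.card_univ]
    rw [← Nat.card_eq_fintype_card, ← Subgroup.index]
    conv_rhs => rw [← h v]
    refine Finset.sum_congr rfl fun x _ => ?_
    rw [← Nat.cast_smul_eq_nsmul k, smul_smul, smul_eq_mul, ← mul_assoc, mul_inv_cancel₀ h0,
      one_mul]
  · rintro ⟨x, c⟩
    have h1 : IsPGroup p (MulAction.stabilizer Γ c) := by
      induction c using Quotient.inductionOn with | h g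
      have h2 : MulAction.stabilizer Γ (QuotientGroup.mk g : Γ ⧸ (S : Subgroup Γ)) =
          (S : Subgroup Γ).map (MulAut.conj g).toMonoidHom := by
        have h3 : (QuotientGroup.mk g : Γ ⧸ (S : Subgroup Γ)) = g • QuotientGroup.mk 1 := by
          rw [MulAction.Quotient.smul_mk, smul_eq_mul, mul_one]
        rw [h3, MulAction.stabilizer_smul_eq_stabilizer_map_conj, MulAction.stabilizer_quotient]
      exact h2 ▸ S.isPGroup'.map _
    exact h1.to_le fun g hg => (congrArg Prod.snd hg : _)

open Classical in
theorem IsPPermutation.exists_pres [Fact p.Prime] [CharP k p] [Fintype (PCosets p Γ)]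
    (h : IsPPermutation ρ) : Nonempty (Pres (PCosets p Γ) ρ) := by
  obtain ⟨X, _, _, i, r, hi, hr, h, hp⟩ := h.exists_stabilizer_isPGroup (p := p)
  have : Fintype (MulAction.orbitRel.Quotient Γ X) := Fintype.ofFinite _
  have hsmul : ∀ (x : X) (z : PCosets p Γ) (g : Γ), z.1.1 = MulAction.stabilizer Γ x →
      Quotient.out (g • z.2) • x = g • Quotient.out z.2 • x := by
    intro x z g hz
    rw [← mul_smul, ← inv_smul_eq_iff, ← mul_smul]
    change _ ∈ MulAction.stabilizer Γ x
    rw [← hz, ← QuotientGroup.eq, QuotientGroup.out_eq', ← smul_eq_mul,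
      ← MulAction.Quotient.smul_mk, QuotientGroup.out_eq']
  refine ⟨{
    ι := MulAction.orbitRel.Quotient Γ X
    i := fun l z => if z.1.1 = MulAction.stabilizer Γ l.out then i (z.2.out • l.out) else 0
    r := fun l z => if z.1.1 = MulAction.stabilizer Γ l.out then r (z.2.out • l.out) else 0
    hi := fun l g z v => ?_
    hr := fun l g z => ?_
    sum_eq := fun v => ?_ }⟩
  · change (if z.1.1 = _ then _ else _ : V →ₗ[k] k) _ = _
    split_ifs with hz
    · change i (Quotient.out (g • z.2) • l.out) (ρ g v) = _
      rw [hsmul _ _ _ hz, hi]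
    · rfl
  · change (if z.1.1 = _ then _ else _ : V) = _
    split_ifs with hz
    · change r (Quotient.out (g • z.2) • l.out) = _
      rw [hsmul _ _ _ hz, hr]
    · simp
  · have : ∀ l : MulAction.orbitRel.Quotient Γ X, Fintype (Γ ⧸ MulAction.stabilizer Γ l.out) :=
      fun _ => Fintype.ofFinite _
    have : Fintype (Σ l : MulAction.orbitRel.Quotient Γ X, Γ ⧸ MulAction.stabilizer Γ l.out) :=
      inferInstance
    have hs : ∑ x, i x v • r x = ∑ l : MulAction.orbitRel.Quotient Γ X,
        ∑ c : Γ ⧸ MulAction.stabilizer Γ l.out, i (c.out • l.out) v • r (c.out • l.out) := by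
      refine (Fintype.sum_equiv (MulAction.selfEquivSigmaOrbitsQuotientStabilizer Γ X)
        (fun x => i x v • r x) (fun z :
        Σ l : MulAction.orbitRel.Quotient Γ X, Γ ⧸ MulAction.stabilizer Γ l.out =>
          i (z.2.out • z.1.out) v • r (z.2.out • z.1.out)) fun x => ?_).trans
        ((Finset.sum_congr (by ext; simp) fun _ _ => rfl).trans (Fintype.sum_sigma _))
      obtain ⟨⟨l, c⟩, rfl⟩ := (MulAction.selfEquivSigmaOrbitsQuotientStabilizer Γ X).symm.surjective x
      rw [Equiv.apply_symm_apply]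
      have h3 : (MulAction.selfEquivSigmaOrbitsQuotientStabilizer Γ X).symm ⟨l, c⟩ =
          c.out • l.out := by
        conv_lhs => rw [← QuotientGroup.out_eq' c]
        rfl
      rw [h3]
    conv_rhs => rw [← h v, hs]
    refine Finset.sum_congr rfl fun l _ => ?_
    have : Fintype {Q : Subgroup Γ // IsPGroup p Q} := Fintype.ofFinite _
    have : ∀ Q : {Q : Subgroup Γ // IsPGroup p Q}, Fintype (Γ ⧸ Q.1) := fun Q => Fintype.ofFinite _
    have e : ∀ f : PCosets p Γ → V, ∑ z, f z = ∑ Q, ∑ c, f ⟨Q, c⟩ := fun f =>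
      (Finset.sum_congr (by ext; simp) fun _ _ => rfl).trans (Fintype.sum_sigma f)
    rw [e, Finset.sum_eq_single ⟨MulAction.stabilizer Γ l.out, hp _⟩]
    · refine Finset.sum_congr (by ext; simp) fun c _ => ?_
      simp only [if_true]
    · intro Q _ hQ
      have hQ' : Q.1 ≠ MulAction.stabilizer Γ l.out := fun e => hQ (Subtype.ext e)
      simp [hQ']
    · simp

end CosetPresentation

section RankVector

variable (k : Type u) [Field k] [IsAlgClosed k] (p : ℕ) [Fact p.Prime] [CharP k p]
  (Γ : Type) [Group Γ] [Finite Γ]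

open Classical in
instance : Fintype (PCosets p Γ) := Fintype.ofFinite _

open Classical in
/-- The data provided by the semisimple quotient of the algebra of invariant matrices: an injective
vector valued invariant of isomorphism classes of `p`-permutation modules, and a trace form. -/
theorem exists_rankVector : ∃ (n : ℕ) (d : Fin n → ℕ)
    (φ : ∀ j, invMat k Γ (PCosets p Γ) →ₐ[k] Module.End k (Fin (d j) → k))
    (v : ppermClasses k Γ →+ (Fin n → ℕ)), Function.Injective v ∧ (∀ j, d j ≠ 0) ∧
      (∀ T : ∀ j, Module.End k (Fin (d j) → k), ∃ a, ∀ j, φ j a = T j) ∧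
      ∀ (x : ppermClasses k Γ) (V : Type u) [AddCommGroup V] [Module k V] [Module.Finite k V]
        (ρ : Representation k Γ V) (P : Pres (PCosets p Γ) ρ), cls ρ = x.1 →
          ∀ j, v x j = Module.finrank k (P.fiber (φ j)) := by
  obtain ⟨n, d, φ, hd, hφ, hJ, hN⟩ := exists_matrix_quotient k (invMat k Γ (PCosets p Γ))
  have hpres : ∀ x : ppermClasses k Γ, ∃ (m : ℕ) (ρ : Representation k Γ (Fin m → k)),
      cls ρ = x.1 ∧ Nonempty (Pres (PCosets p Γ) ρ) := by
    rintro ⟨_, m, ρ, rfl, h⟩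
    exact ⟨m, ρ, rfl, h.exists_pres⟩
  choose m ρ hρ P using hpres
  have P := fun x => (P x).some
  have key : ∀ (x : ppermClasses k Γ) (V : Type u) [AddCommGroup V] [Module k V]
      [Module.Finite k V] (σ : Representation k Γ V) (Q : Pres (PCosets p Γ) σ), cls σ = x.1 →
        ∀ j, Module.finrank k ((P x).fiber (φ j)) = Module.finrank k (Q.fiber (φ j)) := by
    intro x V _ _ _ σ Q h j
    obtain ⟨e⟩ := (cls_eq_iff _ _).1 ((hρ x).trans h.symm)
    exact (P x).finrank_fiber_congr Q (φ j) e
  let v : ppermClasses k Γ → Fin n → ℕ := fun x j => Module.finrank k ((P x).fiber (φ j))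
  have hadd : ∀ x y, v (x + y) = v x + v y := by
    intro x y
    funext j
    have h1 : cls ((ρ x).prod (ρ y)) = (x + y).1 := by
      rw [← cls_add, hρ, hρ]
      rfl
    have h2 : IsPPermutation ((ρ x).prod (ρ y)) := (cls_mem_ppermClasses _).1 (h1 ▸ (x + y).2)
    obtain ⟨Q⟩ := h2.exists_pres (p := p)
    exact (key (x + y) _ _ Q h1 j).trans ((P x).finrank_fiber_prod (P y) (φ j) Q)
  refine ⟨n, d, φ, { toFun := v, map_zero' := ?_, map_add' := hadd }, fun x y h => ?_, hd, hφ,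
    fun x V _ _ _ σ Q h j => key x V σ Q h j⟩
  · have := hadd 0 0
    rw [add_zero] at this
    exact left_eq_add.1 this
  · obtain ⟨e⟩ := (P x).equiv_of_finrank_fiber (P y) φ hφ hJ hN fun j => congrFun h j
    refine Subtype.ext ?_
    rw [← hρ, ← hρ y]
    exact (cls_eq_iff _ _).2 ⟨e⟩

end RankVector

section RootsOfUnity

variable {k : Type u} [Field k] {F : Type v} [Field F]

/-- The restriction of a Brauer lift to the `n`-th roots of unity. -/
def BrauerLift.onRoots (θ : BrauerLift k F) (n : ℕ) [NeZero n] : rootsOfUnity n k →* F where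
  toFun ζ := (θ.toHom ⟨ζ, isOfFinOrder_iff_pow_eq_one.2 ⟨n, NeZero.pos n, ζ.2⟩⟩ : F)
  map_one' := congrArg Units.val (map_one θ.toHom)
  map_mul' ζ ξ := congrArg Units.val (map_mul θ.toHom
    ⟨ζ, isOfFinOrder_iff_pow_eq_one.2 ⟨n, NeZero.pos n, ζ.2⟩⟩
    ⟨ξ, isOfFinOrder_iff_pow_eq_one.2 ⟨n, NeZero.pos n, ξ.2⟩⟩)

theorem BrauerLift.lift_coe (θ : BrauerLift k F) (y : CommGroup.torsion kˣ) :
    θ.lift ((y : kˣ) : k) = θ.toHom y := by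
  have h : ∃ z : CommGroup.torsion kˣ, ((z : kˣ) : k) = ((y : kˣ) : k) := ⟨y, rfl⟩
  rw [BrauerLift.lift, dif_pos h]
  have h2 : h.choose = y := Subtype.ext (Units.ext h.choose_spec)
  rw [h2]

theorem BrauerLift.lift_root (θ : BrauerLift k F) (n : ℕ) [NeZero n] (ζ : rootsOfUnity n k) :
    θ.lift ((ζ : kˣ) : k) = θ.onRoots n ζ := θ.lift_coe ⟨ζ, _⟩

theorem BrauerLift.onRoots_injective (θ : BrauerLift k F) (n : ℕ) [NeZero n] :
    Function.Injective (θ.onRoots n) := fun ζ ξ h => by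
  have := θ.injective (Units.ext h)
  exact Subtype.ext (congrArg (fun z : CommGroup.torsion kˣ => (z : kˣ)) this)

instance (n : ℕ) [NeZero n] : Fintype (rootsOfUnity n k) := Fintype.ofFinite _

theorem card_rootsOfUnity_of_isAlgClosed [IsAlgClosed k] (n : ℕ) [NeZero n] [NeZero (n : k)] :
    Fintype.card (rootsOfUnity n k) = n := by
  rw [← Nat.card_eq_fintype_card]
  exact HasEnoughRootsOfUnity.natCard_rootsOfUnity k n

theorem exists_root_pow_ne_one [IsAlgClosed k] (n : ℕ) [NeZero n] [NeZero (n : k)] {j : ℕ}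
    (hj : ¬ n ∣ j) : ∃ ζ : rootsOfUnity n k, ζ ^ j ≠ 1 := by
  obtain ⟨ζ, hζ⟩ := HasEnoughRootsOfUnity.exists_primitiveRoot k n
  refine ⟨hζ.toRootsOfUnity, fun h => hj ((hζ.pow_eq_one_iff_dvd j).1 ?_)⟩
  have := congrArg (fun z : rootsOfUnity n k => ((z : kˣ) : k)) h
  simpa using this

/-- Orthogonality relations for roots of unity. -/
theorem sum_roots_pow [IsAlgClosed k] {R : Type*} [CommRing R] [IsDomain R] (n : ℕ) [NeZero n]
    [NeZero (n : k)] (f : rootsOfUnity n k →* R) (hf : Function.Injective f) (j : ℕ) :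
    ∑ ζ : rootsOfUnity n k, f ζ ^ j = if n ∣ j then (n : R) else 0 := by
  classical
  have h1 : ∀ ζ, f ζ ^ j = (f.comp (powMonoidHom j)) ζ := fun ζ => by simp
  simp only [h1]
  rw [sum_hom_units]
  split_ifs with h h' h'
  · rw [card_rootsOfUnity_of_isAlgClosed]
  · obtain ⟨ζ, hζ⟩ := exists_root_pow_ne_one (k := k) n h'
    exact absurd (hf ((DFunLike.congr_fun h ζ).trans (map_one f).symm)) hζ
  · refine absurd (MonoidHom.ext fun ζ => ?_) h
    obtain ⟨q, rfl⟩ := h'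
    have : ζ ^ n = 1 := Subtype.ext ζ.2
    simp [pow_mul, this]
  · exact Nat.cast_zero

/-- The embedding of the roots of unity into the field. -/
def rootsVal (k : Type u) [Field k] (n : ℕ) : rootsOfUnity n k →* k :=
  (Units.coeHom k).comp (rootsOfUnity n k).subtype

theorem rootsVal_injective (n : ℕ) : Function.Injective (rootsVal k n) := fun _ _ h =>
  Subtype.ext (Units.ext h)

theorem rootsVal_apply (n : ℕ) (ζ : rootsOfUnity n k) : rootsVal k n ζ = ((ζ : kˣ) : k) := rfl

theorem rootsVal_pow (n : ℕ) (ζ : rootsOfUnity n k) : rootsVal k n ζ ^ n = 1 := by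
  rw [← map_pow, show ζ ^ n = 1 from Subtype.ext ζ.2, map_one]

end RootsOfUnity

/-! ## Eigenspaces of automorphisms of permutation modules -/

section Eigen

variable (k : Type u) [Field k] {Γ : Type} [Group Γ] {X : Type} [MulAction Γ X]

/-- The permutation module of a finite `Γ`-set, as the space of functions on it. -/
def funRep (Γ : Type) [Group Γ] (X : Type) [MulAction Γ X] : Representation k Γ (X → k) where
  toFun g := LinearMap.funLeft k k (g⁻¹ • ·)
  map_one' := by ext; simp
  map_mul' g h := by ext; simp [LinearMap.funLeft, mul_smul]

theorem funRep_apply (g : Γ) (f : X → k) (x : X) : funRep k Γ X g f x = f (g⁻¹ • x) := rfl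

variable {k} in
theorem funRep_single [DecidableEq X] (g : Γ) (x : X) (c : k) :
    funRep k Γ X g (Pi.single x c) = Pi.single (g • x) c := by
  ext y
  rw [funRep_apply, Pi.single_apply, Pi.single_apply]
  exact if_congr inv_smul_eq_iff rfl rfl

variable (Γ X) in
/-- An automorphism of a `Γ`-set `X` whose `n`-th power is the identity. -/
structure SetAut (n : ℕ) where
  /-- The underlying permutation. -/
  perm : Equiv.Perm X
  smul : ∀ (g : Γ) x, perm (g • x) = g • perm x
  pow_eq : perm ^ n = 1

namespace SetAut

variable {n : ℕ} (a : SetAut Γ X n)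

theorem pow_smul (j : ℕ) (g : Γ) (x : X) : (a.perm ^ j) (g • x) = g • (a.perm ^ j) x := by
  induction j generalizing x with
  | zero => rfl
  | succ j ih => rw [pow_succ, Equiv.Perm.mul_apply, a.smul, ih]; rfl

/-- The eigenspace of the map `f ↦ f ∘ a` on the permutation module. -/
def eig (c : k) : Submodule k (X → k) where
  carrier := {f | ∀ x, f (a.perm x) = c * f x}
  add_mem' hf hg x := by simp [hf x, hg x, mul_add]
  zero_mem' x := by simp
  smul_mem' r f hf x := by simp [hf x, mul_left_comm]

variable {k} in
theorem eig_pow {c : k} {f : X → k} (hf : f ∈ a.eig k c) (j : ℕ) (x : X) :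
    f ((a.perm ^ j) x) = c ^ j * f x := by
  induction j generalizing x with
  | zero => simp
  | succ j ih => rw [pow_succ, Equiv.Perm.mul_apply, ih, hf, pow_succ, mul_assoc]

/-- The eigenspace as a representation. -/
def eigRep (c : k) : Representation k Γ (a.eig k c) where
  toFun g := (funRep k Γ X g).restrict fun f hf x => by
    rw [funRep_apply, ← a.smul, hf, funRep_apply]
  map_one' := by
    refine LinearMap.ext fun f => Subtype.ext ?_
    change funRep k Γ X 1 f = f
    rw [map_one]
    rfl
  map_mul' g h := by
    refine LinearMap.ext fun f => Subtype.ext ?_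
    change funRep k Γ X (g * h) f = funRep k Γ X g (funRep k Γ X h f)
    rw [map_mul]
    rfl

theorem eigRep_coe (c : k) (g : Γ) (f : a.eig k c) (x : X) :
    (a.eigRep k c g f : X → k) x = (f : X → k) (g⁻¹ • x) := rfl

/-- The inclusion of an eigenspace. -/
def eigIncl (c : k) : (a.eigRep k c).IntertwiningMap (funRep k Γ X) :=
  ⟨(a.eig k c).subtype, fun _ => rfl⟩

/-- The projection to an eigenspace. -/
def eigProj (ζ : rootsOfUnity n k) :
    (funRep k Γ X).IntertwiningMap (a.eigRep k (rootsVal k n ζ)) :=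
  ⟨LinearMap.codRestrict _ ((n : k)⁻¹ • ∑ j ∈ Finset.range n,
      (rootsVal k n ζ)⁻¹ ^ j • LinearMap.funLeft k k ⇑(a.perm ^ j)) fun f x => by
        have h0 : rootsVal k n ζ ≠ 0 := (ζ : kˣ).ne_zero
        simp only [LinearMap.smul_apply, LinearMap.sum_apply, Pi.smul_apply, Finset.sum_apply,
          LinearMap.funLeft_apply, smul_eq_mul]
        rw [mul_left_comm]
        congr 1
        let u : ℕ → k := fun j => (rootsVal k n ζ)⁻¹ ^ j * f ((a.perm ^ j) x)
        have hu : ∀ j, (rootsVal k n ζ)⁻¹ ^ j * f ((a.perm ^ j) (a.perm x)) =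
            rootsVal k n ζ * u (j + 1) := fun j => by
          have : (a.perm ^ j) (a.perm x) = (a.perm ^ (j + 1)) x := by
            rw [pow_succ, Equiv.Perm.mul_apply]
          rw [this]
          simp only [u, pow_succ]
          field_simp
        simp only [hu]
        rw [← Finset.mul_sum]
        congr 1
        have h1 := Finset.sum_range_succ u n
        rw [Finset.sum_range_succ'] at h1
        have h2 : u 0 = u n := by
          simp [u, a.pow_eq, inv_pow, rootsVal_pow]
        rw [h2] at h1
        exact add_right_cancel h1, fun g => by
      refine LinearMap.ext fun f => Subtype.ext (funext fun x => ?_)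
      change ((n : k)⁻¹ • ∑ j ∈ Finset.range n, (rootsVal k n ζ)⁻¹ ^ j •
          LinearMap.funLeft k k ⇑(a.perm ^ j)) (funRep k Γ X g f) x =
        ((n : k)⁻¹ • ∑ j ∈ Finset.range n, (rootsVal k n ζ)⁻¹ ^ j •
          LinearMap.funLeft k k ⇑(a.perm ^ j)) f (g⁻¹ • x)
      simp only [LinearMap.smul_apply, LinearMap.sum_apply, Pi.smul_apply, Finset.sum_apply,
        LinearMap.funLeft_apply, funRep_apply, a.pow_smul]⟩

theorem eigProj_coe (ζ : rootsOfUnity n k) (f : X → k) (x : X) :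
    (a.eigProj k ζ f : X → k) x = (n : k)⁻¹ * ∑ j ∈ Finset.range n,
      (rootsVal k n ζ)⁻¹ ^ j * f ((a.perm ^ j) x) := by
  change ((n : k)⁻¹ • ∑ j ∈ Finset.range n,
      (rootsVal k n ζ)⁻¹ ^ j • LinearMap.funLeft k k ⇑(a.perm ^ j)) f x = _
  simp [LinearMap.sum_apply, Finset.sum_apply, LinearMap.funLeft_apply]

theorem eigProj_of_mem [NeZero (n : k)] (ζ ξ : rootsOfUnity n k) [NeZero n] [IsAlgClosed k]
    (f : a.eig k (rootsVal k n ξ)) :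
    (a.eigProj k ζ f : X → k) = open Classical in if ζ = ξ then (f : X → k) else 0 := by
  classical
  have h0 : rootsVal k n ζ ≠ 0 := (ζ : kˣ).ne_zero
  have hn : (n : k) ≠ 0 := NeZero.ne _
  ext x
  rw [eigProj_coe]
  simp only [a.eig_pow f.2, ← mul_assoc, ← mul_pow]
  rw [← Finset.sum_mul]
  split_ifs with h
  · subst h
    rw [inv_mul_cancel₀ h0]
    simp [hn]
  · have h1 : (rootsVal k n ζ)⁻¹ * rootsVal k n ξ = rootsVal k n (ζ⁻¹ * ξ) := by
      rw [map_mul, rootsVal_apply, rootsVal_apply, rootsVal_apply]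
      simp
    have h2 : rootsVal k n (ζ⁻¹ * ξ) ≠ 1 := by
      intro h3
      rw [← map_one (rootsVal k n)] at h3
      exact h (inv_mul_eq_one.1 (rootsVal_injective n h3))
    have h3 := geom_sum_mul (rootsVal k n (ζ⁻¹ * ξ)) n
    rw [rootsVal_pow, sub_self] at h3
    rw [h1, (mul_eq_zero.1 h3).resolve_right (sub_ne_zero.2 h2)]
    simp

theorem sum_eigProj [NeZero (n : k)] [NeZero n] [IsAlgClosed k] (f : X → k) :
    ∑ ζ : rootsOfUnity n k, (a.eigProj k ζ f : X → k) = f := by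
  have hn : (n : k) ≠ 0 := NeZero.ne _
  ext x
  simp only [Finset.sum_apply, eigProj_coe]
  rw [← Finset.mul_sum, Finset.sum_comm, Finset.sum_eq_single 0]
  · simp only [pow_zero, one_mul, Equiv.Perm.one_apply, Finset.sum_const, Finset.card_univ,
      card_rootsOfUnity_of_isAlgClosed, nsmul_eq_mul]
    rw [← mul_assoc, inv_mul_cancel₀ hn, one_mul]
  · intro j hj hj0
    rw [← Finset.sum_mul]
    have h1 : ∀ ζ : rootsOfUnity n k, (rootsVal k n ζ)⁻¹ ^ j = rootsVal k n ζ⁻¹ ^ j := fun ζ => by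
      rw [rootsVal_apply, rootsVal_apply]; simp
    simp only [h1]
    have h2 := Equiv.sum_comp (Equiv.inv _) (fun ζ => rootsVal k n ζ ^ j)
    simp only [Equiv.inv_apply] at h2
    rw [h2, sum_roots_pow n _ (rootsVal_injective n), if_neg, zero_mul]
    intro h2
    exact absurd (Nat.le_of_dvd (Nat.pos_of_ne_zero hj0) h2) (not_le.2 (Finset.mem_range.1 hj))
  · intro h
    exact absurd (Finset.mem_range.2 (NeZero.pos n)) h

theorem isPPermutation_eigRep [Finite X] [NeZero (n : k)] [NeZero n] [IsAlgClosed k]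
    (ζ : rootsOfUnity n k) : IsPPermutation (a.eigRep k (rootsVal k n ζ)) := by
  classical
  have := Fintype.ofFinite X
  refine (isPPermutation_iff _).2 ⟨X, inferInstance, inferInstance, fun x =>
    LinearMap.proj x ∘ₗ (a.eig k _).subtype, fun x => a.eigProj k ζ (Pi.single x 1),
    fun g x f => ?_, fun g x => ?_, fun f => ?_⟩
  · change (a.eigRep k _ g f : X → k) (g • x) = _
    rw [eigRep_coe, inv_smul_smul]
    rfl
  · beta_reduce
    rw [← funRep_single]
    exact (a.eigProj k ζ).isIntertwining _ _ _ _
  · have h1 : ∑ x, (f : X → k) x • (Pi.single x 1 : X → k) = f := by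
      ext y
      simp [Finset.sum_apply, Pi.single_apply]
    have h2 := congrArg (a.eigProj k ζ) h1
    simp only [map_sum, map_smul] at h2
    refine h2.trans (Subtype.ext ?_)
    rw [eigProj_of_mem, if_pos rfl]

end SetAut

end Eigen

section SpanMatrix

variable (k : Type u) [Field k] {Γ : Type} [Group Γ] {X : Type} [Fintype X] [DecidableEq X]
  [MulAction Γ X] {D : Type} [Finite D] [MulAction Γ D]

/-- The invariant matrix attached to a span of equivariant maps: it counts common preimages. -/
def spanMat (e f : D →[Γ] X) : invMat k Γ X :=
  letI := Fintype.ofFinite D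
  ⟨Matrix.of fun x y => ∑ d, if e d = x ∧ f d = y then 1 else 0, fun g x y => by
    simp only [Matrix.of_apply]
    rw [← Equiv.sum_comp (MulAction.toPerm g)]
    simp⟩

variable {k}

theorem spanMat_apply [h : Fintype D] (e f : D →[Γ] X) (x y : X) :
    (spanMat k e f : Matrix X X k) x y = ∑ d, if e d = x ∧ f d = y then 1 else 0 := by
  rw [Subsingleton.elim h (Fintype.ofFinite D)]
  rfl

theorem invMat.ext {a b : invMat k Γ X}
    (h : ∀ x y, (a : Matrix X X k) x y = (b : Matrix X X k) x y) : a = b :=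
  Subtype.ext (Matrix.ext h)

theorem invMat.mul_apply (a b : invMat k Γ X) (x y : X) :
    ((a * b : invMat k Γ X) : Matrix X X k) x y =
      ∑ z, (a : Matrix X X k) x z * (b : Matrix X X k) z y := by
  rw [MulMemClass.coe_mul, Matrix.mul_apply]

theorem invMat.smul_apply (c : k) (a : invMat k Γ X) (x y : X) :
    ((c • a : invMat k Γ X) : Matrix X X k) x y = c * (a : Matrix X X k) x y := rfl

theorem invMat.sum_apply {ι : Type*} (s : Finset ι) (a : ι → invMat k Γ X) (x y : X) :
    ((∑ l ∈ s, a l : invMat k Γ X) : Matrix X X k) x y = ∑ l ∈ s, (a l : Matrix X X k) x y := by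
  rw [AddSubmonoidClass.coe_finsetSum, Matrix.sum_apply]

/-- The product of the matrices of two spans. -/
theorem spanMat_mul [Fintype D] {D' : Type} [Fintype D'] [MulAction Γ D'] (e f : D →[Γ] X) (e' f' : D' →[Γ] X)
    (x y : X) : ((spanMat k e f * spanMat k e' f' : invMat k Γ X) : Matrix X X k) x y =
      ∑ d, ∑ d', if f d = e' d' ∧ e d = x ∧ f' d' = y then 1 else 0 := by
  simp only [invMat.mul_apply, spanMat_apply, Finset.sum_mul_sum]
  rw [Finset.sum_comm]
  refine Finset.sum_congr rfl fun d _ => ?_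
  rw [Finset.sum_comm]
  refine Finset.sum_congr rfl fun d' _ => ?_
  rw [Finset.sum_eq_single (f d)]
  · by_cases h1 : f d = e' d'
    · by_cases h2 : e d = x <;> by_cases h3 : f' d' = y <;> simp [h1, h2, h3]
    · have h1' : ¬ e' d' = f d := fun h => h1 h.symm
      simp [h1, h1']
  · intro z _ hz
    simp [hz.symm]
  · simp

theorem spanMat_mul_of_injective (e f h : D →[Γ] X) (hf : Function.Injective f) :
    spanMat k e f * spanMat k f h = spanMat k e h := by
  have := Fintype.ofFinite D
  refine invMat.ext fun x y => ?_
  rw [spanMat_mul, spanMat_apply]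
  refine Finset.sum_congr rfl fun d _ => ?_
  rw [Finset.sum_eq_single d]
  · simp
  · intro d' _ hd
    rw [if_neg]
    rintro ⟨h1, -⟩
    exact hd (hf h1).symm
  · simp

/-- The equivariant map `Γ / S → X`, `g S ↦ g x`, attached to a point fixed by `S`. -/
def pointHom (S : Subgroup Γ) (x : X) (hx : S ≤ MulAction.stabilizer Γ x) : Γ ⧸ S →[Γ] X where
  toFun := Quotient.lift (fun g => g • x) fun a b h => by
    have h1 := hx (QuotientGroup.leftRel_apply.1 h)
    rw [MulAction.mem_stabilizer_iff, mul_smul, inv_smul_eq_iff] at h1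
    exact h1.symm
  map_smul' g c := by
    induction c using QuotientGroup.induction_on with | H c
    exact mul_smul g c x

theorem pointHom_injective (x : X) (S : Subgroup Γ) (hx : S = MulAction.stabilizer Γ x) :
    Function.Injective (pointHom S x hx.le) := by
  intro c c' h
  induction c using QuotientGroup.induction_on with | H c
  induction c' using QuotientGroup.induction_on with | H c'
  refine QuotientGroup.eq.2 ?_
  rw [hx, MulAction.mem_stabilizer_iff, mul_smul, inv_smul_eq_iff]
  exact h.symm

open Classical in
/-- Decomposition of a weighted span into orbits. -/
theorem sum_span_eq_sum_orbits [Finite Γ] [Fintype D] (e f : D →[Γ] X) (κ : D → k)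
    (hκ : ∀ (g : Γ) d, κ (g • d) = κ d) (x y : X) :
    ∑ d, κ d * (if e d = x ∧ f d = y then 1 else 0) =
      ∑ ω : MulAction.orbitRel.Quotient Γ D, κ ω.out *
        (spanMat k (pointHom (MulAction.stabilizer Γ ω.out) (e ω.out) fun g hg => by
            rw [MulAction.mem_stabilizer_iff] at hg ⊢; rw [← map_smul, hg])
          (pointHom (MulAction.stabilizer Γ ω.out) (f ω.out) fun g hg => by
            rw [MulAction.mem_stabilizer_iff] at hg ⊢; rw [← map_smul, hg]) :
          Matrix X X k) x y := by
  have : ∀ ω : MulAction.orbitRel.Quotient Γ D, Fintype (Γ ⧸ MulAction.stabilizer Γ ω.out) :=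
    fun _ => Fintype.ofFinite _
  let E := MulAction.selfEquivSigmaOrbitsQuotientStabilizer Γ D
  rw [← Equiv.sum_comp E.symm, Fintype.sum_sigma]
  refine Finset.sum_congr rfl fun ω _ => ?_
  rw [spanMat_apply, Finset.mul_sum]
  refine Finset.sum_congr (by ext; simp) fun c _ => ?_
  induction c using QuotientGroup.induction_on with | H g
  have h1 : E.symm ⟨ω, (g : Γ ⧸ MulAction.stabilizer Γ ω.out)⟩ = g • ω.out := rfl
  rw [h1, hκ, map_smul, map_smul]
  rfl

end SpanMatrix

section CosetHom

variable {Γ : Type} [Group Γ] (S : Subgroup Γ)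

/-- Right multiplication by an element of the normalizer, on cosets. -/
def cosetHom (s : Γ) (hs : s ∈ Subgroup.normalizer (S : Set Γ)) : Γ ⧸ S →[Γ] Γ ⧸ S where
  toFun := Quotient.map (· * s) fun a b h => by
    refine QuotientGroup.leftRel_apply.2 ?_
    have h1 := (Subgroup.mem_normalizer_iff''.1 hs _).1 (QuotientGroup.leftRel_apply.1 h)
    simpa [mul_assoc] using h1
  map_smul' g c := by
    induction c using QuotientGroup.induction_on with | H c
    exact congrArg (QuotientGroup.mk) (mul_assoc g c s)

theorem cosetHom_mk (s : Γ) (hs : s ∈ Subgroup.normalizer (S : Set Γ)) (g : Γ) :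
    cosetHom S s hs (g : Γ ⧸ S) = ((g * s : Γ) : Γ ⧸ S) := rfl

/-- Right multiplication by an element `s` of the normalizer of `S`, as an automorphism of the
`Γ`-set `Γ / S`. -/
def cosetAut (s : Γ) (hs : s ∈ Subgroup.normalizer (S : Set Γ)) : SetAut Γ (Γ ⧸ S) (orderOf s) where
  perm :=
    { toFun := cosetHom S s hs
      invFun := cosetHom S s⁻¹ (inv_mem hs)
      left_inv := fun c => by
        induction c using QuotientGroup.induction_on with | H c
        simp [cosetHom_mk]
      right_inv := fun c => by
        induction c using QuotientGroup.induction_on with | H c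
        simp [cosetHom_mk] }
  smul g c := map_smul (cosetHom S s hs) g c
  pow_eq := by
    have h : ∀ (j : ℕ) (P : Equiv.Perm (Γ ⧸ S)),
        (∀ g : Γ, P (g : Γ ⧸ S) = ((g * s : Γ) : Γ ⧸ S)) →
        ∀ g : Γ, (P ^ j) (g : Γ ⧸ S) = ((g * s ^ j : Γ) : Γ ⧸ S) := by
      intro j P hP
      induction j with
      | zero => simp
      | succ j ih =>
        intro g
        rw [pow_succ', Equiv.Perm.mul_apply, ih, hP, mul_assoc, ← pow_succ]
    ext c
    induction c using QuotientGroup.induction_on with | H c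
    rw [h _ _ fun g => rfl, pow_orderOf_eq_one, mul_one]
    rfl

theorem cosetAut_pow (s : Γ) (hs : s ∈ Subgroup.normalizer (S : Set Γ)) (j : ℕ) (g : Γ) :
    ((cosetAut S s hs).perm ^ j) (g : Γ ⧸ S) = ((g * s ^ j : Γ) : Γ ⧸ S) := by
  induction j generalizing g with
  | zero => simp
  | succ j ih =>
    rw [pow_succ', Equiv.Perm.mul_apply, ih, pow_succ, ← mul_assoc]
    rfl

end CosetHom

section EigenPresentation

variable {k : Type u} [Field k] {Γ : Type} [Group Γ] {X : Type} [Fintype X] [DecidableEq X]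
  [MulAction Γ X] {D : Type} [Fintype D] [DecidableEq D] [MulAction Γ D] {n : ℕ}

namespace SetAut

variable (a : SetAut Γ D n)

/-- A power of an automorphism of a `Γ`-set, as an equivariant map. -/
def powHom (j : ℕ) : D →[Γ] D := ⟨⇑(a.perm ^ j), fun g x => a.pow_smul j g x⟩

/-- The presentation of an eigenspace attached to an embedding of `Γ`-sets. -/
def eigPres [NeZero (n : k)] [NeZero n] [IsAlgClosed k] (ζ : rootsOfUnity n k) (e : D →[Γ] X)
    (he : Function.Injective e) : Pres X (a.eigRep k (rootsVal k n ζ)) where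
  ι := Unit
  i _ x := ∑ d, if e d = x then LinearMap.proj d ∘ₗ (a.eig k _).subtype else 0
  r _ x := ∑ d, if e d = x then a.eigProj k ζ (Pi.single d 1) else 0
  hi _ g x f := by
    simp only [LinearMap.sum_apply]
    rw [← Equiv.sum_comp (MulAction.toPerm g)]
    refine Finset.sum_congr rfl fun d _ => ?_
    rw [MulAction.toPerm_apply, map_smul, if_congr (smul_left_cancel_iff g) rfl rfl]
    split_ifs
    · change (a.eigRep k _ g f : D → k) (g • d) = _
      rw [eigRep_coe, inv_smul_smul]
      rfl
    · rfl
  hr _ g x := by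
    rw [← Equiv.sum_comp (MulAction.toPerm g), map_sum]
    refine Finset.sum_congr rfl fun d _ => ?_
    rw [MulAction.toPerm_apply, map_smul, if_congr (smul_left_cancel_iff g) rfl rfl]
    split_ifs
    · rw [← funRep_single]
      exact (a.eigProj k ζ).isIntertwining _ _ _ _
    · rw [map_zero]
  sum_eq f := by
    have h1 : ∑ d, (f : D → k) d • (Pi.single d 1 : D → k) = f := by
      ext y
      simp [Finset.sum_apply, Pi.single_apply]
    have h2 := congrArg (a.eigProj k ζ) h1
    simp only [map_sum, map_smul] at h2
    have h3 : a.eigProj k ζ (f : D → k) = f := Subtype.ext (by rw [eigProj_of_mem, if_pos rfl])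
    rw [h3] at h2
    rw [Fintype.sum_unique]
    refine Eq.trans ?_ h2
    rw [← Finset.sum_subset (Finset.subset_univ (Finset.univ.image e)), Finset.sum_image he.injOn]
    · refine Finset.sum_congr rfl fun d _ => ?_
      rw [LinearMap.sum_apply, Finset.sum_eq_single d, Finset.sum_eq_single d]
      · simp
      · intro d' _ hd
        exact if_neg fun h => hd (he h)
      · simp
      · intro d' _ hd
        rw [if_neg fun h => hd (he h)]
        rfl
      · simp
    · intro x _ hx
      rw [Finset.sum_eq_zero (s := Finset.univ) (f := fun d => if e d = x then
        a.eigProj k ζ (Pi.single d 1) else 0), smul_zero]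
      intro d _
      refine if_neg fun h => hx ?_
      rw [← h]
      exact Finset.mem_image_of_mem e (Finset.mem_univ d)

theorem eigPres_mat [NeZero (n : k)] [NeZero n] [IsAlgClosed k] (ζ : rootsOfUnity n k)
    (e : D →[Γ] X) (he : Function.Injective e) (l m : (a.eigPres ζ e he).ι) :
    (a.eigPres ζ e he).mat (a.eigPres ζ e he) (.id _) l m =
      (n : k)⁻¹ • ∑ j ∈ Finset.range n, (rootsVal k n ζ)⁻¹ ^ j •
        spanMat k e (e.comp (a.powHom j)) := by
  refine invMat.ext fun x y => ?_
  have hr : (a.eigPres ζ e he).r m y = a.eigProj k ζ fun d => if e d = y then 1 else 0 := by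
    have h1 : (fun d => if e d = y then (1 : k) else 0) =
        ∑ d, if e d = y then Pi.single d 1 else 0 := by
      ext d'
      rw [Finset.sum_apply, Finset.sum_eq_single d']
      · split_ifs <;> simp
      · intro d _ hd
        split_ifs
        · exact Pi.single_eq_of_ne hd.symm _
        · rfl
      · simp
    rw [h1, map_sum]
    refine Finset.sum_congr rfl fun d _ => ?_
    split_ifs
    · rfl
    · rw [map_zero]
  have hi : ∀ f, (a.eigPres ζ e he).i l x f = ∑ d, if e d = x then (f : D → k) d else 0 := by
    intro f
    refine (LinearMap.sum_apply _ _ _).trans (Finset.sum_congr rfl fun d _ => ?_)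
    split_ifs <;> rfl
  rw [Pres.mat_apply, Representation.IntertwiningMap.id_apply, hr, hi, invMat.smul_apply,
    invMat.sum_apply]
  simp only [invMat.smul_apply, spanMat_apply, eigProj_coe, Finset.mul_sum]
  rw [Finset.sum_comm]
  refine Finset.sum_congr rfl fun d _ => ?_
  have h2 : ∀ j, (e.comp (a.powHom j)) d = e ((a.perm ^ j) d) := fun _ => rfl
  simp only [h2]
  by_cases h : e d = x <;> simp [h]

end SetAut

end EigenPresentation

section TraceForms

variable {k : Type u} [Field k] {Γ : Type} [Group Γ] [Finite Γ] {X : Type} [Fintype X]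
  [DecidableEq X] [MulAction Γ X]

/-- The matrix of right multiplication by an element of the normalizer of `S`, on cosets. -/
def normMat (k : Type u) [Field k] {S : Subgroup Γ} (e : Γ ⧸ S →[Γ] X)
    (h : Subgroup.normalizer (S : Set Γ)) : invMat k Γ X :=
  spanMat k e (e.comp (cosetHom S h h.2))

theorem normMat_mul {S : Subgroup Γ} {e : Γ ⧸ S →[Γ] X} (he : Function.Injective e)
    (h h' : Subgroup.normalizer (S : Set Γ)) :
    normMat k e h * normMat k e h' = normMat k e (h * h') := by
  have := Fintype.ofFinite (Γ ⧸ S)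
  refine invMat.ext fun x y => ?_
  rw [normMat, normMat, spanMat_mul, normMat, spanMat_apply]
  refine Finset.sum_congr rfl fun d _ => ?_
  rw [Finset.sum_eq_single (cosetHom S h h.2 d)]
  · induction d using QuotientGroup.induction_on with | H d
    simp only [MulActionHom.comp_apply, cosetHom_mk, mul_assoc, true_and, Subgroup.coe_mul]
    congr
  · intro d' _ hd
    rw [if_neg]
    rintro ⟨h1, -⟩
    exact hd (he h1).symm
  · simp

theorem normMat_pow {S : Subgroup Γ} {e : Γ ⧸ S →[Γ] X} (he : Function.Injective e)
    (h : Subgroup.normalizer (S : Set Γ)) (j : ℕ) :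
    normMat k e h ^ (j + 1) = normMat k e (h ^ (j + 1)) := by
  induction j with
  | zero => simp
  | succ j ih => rw [pow_succ, ih, normMat_mul he, ← pow_succ]

/-- A matrix `normMat` is a combination of the idempotents attached to eigenspaces. -/
theorem normMat_eq_sum [IsAlgClosed k] {S : Subgroup Γ} (e : Γ ⧸ S →[Γ] X)
    (s : Subgroup.normalizer (S : Set Γ)) [NeZero (orderOf (s : Γ))]
    [NeZero ((orderOf (s : Γ) : ℕ) : k)] :
    normMat k e s = ∑ ζ : rootsOfUnity (orderOf (s : Γ)) k, rootsVal k _ ζ •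
      ((orderOf (s : Γ) : k)⁻¹ • ∑ j ∈ Finset.range (orderOf (s : Γ)), (rootsVal k _ ζ)⁻¹ ^ j •
        spanMat k e (e.comp ((cosetAut S s s.2).powHom j))) := by
  obtain ⟨n, hn⟩ : ∃ n, n = orderOf (s : Γ) := ⟨_, rfl⟩
  have hn0 : (orderOf (s : Γ) : k) ≠ 0 := NeZero.ne _
  simp only [Finset.smul_sum, smul_smul]
  rw [Finset.sum_comm]
  simp only [← Finset.sum_smul]
  have key : ∀ j, ∑ ζ : rootsOfUnity (orderOf (s : Γ)) k,
      rootsVal k _ ζ * ((orderOf (s : Γ) : k)⁻¹ * (rootsVal k _ ζ)⁻¹ ^ j) =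
      if orderOf (s : Γ) ∣ j + (orderOf (s : Γ) - 1) then 1 else 0 := by
    intro j
    have h1 : ∀ ζ : rootsOfUnity (orderOf (s : Γ)) k,
        rootsVal k _ ζ * ((orderOf (s : Γ) : k)⁻¹ * (rootsVal k _ ζ)⁻¹ ^ j) =
        (orderOf (s : Γ) : k)⁻¹ * (rootsVal k _ ζ⁻¹) ^ (j + (orderOf (s : Γ) - 1)) := by
      intro ζ
      have h2 : (rootsVal k _ ζ)⁻¹ = rootsVal k _ ζ⁻¹ := by
        rw [rootsVal_apply, rootsVal_apply]; simp
      have h3 : rootsVal k _ ζ = rootsVal k _ ζ⁻¹ ^ (orderOf (s : Γ) - 1) := by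
        have h4 := rootsVal_pow (k := k) _ ζ⁻¹
        have h5 : rootsVal k _ ζ⁻¹ ^ (orderOf (s : Γ) - 1) * rootsVal k _ ζ⁻¹ = 1 := by
          rw [← pow_succ, Nat.sub_add_cancel (NeZero.pos (orderOf (s : Γ))), h4]
        rw [← h2] at h5 ⊢
        have h0 : rootsVal k _ ζ ≠ 0 := (ζ : kˣ).ne_zero
        exact (eq_of_mul_inv_eq_one h5).symm
      conv_lhs => rw [h2]; lhs; rw [h3]
      rw [pow_add]
      ring
    simp only [h1]
    rw [← Finset.mul_sum]
    have h2 := Equiv.sum_comp (Equiv.inv _)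
      (fun ζ => rootsVal k (orderOf (s : Γ)) ζ ^ (j + (orderOf (s : Γ) - 1)))
    simp only [Equiv.inv_apply] at h2
    rw [h2, sum_roots_pow _ _ (rootsVal_injective _)]
    split_ifs
    · exact inv_mul_cancel₀ hn0
    · exact mul_zero _
  have hpos : 0 < orderOf (s : Γ) := NeZero.pos _
  rw [Finset.sum_eq_single (1 % orderOf (s : Γ))]
  · rw [key, if_pos, one_smul]
    · refine congrArg (spanMat k e) (MulActionHom.ext fun c => congrArg e ?_)
      induction c using QuotientGroup.induction_on with | H c
      change _ = ((cosetAut S s s.2).perm ^ _) _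
      rw [cosetAut_pow, pow_mod_orderOf, pow_one]
      rfl
    · rcases Nat.lt_or_ge 1 (orderOf (s : Γ)) with h | h
      · rw [Nat.mod_eq_of_lt h]
        exact dvd_of_eq (by omega)
      · have : orderOf (s : Γ) = 1 := by omega
        rw [this]
        simp
  · intro j hj hj0
    rw [key, if_neg, zero_smul]
    rw [Finset.mem_range] at hj
    rintro ⟨c, hc⟩
    apply hj0
    rcases c with _ | _ | c
    · have : j = 0 := by omega
      have h1 : orderOf (s : Γ) = 1 := by omega
      rw [this, h1]
    · have h1 : j = 1 := by omega
      subst h1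
      rw [Nat.mod_eq_of_lt hj]
    · nlinarith [Nat.sub_add_cancel hpos]
  · intro h
    exact absurd (Finset.mem_range.2 (Nat.mod_lt _ hpos)) h

/-- A trace form which vanishes on the idempotents of eigenspaces vanishes on `normMat`. -/
theorem apply_normMat_eq_zero {p : ℕ} [Fact p.Prime] [CharP k p] [IsAlgClosed k]
    (t : invMat k Γ X →ₗ[k] k) (hnil : ∀ a, IsNilpotent a → t a = 0)
    {S : Subgroup Γ} {e : Γ ⧸ S →[Γ] X} (he : Function.Injective e)
    (hE : ∀ s : Subgroup.normalizer (S : Set Γ), (orderOf (s : Γ)).Coprime p →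
      ∀ ζ : rootsOfUnity (orderOf (s : Γ)) k,
        t ((orderOf (s : Γ) : k)⁻¹ • ∑ j ∈ Finset.range (orderOf (s : Γ)), (rootsVal k _ ζ)⁻¹ ^ j •
          spanMat k e (e.comp ((cosetAut S s s.2).powHom j))) = 0)
    (h : Subgroup.normalizer (S : Set Γ)) : t (normMat k e h) = 0 := by
  have hp : p.Prime := Fact.out
  obtain ⟨a, m, hm, hN⟩ := Nat.exists_eq_pow_mul_and_not_dvd (orderOf_pos h).ne' p hp.ne_one
  have hcop : (p ^ a).Coprime m := Nat.Coprime.pow_left _ ((hp.coprime_iff_not_dvd).2 hm)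
  obtain ⟨u, hu0, hu1⟩ := Nat.chineseRemainder hcop 0 1
  have hs : (h ^ u) ^ m = 1 := by
    rw [← pow_mul, ← orderOf_dvd_iff_pow_eq_one, hN]
    exact Nat.mul_dvd_mul ((Nat.modEq_zero_iff_dvd).1 hu0) dvd_rfl
  have hs1 : (h ^ u) ^ p ^ a = h ^ p ^ a := by
    rw [← pow_mul, pow_eq_pow_iff_modEq, hN, mul_comm u]
    have := hu1.mul_left' (p ^ a)
    rwa [mul_one] at this
  have hord : (orderOf ((h ^ u : Subgroup.normalizer (S : Set Γ)) : Γ)).Coprime p := by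
    rw [Subgroup.orderOf_coe]
    refine Nat.Coprime.coprime_dvd_left (orderOf_dvd_of_pow_eq_one hs) ?_
    exact ((hp.coprime_iff_not_dvd).2 hm).symm
  have hnz : NeZero (orderOf ((h ^ u : Subgroup.normalizer (S : Set Γ)) : Γ)) :=
    ⟨(orderOf_pos _).ne'⟩
  have hnz' : NeZero ((orderOf ((h ^ u : Subgroup.normalizer (S : Set Γ)) : Γ) : ℕ) : k) := by
    refine ⟨fun h0 => ?_⟩
    rw [CharP.cast_eq_zero_iff k p] at h0
    exact hp.one_lt.ne' (Nat.Coprime.eq_one_of_dvd hord.symm h0)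
  have h1 : t (normMat k e (h ^ u)) = 0 := by
    rw [normMat_eq_sum, map_sum]
    refine Finset.sum_eq_zero fun ζ _ => ?_
    rw [map_smul, hE _ hord, smul_zero]
  have h2 : t (normMat k e h - normMat k e (h ^ u)) = 0 := by
    refine hnil _ ⟨p ^ a, ?_⟩
    have hc : Commute (normMat k e h) (normMat k e (h ^ u)) := by
      rw [Commute, SemiconjBy, normMat_mul he, normMat_mul he, ← pow_succ, ← pow_succ']
    have : Nontrivial (invMat k Γ X) := by
      refine ⟨0, 1, fun h0 => ?_⟩
      have := congrArg (fun a : invMat k Γ X => (a : Matrix X X k) (e (1 : Γ)) (e (1 : Γ))) h0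
      simp at this
    have : CharP (invMat k Γ X) p :=
      charP_of_injective_algebraMap (algebraMap k (invMat k Γ X)).injective p
    rw [sub_pow_char_pow_of_commute _ _ hc]
    obtain ⟨b, hb⟩ := Nat.exists_eq_succ_of_ne_zero (pow_pos hp.pos a).ne'
    rw [hb, Nat.succ_eq_add_one, normMat_pow he, normMat_pow he, ← Nat.succ_eq_add_one, ← hb, hs1,
      sub_self]
  rw [map_sub, h1, sub_zero] at h2
  exact h2

/-- A trace form on the algebra of invariant matrices which vanishes on the idempotents attached to
eigenspaces is zero. -/
theorem trace_form_eq_zero {p : ℕ} [Fact p.Prime] [CharP k p] [IsAlgClosed k]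
    (hX : ∀ x : X, IsPGroup p (MulAction.stabilizer Γ x))
    (hX' : ∀ S : Subgroup Γ, IsPGroup p S → ∃ x : X, MulAction.stabilizer Γ x = S)
    (t : invMat k Γ X →ₗ[k] k) (hcomm : ∀ a b, t (a * b) = t (b * a))
    (hnil : ∀ a, IsNilpotent a → t a = 0)
    (hE : ∀ S : Subgroup Γ, IsPGroup p S → ∀ e : Γ ⧸ S →[Γ] X, Function.Injective e →
      ∀ s : Subgroup.normalizer (S : Set Γ), (orderOf (s : Γ)).Coprime p →
      ∀ ζ : rootsOfUnity (orderOf (s : Γ)) k,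
        t ((orderOf (s : Γ) : k)⁻¹ • ∑ j ∈ Finset.range (orderOf (s : Γ)), (rootsVal k _ ζ)⁻¹ ^ j •
          spanMat k e (e.comp ((cosetAut S s s.2).powHom j))) = 0) : t = 0 := by
  classical
  have main : ∀ (m : ℕ) (S : Subgroup Γ), Nat.card S = m → IsPGroup p S → ∀ (x y : X)
      (hx : S ≤ MulAction.stabilizer Γ x) (hy : S ≤ MulAction.stabilizer Γ y),
      t (spanMat k (pointHom S x hx) (pointHom S y hy)) = 0 := by
    intro m
    induction m using Nat.strong_induction_on with | h m ih
    intro S hm hS x y hx hy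
    obtain ⟨z, hz⟩ := hX' S hS
    let f := pointHom S z hz.ge
    have hf : Function.Injective f := pointHom_injective z S hz.symm
    rw [← spanMat_mul_of_injective _ f _ hf, hcomm]
    have := Fintype.ofFinite (Γ ⧸ S)
    let D := {d : (Γ ⧸ S) × (Γ ⧸ S) // pointHom S y hy d.1 = pointHom S x hx d.2}
    let A : MulAction Γ D :=
      { smul := fun g d => ⟨(g • d.1.1, g • d.1.2), by rw [map_smul, map_smul, d.2]⟩
        one_smul := fun d => Subtype.ext (one_smul Γ d.1)
        mul_smul := fun g h d => Subtype.ext (mul_smul g h d.1) }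
    let e1 : D →[Γ] X := ⟨fun d => f d.1.1, fun g d => map_smul f g d.1.1⟩
    let e2 : D →[Γ] X := ⟨fun d => f d.1.2, fun g d => map_smul f g d.1.2⟩
    have h1 : spanMat k f (pointHom S y hy) * spanMat k (pointHom S x hx) f =
        ∑ ω : MulAction.orbitRel.Quotient Γ D, spanMat k
          (pointHom (MulAction.stabilizer Γ ω.out) (e1 ω.out) fun g hg => by
            rw [MulAction.mem_stabilizer_iff] at hg ⊢; rw [← map_smul, hg])
          (pointHom (MulAction.stabilizer Γ ω.out) (e2 ω.out) fun g hg => by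
            rw [MulAction.mem_stabilizer_iff] at hg ⊢; rw [← map_smul, hg]) := by
      refine invMat.ext fun x' y' => ?_
      rw [spanMat_mul, invMat.sum_apply]
      have h2 := sum_span_eq_sum_orbits (Γ := Γ) e1 e2 (fun _ => (1 : k)) (fun _ _ => rfl) x' y'
      simp only [one_mul] at h2
      have h3 : ∀ (cond : (Γ ⧸ S) × (Γ ⧸ S) → Prop) [DecidablePred cond] (w : (Γ ⧸ S) × (Γ ⧸ S) → k),
          ∑ q, (if cond q then w q else 0) = ∑ d : {q // cond q}, w d := fun cond _ w => by
        rw [← Finset.sum_filter]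
        exact Finset.sum_subtype _ (by simp) _
      rw [← h2, ← Fintype.sum_prod_type'
        (f := fun d d' => if pointHom S y hy d = pointHom S x hx d' ∧ f d = x' ∧ f d' = y'
          then (1 : k) else 0)]
      simp only [ite_and]
      exact h3 (fun q => pointHom S y hy q.1 = pointHom S x hx q.2) fun q =>
        if f q.1 = x' then if f q.2 = y' then 1 else 0 else 0
    rw [h1, map_sum]
    refine Finset.sum_eq_zero fun ω _ => ?_
    generalize ω.out = d
    have hst : ∀ c : Γ ⧸ S, ∃ g : Γ, f c = g • z ∧
        Nat.card (MulAction.stabilizer Γ (f c)) = m := by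
      intro c
      induction c using QuotientGroup.induction_on with | H g
      refine ⟨g, rfl, ?_⟩
      rw [show f (g : Γ ⧸ S) = g • z from rfl, MulAction.stabilizer_smul_eq_stabilizer_map_conj, hz,
        ← hm]
      exact Subgroup.card_map_of_injective (MulAut.conj g).injective
    obtain ⟨g1, hg1, hc1⟩ := hst d.1.1
    obtain ⟨g2, hg2, hc2⟩ := hst d.1.2
    have hle1 : MulAction.stabilizer Γ d ≤ MulAction.stabilizer Γ (f d.1.1) := fun g hg => by
      rw [MulAction.mem_stabilizer_iff] at hg ⊢
      exact (map_smul e1 g d).symm.trans (congrArg e1 hg)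
    have hle2 : MulAction.stabilizer Γ d ≤ MulAction.stabilizer Γ (f d.1.2) := fun g hg => by
      rw [MulAction.mem_stabilizer_iff] at hg ⊢
      exact (map_smul e2 g d).symm.trans (congrArg e2 hg)
    have hp : IsPGroup p (MulAction.stabilizer Γ d) := (hX (f d.1.1)).to_le hle1
    rcases lt_or_ge (Nat.card (MulAction.stabilizer Γ d)) m with hlt | hge
    · exact ih _ hlt _ rfl hp _ _ _ _
    have heq1 := Subgroup.eq_of_le_of_card_ge hle1 (hc1.trans_le hge)
    have heq2 := Subgroup.eq_of_le_of_card_ge hle2 (hc2.trans_le hge)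
    have hz2 : f d.1.2 = (g2 * g1⁻¹) • f d.1.1 := by
      rw [hg1, hg2, smul_smul, inv_mul_cancel_right]
    have hn : g2 * g1⁻¹ ∈ Subgroup.normalizer ((MulAction.stabilizer Γ d : Subgroup Γ) : Set Γ) := by
      rw [Subgroup.mem_normalizer_iff_map_conj_eq]
      conv_lhs => rw [heq1]
      conv_rhs => rw [heq2, hz2, MulAction.stabilizer_smul_eq_stabilizer_map_conj]
      rfl
    have h4 := apply_normMat_eq_zero t hnil (pointHom_injective (e1 d) _ heq1)
      (fun s hs ζ => hE _ hp _ (pointHom_injective (e1 d) _ heq1) s hs ζ) ⟨_, hn⟩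
    refine Eq.trans (congrArg t ?_) h4
    refine congrArg (spanMat k _) (MulActionHom.ext fun c => ?_)
    induction c using QuotientGroup.induction_on with | H c
    change c • f d.1.2 = (c * (g2 * g1⁻¹)) • f d.1.1
    rw [hz2, mul_smul c]
  ext a
  let e1 : X × X →[Γ] X := ⟨Prod.fst, fun _ _ => rfl⟩
  let e2 : X × X →[Γ] X := ⟨Prod.snd, fun _ _ => rfl⟩
  have h1 : a = ∑ ω : MulAction.orbitRel.Quotient Γ (X × X),
      (a : Matrix X X k) ω.out.1 ω.out.2 • spanMat k
          (pointHom (MulAction.stabilizer Γ ω.out) (e1 ω.out) fun g hg => by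
            rw [MulAction.mem_stabilizer_iff] at hg ⊢; rw [← map_smul, hg])
          (pointHom (MulAction.stabilizer Γ ω.out) (e2 ω.out) fun g hg => by
            rw [MulAction.mem_stabilizer_iff] at hg ⊢; rw [← map_smul, hg]) := by
    refine invMat.ext fun x y => ?_
    rw [invMat.sum_apply]
    simp only [invMat.smul_apply]
    rw [← sum_span_eq_sum_orbits (Γ := Γ) e1 e2 (fun d => (a : Matrix X X k) d.1 d.2)
      (fun g d => a.2 g d.1 d.2), Finset.sum_eq_single (x, y)]
    · rw [if_pos ⟨rfl, rfl⟩, mul_one]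
    · rintro ⟨x', y'⟩ _ hd
      rw [if_neg, mul_zero]
      rintro ⟨rfl, rfl⟩
      exact hd rfl
    · simp
  rw [h1, map_sum]
  refine Finset.sum_eq_zero fun ω _ => ?_
  rw [map_smul, main _ _ rfl ((hX ω.out.1).to_le _), smul_zero]
  intro g hg
  exact congrArg Prod.fst hg

end TraceForms

section Spanning

variable {k : Type u} [Field k] {Γ : Type} [Group Γ]

theorem Pres.trace_mat_id {X : Type} [Fintype X] [DecidableEq X] [MulAction Γ X] {V : Type w}
    [AddCommGroup V] [Module k V] {ρ : Representation k Γ V} (P : Pres X ρ) [Unique P.ι] {d : ℕ}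
    (φ : invMat k Γ X →ₐ[k] Module.End k (Fin d → k)) :
    LinearMap.trace k _ (φ (P.mat P (.id ρ) default default)) =
      (Module.finrank k (P.fiber φ) : k) := by
  have h1 : LinearMap.IsProj (P.fiber φ) (matAct φ (P.mat P (.id ρ))) :=
    ⟨fun x => ⟨x, rfl⟩, fun x hx => P.fiber_apply_self φ hx⟩
  rw [← h1.trace]
  have h2 : φ (P.mat P (.id ρ) default default) =
      (LinearEquiv.funUnique P.ι k (Fin d → k)).conj (matAct φ (P.mat P (.id ρ))) := by
    refine LinearMap.ext fun w => ?_
    rw [LinearEquiv.conj_apply_apply]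
    change _ = matAct φ (P.mat P (.id ρ)) _ default
    rw [matAct_apply, Fintype.sum_unique]
    rfl
  rw [h2, LinearMap.trace_conj']

instance {X : Type} [Fintype X] [DecidableEq X] [MulAction Γ X] {D : Type} [Fintype D]
    [DecidableEq D] [MulAction Γ D] {n : ℕ} (a : SetAut Γ D n) [NeZero (n : k)] [NeZero n]
    [IsAlgClosed k] (ζ : rootsOfUnity n k) (e : D →[Γ] X) (he : Function.Injective e) :
    Unique (a.eigPres ζ e he).ι :=
  inferInstanceAs (Unique Unit)

theorem PCosets.stabilizer_mk {p : ℕ} (Q : {Q : Subgroup Γ // IsPGroup p Q}) (g : Γ) :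
    MulAction.stabilizer Γ (⟨Q, (g : Γ ⧸ Q.1)⟩ : PCosets p Γ) =
      Q.1.map (MulAut.conj g).toMonoidHom := by
  have h1 : MulAction.stabilizer Γ (⟨Q, ((1 : Γ) : Γ ⧸ Q.1)⟩ : PCosets p Γ) = Q.1 := by
    ext h
    rw [MulAction.mem_stabilizer_iff, PCosets.smul_mk]
    have : (⟨Q, h • ((1 : Γ) : Γ ⧸ Q.1)⟩ : PCosets p Γ) = ⟨Q, ((1 : Γ) : Γ ⧸ Q.1)⟩ ↔
        h • ((1 : Γ) : Γ ⧸ Q.1) = ((1 : Γ) : Γ ⧸ Q.1) :=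
      ⟨fun h => eq_of_heq (Sigma.mk.inj h).2, fun h => by rw [h]⟩
    rw [this, MulAction.Quotient.smul_coe, smul_eq_mul, mul_one, eq_comm, QuotientGroup.eq]
    simp
  conv_rhs => rw [← h1]
  have h2 : (⟨Q, (g : Γ ⧸ Q.1)⟩ : PCosets p Γ) = g • ⟨Q, ((1 : Γ) : Γ ⧸ Q.1)⟩ := by
    rw [PCosets.smul_mk, MulAction.Quotient.smul_coe, smul_eq_mul, mul_one]
  rw [h2, MulAction.stabilizer_smul_eq_stabilizer_map_conj]

variable (k Γ) in
/-- The classes of the eigenspaces of right multiplications by `p'`-elements `s` of the normalizer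
of a `p`-subgroup `Q` on the permutation module of `Γ / Q`. -/
def cosetEigClasses [Finite Γ] (p : ℕ) : Set (ppermClasses k Γ) :=
  {y | ∃ (Q : Subgroup Γ) (s : Subgroup.normalizer (Q : Set Γ)) (ζ : rootsOfUnity (orderOf (s : Γ)) k),
    IsPGroup p Q ∧ (orderOf (s : Γ)).Coprime p ∧
      y.1 = cls ((cosetAut Q s s.2).eigRep k (rootsVal k _ ζ))}

/-- `F T(Γ)` is spanned by the classes of eigenspaces of right multiplications by `p'`-elements on
the permutation modules of coset spaces. -/
theorem span_cosetEigClasses {F : Type v} [Field F] [CharZero F] [Finite Γ] {p : ℕ} [Fact p.Prime]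
    [CharP k p] [IsAlgClosed k] :
    Submodule.span F (gcls F '' cosetEigClasses k Γ p) = ⊤ := by
  classical
  obtain ⟨n, d, φ, v, hv, hd, hφ, hfib⟩ := exists_rankVector k p Γ
  refine span_gcls_eq_top (Fact.out : p.Prime).one_lt v hv _ fun m hm => ?_
  let t : invMat k Γ (PCosets p Γ) →ₗ[k] k :=
    ∑ j, (m j : k) • (LinearMap.trace k (Fin (d j) → k) ∘ₗ (φ j).toLinearMap)
  have ht : ∀ a, t a = ∑ j, (m j : k) * LinearMap.trace k (Fin (d j) → k) (φ j a) := fun a => by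
    simp [t, LinearMap.sum_apply]
  have h0 : t = 0 := by
    refine trace_form_eq_zero (p := p) ?_ ?_ t ?_ ?_ ?_
    · rintro ⟨Q, c⟩
      induction c using QuotientGroup.induction_on with | H g
      rw [PCosets.stabilizer_mk]
      exact Q.2.map _
    · intro S hS
      refine ⟨⟨⟨S, hS⟩, ((1 : Γ) : Γ ⧸ S)⟩, ?_⟩
      rw [PCosets.stabilizer_mk, map_one]
      exact Subgroup.map_id S
    · intro a b
      simp only [ht, map_mul]
      exact Finset.sum_congr rfl fun j _ => by rw [LinearMap.trace_mul_comm]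
    · intro a ha
      rw [ht]
      refine Finset.sum_eq_zero fun j _ => ?_
      rw [(LinearMap.isNilpotent_trace_of_isNilpotent (ha.map (φ j))).eq_zero, mul_zero]
    · intro S hS e he s hs ζ
      have hnz : NeZero (orderOf (s : Γ)) := ⟨(orderOf_pos _).ne'⟩
      have hnz' : NeZero ((orderOf (s : Γ) : ℕ) : k) := by
        refine ⟨fun h0 => ?_⟩
        rw [CharP.cast_eq_zero_iff k p] at h0
        exact (Fact.out : p.Prime).one_lt.ne' (Nat.Coprime.eq_one_of_dvd hs.symm h0)
      have : Fintype (Γ ⧸ S) := Fintype.ofFinite _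
      let P := (cosetAut S s s.2).eigPres ζ e he
      have h1 := (cosetAut S s s.2).eigPres_mat ζ e he default default
      rw [← h1, ht]
      let x : ppermClasses k Γ := ⟨_, (cls_mem_ppermClasses _).2
        ((cosetAut S (s : Γ) s.2).isPPermutation_eigRep k ζ)⟩
      have h2 := hm x ⟨S, s, ζ, hS, hs, rfl⟩
      have h3 : ∀ j, LinearMap.trace k (Fin (d j) → k) (φ j (P.mat P (.id _) default default)) =
          (v x j : k) := fun j => by
        rw [P.trace_mat_id, hfib x _ _ P rfl]
      refine (Finset.sum_congr rfl fun j _ => congrArg _ (h3 j)).trans ?_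
      have h4 := congrArg (fun z : ℤ => (z : k)) h2
      simpa using h4
  intro j
  have : NeZero (d j) := ⟨hd j⟩
  let E : Module.End k (Fin (d j) → k) :=
    LinearMap.single k (fun _ => k) 0 ∘ₗ LinearMap.proj 0
  have hE : LinearMap.trace k _ E = 1 := by
    rw [LinearMap.trace_comp_comm']
    have : (LinearMap.proj 0 ∘ₗ LinearMap.single k (fun _ => k) 0 : k →ₗ[k] k) =
        (LinearMap.id : k →ₗ[k] k) := by
      ext
      simp
    rw [LinearMap.proj_comp_single_same, LinearMap.trace_id]
    simp
  obtain ⟨a, ha⟩ := hφ fun i => if h : i = j then h ▸ E else 0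
  have h1 : t a = 0 := by rw [h0]; rfl
  rw [ht, Finset.sum_eq_single j] at h1
  · rw [ha, dif_pos rfl, hE, mul_one] at h1
    exact (CharP.intCast_eq_zero_iff k p _).1 h1
  · intro i _ hi
    rw [ha, dif_neg hi, map_zero, mul_zero]
  · simp

end Spanning

section LiftedTrace

variable {k : Type u} [Field k] {F : Type v} [Field F] (θ : BrauerLift k F)

/-- The sum of the lifts to `F` of the eigenvalues of an endomorphism. -/
def liftTrace {V : Type w} [AddCommGroup V] [Module k V] [Module.Finite k V] (B : Module.End k V) :
    F :=
  (B.charpoly.roots.map θ.lift).sum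

theorem liftTrace_conj {V : Type w} {W : Type w'} [AddCommGroup V] [Module k V]
    [Module.Finite k V] [AddCommGroup W] [Module k W] [Module.Finite k W] (e : V ≃ₗ[k] W)
    (B : Module.End k V) : liftTrace θ (e.conj B) = liftTrace θ B := by
  rw [liftTrace, LinearEquiv.charpoly_conj]
  rfl

variable {V : Type w} [AddCommGroup V] [Module k V] [Module.Finite k V]

theorem finrank_eigenspace_eq {N : ℕ} (hN : (N : k) ≠ 0) {B : Module.End k V} (hB : B ^ N = 1)
    (c : k) : Module.finrank k (B.eigenspace c) = B.charpoly.rootMultiplicity c := by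
  have h1 : B.IsSemisimple := by
    refine Module.End.isSemisimple_of_squarefree_aeval_eq_zero (p := Polynomial.X ^ N - 1)
      (Polynomial.X_pow_sub_one_separable_iff.2 hN).squarefree ?_
    simp [hB]
  rw [← LinearMap.finrank_maxGenEigenspace_eq,
    (Module.End.isFinitelySemisimple_iff_isSemisimple.2 h1).maxGenEigenspace_eq_eigenspace]

theorem liftTrace_eq_sum {N : ℕ} [NeZero N] (hN : (N : k) ≠ 0) {B : Module.End k V}
    (hB : B ^ N = 1) : liftTrace θ B =
      ∑ ζ : rootsOfUnity N k, θ.onRoots N ζ * Module.finrank k (B.eigenspace (rootsVal k N ζ)) := by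
  classical
  rw [liftTrace, Finset.sum_multiset_map_count]
  have h1 : B.charpoly.roots.toFinset ⊆ Finset.univ.map ⟨_, rootsVal_injective (k := k) N⟩ := by
    intro c hc
    rw [Multiset.mem_toFinset, Polynomial.mem_roots (LinearMap.charpoly_monic _).ne_zero,
      ← Module.End.hasEigenvalue_iff_isRoot_charpoly] at hc
    obtain ⟨v, hv⟩ := hc.exists_hasEigenvector
    have h2 := hv.pow_apply N
    rw [hB, Module.End.one_apply] at h2
    have h3 : c ^ N = 1 := by
      have : (c ^ N - 1) • v = 0 := by rw [sub_smul, one_smul, ← h2, sub_self]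
      exact sub_eq_zero.1 ((smul_eq_zero.1 this).resolve_right hv.2)
    exact Finset.mem_map.2 ⟨rootsOfUnity.mkOfPowEq c h3, Finset.mem_univ _, rfl⟩
  rw [Finset.sum_subset h1, Finset.sum_map]
  · refine Finset.sum_congr rfl fun ζ _ => ?_
    rw [finrank_eigenspace_eq hN hB, Polynomial.count_roots, nsmul_eq_mul, mul_comm]
    congr 1
    exact θ.lift_root N ζ
  · intro c _ hc
    rw [Multiset.mem_toFinset] at hc
    rw [Multiset.count_eq_zero_of_notMem hc, zero_smul]

theorem liftTrace_smul {N : ℕ} [NeZero N] (hN : (N : k) ≠ 0) {B : Module.End k V} (hB : B ^ N = 1)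
    (ζ : rootsOfUnity N k) :
    liftTrace θ (rootsVal k N ζ • B) = θ.onRoots N ζ * liftTrace θ B := by
  rw [liftTrace_eq_sum θ hN hB, liftTrace_eq_sum θ hN (B := rootsVal k N ζ • B)
    (by rw [smul_pow, rootsVal_pow, hB, one_smul]), Finset.mul_sum,
    ← Equiv.sum_comp (Equiv.mulLeft ζ)]
  refine Finset.sum_congr rfl fun ξ _ => ?_
  have h0 : rootsVal k N ζ ≠ 0 := (ζ : kˣ).ne_zero
  have h1 : (rootsVal k N ζ • B).eigenspace (rootsVal k N (ζ * ξ)) =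
      B.eigenspace (rootsVal k N ξ) := by
    ext v
    rw [Module.End.mem_eigenspace_iff, Module.End.mem_eigenspace_iff, LinearMap.smul_apply, map_mul,
      mul_smul]
    exact ⟨fun h => smul_right_injective _ h0 h, fun h => by rw [h]⟩
  rw [Equiv.coe_mulLeft, h1, map_mul, mul_assoc]

/-- Additivity of the lifted trace. -/
theorem liftTrace_eq_sum_of_decomposition {N : ℕ} [NeZero N] (hN : (N : k) ≠ 0) {ι : Type*}
    [Fintype ι] {W : ι → Type w'} [∀ i, AddCommGroup (W i)] [∀ i, Module k (W i)]
    [∀ i, Module.Finite k (W i)] (j : ∀ i, W i →ₗ[k] V) (q : ∀ i, V →ₗ[k] W i)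
    (hqj : ∀ i x, q i (j i x) = x) (hqj' : ∀ i l x, i ≠ l → q i (j l x) = 0)
    (hjq : ∀ v, ∑ i, j i (q i v) = v) (B : Module.End k V) (C : ∀ i, Module.End k (W i))
    (hC : ∀ i, C i ^ N = 1) (hBC : ∀ i x, B (j i x) = j i (C i x)) :
    liftTrace θ B = ∑ i, liftTrace θ (C i) := by
  classical
  have hqB : ∀ i v, q i (B v) = C i (q i v) := by
    intro i v
    conv_lhs => rw [← hjq v, map_sum, map_sum]
    rw [Finset.sum_eq_single i]
    · rw [hBC, hqj]
    · intro l _ hl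
      rw [hBC, hqj' _ _ _ hl.symm]
    · simp
  have hpow : ∀ (n : ℕ) i x, (B ^ n) (j i x) = j i ((C i ^ n) x) := by
    intro n i x
    induction n with
    | zero => simp
    | succ n ih => rw [pow_succ', Module.End.mul_apply, ih, hBC, pow_succ', Module.End.mul_apply]
  have hB : B ^ N = 1 := by
    refine LinearMap.ext fun v => ?_
    rw [← hjq v, map_sum]
    simp only [hpow, hC]
    simp
  rw [liftTrace_eq_sum θ hN hB]
  simp only [fun i => liftTrace_eq_sum θ hN (hC i)]
  rw [Finset.sum_comm]
  refine Finset.sum_congr rfl fun ζ _ => ?_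
  rw [← Finset.mul_sum, ← Nat.cast_sum]
  congr 2
  let E : B.eigenspace (rootsVal k N ζ) ≃ₗ[k] ∀ i, (C i).eigenspace (rootsVal k N ζ) :=
    { toFun := fun v i => ⟨q i v, by
        rw [Module.End.mem_eigenspace_iff, ← hqB, Module.End.mem_eigenspace_iff.1 v.2, map_smul]⟩
      map_add' := fun v w => funext fun i => Subtype.ext (map_add (q i) v.1 w.1)
      map_smul' := fun c v => funext fun i => Subtype.ext (map_smul (q i) c v.1)
      invFun := fun w => ⟨∑ i, j i (w i), by
        rw [Module.End.mem_eigenspace_iff, map_sum, Finset.smul_sum]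
        refine Finset.sum_congr rfl fun i _ => ?_
        rw [hBC, Module.End.mem_eigenspace_iff.1 (w i).2, map_smul]⟩
      left_inv := fun v => Subtype.ext (hjq v)
      right_inv := fun w => funext fun i => Subtype.ext (by
        change q i (∑ l, j l (w l)) = w i
        rw [map_sum, Finset.sum_eq_single i]
        · rw [hqj]
        · intro l _ hl
          rw [hqj' _ _ _ hl.symm]
        · simp) }
  rw [E.finrank_eq, Module.finrank_pi_fintype]

end LiftedTrace

section Permutation

variable {k : Type u} [Field k] {F : Type v} [Field F] (θ : BrauerLift k F) {Z : Type}

/-- The condition for a scalar to be an eigenvalue of the restriction of a permutation to the cycle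
of a point. -/
def CycleEigenvalue (c : Equiv.Perm Z) (z : Z) (η : k) : Prop := ∀ n, (c ^ n) z = z → η ^ n = 1

theorem CycleEigenvalue.pow_eq {c : Equiv.Perm Z} {z : Z} {η : k} (h : CycleEigenvalue c z η)
    {i j : ℕ} (hij : (c ^ i) z = (c ^ j) z) : η ^ i = η ^ j := by
  wlog hle : i ≤ j generalizing i j
  · exact (this hij.symm (le_of_not_ge hle)).symm
  obtain ⟨m, rfl⟩ := Nat.exists_eq_add_of_le hle
  rw [pow_add, Equiv.Perm.mul_apply] at hij
  rw [pow_add, h m ((c ^ i).injective hij).symm, mul_one]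

open Classical in
/-- The dimension of the eigenspaces of a permutation matrix. -/
theorem finrank_eigenspace_perm [Fintype Z] (c : Equiv.Perm Z) (η : k) :
    Module.finrank k (Module.End.eigenspace (LinearMap.funLeft k k c) η) =
      Fintype.card {ω : Quotient (Equiv.Perm.SameCycle.setoid c) //
        CycleEigenvalue c ω.out η} := by
  have hrep : ∀ z : Z, ∃ i : ℕ, (c ^ i) (Quotient.mk (Equiv.Perm.SameCycle.setoid c) z).out = z := by
    intro z
    have h : Equiv.Perm.SameCycle c (Quotient.mk (Equiv.Perm.SameCycle.setoid c) z).out z :=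
      Quotient.mk_out (s := Equiv.Perm.SameCycle.setoid c) z
    obtain ⟨i, -, hi⟩ := h.exists_pow_eq'
    exact ⟨i, hi⟩
  choose i hi using hrep
  have hmem : ∀ f : Z → k, f ∈ Module.End.eigenspace (LinearMap.funLeft k k c) η ↔
      ∀ z, f (c z) = η * f z := fun f => by
    rw [Module.End.mem_eigenspace_iff, funext_iff]
    rfl
  have hpow : ∀ f : Z → k, (∀ z, f (c z) = η * f z) → ∀ n z, f ((c ^ n) z) = η ^ n * f z := by
    intro f hf n z
    induction n with
    | zero => simp
    | succ n ih => rw [pow_succ', Equiv.Perm.mul_apply, hf, ih, pow_succ', mul_assoc]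
  have hq : ∀ z, Quotient.mk (Equiv.Perm.SameCycle.setoid c) (c z) = Quotient.mk (Equiv.Perm.SameCycle.setoid c) z := fun z =>
    Quotient.sound (Equiv.Perm.sameCycle_apply_left.2 (Equiv.Perm.SameCycle.refl c z))
  let E : Module.End.eigenspace (LinearMap.funLeft k k c) η ≃ₗ[k]
      ({ω : Quotient (Equiv.Perm.SameCycle.setoid c) // CycleEigenvalue c ω.out η} → k) :=
    { toFun := fun f ω => f.1 ω.1.out
      map_add' := fun f g => rfl
      map_smul' := fun r f => rfl
      invFun := fun g => ⟨fun z => if h : CycleEigenvalue c (Quotient.mk (Equiv.Perm.SameCycle.setoid c) z).out η then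
          η ^ i z * g ⟨_, h⟩ else 0, (hmem _).2 fun z => by
        simp only [hq]
        split_ifs with h
        · rw [← mul_assoc, ← pow_succ']
          congr 1
          have h1 := hi (c z)
          rw [hq] at h1
          refine h.pow_eq (h1.trans ?_)
          rw [pow_succ', Equiv.Perm.mul_apply, hi]
        · rw [mul_zero]⟩
      left_inv := fun f => Subtype.ext (funext fun z => by
        have hf := (hmem _).1 f.2
        change (if h : CycleEigenvalue c (Quotient.mk (Equiv.Perm.SameCycle.setoid c) z).out η then
          η ^ i z * f.1 (Quotient.mk (Equiv.Perm.SameCycle.setoid c) z).out else 0) = f.1 z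
        have h1 := hpow _ hf (i z) (Quotient.mk (Equiv.Perm.SameCycle.setoid c) z).out
        rw [hi] at h1
        rw [h1]
        split_ifs with h
        · rfl
        · rw [CycleEigenvalue] at h
          push Not at h
          obtain ⟨n, hn, hn1⟩ := h
          have h2 := hpow _ hf n (Quotient.mk (Equiv.Perm.SameCycle.setoid c) z).out
          rw [hn] at h2
          have h3 : (η ^ n - 1) * f.1 (Quotient.mk (Equiv.Perm.SameCycle.setoid c) z).out = 0 := by rw [sub_mul, ← h2, one_mul, sub_self]
          rw [(mul_eq_zero.1 h3).resolve_left (sub_ne_zero.2 hn1), mul_zero])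
      right_inv := fun g => funext fun ω => by
        have h1 : Quotient.mk (Equiv.Perm.SameCycle.setoid c) ω.1.out = ω.1 := Quotient.out_eq _
        have h2 := ω.2
        have h3 := hi ω.1.out
        change (if h : CycleEigenvalue c (Quotient.mk (Equiv.Perm.SameCycle.setoid c) ω.1.out).out η then
          η ^ i ω.1.out * g ⟨_, h⟩ else 0) = g ω
        rw [dif_pos (by rw [h1]; exact h2)]
        have h4 : η ^ i ω.1.out = 1 := h2 _ (by rw [h1] at h3; exact h3)
        rw [h4, one_mul]
        exact congrArg g (Subtype.ext h1) }
  rw [E.finrank_eq, Module.finrank_fintype_fun_eq_card]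

/-- The lifted trace of a permutation matrix is the number of fixed points. -/
theorem liftTrace_perm [Fintype Z] [DecidableEq Z] [IsAlgClosed k] {N : ℕ} [NeZero N] [NeZero (N : k)] {c : Equiv.Perm Z}
    (hc : c ^ N = 1) :
    liftTrace θ (LinearMap.funLeft k k c) = (Fintype.card {z // c z = z} : F) := by
  classical
  have hB : (LinearMap.funLeft k k c) ^ N = 1 := by
    have h : ∀ n : ℕ, ((LinearMap.funLeft k k c) ^ n : Module.End k (Z → k)) =
        LinearMap.funLeft k k ⇑(c ^ n) := by
      intro n
      induction n with
      | zero => rfl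
      | succ n ih => rw [pow_succ, ih, pow_succ']; rfl
    rw [h, hc]
    rfl
  rw [liftTrace_eq_sum θ (NeZero.ne _) hB]
  have h1 : ∀ ζ : rootsOfUnity N k, (Module.finrank k (Module.End.eigenspace
      (LinearMap.funLeft k k c) (rootsVal k N ζ)) : F) =
      ∑ ω : Quotient (Equiv.Perm.SameCycle.setoid c),
        if CycleEigenvalue c ω.out (rootsVal k N ζ) then 1 else 0 := by
    intro ζ
    rw [finrank_eigenspace_perm c,
      Fintype.card_subtype, Finset.sum_boole]
  simp only [h1, Finset.mul_sum]
  rw [Finset.sum_comm]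
  have key : ∀ z : Z, ∑ ζ : rootsOfUnity N k, θ.onRoots N ζ *
      (if CycleEigenvalue c z (rootsVal k N ζ) then (1 : F) else 0) = if c z = z then 1 else 0 := by
    intro z
    split_ifs with hz
    · rw [Finset.sum_eq_single 1]
      · rw [map_one, map_one, if_pos, one_mul]
        intro n _
        exact one_pow n
      · intro ζ _ hζ
        rw [if_neg, mul_zero]
        intro h
        have h2 := h 1 (by simpa using hz)
        rw [pow_one, ← map_one (rootsVal k N)] at h2
        exact hζ (rootsVal_injective N h2)
      · simp
    · obtain ⟨l, hl⟩ : ∃ l, l = Function.minimalPeriod c z := ⟨_, rfl⟩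
      have hper : ∀ n, (c ^ n) z = z ↔ l ∣ n := fun n => by
        rw [← Equiv.Perm.iterate_eq_pow, hl]
        exact Function.isPeriodicPt_iff_minimalPeriod_dvd
      have hlN : l ∣ N := (hper N).1 (by rw [hc]; rfl)
      obtain ⟨r, hr⟩ := hlN
      have hl1 : l ≠ 1 := fun h => hz (by simpa [h] using (hper 1).2 (by rw [h]))
      have hr0 : 0 < r := Nat.pos_of_ne_zero fun h => NeZero.ne N (by rw [hr, h, mul_zero])
      have hnr : ¬ N ∣ r := fun h => by
        have h2 := Nat.le_of_dvd hr0 h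
        have h3 : 0 < l := Nat.pos_of_ne_zero fun h => NeZero.ne N (by rw [hr, h, zero_mul])
        have h4 : 2 ≤ l := by omega
        nlinarith
      obtain ⟨ζ₀, hζ₀⟩ := exists_root_pow_ne_one (k := k) N hnr
      have hgood : CycleEigenvalue c z (rootsVal k N (ζ₀ ^ r)) := by
        intro n hn
        obtain ⟨q, rfl⟩ := (hper n).1 hn
        rw [map_pow, ← pow_mul, ← mul_assoc, mul_comm r l, ← hr, pow_mul, rootsVal_pow, one_pow]
      have hshift : ∀ ζ, CycleEigenvalue c z (rootsVal k N (ζ₀ ^ r * ζ)) ↔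
          CycleEigenvalue c z (rootsVal k N ζ) := by
        intro ζ
        refine forall₂_congr fun n hn => ?_
        rw [map_mul, mul_pow, hgood n hn, one_mul]
      set s := ∑ ζ : rootsOfUnity N k, θ.onRoots N ζ *
        (if CycleEigenvalue c z (rootsVal k N ζ) then (1 : F) else 0) with hs
      have h3 : s = θ.onRoots N (ζ₀ ^ r) * s := by
        conv_lhs => rw [hs, ← Equiv.sum_comp (Equiv.mulLeft (ζ₀ ^ r))]
        rw [hs, Finset.mul_sum]
        refine Finset.sum_congr rfl fun ζ _ => ?_
        simp only [Equiv.coe_mulLeft, hshift]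
        rw [map_mul, mul_assoc]
      have h4 : (θ.onRoots N (ζ₀ ^ r) - 1) * s = 0 := by rw [sub_mul, ← h3, one_mul, sub_self]
      refine (mul_eq_zero.1 h4).resolve_left (sub_ne_zero.2 fun h5 => hζ₀ ?_)
      rw [← map_one (θ.onRoots N)] at h5
      exact θ.onRoots_injective N h5
  simp only [key]
  rw [Finset.sum_boole, Fintype.card_subtype]
  congr 1
  refine Finset.card_bij (fun ω _ => ω.out) (fun ω hω => ?_) (fun ω _ ω' _ h => Quotient.out_injective h)
    fun z hz => ?_
  · simpa using hω
  · refine ⟨Quotient.mk (Equiv.Perm.SameCycle.setoid c) z, ?_⟩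
    have hz' : c z = z := by simpa using hz
    have h2 : Equiv.Perm.SameCycle c (Quotient.mk (Equiv.Perm.SameCycle.setoid c) z).out z :=
      Quotient.mk_out (s := Equiv.Perm.SameCycle.setoid c) z
    obtain ⟨n, hn⟩ := h2.symm
    have h3 : (Quotient.mk (Equiv.Perm.SameCycle.setoid c) z).out = z :=
      hn.symm.trans (Function.IsFixedPt.perm_zpow (e := c) hz' n)
    exact ⟨by simpa [h3] using hz', h3⟩

end Permutation

section BrauerFunctor

variable {k : Type u} [Field k] {Γ : Type} [Group Γ] {V : Type w} {W : Type w'} [AddCommGroup V]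
  [Module k V] [AddCommGroup W] [Module k W] {ρ : Representation k Γ V} {σ : Representation k Γ W}
  (P : Subgroup Γ)

theorem brauerAction_pow_mk (t : Subgroup.normalizer (P : Set Γ)) (n : ℕ) (x : fixedPoints ρ P) :
    (brauerAction ρ P t ^ n) (Submodule.Quotient.mk x) =
      Submodule.Quotient.mk ⟨ρ ((t : Γ) ^ n) x,
        fixedPoints_map_normalizer ρ P (pow_mem t.2 n) x x.2⟩ := by
  induction n with
  | zero => simp
  | succ n ih =>
    rw [pow_succ', Module.End.mul_apply, ih]
    refine congrArg Submodule.Quotient.mk (Subtype.ext ?_)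
    change ρ t (ρ ((t : Γ) ^ n) x) = ρ ((t : Γ) ^ (n + 1)) x
    rw [pow_succ', map_mul, Module.End.mul_apply]

theorem brauerAction_pow_eq_one (t : Subgroup.normalizer (P : Set Γ)) {n : ℕ}
    (hn : (t : Γ) ^ n = 1) : brauerAction ρ P t ^ n = 1 := by
  refine LinearMap.ext fun x => ?_
  induction x using Submodule.Quotient.induction_on with | H x
  rw [brauerAction_pow_mk]
  refine congrArg Submodule.Quotient.mk (Subtype.ext ?_)
  change ρ ((t : Γ) ^ n) x = x
  rw [hn, map_one]
  rfl

theorem brauerFunctor_brauerAction (f : ρ.IntertwiningMap σ) (t : Subgroup.normalizer (P : Set Γ))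
    (x : BrauerQuotient ρ P) :
    brauerFunctor P f (brauerAction ρ P t x) = brauerAction σ P t (brauerFunctor P f x) := by
  induction x using Submodule.Quotient.induction_on with | H x
  exact congrArg Submodule.Quotient.mk (Subtype.ext (f.isIntertwining _ _ _ _))

theorem brauerValue_eq_liftTrace {F : Type v} [Field F] (θ : BrauerLift k F) [Module.Finite k V]
    (t : Subgroup.normalizer (P : Set Γ)) :
    brauerValue θ ρ P t = liftTrace θ (brauerAction ρ P t) := rfl

theorem BrauerLift.onRoots_inclusion {F : Type v} [Field F] (θ : BrauerLift k F) {n N : ℕ}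
    [NeZero n] [NeZero N] (h : rootsOfUnity n k ≤ rootsOfUnity N k) (ζ : rootsOfUnity n k) :
    θ.onRoots N (Subgroup.inclusion h ζ) = θ.onRoots n ζ := rfl

/-- The weighted sum of the Brauer characters of the summands of a decomposition, as a trace on the
Brauer quotient of the whole module. -/
theorem sum_brauerValue {F : Type v} [Field F] (θ : BrauerLift k F) [Module.Finite k V] {n : ℕ}
    [NeZero n] [NeZero (n : k)] {ι : Type*} [Fintype ι] {W : ι → Type w'} [∀ i, AddCommGroup (W i)]
    [∀ i, Module k (W i)] [∀ i, Module.Finite k (W i)] {σ : ∀ i, Representation k Γ (W i)}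
    (j : ∀ i, (σ i).IntertwiningMap ρ) (q : ∀ i, ρ.IntertwiningMap (σ i))
    (hqj : ∀ i x, q i (j i x) = x) (hqj' : ∀ i l x, i ≠ l → q i (j l x) = 0)
    (hjq : ∀ v, ∑ i, j i (q i v) = v) (z : ι → rootsOfUnity n k) (a : ρ.IntertwiningMap ρ)
    (ha : ∀ i x, a (j i x) = rootsVal k n (z i) • j i x) (t : Subgroup.normalizer (P : Set Γ))
    (ht : (orderOf (t : Γ) : k) ≠ 0) :
    ∑ i, θ.onRoots n (z i) * brauerValue θ (σ i) P t =
      liftTrace θ (brauerFunctor P a ∘ₗ brauerAction ρ P t) := by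
  have hn : (n : k) ≠ 0 := NeZero.ne _
  have ht' : orderOf (t : Γ) ≠ 0 := fun h => ht (by rw [h, Nat.cast_zero])
  let N := n * orderOf (t : Γ)
  have hN : NeZero N := ⟨mul_ne_zero (NeZero.ne n) ht'⟩
  have hNk : (N : k) ≠ 0 := by
    rw [Nat.cast_mul]
    exact mul_ne_zero hn ht
  have hle : rootsOfUnity n k ≤ rootsOfUnity N k := rootsOfUnity_le_of_dvd (dvd_mul_right _ _)
  have hpow : ∀ i, brauerAction (σ i) P t ^ N = 1 := fun i =>
    brauerAction_pow_eq_one P t (by rw [show N = orderOf (t : Γ) * n from mul_comm _ _, pow_mul, pow_orderOf_eq_one,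
      one_pow])
  rw [liftTrace_eq_sum_of_decomposition θ hNk (fun i => brauerFunctor P (j i))
    (fun i => brauerFunctor P (q i)) ?_ ?_ ?_ _
    (fun i => rootsVal k N (Subgroup.inclusion hle (z i)) • brauerAction (σ i) P t)]
  · refine Finset.sum_congr rfl fun i _ => ?_
    rw [liftTrace_smul θ hNk (hpow i), brauerValue_eq_liftTrace, θ.onRoots_inclusion]
  · intro i
    rw [smul_pow, rootsVal_pow, hpow, one_smul]
  · intro i x
    rw [LinearMap.comp_apply, ← brauerFunctor_brauerAction, LinearMap.smul_apply, map_smul]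
    generalize brauerAction (σ i) P t x = y
    induction y using Submodule.Quotient.induction_on with | H y
    exact congrArg Submodule.Quotient.mk (Subtype.ext (ha i _))
  · intro i x
    induction x using Submodule.Quotient.induction_on with | H x
    exact congrArg Submodule.Quotient.mk (Subtype.ext (hqj i _))
  · intro i l x hil
    induction x using Submodule.Quotient.induction_on with | H x
    refine (Submodule.Quotient.mk_eq_zero _).2 ?_
    change q i (j l x.1) ∈ traceSpace (σ i) P
    rw [hqj' i l _ hil]
    exact zero_mem _
  · intro x
    induction x using Submodule.Quotient.induction_on with | H x
    change ∑ i, ((traceSpace ρ P).submoduleOf (fixedPoints ρ P)).mkQ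
      ⟨j i (q i x.1), fixedPoints_map _ _ P _ _ (fixedPoints_map _ _ P _ _ x.2)⟩ = _
    rw [← map_sum]
    refine congrArg Submodule.Quotient.mk (Subtype.ext ?_)
    rw [AddSubmonoidClass.coe_finsetSum]
    exact hjq x.1

end BrauerFunctor

section PermutationModules

variable {k : Type u} [Field k] {p : ℕ} [Fact p.Prime] [CharP k p] {Γ : Type} [Group Γ] [Finite Γ]
  {X : Type} [Finite X] [MulAction Γ X] {P : Subgroup Γ}

/-- A function which is invariant under a `p`-group and vanishes at the fixed points is a sum of
relative traces from proper subgroups. -/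
theorem mem_traceSpace_of_vanish (f : X → k) (hf : f ∈ fixedPoints (funRep k Γ X) P)
    (hf0 : ∀ x, (∀ g ∈ P, g • x = x) → f x = 0) : f ∈ traceSpace (funRep k Γ X) P := by
  classical
  have := Fintype.ofFinite X
  have := Fintype.ofFinite Γ
  obtain ⟨n, hn⟩ : ∃ n, n = (Finset.univ.filter fun x => f x ≠ 0).card := ⟨_, rfl⟩
  induction n using Nat.strong_induction_on generalizing f with | h n ih
  by_cases h0 : f = 0
  · rw [h0]; exact zero_mem _
  obtain ⟨x, hx⟩ := Function.ne_iff.1 h0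
  have hinv : ∀ g ∈ P, ∀ y, f (g • y) = f y := fun g hg y => by
    have := congrFun ((mem_fixedPoints _ P f).1 hf g⁻¹ (inv_mem hg)) y
    rwa [funRep_apply, inv_inv] at this
  let R : Subgroup Γ := P ⊓ MulAction.stabilizer Γ x
  have hR : R < P := by
    refine lt_of_le_of_ne inf_le_left fun h => hx (hf0 x fun g hg => ?_)
    rw [← h] at hg
    exact hg.2
  let O : Finset X := Finset.univ.filter fun y => ∃ g ∈ P, g • x = y
  have hO : ∀ y, ∃ g : Γ, y ∈ O → g ∈ P ∧ g • x = y := fun y => by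
    by_cases h : y ∈ O
    · obtain ⟨g, hg⟩ := (Finset.mem_filter.1 h).2
      exact ⟨g, fun _ => hg⟩
    · exact ⟨1, fun h' => absurd h' h⟩
  choose τ hτ using hO
  have hτinj : Set.InjOn τ O := fun y hy y' hy' h => by
    rw [← (hτ y hy).2, ← (hτ y' hy').2, h]
  have hT : IsTransversal (O.image τ) R P := by
    refine ⟨?_, ?_, ?_⟩
    · rintro ⟨s, r⟩ ⟨hs, hr⟩
      obtain ⟨y, hy, rfl⟩ := Finset.mem_image.1 hs
      exact mul_mem (hτ y hy).1 hr.1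
    · rintro ⟨s, r⟩ ⟨hs, hr⟩ ⟨s', r'⟩ ⟨hs', hr'⟩ h
      obtain ⟨y, hy, rfl⟩ := Finset.mem_image.1 hs
      obtain ⟨y', hy', rfl⟩ := Finset.mem_image.1 hs'
      have h' : τ y * r = τ y' * r' := h
      have h1 : y = y' := by
        have := congrArg (· • x) h'
        simp only [mul_smul] at this
        rw [MulAction.mem_stabilizer_iff.1 hr.2, MulAction.mem_stabilizer_iff.1 hr'.2,
          (hτ y hy).2, (hτ y' hy').2] at this
        exact this
      subst h1
      exact Prod.ext rfl (mul_left_cancel h')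
    · intro g hg
      have hy : g • x ∈ O := Finset.mem_filter.2 ⟨Finset.mem_univ _, g, hg, rfl⟩
      refine ⟨(τ (g • x), (τ (g • x))⁻¹ * g), ⟨Finset.mem_image_of_mem _ hy, ?_, ?_⟩, by simp⟩
      · exact P.mul_mem (P.inv_mem (hτ _ hy).1) hg
      · change (τ (g • x))⁻¹ * g ∈ MulAction.stabilizer Γ x
        rw [MulAction.mem_stabilizer_iff, mul_smul, inv_smul_eq_iff, (hτ _ hy).2]
  let g : X → k := ∑ s ∈ O.image τ, funRep k Γ X s (Pi.single x (f x))
  have hg : g ∈ traceSpace (funRep k Γ X) P := by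
    refine Submodule.subset_span ⟨R, hR, _, hT, Pi.single x (f x), ?_, rfl⟩
    rw [mem_fixedPoints]
    intro r hr
    rw [funRep_single, MulAction.mem_stabilizer_iff.1 hr.2]
  have hg' : ∀ y, g y = if y ∈ O then f y else 0 := by
    intro y
    simp only [g]
    rw [Finset.sum_image hτinj, Finset.sum_apply]
    simp only [funRep_single]
    split_ifs with hy
    · rw [Finset.sum_eq_single y]
      · rw [(hτ y hy).2, Pi.single_eq_same, ← (hτ y hy).2, hinv _ (hτ y hy).1]
      · intro y' hy' h
        rw [(hτ y' hy').2, Pi.single_eq_of_ne h.symm]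
      · exact fun h => absurd hy h
    · refine Finset.sum_eq_zero fun y' hy' => ?_
      rw [(hτ y' hy').2, Pi.single_eq_of_ne]
      rintro rfl
      exact hy hy'
  have hxO : x ∈ O := Finset.mem_filter.2 ⟨Finset.mem_univ _, 1, one_mem P, one_smul _ _⟩
  have h1 : f - g ∈ traceSpace (funRep k Γ X) P := by
    refine ih _ ?_ (f - g) ?_ ?_ rfl
    · rw [hn]
      refine Finset.card_lt_card ⟨?_, ?_⟩
      · intro y hy
        rw [Finset.mem_filter] at hy ⊢
        refine ⟨Finset.mem_univ _, fun h => hy.2 ?_⟩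
        rw [Pi.sub_apply, hg', h]
        simp
      · intro h
        have := h (Finset.mem_filter.2 ⟨Finset.mem_univ x, hx⟩)
        rw [Finset.mem_filter, Pi.sub_apply, hg', if_pos hxO] at this
        exact this.2 (sub_self _)
    · rw [mem_fixedPoints]
      intro s hs
      ext y
      have hmem : s⁻¹ • y ∈ O ↔ y ∈ O := by
        simp only [O, Finset.mem_filter, Finset.mem_univ, true_and]
        constructor
        · rintro ⟨r, hr, h⟩
          exact ⟨s * r, mul_mem hs hr, by rw [mul_smul, h, smul_inv_smul]⟩
        · rintro ⟨r, hr, h⟩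
          exact ⟨s⁻¹ * r, mul_mem (inv_mem hs) hr, by rw [mul_smul, h]⟩
      rw [funRep_apply, Pi.sub_apply, Pi.sub_apply, hg', hg', hinv _ (inv_mem hs)]
      simp only [hmem]
    · intro y hy
      rw [Pi.sub_apply, hg', hf0 y hy]
      simp
  rw [← sub_add_cancel f g]
  exact add_mem h1 hg

theorem IsTransversal.dvd_card {T : Finset Γ} {R P : Subgroup Γ} (hP : IsPGroup p P) (hR : R < P)
    (hT : IsTransversal T R P) : p ∣ T.card := by
  have h1 : T.card * Nat.card R = Nat.card P := by
    have h2 := hT.image_eq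
    have h3 := hT.injOn.ncard_image
    rw [h2, Set.ncard_prod, Set.ncard_coe_finset] at h3
    exact h3.symm
  obtain ⟨n, hn⟩ := IsPGroup.iff_card.1 hP
  obtain ⟨i, -, hi⟩ := (Nat.dvd_prime_pow (Fact.out : p.Prime)).1 (hn ▸ h1 ▸ dvd_mul_right T.card _)
  rw [hi]
  refine dvd_pow_self p fun h0 => ?_
  rw [h0, pow_zero] at hi
  rw [hi, one_mul] at h1
  exact hR.ne (Subgroup.eq_of_le_of_card_ge hR.le h1.ge)

theorem vanish_of_mem_traceSpace (hP : IsPGroup p P) (f : X → k)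
    (hf : f ∈ traceSpace (funRep k Γ X) P) (x : X) (hx : ∀ g ∈ P, g • x = x) : f x = 0 := by
  change f ∈ LinearMap.ker (LinearMap.proj x : (X → k) →ₗ[k] k)
  revert f
  change traceSpace (funRep k Γ X) P ≤ _
  refine Submodule.span_le.2 ?_
  rintro _ ⟨R, hR, T, hT, f, hf, rfl⟩
  rw [SetLike.mem_coe, LinearMap.mem_ker, LinearMap.proj_apply, Finset.sum_apply]
  have h1 : ∀ s ∈ T, funRep k Γ X s f x = f x := by
    intro s hs
    have hsP : s ∈ P := by
      have := hT.mapsTo (x := (s, 1)) ⟨hs, one_mem R⟩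
      simpa using this
    rw [funRep_apply, hx _ (inv_mem hsP)]
  rw [Finset.sum_congr rfl h1, Finset.sum_const, nsmul_eq_mul,
    (CharP.cast_eq_zero_iff k p _).2 (hT.dvd_card hP hR), zero_mul]

/-- The Brauer quotient of a permutation module is the permutation module of the fixed points. -/
def brauerFunRepEquiv (hP : IsPGroup p P) :
    BrauerQuotient (funRep k Γ X) P ≃ₗ[k] ({x : X // ∀ g ∈ P, g • x = x} → k) := by
  classical
  refine (Submodule.quotEquivOfEq _ _ ?_).trans (LinearMap.quotKerEquivOfSurjective
    (LinearMap.funLeft k k Subtype.val ∘ₗ (fixedPoints (funRep k Γ X) P).subtype) ?_)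
  · ext f
    rw [LinearMap.mem_ker]
    change (f : X → k) ∈ traceSpace (funRep k Γ X) P ↔ _
    constructor
    · intro h
      ext x
      exact vanish_of_mem_traceSpace hP _ h x.1 x.2
    · intro h
      exact mem_traceSpace_of_vanish _ f.2 fun x hx => congrFun h ⟨x, hx⟩
  · intro f
    refine ⟨⟨fun x => if h : ∀ g ∈ P, g • x = x then f ⟨x, h⟩ else 0, ?_⟩, ?_⟩
    · rw [mem_fixedPoints]
      intro s hs
      ext x
      rw [funRep_apply]
      by_cases h : ∀ g ∈ P, g • x = x
      · have h1 : s⁻¹ • x = x := h _ (inv_mem hs)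
        simp only [h1]
      · rw [dif_neg h, dif_neg]
        intro h'
        refine h fun g hg => ?_
        have h2 : x = s⁻¹ • x := by
          have := h' s hs
          rwa [smul_inv_smul] at this
        rw [h2]
        exact h' g hg
    · ext x
      exact dif_pos x.2

variable {n : ℕ}

/-- The automorphism of the permutation module given by an automorphism of a `Γ`-set. -/
def SetAut.intertwining (k : Type u) [Field k] (a : SetAut Γ X n) :
    (funRep k Γ X).IntertwiningMap (funRep k Γ X) :=
  ⟨LinearMap.funLeft k k a.perm, fun g => by
    ext f x
    exact congrArg f (a.smul g⁻¹ x).symm⟩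

open Classical in
/-- The trace on the Brauer quotient of a permutation module. -/
theorem liftTrace_funRep [IsAlgClosed k] [Fintype X] {F : Type v} [Field F] (θ : BrauerLift k F)
    [NeZero n] [NeZero (n : k)] (a : SetAut Γ X n) (hP : IsPGroup p P)
    (t : Subgroup.normalizer (P : Set Γ)) (ht : (orderOf (t : Γ) : k) ≠ 0) :
    liftTrace θ (brauerFunctor P (a.intertwining k) ∘ₗ brauerAction (funRep k Γ X) P t) =
      (Fintype.card {x : X // (∀ g ∈ P, g • x = x) ∧ (t : Γ) • x = a.perm x} : F) := by
  let Z := {x : X // ∀ g ∈ P, g • x = x}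
  have hstab : ∀ s ∈ Subgroup.normalizer (P : Set Γ), ∀ x : X, (∀ g ∈ P, g • x = x) →
      ∀ g ∈ P, g • s • x = s • x := by
    intro s hs x hx g hg
    have h1 := (Subgroup.mem_normalizer_iff''.1 hs g).1 hg
    have h2 := hx _ h1
    rw [mul_smul, mul_smul, inv_smul_eq_iff] at h2
    exact h2
  have haP : ∀ x : X, (∀ g ∈ P, g • x = x) → ∀ g ∈ P, g • a.perm x = a.perm x := by
    intro x hx g hg
    rw [← a.smul, hx g hg]
  let c₀ : Equiv.Perm X := (MulAction.toPerm (t : Γ)⁻¹) * a.perm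
  have hc0 : Commute (MulAction.toPerm (t : Γ)⁻¹) a.perm := by
    ext x
    exact (a.smul _ _).symm
  have hcP : ∀ x : X, (∀ g ∈ P, g • x = x) ↔ (∀ g ∈ P, g • c₀ x = c₀ x) := by
    intro x
    constructor
    · intro hx
      exact hstab _ (inv_mem t.2) _ (haP x hx)
    · intro hx g hg
      have h1 := hstab _ t.2 _ hx g hg
      have h2 : (t : Γ) • c₀ x = a.perm x := smul_inv_smul _ _
      rw [h2, ← a.smul] at h1
      exact a.perm.injective h1
  let c : Equiv.Perm Z := c₀.subtypePerm fun x => (hcP x).symm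
  let N := n * orderOf (t : Γ)
  have hN : NeZero N := ⟨mul_ne_zero (NeZero.ne n) fun h => ht (by rw [h, Nat.cast_zero])⟩
  have hNk : NeZero (N : k) := ⟨by
    rw [Nat.cast_mul]
    exact mul_ne_zero (NeZero.ne _) ht⟩
  have hc : c ^ N = 1 := by
    have h1 : c₀ ^ N = 1 := by
      rw [hc0.mul_pow]
      have h2 : a.perm ^ N = 1 := by rw [pow_mul, a.pow_eq, one_pow]
      have h3 : (MulAction.toPerm (t : Γ)⁻¹ : Equiv.Perm X) ^ N = 1 := by
        have h4 : (MulAction.toPerm (t : Γ)⁻¹ : Equiv.Perm X) = MulAction.toPermHom Γ X (t : Γ)⁻¹ := rfl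
        rw [h4, ← map_pow, show N = orderOf (t : Γ) * n from mul_comm _ _, pow_mul, inv_pow, pow_orderOf_eq_one, inv_one, one_pow, map_one]
      rw [h2, h3, one_mul]
    rw [Equiv.Perm.subtypePerm_pow]
    ext x
    exact congrArg (fun q : Equiv.Perm X => q x) h1
  rw [← liftTrace_conj θ (brauerFunRepEquiv hP)]
  have h1 : (brauerFunRepEquiv (k := k) (X := X) hP).conj (brauerFunctor P (a.intertwining k) ∘ₗ
      brauerAction (funRep k Γ X) P t) = LinearMap.funLeft k k c := by
    refine LinearMap.ext fun f => ?_
    obtain ⟨y, rfl⟩ := (brauerFunRepEquiv (k := k) (X := X) hP).surjective f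
    rw [LinearEquiv.conj_apply_apply, LinearEquiv.symm_apply_apply]
    induction y using Submodule.Quotient.induction_on with | H y
    rfl
  rw [h1, liftTrace_perm θ hc]
  congr 1
  refine Fintype.card_congr ((Equiv.subtypeSubtypeEquivSubtypeInter _ _).symm.trans
    (Equiv.subtypeEquivRight fun x => ?_)).symm
  rw [Subtype.ext_iff]
  change _ ↔ (t : Γ)⁻¹ • a.perm x = x
  rw [inv_smul_eq_iff, eq_comm]

end PermutationModules

section ClassSums

variable {k : Type u} [Field k] {Γ : Type} [Group Γ]

/-- The product of a family of representations. -/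
def piRep {ι : Type*} {W : ι → Type w'} [∀ i, AddCommGroup (W i)] [∀ i, Module k (W i)]
    (σ : ∀ i, Representation k Γ (W i)) : Representation k Γ (∀ i, W i) where
  toFun g := LinearMap.pi fun i => σ i g ∘ₗ LinearMap.proj i
  map_one' := by
    refine LinearMap.ext fun x => funext fun i => ?_
    simp
  map_mul' g h := by
    refine LinearMap.ext fun x => funext fun i => ?_
    simp

theorem cls_piRep {n : ℕ} {W : Fin n → Type w'} [∀ i, AddCommGroup (W i)] [∀ i, Module k (W i)]
    [∀ i, Module.Finite k (W i)] (σ : ∀ i, Representation k Γ (W i)) :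
    cls (piRep σ) = ∑ i, cls (σ i) := by
  induction n with
  | zero => exact (cls_eq_zero _).trans (by simp)
  | succ n ih =>
    rw [Fin.sum_univ_succ, ← ih, cls_add]
    refine (cls_eq_iff _ _).2 ⟨.mk
      { toFun := fun x => (x 0, fun i => x i.succ)
        map_add' := fun x y => rfl
        map_smul' := fun c x => rfl
        invFun := fun x => Fin.cons x.1 x.2
        left_inv := fun x => Fin.cons_self_tail x
        right_inv := fun x => by simp } fun g => rfl⟩

/-- The class of a module is the sum of the classes of the summands of a decomposition. -/
theorem cls_eq_sum {V : Type w} [AddCommGroup V] [Module k V] [Module.Finite k V]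
    {ρ : Representation k Γ V} {ι : Type*} [Fintype ι] {W : ι → Type w'} [∀ i, AddCommGroup (W i)]
    [∀ i, Module k (W i)] [∀ i, Module.Finite k (W i)] {σ : ∀ i, Representation k Γ (W i)}
    (j : ∀ i, (σ i).IntertwiningMap ρ) (q : ∀ i, ρ.IntertwiningMap (σ i))
    (hqj : ∀ i x, q i (j i x) = x) (hqj' : ∀ i l x, i ≠ l → q i (j l x) = 0)
    (hjq : ∀ v, ∑ i, j i (q i v) = v) : cls ρ = ∑ i, cls (σ i) := by
  classical
  let e := Fintype.equivFin ι
  rw [← Equiv.sum_comp e.symm, ← cls_piRep]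
  refine (cls_eq_iff _ _).2 ⟨.mk
    { toFun := fun v i => q (e.symm i) v
      map_add' := fun v w => funext fun i => map_add _ _ _
      map_smul' := fun c v => funext fun i => map_smul _ _ _
      invFun := fun w => ∑ i, j (e.symm i) (w i)
      left_inv := fun v => (Equiv.sum_comp e.symm fun i => j i (q i v)).trans (hjq v)
      right_inv := fun w => funext fun i => by
        beta_reduce
        rw [map_sum, Finset.sum_eq_single i]
        · rw [hqj]
        · intro l _ hl
          rw [hqj']
          exact fun h => hl (e.symm.injective h).symm
        · simp } fun g => ?_⟩
  refine LinearMap.ext fun v => funext fun i => ?_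
  exact (q (e.symm i)).isIntertwining _ _ _ _

theorem gcls_sum {F : Type v} [Field F] {M : Type w} [AddCommMonoid M] {ι : Type*} (s : Finset ι)
    (f : ι → M) : gcls F (∑ i ∈ s, f i) = ∑ i ∈ s, gcls F (f i) :=
  map_sum (⟨⟨gcls F, gcls_zero⟩, gcls_add⟩ : M →+ LinGroth F M) f s

end ClassSums

section Twist

variable {k : Type u} [Field k] {Γ : Type} [Group Γ] {X : Type} [MulAction Γ X] {n : ℕ}

namespace SetAut

/-- Powers of automorphisms. -/
def pow (a : SetAut Γ X n) (j : ℕ) : SetAut Γ X n :=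
  ⟨a.perm ^ j, fun g x => a.pow_smul j g x, by rw [← pow_mul, mul_comm, pow_mul, a.pow_eq, one_pow]⟩

/-- An isomorphism of `Γ`-sets with automorphisms induces isomorphisms of eigenspaces. -/
def eigEquiv {Y : Type} [MulAction Γ Y] {m : ℕ} (a : SetAut Γ X n) (b : SetAut Γ Y m) (e : X ≃ Y)
    (he : ∀ (g : Γ) x, e (g • x) = g • e x) (hab : ∀ x, e (a.perm x) = b.perm (e x)) (c : k) :
    (b.eigRep k c).Equiv (a.eigRep k c) :=
  .mk
    { toFun := fun f => ⟨fun x => (f : Y → k) (e x), fun x => by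
        beta_reduce
        rw [hab]
        exact f.2 _⟩
      map_add' := fun _ _ => rfl
      map_smul' := fun _ _ => rfl
      invFun := fun f => ⟨fun y => (f : X → k) (e.symm y), fun y => by
        have h := f.2 (e.symm y)
        beta_reduce
        rw [← h]
        refine congrArg (f : X → k) ?_
        rw [e.symm_apply_eq, hab, e.apply_symm_apply]⟩
      left_inv := fun f => Subtype.ext (funext fun y => by simp)
      right_inv := fun f => Subtype.ext (funext fun x => by simp) } fun g => by
    refine LinearMap.ext fun f => Subtype.ext (funext fun x => ?_)
    exact congrArg (f : Y → k) (he g⁻¹ x).symm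

variable [Finite X] [Finite Γ] [IsAlgClosed k] [NeZero n] [NeZero (n : k)]

theorem sum_eigIncl_eigProj (a : SetAut Γ X n) (f : X → k) :
    ∑ ζ : rootsOfUnity n k, a.eigIncl k _ (a.eigProj k ζ f) = f := a.sum_eigProj k f

theorem eigProj_eigIncl (a : SetAut Γ X n) (ζ : rootsOfUnity n k)
    (f : a.eig k (rootsVal k n ζ)) : a.eigProj k ζ (a.eigIncl k _ f) = f :=
  Subtype.ext ((a.eigProj_of_mem k ζ ζ f).trans (if_pos rfl))

theorem eigProj_eigIncl_of_ne (a : SetAut Γ X n) {ζ ξ : rootsOfUnity n k} (h : ζ ≠ ξ)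
    (f : a.eig k (rootsVal k n ξ)) : a.eigProj k ζ (a.eigIncl k _ f) = 0 :=
  Subtype.ext ((a.eigProj_of_mem k ζ ξ f).trans (if_neg h))

variable (k) in
/-- The class of an eigenspace. -/
def eigClass (a : SetAut Γ X n) (ζ : rootsOfUnity n k) : ppermClasses k Γ :=
  ⟨cls (a.eigRep k (rootsVal k n ζ)), (cls_mem_ppermClasses _).2 (a.isPPermutation_eigRep k ζ)⟩

variable {F : Type v} [Field F] (θ : BrauerLift k F)

/-- The class of the permutation module of a `Γ`-set, twisted by a power of an automorphism `a`: the
combination of the classes of the eigenspaces of `a`, weighted by the (lifted) eigenvalues. -/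
def twist (a : SetAut Γ X n) (j : ℕ) : PPermGroup k F Γ :=
  ∑ ζ : rootsOfUnity n k, θ.onRoots n ζ ^ j • gcls F (a.eigClass k ζ)

theorem gcls_eigClass [CharZero F] (a : SetAut Γ X n) (ζ : rootsOfUnity n k) :
    gcls F (a.eigClass k ζ) =
      (n : F)⁻¹ • ∑ j ∈ Finset.range n, θ.onRoots n ζ⁻¹ ^ j • a.twist θ j := by
  classical
  have hn : (n : F) ≠ 0 := Nat.cast_ne_zero.2 (NeZero.ne n)
  simp only [twist, Finset.smul_sum, smul_smul]
  rw [Finset.sum_comm, Finset.sum_eq_single ζ]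
  · rw [← Finset.sum_smul]
    have h1 : ∀ j, (n : F)⁻¹ * (θ.onRoots n ζ⁻¹ ^ j * θ.onRoots n ζ ^ j) = (n : F)⁻¹ := fun j => by
      rw [← mul_pow, ← map_mul, inv_mul_cancel, map_one, one_pow, mul_one]
    rw [Finset.sum_congr rfl fun j _ => h1 j, Finset.sum_const, Finset.card_range, nsmul_eq_mul,
      mul_inv_cancel₀ hn, one_smul]
  · intro ξ _ hξ
    rw [← Finset.sum_smul]
    have h1 : ∀ j, (n : F)⁻¹ * (θ.onRoots n ζ⁻¹ ^ j * θ.onRoots n ξ ^ j) =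
        (n : F)⁻¹ * θ.onRoots n (ζ⁻¹ * ξ) ^ j := fun j => by
      rw [← mul_pow, ← map_mul]
    simp only [h1]
    rw [← Finset.mul_sum]
    have h2 : θ.onRoots n (ζ⁻¹ * ξ) ≠ 1 := by
      intro h3
      rw [← map_one (θ.onRoots n)] at h3
      exact hξ (inv_mul_eq_one.1 (θ.onRoots_injective n h3)).symm
    have h3 := geom_sum_mul (θ.onRoots n (ζ⁻¹ * ξ)) n
    rw [← map_pow, show (ζ⁻¹ * ξ) ^ n = 1 from Subtype.ext (ζ⁻¹ * ξ).2, map_one, sub_self] at h3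
    rw [(mul_eq_zero.1 h3).resolve_right (sub_ne_zero.2 h2), mul_zero, zero_smul]
  · simp

/-- A class twisted by a power of an automorphism. -/
theorem twist_pow (a : SetAut Γ X n) (j : ℕ) : (a.pow j).twist θ 1 = a.twist θ j := by
  classical
  have key : ∀ η : rootsOfUnity n k, (a.pow j).eigClass k η =
      ∑ ζ : {ζ : rootsOfUnity n k // ζ ^ j = η}, a.eigClass k ζ.1 := by
    intro η
    refine Subtype.ext ?_
    rw [AddSubmonoid.coe_finsetSum]
    refine cls_eq_sum (W := fun ζ : {ζ : rootsOfUnity n k // ζ ^ j = η} => a.eig k (rootsVal k n ζ.1))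
      (fun ζ => ⟨(a.eigIncl k _).toLinearMap.codRestrict _ fun f x => ?_, fun g => ?_⟩)
      (fun ζ => (a.eigProj k ζ.1).comp ((a.pow j).eigIncl k _)) ?_ ?_ ?_
    · have h1 := a.eig_pow f.2 j x
      rw [← map_pow, ζ.2] at h1
      exact h1
    · refine LinearMap.ext fun f => Subtype.ext ?_
      rfl
    · intro ζ f
      exact a.eigProj_eigIncl ζ.1 f
    · intro ζ ξ f h
      exact a.eigProj_eigIncl_of_ne (fun h' => h (Subtype.ext h')) f
    · intro f
      refine Subtype.ext ?_
      rw [AddSubmonoidClass.coe_finsetSum]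
      have h1 := a.sum_eigIncl_eigProj (k := k) (f : X → k)
      refine Eq.trans ?_ h1
      change ∑ ζ : {ζ : rootsOfUnity n k // ζ ^ j = η},
        (a.eigProj k ζ.1 (f : X → k) : X → k) = ∑ ζ, (a.eigProj k ζ (f : X → k) : X → k)
      rw [← Finset.sum_filter_of_ne (p := fun ζ => ζ ^ j = η)]
      · exact (Finset.sum_subtype (Finset.univ.filter fun ζ : rootsOfUnity n k => ζ ^ j = η)
          (fun ζ => by simp) fun ζ => (a.eigProj k ζ (f : X → k) : X → k)).symm
      · intro ζ _ h
        by_contra hζ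
        refine h (funext fun x => ?_)
        have h2 := a.eig_pow (a.eigProj k ζ (f : X → k)).2 j x
        have h3 : (a.eigProj k ζ (f : X → k) : X → k) ((a.perm ^ j) x) =
            rootsVal k n η * (a.eigProj k ζ (f : X → k) : X → k) x := by
          rw [eigProj_coe, eigProj_coe, mul_left_comm]
          congr 1
          rw [Finset.mul_sum]
          refine Finset.sum_congr rfl fun i _ => ?_
          have h4 := f.2 ((a.perm ^ i) x)
          rw [show (a.perm ^ i) ((a.perm ^ j) x) = (a.pow j).perm ((a.perm ^ i) x) by
            change _ = (a.perm ^ j) _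
            rw [← Equiv.Perm.mul_apply, ← Equiv.Perm.mul_apply, ← pow_add, ← pow_add, add_comm],
            h4, mul_left_comm]
        have h5 : (rootsVal k n ζ ^ j - rootsVal k n η) *
            (a.eigProj k ζ (f : X → k) : X → k) x = 0 := by
          rw [sub_mul, ← h2, ← h3, sub_self]
        refine (mul_eq_zero.1 h5).resolve_left (sub_ne_zero.2 fun h6 => hζ ?_)
        rw [← map_pow] at h6
        exact rootsVal_injective n h6
  have key2 : ∀ η : rootsOfUnity n k, gcls F ((a.pow j).eigClass k η) =
      ∑ ζ : rootsOfUnity n k with ζ ^ j = η, gcls F (a.eigClass k ζ) := fun η => by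
    rw [key, gcls_sum]
    exact (Finset.sum_subtype (Finset.univ.filter fun ζ : rootsOfUnity n k => ζ ^ j = η)
      (fun ζ => by simp) fun ζ => gcls F (a.eigClass k ζ)).symm
  rw [twist, twist]
  refine Eq.trans ?_ (Finset.sum_fiberwise Finset.univ (fun ζ : rootsOfUnity n k => ζ ^ j) _)
  refine Finset.sum_congr rfl fun η _ => ?_
  rw [key2, Finset.smul_sum]
  refine Finset.sum_congr rfl fun ζ hζ => ?_
  rw [pow_one, ← map_pow, (Finset.mem_filter.1 hζ).2]

end SetAut

end Twist

section TauTwist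

variable {k : Type u} [Field k] {F : Type v} [Field F] (θ : BrauerLift k F) {Γ : Type} [Group Γ]

theorem brauerValueHom_cls {V : Type w} [AddCommGroup V] [Module k V] [Module.Finite k V]
    (ρ : Representation k Γ V) (P : Subgroup Γ) (t : Subgroup.normalizer (P : Set Γ)) :
    brauerValueHom θ P t (cls ρ) = brauerValue θ ρ P t := by
  change Multiset.sum _ = Multiset.sum _
  rw [brauer_charpoly_congr _ _ (transportEquiv (Module.finBasis k V).equivFun ρ)]

variable [Finite Γ]

theorem tau_gcls (P : Subgroup Γ) (t : Subgroup.normalizer (P : Set Γ)) (x : ppermClasses k Γ) :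
    tau θ P t (gcls F x) = brauerValueHom θ P t x.1 :=
  extend_gcls _ _

open Classical in
/-- The value of `τ_{P, t}` on a twisted permutation module. -/
theorem tau_twist {p : ℕ} [Fact p.Prime] [CharP k p] [IsAlgClosed k] {X : Type} [MulAction Γ X]
    [Fintype X] {n : ℕ} [NeZero n] [NeZero (n : k)] (a : SetAut Γ X n) (j : ℕ) {P : Subgroup Γ}
    (hP : IsPGroup p P) (t : Subgroup.normalizer (P : Set Γ)) (ht : (orderOf (t : Γ)).Coprime p) :
    tau θ P t (a.twist θ j) =
      (Fintype.card {x : X // (∀ g ∈ P, g • x = x) ∧ (t : Γ) • x = (a.perm ^ j) x} : F) := by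
  have ht' : (orderOf (t : Γ) : k) ≠ 0 := by
    rw [Ne, CharP.cast_eq_zero_iff k p]
    exact fun h => (Fact.out : p.Prime).one_lt.ne' (Nat.Coprime.eq_one_of_dvd ht.symm h)
  refine Eq.trans ?_ (liftTrace_funRep θ (a.pow j) hP t ht')
  rw [SetAut.twist, map_sum, ← sum_brauerValue P θ (fun ζ => a.eigIncl k (rootsVal k n ζ)) (fun ζ => a.eigProj k ζ)
      a.eigProj_eigIncl (fun _ _ x h => a.eigProj_eigIncl_of_ne h x) a.sum_eigIncl_eigProj
      (fun ζ => ζ ^ j) ((a.pow j).intertwining k) _ t ht']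
  · refine Finset.sum_congr rfl fun ζ _ => ?_
    rw [map_smul, tau_gcls, map_pow, smul_eq_mul]
    exact congrArg _ (brauerValueHom_cls _ _ _ _)
  · intro ζ f
    ext x
    rw [map_pow]
    exact a.eig_pow f.2 j x

end TauTwist

section Conjugacy

/-- The twisted norms `c σ(c) ⋯ σ^(i - 1)(c)`. -/
def twNorm {Q : Type*} [Group Q] (σ : Q →* Q) (c : Q) : ℕ → Q
  | 0 => 1
  | i + 1 => c * σ (twNorm σ c i)

theorem exists_eq_mul_inv_of_comm {A : Type*} [G : Group A] [Finite A]
    (hA : ∀ x y : A, x * y = y * x) (σ : A →* A) {m : ℕ} (hm : (Nat.card A).Coprime m) {c : A}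
    (hc : twNorm σ c m = 1) : ∃ y, c = y * (σ y)⁻¹ := by
  let _ : CommGroup A := { G with mul_comm := hA }
  let z := ∏ i ∈ Finset.range m, twNorm σ c i
  have h1 : z * (σ z)⁻¹ = c ^ m := by
    have h2 : c ^ m * σ z = ∏ i ∈ Finset.range m, twNorm σ c (i + 1) := by
      simp only [z, map_prod, twNorm, Finset.prod_mul_distrib, Finset.prod_const, Finset.card_range]
    have h3 : ∏ i ∈ Finset.range m, twNorm σ c (i + 1) = z := by
      have h4 := Finset.prod_range_succ (twNorm σ c) m
      rw [Finset.prod_range_succ', hc, mul_one] at h4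
      simpa [twNorm] using h4
    rw [mul_inv_eq_iff_eq_mul]
    exact (h2.trans h3).symm
  obtain ⟨y, hy⟩ : ∃ y : A, y ^ m = z := (powCoprime hm).surjective z
  refine ⟨y, (powCoprime hm).injective ?_⟩
  simp only [powCoprime_apply]
  rw [mul_pow, inv_pow, ← map_pow, hy, h1]

theorem twNorm_map {Q R : Type*} [Group Q] [Group R] (σ : Q →* Q) (τ : R →* R) (f : Q →* R)
    (h : ∀ x, f (σ x) = τ (f x)) (c : Q) (i : ℕ) : f (twNorm σ c i) = twNorm τ (f c) i := by
  induction i with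
  | zero => exact map_one f
  | succ i ih => rw [twNorm, twNorm, map_mul, h, ih]

theorem twNorm_conj {Q : Type*} [Group Q] (σ : Q →* Q) (c x : Q) (i : ℕ) :
    twNorm σ (x⁻¹ * c * σ x) i = x⁻¹ * twNorm σ c i * (⇑σ)^[i] x := by
  induction i with
  | zero => simp [twNorm]
  | succ i ih =>
    rw [twNorm, ih, twNorm, map_mul, map_mul, map_inv, Function.iterate_succ_apply']
    group

theorem exists_eq_mul_inv_of_isPGroup {p : ℕ} [Fact p.Prime] {m : ℕ} (hm : m.Coprime p) :
    ∀ (N : ℕ) (Q : Type) [Group Q] [Finite Q], Nat.card Q = N → IsPGroup p Q → ∀ (σ : Q →* Q),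
      (∀ x, (⇑σ)^[m] x = x) → ∀ c : Q, twNorm σ c m = 1 → ∃ x, c = x * (σ x)⁻¹ := by
  intro N
  induction N using Nat.strong_induction_on with | h N ih
  intro Q _ _ hN hQ σ hσ c hc
  rcases subsingleton_or_nontrivial Q with h | h
  · exact ⟨1, Subsingleton.elim _ _⟩
  have hcop : ∀ H : Subgroup Q, (Nat.card H).Coprime m := fun H => by
    obtain ⟨n, hn⟩ := IsPGroup.iff_card.1 (hQ.to_subgroup H)
    rw [hn]
    exact (Nat.Coprime.pow_right n hm).symm
  have hm0 : m ≠ 0 := by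
    rintro rfl
    exact (Fact.out : p.Prime).one_lt.ne' (by simpa using hm)
  have hsurj : Function.Surjective σ := fun x => by
    obtain ⟨n, rfl⟩ := Nat.exists_eq_succ_of_ne_zero hm0
    exact ⟨_, by rw [← Function.iterate_succ_apply' (⇑σ)]; exact hσ x⟩
  let Z := Subgroup.center Q
  have hZ : ∀ z ∈ Z, σ z ∈ Z := fun z hz => by
    rw [Subgroup.mem_center_iff] at hz ⊢
    intro g
    obtain ⟨g, rfl⟩ := hsurj g
    rw [← map_mul, hz, map_mul]
  have hZ1 : 1 < Nat.card Z := by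
    have := hQ.center_nontrivial
    exact Finite.one_lt_card
  let τ : Q ⧸ Z →* Q ⧸ Z := QuotientGroup.map Z Z σ hZ
  have hτ : ∀ x : Q, τ (QuotientGroup.mk' Z x) = QuotientGroup.mk' Z (σ x) := fun x => rfl
  have hτm : ∀ (i : ℕ) (x : Q), (⇑τ)^[i] (QuotientGroup.mk' Z x) = QuotientGroup.mk' Z ((⇑σ)^[i] x) := by
    intro i x
    induction i with
    | zero => rfl
    | succ i ih => rw [Function.iterate_succ_apply', ih, hτ, ← Function.iterate_succ_apply' (⇑σ)]
  have hlt : Nat.card (Q ⧸ Z) < N := by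
    rw [← hN, Subgroup.card_eq_card_quotient_mul_card_subgroup Z]
    exact lt_mul_of_one_lt_right Nat.card_pos hZ1
  obtain ⟨y, hy⟩ := ih _ hlt (Q ⧸ Z) rfl (hQ.to_quotient Z) τ (fun y => by
    obtain ⟨x, rfl⟩ := QuotientGroup.mk'_surjective Z y
    rw [hτm, hσ]) (QuotientGroup.mk' Z c) (by
      rw [← twNorm_map σ τ _ (fun x => (hτ x).symm), hc, map_one])
  obtain ⟨x, rfl⟩ := QuotientGroup.mk'_surjective Z y
  have hcZ : x⁻¹ * c * σ x ∈ Z := by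
    rw [← QuotientGroup.ker_mk' Z, MonoidHom.mem_ker, map_mul, map_mul, hy, hτ, map_inv]
    group
  let σZ : Z →* Z := (σ.comp Z.subtype).codRestrict Z fun z => hZ z z.2
  obtain ⟨z, hz⟩ := exists_eq_mul_inv_of_comm
    (fun x y => Subtype.ext (Subgroup.mem_center_iff.1 y.2 x)) σZ (hcop Z) (c := ⟨_, hcZ⟩) (Subtype.ext (by
    have h1 := twNorm_map σZ σ Z.subtype (fun _ => rfl) ⟨_, hcZ⟩ m
    refine h1.trans ?_
    rw [Subgroup.subtype_apply, twNorm_conj, hc, hσ]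
    simp))
  refine ⟨x * z, ?_⟩
  have h2 : x⁻¹ * c * σ x = z * (σ z)⁻¹ := congrArg Subtype.val hz
  have h3 : c = x * (z * (σ z)⁻¹) * (σ x)⁻¹ := by rw [← h2]; group
  rw [h3, map_mul]
  group

/-- Two `p'`-elements which normalize a `p`-subgroup `Q`, and which agree modulo `Q`, are conjugate
under `Q`. -/
theorem exists_conj_of_mul_inv_mem {p : ℕ} [Fact p.Prime] {Γ : Type} [Group Γ] [Finite Γ]
    {Q : Subgroup Γ} (hQ : IsPGroup p Q) {s s' : Γ} (hs : s ∈ Subgroup.normalizer (Q : Set Γ))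
    (h1 : (orderOf s).Coprime p) (h2 : (orderOf s').Coprime p) (h : s' * s⁻¹ ∈ Q) :
    ∃ x ∈ Q, x * s * x⁻¹ = s' := by
  have hmem : ∀ x : Q, s * x * s⁻¹ ∈ Q := fun x => (Subgroup.mem_normalizer_iff.1 hs x).1 x.2
  let σ : Q →* Q :=
    { toFun := fun x => ⟨s * x * s⁻¹, hmem x⟩
      map_one' := Subtype.ext (by simp)
      map_mul' := fun x y => Subtype.ext (by simp) }
  have hσ : ∀ (i : ℕ) (x : Q), ((⇑σ)^[i] x : Γ) = s ^ i * x * (s ^ i)⁻¹ := by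
    intro i x
    induction i with
    | zero => simp
    | succ i ih =>
      rw [Function.iterate_succ_apply']
      change s * _ * s⁻¹ = _
      rw [ih, pow_succ']
      group
  have hnorm : ∀ i, ((twNorm σ ⟨s' * s⁻¹, h⟩ i : Q) : Γ) = s' ^ i * (s ^ i)⁻¹ := by
    intro i
    induction i with
    | zero => simp [twNorm]
    | succ i ih =>
      change s' * s⁻¹ * (s * ((twNorm σ ⟨s' * s⁻¹, h⟩ i : Q) : Γ) * s⁻¹) = _
      rw [ih, pow_succ', pow_succ']
      group
  let m := orderOf s * orderOf s'
  have hs1 : s ^ m = 1 := by rw [pow_mul, pow_orderOf_eq_one, one_pow]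
  have hs2 : s' ^ m = 1 := by
    rw [show m = orderOf s' * orderOf s from mul_comm _ _, pow_mul, pow_orderOf_eq_one, one_pow]
  obtain ⟨x, hx⟩ := exists_eq_mul_inv_of_isPGroup (Nat.Coprime.mul_left h1 h2) _ Q rfl hQ σ
    (fun x => Subtype.ext (by rw [hσ, hs1]; simp)) ⟨s' * s⁻¹, h⟩
    (Subtype.ext (by rw [hnorm, hs1, hs2]; simp))
  refine ⟨x, x.2, ?_⟩
  have h3 : s' * s⁻¹ = x * (s * x * s⁻¹)⁻¹ := congrArg Subtype.val hx
  have h4 : s' = x * (s * x * s⁻¹)⁻¹ * s := by rw [← h3]; group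
  rw [h4]
  group

end Conjugacy

section Triangular

/-- A matrix which is triangular with respect to a rank function, with non-zero diagonal entries, has
trivial kernel. -/
theorem eq_zero_of_triangular {F : Type*} [Field F] {C : Type*} [Fintype C] (r : C → ℕ)
    (M : C → C → F) (hM : ∀ c d, M c d ≠ 0 → c = d ∨ r c < r d) (hd : ∀ c, M c c ≠ 0) (l : C → F)
    (hl : ∀ c, ∑ d, l d * M c d = 0) : l = 0 := by
  classical
  by_contra h
  obtain ⟨c₀, hc₀⟩ := Function.ne_iff.1 h
  obtain ⟨c, hc, hmax⟩ := Finset.exists_max_image (Finset.univ.filter fun c => l c ≠ 0) r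
    ⟨c₀, by simpa using hc₀⟩
  have hc' : l c ≠ 0 := (Finset.mem_filter.1 hc).2
  have h1 := hl c
  rw [Finset.sum_eq_single c] at h1
  · exact (mul_ne_zero hc' (hd c)) h1
  · intro d _ hdc
    by_contra h2
    have h3 := hM c d (right_ne_zero_of_mul h2)
    have h4 := hmax d (by simpa using left_ne_zero_of_mul h2)
    rcases h3 with h3 | h3
    · exact hdc h3.symm
    · omega
  · simp

theorem exists_of_triangular {F : Type*} [Field F] {C : Type*} [Fintype C] (r : C → ℕ)
    (M : C → C → F) (hM : ∀ c d, M c d ≠ 0 → c = d ∨ r c < r d) (hd : ∀ c, M c c ≠ 0) (g : C → F) :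
    ∃ l : C → F, ∀ c, ∑ d, l d * M c d = g c := by
  let T : (C → F) →ₗ[F] (C → F) :=
    LinearMap.pi fun c => ∑ d, M c d • LinearMap.proj d
  have hT : ∀ l c, T l c = ∑ d, l d * M c d := fun l c => by
    simp [T, LinearMap.sum_apply, mul_comm]
  have h1 : Function.Injective T := by
    rw [← LinearMap.ker_eq_bot, LinearMap.ker_eq_bot']
    intro l hl
    exact eq_zero_of_triangular r M hM hd l fun c => by rw [← hT, hl]; rfl
  obtain ⟨l, hl⟩ := (LinearMap.injective_iff_surjective.1 h1) g
  exact ⟨l, fun c => by rw [← hT, hl]⟩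

end Triangular

section TwistCongr

variable {k : Type u} [Field k] {Γ : Type} [Group Γ] {X : Type} [MulAction Γ X] {n : ℕ}

namespace SetAut

/-- An automorphism with `a ^ n = 1`, regarded as an automorphism with `a ^ N = 1`, if `n ∣ N`. -/
def ofDvd (a : SetAut Γ X n) {N : ℕ} (h : n ∣ N) : SetAut Γ X N :=
  ⟨a.perm, a.smul, by obtain ⟨m, rfl⟩ := h; rw [pow_mul, a.pow_eq, one_pow]⟩

variable [Finite X] [Finite Γ] [IsAlgClosed k] {F : Type v} [Field F] (θ : BrauerLift k F)

theorem twist_ofDvd [NeZero n] [NeZero (n : k)] (a : SetAut Γ X n) {N : ℕ} [NeZero N]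
    [NeZero (N : k)] (h : n ∣ N) (j : ℕ) : (a.ofDvd h).twist θ j = a.twist θ j := by
  symm
  refine Fintype.sum_of_injective
    (fun ζ : rootsOfUnity n k => (⟨ζ.1, rootsOfUnity_le_of_dvd h ζ.2⟩ : rootsOfUnity N k))
    (fun ζ ξ hh => Subtype.ext (congrArg (fun z : rootsOfUnity N k => (z : kˣ)) hh)) _ _
    (fun ξ hξ => ?_) (fun ζ => rfl)
  have h1 : rootsVal k N ξ ^ n ≠ 1 := fun h1 => by
    refine hξ ⟨⟨ξ.1, ?_⟩, rfl⟩
    rw [mem_rootsOfUnity]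
    refine Units.ext ?_
    rw [rootsVal_apply] at h1
    simpa using h1
  have h2 : Subsingleton ((a.ofDvd h).eig k (rootsVal k N ξ)) := by
    refine subsingleton_of_forall_eq 0 fun f => Subtype.ext (funext fun x => ?_)
    have h3 := (a.ofDvd h).eig_pow f.2 n x
    rw [show (a.ofDvd h).perm ^ n = 1 from a.pow_eq] at h3
    have h4 : (rootsVal k N ξ ^ n - 1) * (f : X → k) x = 0 := by
      rw [sub_mul, one_mul, ← h3]
      exact sub_self _
    exact (mul_eq_zero.1 h4).resolve_left (sub_ne_zero.2 h1)
  have h3 : (a.ofDvd h).eigClass k ξ = 0 := Subtype.ext (cls_eq_zero _)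
  rw [h3, gcls_zero, smul_zero]

/-- Isomorphic `Γ`-sets with automorphisms have the same twisted classes. -/
theorem twist_congr {Y : Type} [MulAction Γ Y] [Finite Y] {m : ℕ} [NeZero n] [NeZero (n : k)]
    [NeZero m] [NeZero (m : k)] (a : SetAut Γ X n) (b : SetAut Γ Y m) (e : X ≃ Y)
    (he : ∀ (g : Γ) x, e (g • x) = g • e x) (hab : ∀ x, e (a.perm x) = b.perm (e x)) (j : ℕ) :
    a.twist θ j = b.twist θ j := by
  have h1 : NeZero (n * m) := ⟨mul_ne_zero (NeZero.ne n) (NeZero.ne m)⟩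
  have h2 : NeZero ((n * m : ℕ) : k) := ⟨by
    rw [Nat.cast_mul]
    exact mul_ne_zero (NeZero.ne _) (NeZero.ne _)⟩
  rw [← a.twist_ofDvd θ (dvd_mul_right n m), ← b.twist_ofDvd θ (dvd_mul_left m n)]
  refine Finset.sum_congr rfl fun ζ _ => ?_
  have h3 : (a.ofDvd (dvd_mul_right n m)).eigClass k ζ = (b.ofDvd (dvd_mul_left m n)).eigClass k ζ :=
    Subtype.ext ((cls_eq_iff _ _).2 ⟨(eigEquiv (a.ofDvd (dvd_mul_right n m))
      (b.ofDvd (dvd_mul_left m n)) e he hab _).symm⟩)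
  rw [h3]

end SetAut

end TwistCongr

section Pairs

/-- The pairs `(Q, s)` consisting of a `p`-subgroup `Q` and a `p'`-element `s` normalizing `Q`. -/
structure PPair (p : ℕ) (Γ : Type) [Group Γ] where
  /-- The `p`-subgroup. -/
  Q : Subgroup Γ
  /-- The `p'`-element. -/
  s : Γ
  isPGroup : IsPGroup p Q
  mem : s ∈ Subgroup.normalizer (Q : Set Γ)
  coprime : (orderOf s).Coprime p

namespace PPair

variable {p : ℕ} {Γ : Type} [Group Γ]

theorem ext' {c d : PPair p Γ} (h1 : c.Q = d.Q) (h2 : c.s = d.s) : c = d := by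
  cases c; cases d; cases h1; cases h2; rfl

variable [Finite Γ]

instance : Finite (PPair p Γ) :=
  Finite.of_injective (fun c => (c.Q, c.s)) fun _ _ h =>
    ext' (congrArg Prod.fst h) (congrArg Prod.snd h)

instance neZero_orderOf (c : PPair p Γ) : NeZero (orderOf c.s) := ⟨(orderOf_pos c.s).ne'⟩

theorem cast_ne_zero {k : Type u} [Field k] [Fact p.Prime] [CharP k p] {n : ℕ} (h : n.Coprime p) :
    (n : k) ≠ 0 := by
  rw [Ne, CharP.cast_eq_zero_iff k p]
  exact fun h' => (Fact.out : p.Prime).one_lt.ne' (Nat.Coprime.eq_one_of_dvd h.symm h')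

instance neZero_orderOf_cast {k : Type u} [Field k] [Fact p.Prime] [CharP k p] (c : PPair p Γ) :
    NeZero (orderOf c.s : k) := ⟨cast_ne_zero c.coprime⟩

/-- Conjugacy of pairs. -/
instance setoid (p : ℕ) (Γ : Type) [Group Γ] : Setoid (PPair p Γ) where
  r c d := PairConj c.Q c.s d.Q d.s
  iseqv := by
    refine ⟨fun c => ⟨1, ?_, by simp⟩, ?_, ?_⟩
    · rw [map_one]
      exact Subgroup.map_id c.Q
    · rintro c d ⟨g, h1, h2⟩
      refine ⟨g⁻¹, ?_, by rw [← h2]; group⟩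
      rw [← h1, Subgroup.map_map]
      convert Subgroup.map_id c.Q
      ext x
      simp [mul_assoc]
    · rintro c d e ⟨g, h1, h2⟩ ⟨h, h3, h4⟩
      refine ⟨h * g, ?_, by rw [← h4, ← h2]; group⟩
      rw [← h3, ← h1, Subgroup.map_map]
      congr 1
      ext x
      simp

theorem equiv_def {c d : PPair p Γ} : c ≈ d ↔ PairConj c.Q c.s d.Q d.s := Iff.rfl

variable {k : Type u} [Field k] [IsAlgClosed k] [Fact p.Prime] [CharP k p] {F : Type v} [Field F]
  (θ : BrauerLift k F)

/-- The permutation module `k[Γ/Q]`, twisted by right multiplication by `s`. -/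
def twist (c : PPair p Γ) : PPermGroup k F Γ := (cosetAut c.Q c.s c.mem).twist θ 1

/-- The linear form `τ_{Q, s}`. -/
def tau (c : PPair p Γ) : PPermGroup k F Γ →ₗ[F] F := DiagPPerm.tau θ c.Q ⟨c.s, c.mem⟩

theorem twist_eq_of_equiv {c d : PPair p Γ} (h : c ≈ d) : c.twist θ = d.twist θ := by
  obtain ⟨g, h1, h2⟩ := h
  have hmem : ∀ x, g * x * g⁻¹ ∈ d.Q ↔ x ∈ c.Q := fun x => by
    rw [← h1]
    refine ⟨?_, fun hx => ⟨x, hx, rfl⟩⟩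
    rintro ⟨y, hy, hxy⟩
    have : y = x := by simpa using hxy
    rwa [← this]
  let e : Γ ⧸ c.Q ≃ Γ ⧸ d.Q := Quotient.congr (Equiv.mulRight g⁻¹) fun a b => by
    refine QuotientGroup.leftRel_apply.trans (Iff.trans ?_ QuotientGroup.leftRel_apply.symm)
    rw [← hmem]
    simp [mul_assoc]
  have he : ∀ x : Γ, e (x : Γ ⧸ c.Q) = ((x * g⁻¹ : Γ) : Γ ⧸ d.Q) := fun x => rfl
  refine SetAut.twist_congr θ _ _ e (fun x y => ?_) (fun y => ?_) 1
  · induction y using QuotientGroup.induction_on with | H y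
    exact congrArg (QuotientGroup.mk) (mul_assoc x y g⁻¹)
  · induction y using QuotientGroup.induction_on with | H y
    refine congrArg (QuotientGroup.mk) ?_
    change y * c.s * g⁻¹ = y * g⁻¹ * d.s
    rw [← h2]
    group

/-- `F T(Γ)` is spanned by the twisted permutation modules. -/
theorem span_twist [CharZero F] :
    Submodule.span F (Set.range fun c : PPair p Γ => c.twist θ) = ⊤ := by
  rw [eq_top_iff, ← span_cosetEigClasses (k := k) (p := p) (Γ := Γ), Submodule.span_le]
  rintro _ ⟨y, ⟨Q, s, ζ, hQ, hs, hy⟩, rfl⟩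
  let c : PPair p Γ := ⟨Q, s, hQ, s.2, hs⟩
  have h0 : NeZero (orderOf (s : Γ)) := neZero_orderOf c
  have h0' : NeZero (orderOf (s : Γ) : k) := neZero_orderOf_cast c
  have h1 : y = (cosetAut Q (s : Γ) s.2).eigClass k ζ := Subtype.ext hy
  rw [SetLike.mem_coe, h1, SetAut.gcls_eigClass θ]
  refine Submodule.smul_mem _ _ (Submodule.sum_mem _ fun j _ => Submodule.smul_mem _ _ ?_)
  let d : PPair p Γ := ⟨Q, (s : Γ) ^ j, hQ, pow_mem s.2 j,
    Nat.Coprime.coprime_dvd_left (orderOf_pow_dvd j) hs⟩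
  refine Submodule.subset_span ⟨d, ?_⟩
  rw [← SetAut.twist_pow]
  have : NeZero (orderOf ((s : Γ) ^ j)) := neZero_orderOf d
  have : NeZero (orderOf ((s : Γ) ^ j) : k) := neZero_orderOf_cast d
  refine (SetAut.twist_congr θ ((cosetAut Q (s : Γ) s.2).pow j) (cosetAut Q ((s : Γ) ^ j) d.mem)
    (Equiv.refl _) (fun _ _ => rfl) (fun y => ?_) 1).symm
  induction y using QuotientGroup.induction_on with | H y
  exact cosetAut_pow _ _ _ _ _

theorem tau_twist {X : Type} [MulAction Γ X] [Finite X] {n : ℕ} [NeZero n] [NeZero (n : k)]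
    (a : SetAut Γ X n) (c : PPair p Γ) : c.tau θ (a.twist θ 1) =
      (Nat.card {x : X // (∀ g ∈ c.Q, g • x = x) ∧ c.s • x = a.perm x} : F) := by
  classical
  have := Fintype.ofFinite X
  rw [tau, DiagPPerm.tau_twist θ a 1 c.isPGroup ⟨c.s, c.mem⟩ c.coprime, Nat.card_eq_fintype_card,
    pow_one]

theorem tau_eq_of_equiv [CharZero F] {c d : PPair p Γ} (h : c ≈ d) (x : PPermGroup k F Γ) :
    c.tau θ x = d.tau θ x := by
  classical
  have hx : x ∈ Submodule.span F (Set.range fun c : PPair p Γ => c.twist θ) := by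
    rw [span_twist]; trivial
  obtain ⟨g, h1, h2⟩ := h
  induction hx using Submodule.span_induction with
  | zero => simp
  | add x y _ _ hx hy => rw [map_add, map_add, hx, hy]
  | smul r x _ hx => rw [map_smul, map_smul, hx]
  | mem x hx =>
    obtain ⟨e, rfl⟩ := hx
    let A := cosetAut e.Q e.s e.mem
    change c.tau θ (A.twist θ 1) = d.tau θ (A.twist θ 1)
    rw [tau_twist, tau_twist]
    refine congrArg _ (Nat.card_congr ((MulAction.toPerm g).subtypeEquiv fun x => ?_))
    rw [MulAction.toPerm_apply, ← h1, ← h2]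
    refine and_congr ⟨?_, fun h y hy => ?_⟩ ?_
    · rintro h _ ⟨y, hy, rfl⟩
      simp only [MulEquiv.coe_toMonoidHom, MulAut.conj_apply, mul_smul, inv_smul_smul, h y hy]
    · have h3 := h _ ⟨y, hy, rfl⟩
      simp only [MulEquiv.coe_toMonoidHom, MulAut.conj_apply, mul_smul, inv_smul_smul] at h3
      exact MulAction.injective g h3
    · rw [mul_smul, mul_smul, inv_smul_smul, A.smul]
      exact (MulAction.injective g).eq_iff.symm

theorem exists_of_tau_twist_ne_zero {c d : PPair p Γ} (h : c.tau θ (d.twist θ) ≠ 0) :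
    ∃ g : Γ, (∀ x ∈ c.Q, g⁻¹ * x * g ∈ d.Q) ∧ g⁻¹ * c.s * g * d.s⁻¹ ∈ d.Q := by
  rw [twist, tau_twist] at h
  obtain ⟨x, hx1, hx2⟩ : Nonempty {x : Γ ⧸ d.Q //
      (∀ g ∈ c.Q, g • x = x) ∧ c.s • x = (cosetAut d.Q d.s d.mem).perm x} := by
    rw [← not_isEmpty_iff]
    intro h'
    exact h (by rw [Nat.card_of_isEmpty, Nat.cast_zero])
  induction x using QuotientGroup.induction_on with | H g
  refine ⟨g, fun x hx => ?_, ?_⟩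
  · have h1 := QuotientGroup.eq.1 (hx1 x hx).symm
    simpa [mul_assoc] using h1
  · have h1 : (c.s * g)⁻¹ * (g * d.s) ∈ d.Q := QuotientGroup.eq.1 hx2
    have h2 := (Subgroup.mem_normalizer_iff.1 d.mem _).1 (inv_mem h1)
    simpa [mul_assoc] using h2

theorem card_le_of_tau_twist_ne_zero {c d : PPair p Γ} (h : c.tau θ (d.twist θ) ≠ 0) :
    c ≈ d ∨ Nat.card c.Q < Nat.card d.Q := by
  obtain ⟨g, h1, h2⟩ := exists_of_tau_twist_ne_zero θ h
  have h3 : c.Q.map (MulAut.conj g⁻¹).toMonoidHom ≤ d.Q := by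
    rintro _ ⟨x, hx, rfl⟩
    simpa using h1 x hx
  have h4 : Nat.card (c.Q.map (MulAut.conj g⁻¹).toMonoidHom) = Nat.card c.Q :=
    Subgroup.card_map_of_injective (MulAut.conj g⁻¹).injective
  rcases (Subgroup.card_le_of_le h3).lt_or_eq with h5 | h5
  · exact .inr (h4 ▸ h5)
  · left
    have h6 := Subgroup.eq_of_le_of_card_ge h3 h5.ge
    have h7 : orderOf (g⁻¹ * c.s * g) = orderOf c.s := by
      have := MulEquiv.orderOf_eq (MulAut.conj g⁻¹) c.s
      simpa using this
    obtain ⟨y, hy, hy2⟩ := exists_conj_of_mul_inv_mem d.isPGroup d.mem d.coprime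
      (s' := g⁻¹ * c.s * g) (by rw [h7]; exact c.coprime) h2
    refine Setoid.symm (equiv_def.2 ⟨g * y, ?_, ?_⟩)
    · rw [map_mul, ← h6]
      change Subgroup.map ((MulAut.conj g).toMonoidHom.comp (MulAut.conj y).toMonoidHom) _ = _
      have h8 : Subgroup.map (MulAut.conj y).toMonoidHom d.Q = d.Q :=
        (Subgroup.mem_normalizer_iff_map_conj_eq (H := d.Q)).1 (Subgroup.le_normalizer hy)
      rw [h6, ← Subgroup.map_map, h8, ← h6, Subgroup.map_map]
      convert Subgroup.map_id c.Q
      ext x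
      simp [mul_assoc]
    · rw [mul_inv_rev, show g * y * d.s * (y⁻¹ * g⁻¹) = g * (y * d.s * y⁻¹) * g⁻¹ by group, hy2]
      group

theorem tau_twist_self_ne_zero [CharZero F] (c : PPair p Γ) : c.tau θ (c.twist θ) ≠ 0 := by
  rw [twist, tau_twist, Nat.cast_ne_zero, ← Nat.pos_iff_ne_zero, Nat.card_pos_iff]
  refine ⟨⟨⟨((1 : Γ) : Γ ⧸ c.Q), fun g hg => ?_, ?_⟩⟩, inferInstance⟩
  · exact QuotientGroup.eq.2 (by simpa using hg)
  · change ((c.s * 1 : Γ) : Γ ⧸ c.Q) = ((1 * c.s : Γ) : Γ ⧸ c.Q)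
    rw [one_mul, mul_one]

/-- Conjugacy classes of pairs. -/
abbrev Class (p : ℕ) (Γ : Type) [Group Γ] : Type := Quotient (setoid p Γ)

instance : Fintype (Class p Γ) := Fintype.ofFinite _

theorem tau_out_twist_out [CharZero F] (c d : Class p Γ)
    (h : c.out.tau θ (d.out.twist (k := k) θ) ≠ 0) :
    c = d ∨ Nat.card c.out.Q < Nat.card d.out.Q :=
  (card_le_of_tau_twist_ne_zero θ h).imp_left fun h => by
    rw [← Quotient.out_eq c, ← Quotient.out_eq d]
    exact Quotient.sound h

theorem exists_eq_sum_twist [CharZero F] (x : PPermGroup k F Γ) :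
    ∃ l : Class p Γ → F, x = ∑ c, l c • c.out.twist θ := by
  have h : Submodule.span F (Set.range fun c : Class p Γ => c.out.twist (k := k) θ) = ⊤ := by
    rw [eq_top_iff, ← span_twist θ, Submodule.span_le]
    rintro _ ⟨c, rfl⟩
    refine Submodule.subset_span ⟨Quotient.mk _ c, twist_eq_of_equiv θ ?_⟩
    exact Quotient.mk_out (s := setoid p Γ) c
  obtain ⟨l, hl⟩ := (Submodule.mem_span_range_iff_exists_fun F).1
    (h.symm ▸ Submodule.mem_top : x ∈ Submodule.span F
      (Set.range fun c : Class p Γ => c.out.twist (k := k) θ))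
  exact ⟨l, hl.symm⟩

/-- The linear forms `τ_{Q, s}` separate the elements of `F T(Γ)`. -/
theorem eq_zero_of_tau [CharZero F] {x : PPermGroup k F Γ} (h : ∀ c : PPair p Γ, c.tau θ x = 0) :
    x = 0 := by
  obtain ⟨l, rfl⟩ := exists_eq_sum_twist (p := p) θ x
  have h1 := eq_zero_of_triangular (fun c : Class p Γ => Nat.card c.out.Q)
    (fun c d => c.out.tau θ (d.out.twist (k := k) θ)) (tau_out_twist_out θ)
    (fun c => tau_twist_self_ne_zero θ c.out) l fun c => by
      have := h c.out
      simpa only [map_sum, map_smul, smul_eq_mul] using this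
  simp [h1]

theorem ext_tau [CharZero F] {x y : PPermGroup k F Γ} (h : ∀ c : PPair p Γ, c.tau θ x = c.tau θ y) :
    x = y :=
  sub_eq_zero.1 (eq_zero_of_tau θ fun c => by rw [map_sub, h, sub_self])

/-- Every class function on pairs is realized by an element of `F T(Γ)`. -/
theorem exists_tau_eq [CharZero F] (f : PPair p Γ → F) (hf : ∀ c d : PPair p Γ, c ≈ d → f c = f d) :
    ∃ x : PPermGroup k F Γ, ∀ c : PPair p Γ, c.tau θ x = f c := by
  obtain ⟨l, hl⟩ := exists_of_triangular (fun c : Class p Γ => Nat.card c.out.Q)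
    (fun c d => c.out.tau θ (d.out.twist (k := k) θ)) (tau_out_twist_out θ)
    (fun c => tau_twist_self_ne_zero θ c.out) (fun c => f c.out)
  refine ⟨∑ c, l c • c.out.twist θ, fun c => ?_⟩
  have h1 : (Quotient.mk (setoid p Γ) c).out ≈ c := Quotient.mk_out (s := setoid p Γ) c
  rw [← tau_eq_of_equiv θ h1, ← hf _ _ h1]
  simpa only [map_sum, map_smul, smul_eq_mul] using hl (Quotient.mk _ c)

theorem isPairIdempotent_pairIdempotent [CharZero F] (c : PPair p Γ) :
    IsPairIdempotent p θ c.Q c.s (pairIdempotent p θ c.Q c.s) := by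
  classical
  refine Classical.epsilon_spec (p := IsPairIdempotent p θ c.Q c.s) ?_
  obtain ⟨x, hx⟩ := exists_tau_eq θ (fun d : PPair p Γ => if d ≈ c then (1 : F) else 0)
    fun d e h => if_congr ⟨fun h' => Setoid.trans (Setoid.symm h) h',
      fun h' => Setoid.trans h h'⟩ rfl rfl
  refine ⟨x, fun Q t hQ ht => ?_⟩
  let d : PPair p Γ := ⟨Q, t, hQ, t.2, by rwa [Subgroup.orderOf_coe]⟩
  have h1 := hx d
  exact ⟨fun h => h1.trans (if_pos h), fun h => h1.trans (if_neg h)⟩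

open Classical in
theorem tau_pairIdempotent [CharZero F] (c d : PPair p Γ) :
    d.tau θ (pairIdempotent p θ c.Q c.s) = if d ≈ c then 1 else 0 := by
  have h := isPairIdempotent_pairIdempotent θ c d.Q ⟨d.s, d.mem⟩ d.isPGroup
    (by rw [← Subgroup.orderOf_coe]; exact d.coprime)
  split_ifs with h1
  · exact h.1 h1
  · exact h.2 h1

end PPair

end Pairs

section FreeActions

variable {G : Type} [Group G] {X : Type} [MulAction G X]

theorem exists_transversal (h : ∀ (g : G) (x : X), g • x = x → g = 1) :
    ∃ T : Set X, ∀ x, ∃! g : G, g⁻¹ • x ∈ T := by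
  let _ : Setoid X := MulAction.orbitRel G X
  refine ⟨Set.range (Quotient.out : Quotient (MulAction.orbitRel G X) → X), fun x => ?_⟩
  obtain ⟨g, hg⟩ : x ∈ MulAction.orbit G (Quotient.out (s := MulAction.orbitRel G X) (Quotient.mk _ x)) :=
    MulAction.orbitRel_apply.1 (Setoid.symm (Quotient.mk_out (s := MulAction.orbitRel G X) x))
  refine ⟨g, ⟨Quotient.mk (MulAction.orbitRel G X) x, ?_⟩, fun g' hg' => ?_⟩
  · exact eq_inv_smul_iff.2 hg
  · obtain ⟨q, hq⟩ := hg'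
    have h1 : Quotient.mk (MulAction.orbitRel G X) x = q := by
      rw [← Quotient.out_eq q]
      exact Quotient.sound (MulAction.orbitRel_apply.2 ⟨g', by
        change g' • q.out = x
        rw [hq, smul_inv_smul]⟩)
    rw [h1] at hg
    change g • q.out = x at hg
    have h2 : (g⁻¹ * g') • q.out = q.out := by
      rw [mul_smul, inv_smul_eq_iff, hg, hq, smul_inv_smul]
    exact (inv_mul_eq_one.1 (h _ _ h2)).symm

theorem exists_partition {k : Type u} [Field k] [Fintype G]
    (h : ∀ (g : G) (x : X), g • x = x → g = 1) : ∃ e : X → k, ∀ x, ∑ g : G, e (g⁻¹ • x) = 1 := by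
  classical
  obtain ⟨T, hT⟩ := exists_transversal h
  refine ⟨fun x => if x ∈ T then 1 else 0, fun x => ?_⟩
  obtain ⟨g, hg, hg'⟩ := hT x
  rw [Finset.sum_eq_single g]
  · exact if_pos hg
  · exact fun g' _ h' => if_neg fun h'' => h' (hg' _ h'')
  · simp

theorem sum_eq_zero_of_mul_left {k : Type u} [Field k] [Fintype G] (g₀ : G)
    (h0 : (orderOf g₀ : k) = 0) (f : G → k) (hf : ∀ g, f (g₀ * g) = f g) : ∑ g, f g = 0 := by
  classical
  let R := Subgroup.zpowers g₀
  obtain ⟨e, he⟩ := exists_partition (k := k) (G := R) (X := G) fun r x h =>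
    Subtype.ext (mul_eq_right.1 h)
  have hR : ∀ (r : R) g, f (r⁻¹ • g) = f g := by
    let S : Subgroup G :=
      { carrier := {x | ∀ g, f (x * g) = f g}
        mul_mem' := fun {a b} ha hb g => by rw [mul_assoc, ha, hb]
        one_mem' := fun g => by rw [one_mul]
        inv_mem' := fun {a} ha g => by rw [← ha, mul_inv_cancel_left] }
    have h1 : R ≤ S := (Subgroup.zpowers_le).2 hf
    exact fun r g => h1 (r⁻¹).2 g
  calc ∑ g, f g = ∑ g, ∑ r : R, e (r⁻¹ • g) * f g := by
        refine Finset.sum_congr rfl fun g _ => ?_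
        rw [← Finset.sum_mul, he, one_mul]
    _ = ∑ r : R, ∑ g, e (r⁻¹ • g) * f (r⁻¹ • g) := by
        rw [Finset.sum_comm]
        simp only [hR]
    _ = ∑ r : R, ∑ g, e g * f g := by
        refine Finset.sum_congr rfl fun r _ => ?_
        exact Equiv.sum_comp (MulAction.toPerm r⁻¹) fun g => e g * f g
    _ = 0 := by
        rw [Finset.sum_const, Finset.card_univ, Fintype.card_zpowers, nsmul_eq_mul, h0, zero_mul]

end FreeActions

section Higman

variable {k : Type u} [Field k] {Γ : Type} [Group Γ] {G : Type} [Group G]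

/-- The eigenspaces of automorphisms of a `Γ`-set on which `G` acts freely are relatively
projective. -/
theorem SetAut.exists_higman [Finite Γ] [Fintype G] {X : Type} [Finite X] [MulAction Γ X] {n : ℕ} [NeZero n]
    [NeZero (n : k)] [IsAlgClosed k] (a : SetAut Γ X n) (j : G →* Γ)
    (h : ∀ g (x : X), j g • x = x → g = 1) (ζ : rootsOfUnity n k) :
    ∃ θ : a.eig k (rootsVal k n ζ) →ₗ[k] a.eig k (rootsVal k n ζ), ∀ v,
      ∑ g : G, a.eigRep k (rootsVal k n ζ) (j g) (θ (a.eigRep k (rootsVal k n ζ) (j g⁻¹) v)) = v := by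
  let _ : MulAction G X := MulAction.compHom X j
  obtain ⟨e, he⟩ := exists_partition (k := k) (G := G) (X := X) h
  have he' : ∀ x, ∑ g : G, e ((j g)⁻¹ • x) = 1 := fun x => by
    rw [← he x]
    exact Finset.sum_congr rfl fun g _ => by rw [← map_inv]; rfl
  refine ⟨(a.eigProj k ζ).toLinearMap ∘ₗ LinearMap.mulLeft k e ∘ₗ (a.eigIncl k _).toLinearMap,
    fun v => ?_⟩
  have h1 : ∀ g : G, a.eigRep k (rootsVal k n ζ) (j g) (((a.eigProj k ζ).toLinearMap ∘ₗ
      LinearMap.mulLeft k e ∘ₗ (a.eigIncl k _).toLinearMap)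
        (a.eigRep k (rootsVal k n ζ) (j g⁻¹) v)) =
      a.eigProj k ζ (funRep k Γ X (j g) (e * funRep k Γ X (j g⁻¹) (v : X → k))) := fun g =>
    ((a.eigProj k ζ).isIntertwining _ _ _ _).symm
  rw [Finset.sum_congr rfl fun g _ => h1 g, ← map_sum]
  refine Eq.trans (congrArg _ ?_) (a.eigProj_eigIncl ζ v)
  ext x
  rw [Finset.sum_apply]
  have h2 : ∀ g : G, funRep k Γ X (j g) (e * funRep k Γ X (j g⁻¹) (v : X → k)) x =
      e ((j g)⁻¹ • x) * (v : X → k) x := fun g => by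
    rw [funRep_apply, Pi.mul_apply, funRep_apply, map_inv, inv_inv, smul_inv_smul]
  rw [Finset.sum_congr rfl fun g _ => h2 g, ← Finset.sum_mul, he', one_mul]
  rfl

variable {p : ℕ} [Fact p.Prime] [CharP k p]

/-- A `p`-permutation module which is relatively projective with respect to `G` has no Brauer quotient
at the `p`-subgroups which meet `G` non-trivially. -/
theorem fixedPoints_le_traceSpace [Fintype G] [Finite Γ] {V : Type w} [AddCommGroup V] [Module k V]
    {ρ : Representation k Γ V} (hρ : IsPPermutation ρ) (j : G →* Γ) (hj : Function.Injective j)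
    (θ : V →ₗ[k] V) (hθ : ∀ v, ∑ g : G, ρ (j g) (θ (ρ (j g⁻¹) v)) = v) {P : Subgroup Γ}
    (hP : IsPGroup p P) {g₀ : G} (hg : g₀ ≠ 1) (hgP : j g₀ ∈ P) :
    fixedPoints ρ P ≤ traceSpace ρ P := by
  obtain ⟨X, _, _, i, r, hi, hr, hir⟩ := (isPPermutation_iff ρ).1 hρ
  have hord : (orderOf g₀ : k) = 0 := by
    rw [CharP.cast_eq_zero_iff k p]
    obtain ⟨n, hn⟩ := IsPGroup.iff_orderOf.1 hP ⟨j g₀, hgP⟩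
    rw [Subgroup.orderOf_mk, orderOf_injective j hj] at hn
    rw [hn]
    refine dvd_pow_self p ?_
    rintro rfl
    exact hg (orderOf_eq_one_iff.1 (by rw [hn, pow_zero]))
  let I : ρ.IntertwiningMap (funRep k Γ X) := ⟨LinearMap.pi i, fun g => by
    refine LinearMap.ext fun v => funext fun x => ?_
    change i x (ρ g v) = i (g⁻¹ • x) v
    rw [← hi g (g⁻¹ • x), smul_inv_smul]⟩
  let R : (funRep k Γ X).IntertwiningMap ρ := ⟨∑ x, (LinearMap.proj x).smulRight (r x), fun g => by
    refine LinearMap.ext fun f => ?_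
    simp only [LinearMap.comp_apply, LinearMap.sum_apply, LinearMap.smulRight_apply,
      LinearMap.proj_apply, map_sum, map_smul, funRep_apply, ← hr]
    rw [← Equiv.sum_comp (MulAction.toPerm g)]
    simp⟩
  have hRI : ∀ v, R (I v) = v := fun v => by
    refine Eq.trans ?_ (hir v)
    change (∑ x, (LinearMap.proj x).smulRight (r x) : (X → k) →ₗ[k] V) (fun x => i x v) = _
    simp [LinearMap.sum_apply]
  intro v hv
  rw [← hRI v]
  refine traceSpace_map _ _ P R _ (mem_traceSpace_of_vanish _ (fixedPoints_map _ _ P I v hv)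
    fun x hx => ?_)
  change i x v = 0
  rw [← hθ v, map_sum]
  refine sum_eq_zero_of_mul_left g₀ hord _ fun g => ?_
  have h1 : ρ (j (g₀ * g)⁻¹) v = ρ (j g⁻¹) v := by
    rw [mul_inv_rev, map_mul, map_mul, Module.End.mul_apply, map_inv j g₀,
      (mem_fixedPoints ρ P v).1 hv _ (inv_mem hgP)]
  have h2 := hi (j g₀) x (ρ (j g) (θ (ρ (j g⁻¹) v)))
  rw [hx _ hgP] at h2
  rw [h1, map_mul, map_mul, Module.End.mul_apply, h2]

end Higman

section DiagonalTwists

theorem eq_one_of_inv_mul_mul_eq_one {G : Type*} [Group G] {x g : G} (h : x⁻¹ * g * x = 1) :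
    g = 1 := by
  rw [mul_assoc, inv_mul_eq_one] at h
  exact mul_eq_right.1 h.symm

variable {k : Type u} [Field k] {F : Type v} [Field F] {G H : Type} [Group G] [Group H] [Finite G]
  [Finite H]

theorem diagClasses_le : diagClasses k G H ≤ ppermClasses k (G × H) := by
  rintro _ ⟨n, ρ, rfl, h⟩
  exact (cls_mem_ppermClasses ρ).2 h.pperm

/-- The map from `F T^Δ(G, H)` to `F T(G × H)`. -/
def toPPerm : DiagGroup k F G H →ₗ[F] PPermGroup k F (G × H) :=
  extend
    { toFun := fun x => gcls F (AddSubmonoid.inclusion diagClasses_le x)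
      map_zero' := by simp
      map_add' := fun x y => by simp }

theorem toPPerm_gcls (x : diagClasses k G H) :
    toPPerm (gcls F x) = gcls F (AddSubmonoid.inclusion diagClasses_le x) :=
  extend_gcls _ _

theorem toPPerm_injective [CharZero F] [IsAlgClosed k] (p : ℕ) [Fact p.Prime] [CharP k p] :
    Function.Injective (toPPerm : DiagGroup k F G H → PPermGroup k F (G × H)) := by
  obtain ⟨n, d, φ, v, hv, -⟩ := exists_rankVector k p (G × H)
  let v' := v.comp (AddSubmonoid.inclusion (diagClasses_le (k := k) (G := G) (H := H)))
  have h1 : (vecExtend F v).comp toPPerm = vecExtend F v' := extend_ext fun x => by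
    rw [LinearMap.comp_apply, toPPerm_gcls, vecExtend_gcls, vecExtend_gcls]
    rfl
  have h2 : Function.Injective (vecExtend F v') := vecExtend_injective v'
    (hv.comp (AddSubmonoid.inclusion_injective diagClasses_le))
  rw [← h1] at h2
  exact Function.Injective.of_comp h2

variable (G H) in
/-- A `(G, H)`-biset is bifree if both groups act freely. -/
structure IsBifree (X : Type) [MulAction (G × H) X] : Prop where
  left : ∀ (g : G) (x : X), ((g, 1) : G × H) • x = x → g = 1
  right : ∀ (h : H) (x : X), ((1, h) : G × H) • x = x → h = 1

namespace SetAut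

variable [IsAlgClosed k] {X : Type} [MulAction (G × H) X] [Finite X] {n : ℕ} [NeZero n]
  [NeZero (n : k)]

theorem isDiagonalPPermutation_eigRep (a : SetAut (G × H) X n) (hX : IsBifree G H X)
    (ζ : rootsOfUnity n k) : IsDiagonalPPermutation (a.eigRep k (rootsVal k n ζ)) := by
  have := Fintype.ofFinite G
  have := Fintype.ofFinite H
  exact (isDiagonalPPermutation_iff _).2 ⟨a.isPPermutation_eigRep k ζ,
    a.exists_higman (MonoidHom.inl G H) hX.left ζ, a.exists_higman (MonoidHom.inr G H) hX.right ζ⟩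

variable (k) in
/-- The class of an eigenspace. -/
def diagEigClass (a : SetAut (G × H) X n) (hX : IsBifree G H X) (ζ : rootsOfUnity n k) :
    diagClasses k G H :=
  ⟨cls (a.eigRep k (rootsVal k n ζ)),
    (cls_mem_diagClasses _).2 (a.isDiagonalPPermutation_eigRep hX ζ)⟩

/-- The class in `F T^Δ(G, H)` of the permutation bimodule of a bifree biset, twisted by an
automorphism. -/
def diagTwist (a : SetAut (G × H) X n) (hX : IsBifree G H X) (θ : BrauerLift k F) :
    DiagGroup k F G H :=
  ∑ ζ : rootsOfUnity n k, θ.onRoots n ζ • gcls F (a.diagEigClass k hX ζ)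

theorem toPPerm_diagTwist (a : SetAut (G × H) X n) (hX : IsBifree G H X) (θ : BrauerLift k F) :
    toPPerm (a.diagTwist hX θ) = a.twist θ 1 := by
  rw [diagTwist, map_sum, twist]
  refine Finset.sum_congr rfl fun ζ _ => ?_
  rw [map_smul, toPPerm_gcls, pow_one]
  rfl

end SetAut

namespace PPair

variable {p : ℕ}

/-- A pair of `G × H` is diagonal if its `p`-subgroup meets `G` and `H` trivially. -/
def IsDiag (c : PPair p (G × H)) : Prop :=
  (∀ g : G, (g, 1) ∈ c.Q → g = 1) ∧ ∀ h : H, (1, h) ∈ c.Q → h = 1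

theorem IsDiag.of_subconj {c d : PPair p (G × H)} (h : d.IsDiag) (x : G × H)
    (hx : ∀ y ∈ c.Q, x⁻¹ * y * x ∈ d.Q) : c.IsDiag := by
  refine ⟨fun g hg => ?_, fun g hg => ?_⟩
  · have h1 := hx _ hg
    have h2 : x⁻¹ * (g, 1) * x = (x.1⁻¹ * g * x.1, 1) := Prod.ext rfl (by simp)
    rw [h2] at h1
    exact eq_one_of_inv_mul_mul_eq_one (h.1 _ h1)
  · have h1 := hx _ hg
    have h2 : x⁻¹ * (1, g) * x = (1, x.2⁻¹ * g * x.2) := Prod.ext (by simp) rfl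
    rw [h2] at h1
    exact eq_one_of_inv_mul_mul_eq_one (h.2 _ h1)

theorem IsDiag.of_equiv {c d : PPair p (G × H)} (h : d.IsDiag) (hc : c ≈ d) : c.IsDiag := by
  obtain ⟨g, h1, h2⟩ := hc
  refine h.of_subconj g⁻¹ fun y hy => ?_
  rw [← h1]
  exact ⟨y, hy, by simp⟩

theorem IsDiag.isBifree {c : PPair p (G × H)} (h : c.IsDiag) : IsBifree G H ((G × H) ⧸ c.Q) := by
  refine ⟨fun g x hx => ?_, fun g x hx => ?_⟩
  · induction x using QuotientGroup.induction_on with | H x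
    have h1 := QuotientGroup.eq.1 hx.symm
    have h2 : x⁻¹ * ((g, 1) * x) = (x.1⁻¹ * g * x.1, 1) := Prod.ext (by simp [mul_assoc]) (by simp)
    change x⁻¹ * ((g, 1) * x) ∈ c.Q at h1
    rw [h2] at h1
    exact eq_one_of_inv_mul_mul_eq_one (h.1 _ h1)
  · induction x using QuotientGroup.induction_on with | H x
    have h1 := QuotientGroup.eq.1 hx.symm
    have h2 : x⁻¹ * ((1, g) * x) = (1, x.2⁻¹ * g * x.2) := Prod.ext (by simp) (by simp [mul_assoc])
    change x⁻¹ * ((1, g) * x) ∈ c.Q at h1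
    rw [h2] at h1
    exact eq_one_of_inv_mul_mul_eq_one (h.2 _ h1)

variable [IsAlgClosed k] [Fact p.Prime] [CharP k p] (θ : BrauerLift k F)

/-- The diagonal version of `PPair.twist`. -/
def diagTwist (c : PPair p (G × H)) (h : c.IsDiag) : DiagGroup k F G H :=
  (cosetAut c.Q c.s c.mem).diagTwist h.isBifree θ

theorem toPPerm_diagTwist (c : PPair p (G × H)) (h : c.IsDiag) :
    toPPerm (c.diagTwist θ h) = c.twist θ :=
  SetAut.toPPerm_diagTwist _ _ _

theorem tau_toPPerm_of_not_isDiag {c : PPair p (G × H)} (hc : ¬ c.IsDiag)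
    (x : DiagGroup k F G H) : c.tau θ (toPPerm x) = 0 := by
  induction x using gcls_induction with
  | add x y hx hy => rw [map_add, map_add, hx, hy, add_zero]
  | smul r x hx => rw [map_smul, map_smul, hx, smul_zero]
  | of x =>
    obtain ⟨_, n, ρ, rfl, h⟩ := x
    rw [toPPerm_gcls, tau, tau_gcls]
    change brauerValueHom θ _ _ (cls ρ) = 0
    rw [brauerValueHom_cls]
    have := Fintype.ofFinite G
    have := Fintype.ofFinite H
    obtain ⟨h, ⟨f, hf⟩, f', hf'⟩ := (isDiagonalPPermutation_iff ρ).1 h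
    have h1 : fixedPoints ρ c.Q ≤ traceSpace ρ c.Q := by
      rw [IsDiag, not_and_or] at hc
      push Not at hc
      rcases hc with ⟨g, hg, hg1⟩ | ⟨g, hg, hg1⟩
      · exact fixedPoints_le_traceSpace h (MonoidHom.inl G H) (fun x y hxy => congrArg Prod.fst hxy)
          f hf c.isPGroup hg1 hg
      · exact fixedPoints_le_traceSpace h (MonoidHom.inr G H) (fun x y hxy => congrArg Prod.snd hxy)
          f' hf' c.isPGroup hg1 hg
    have h2 : Subsingleton (BrauerQuotient ρ c.Q) :=
      Submodule.Quotient.subsingleton_iff.2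
        (eq_top_iff.2 fun v _ => h1 v.2)
    rw [brauerValue, Subsingleton.elim (brauerAction ρ c.Q ⟨c.s, c.mem⟩) 0, LinearMap.charpoly_zero,
      Module.finrank_zero_of_subsingleton]
    simp

variable [CharZero F]

theorem exists_diagTwist {x : PPermGroup k F (G × H)}
    (hx : ∀ c : PPair p (G × H), ¬ c.IsDiag → c.tau θ x = 0) :
    ∃ y ∈ Submodule.span F (Set.range fun c : {c : PPair p (G × H) // c.IsDiag} =>
      c.1.diagTwist θ c.2), toPPerm y = x := by
  classical
  obtain ⟨l, rfl⟩ := exists_eq_sum_twist (p := p) θ x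
  have h0 : (fun c : {c : Class p (G × H) // ¬ c.out.IsDiag} => l c.1) = 0 := by
    refine eq_zero_of_triangular (fun c => Nat.card c.1.out.Q)
      (fun c d => c.1.out.tau θ (d.1.out.twist (k := k) θ))
      (fun c d h => (tau_out_twist_out θ c.1 d.1 h).imp_left Subtype.ext)
      (fun c => tau_twist_self_ne_zero θ c.1.out) _ fun c => ?_
    have h1 := hx c.1.out c.2
    simp only [map_sum, map_smul, smul_eq_mul] at h1
    rw [← Fintype.sum_subtype_add_sum_subtype (fun d : Class p (G × H) => d.out.IsDiag)] at h1
    rw [← h1, right_eq_add]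
    refine Finset.sum_eq_zero fun d _ => ?_
    by_contra h2
    obtain ⟨g, hg, -⟩ := exists_of_tau_twist_ne_zero θ (right_ne_zero_of_mul h2)
    exact c.2 (d.2.of_subconj g hg)
  refine ⟨∑ c : {c : Class p (G × H) // c.out.IsDiag}, l c.1 • c.1.out.diagTwist θ c.2,
    Submodule.sum_mem _ fun c _ => Submodule.smul_mem _ _
      (Submodule.subset_span ⟨⟨c.1.out, c.2⟩, rfl⟩), ?_⟩
  rw [map_sum, ← Fintype.sum_subtype_add_sum_subtype (fun d : Class p (G × H) => d.out.IsDiag),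
    Finset.sum_eq_zero (s := (Finset.univ : Finset {d : Class p (G × H) // ¬ d.out.IsDiag}))
      fun d _ => by rw [show l d.1 = 0 from congrFun h0 d, zero_smul], add_zero]
  exact Finset.sum_congr rfl fun c _ => by rw [map_smul, toPPerm_diagTwist]

theorem span_diagTwist : Submodule.span F (Set.range
    fun c : {c : PPair p (G × H) // c.IsDiag} => c.1.diagTwist (k := k) θ c.2) = ⊤ := by
  refine eq_top_iff.2 fun x _ => ?_
  obtain ⟨y, hy, hyx⟩ := exists_diagTwist θ (x := toPPerm x)
    fun c hc => tau_toPPerm_of_not_isDiag (p := p) θ hc x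
  rwa [← toPPerm_injective p hyx]

theorem ext_tau_toPPerm {x y : DiagGroup k F G H} (h : ∀ c : PPair p (G × H), c.IsDiag →
    c.tau θ (toPPerm x) = c.tau θ (toPPerm y)) : x = y := by
  refine toPPerm_injective p (ext_tau θ fun c => ?_)
  by_cases hc : c.IsDiag
  · exact h c hc
  · rw [tau_toPPerm_of_not_isDiag θ hc, tau_toPPerm_of_not_isDiag θ hc]

open Classical in
/-- The elements of `F T^Δ(G, H)` which are dual to the linear forms `τ_{Q, s}`. -/
theorem exists_prim (c : PPair p (G × H)) (hc : c.IsDiag) : ∃ x : DiagGroup k F G H,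
    ∀ d : PPair p (G × H), d.tau θ (toPPerm x) = if d ≈ c then 1 else 0 := by
  obtain ⟨x, hx⟩ := exists_tau_eq θ (fun d : PPair p (G × H) => if d ≈ c then (1 : F) else 0)
    fun d e h => if_congr ⟨fun h' => Setoid.trans (Setoid.symm h) h',
      fun h' => Setoid.trans h h'⟩ rfl rfl
  obtain ⟨y, -, rfl⟩ := exists_diagTwist θ (x := x) fun d hd => by
    rw [hx, if_neg fun h => hd (hc.of_equiv h)]
  exact ⟨y, hx⟩

open Classical in
theorem mem_span_of_prim (c : PPair p (G × H) → DiagGroup k F G H)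
    (hc : ∀ d : PPair p (G × H), d.IsDiag → ∃ r : F, r ≠ 0 ∧
      ∀ e : PPair p (G × H), e.tau θ (toPPerm (c d)) = if e ≈ d then r else 0)
    (x : DiagGroup k F G H) :
    x ∈ Submodule.span F (c '' {d | d.IsDiag}) := by
  have h1 : x = ∑ q : {q : Class p (G × H) // q.out.IsDiag},
      (q.1.out.tau θ (toPPerm x) * (hc q.1.out q.2).choose⁻¹) • c q.1.out := by
    refine ext_tau_toPPerm θ fun d hd => ?_
    have hd1 : (Quotient.mk (setoid p (G × H)) d).out ≈ d := Quotient.mk_out (s := setoid p _) d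
    have hd2 : (Quotient.mk (setoid p (G × H)) d).out.IsDiag := hd.of_equiv hd1
    rw [map_sum, map_sum, Finset.sum_eq_single ⟨_, hd2⟩]
    · obtain ⟨hr, h2⟩ := (hc _ hd2).choose_spec
      rw [map_smul, map_smul, h2, if_pos (Setoid.symm hd1), smul_eq_mul, mul_assoc,
        inv_mul_cancel₀ hr, mul_one, tau_eq_of_equiv θ hd1]
    · intro q _ hq
      obtain ⟨hr, h2⟩ := (hc _ q.2).choose_spec
      rw [map_smul, map_smul, h2, if_neg, smul_zero]
      intro h3
      refine hq (Subtype.ext ?_)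
      rw [← Quotient.out_eq q.1]
      exact Quotient.sound (Setoid.symm h3)
    · simp
  rw [h1]
  exact Submodule.sum_mem _ fun q _ => Submodule.smul_mem _ _ (Submodule.subset_span ⟨_, q.2, rfl⟩)

end PPair

end DiagonalTwists

section BisetComposition

variable (G H K X Y : Type) [Group G] [Group H] [Group K] [MulAction (G × H) X]
  [MulAction (H × K) Y]

/-- The equivalence relation defining `X ×_H Y`. -/
def bisetSetoid : Setoid (X × Y) where
  r z z' := ∃ h : H, (((1, h) : G × H) • z.1, ((h, 1) : H × K) • z.2) = z'
  iseqv := by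
    refine ⟨fun z => ⟨1, Prod.ext (one_smul (G × H) z.1) (one_smul (H × K) z.2)⟩, ?_, ?_⟩
    · rintro z _ ⟨h, rfl⟩
      refine ⟨h⁻¹, Prod.ext ?_ ?_⟩
      · change ((1, h⁻¹) : G × H) • ((1, h) : G × H) • z.1 = z.1
        rw [smul_smul]
        simp [← Prod.one_eq_mk]
      · change ((h⁻¹, 1) : H × K) • ((h, 1) : H × K) • z.2 = z.2
        rw [smul_smul]
        simp [← Prod.one_eq_mk]
    · rintro z _ _ ⟨h, rfl⟩ ⟨h', rfl⟩
      refine ⟨h' * h, Prod.ext ?_ ?_⟩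
      · change _ = ((1, h') : G × H) • ((1, h) : G × H) • z.1
        rw [smul_smul]
        simp
      · change _ = ((h', 1) : H × K) • ((h, 1) : H × K) • z.2
        rw [smul_smul]
        simp

/-- The composition `X ×_H Y` of bisets. -/
def BisetComp : Type := Quotient (bisetSetoid G H K X Y)

instance [Finite X] [Finite Y] : Finite (BisetComp G H K X Y) :=
  inferInstanceAs (Finite (Quotient _))

variable {G H K X Y}

/-- The class of a pair. -/
def BisetComp.mk (x : X) (y : Y) : BisetComp G H K X Y := Quotient.mk (bisetSetoid G H K X Y) (x, y)

theorem BisetComp.ind {motive : BisetComp G H K X Y → Prop} (h : ∀ x y, motive (.mk x y))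
    (z : BisetComp G H K X Y) : motive z :=
  Quotient.ind (fun z => h z.1 z.2) z

theorem BisetComp.mk_eq_iff {x x' : X} {y y' : Y} :
    (BisetComp.mk x y : BisetComp G H K X Y) = .mk x' y' ↔
      ∃ h : H, ((1, h) : G × H) • x = x' ∧ ((h, 1) : H × K) • y = y' :=
  Quotient.eq.trans (exists_congr fun _ => Prod.ext_iff)

/-- Maps on `X ×_H Y` induced by equivariant maps. -/
def BisetComp.map {X' Y' : Type} [MulAction (G × H) X'] [MulAction (H × K) Y'] (f : X → X')
    (g : Y → Y') (hf : ∀ (h : H) x, f (((1, h) : G × H) • x) = ((1, h) : G × H) • f x)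
    (hg : ∀ (h : H) y, g (((h, 1) : H × K) • y) = ((h, 1) : H × K) • g y) :
    BisetComp G H K X Y → BisetComp G H K X' Y' :=
  Quotient.map (fun z => (f z.1, g z.2)) (by
    rintro z _ ⟨h, rfl⟩
    exact ⟨h, Prod.ext (hf h z.1).symm (hg h z.2).symm⟩)

theorem BisetComp.comm_left (g : G) (h : H) (x : X) :
    ((g, 1) : G × H) • ((1, h) : G × H) • x = ((1, h) : G × H) • ((g, 1) : G × H) • x := by
  rw [smul_smul, smul_smul]
  simp

instance : MulAction (G × K) (BisetComp G H K X Y) where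
  smul x := BisetComp.map (((x.1, 1) : G × H) • ·) (((1, x.2) : H × K) • ·)
    (fun h z => BisetComp.comm_left _ _ _) (fun h z => (BisetComp.comm_left _ _ _).symm)
  one_smul z := by
    induction z using BisetComp.ind with | h x y
    exact congrArg₂ BisetComp.mk (one_smul (G × H) x) (one_smul (H × K) y)
  mul_smul g g' z := by
    induction z using BisetComp.ind with | h x y
    refine congrArg₂ BisetComp.mk ?_ ?_
    · change _ = ((g.1, 1) : G × H) • ((g'.1, 1) : G × H) • x
      rw [smul_smul]
      simp
    · change _ = ((1, g.2) : H × K) • ((1, g'.2) : H × K) • y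
      rw [smul_smul]
      simp

theorem BisetComp.smul_mk (g : G × K) (x : X) (y : Y) :
    g • (BisetComp.mk x y : BisetComp G H K X Y) =
      .mk (((g.1, 1) : G × H) • x) (((1, g.2) : H × K) • y) := rfl

theorem SetAut.symm_smul {Γ D : Type} [Group Γ] [MulAction Γ D] {n : ℕ} (a : SetAut Γ D n) (g : Γ)
    (x : D) : a.perm.symm (g • x) = g • a.perm.symm x := by
  rw [Equiv.symm_apply_eq, a.smul, Equiv.apply_symm_apply]

/-- The permutation of `X ×_H Y` induced by automorphisms of `X` and `Y`. -/
def SetAut.compPerm {n m : ℕ} (a : SetAut (G × H) X n) (b : SetAut (H × K) Y m) :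
    Equiv.Perm (BisetComp G H K X Y) where
  toFun := BisetComp.map a.perm b.perm (fun h => a.smul (1, h)) fun h => b.smul (h, 1)
  invFun := BisetComp.map a.perm.symm b.perm.symm (fun h => a.symm_smul (1, h))
    fun h => b.symm_smul (h, 1)
  left_inv z := by
    induction z using BisetComp.ind with | h x y
    exact congrArg₂ BisetComp.mk (a.perm.symm_apply_apply x) (b.perm.symm_apply_apply y)
  right_inv z := by
    induction z using BisetComp.ind with | h x y
    exact congrArg₂ BisetComp.mk (a.perm.apply_symm_apply x) (b.perm.apply_symm_apply y)

/-- The automorphism of `X ×_H Y` induced by automorphisms of `X` and `Y`. -/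
def SetAut.comp {n m : ℕ} (a : SetAut (G × H) X n) (b : SetAut (H × K) Y m) :
    SetAut (G × K) (BisetComp G H K X Y) (n * m) where
  perm := a.compPerm b
  smul g z := by
    induction z using BisetComp.ind with | h x y
    exact congrArg₂ BisetComp.mk (a.smul _ x) (b.smul _ y)
  pow_eq := by
    have h : ∀ (A : Equiv.Perm (BisetComp G H K X Y)),
        (∀ x y, A (.mk x y) = .mk (a.perm x) (b.perm y)) →
        ∀ (j : ℕ) x y, (A ^ j) (.mk x y) = .mk ((a.perm ^ j) x) ((b.perm ^ j) y) := by
      intro A hA j x y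
      induction j with
      | zero => rfl
      | succ j ih => rw [pow_succ', Equiv.Perm.mul_apply, ih, hA, pow_succ', pow_succ']; rfl
    ext z
    induction z using BisetComp.ind with | h x y
    rw [h (a.compPerm b) fun _ _ => rfl, pow_mul, a.pow_eq, one_pow, mul_comm, pow_mul, b.pow_eq, one_pow]
    rfl

end BisetComposition

section Linearization

variable {k : Type u} [Field k] {G H K X Y : Type} [Group G] [Group H] [Group K]
  [MulAction (G × H) X] [MulAction (H × K) Y] [Finite H]

/-- Functoriality of the tensor product of bimodules, as an intertwining map. -/
def btmapHom {V V' W W' : Type*} [AddCommGroup V] [Module k V] [AddCommGroup W]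
    [Module k W] [AddCommGroup V'] [Module k V'] [AddCommGroup W'] [Module k W']
    {ρ : Representation k (G × H) V} {σ : Representation k (H × K) W}
    {ρ' : Representation k (G × H) V'} {σ' : Representation k (H × K) W'}
    (f : ρ.IntertwiningMap ρ') (g : σ.IntertwiningMap σ') :
    (btRep ρ σ).IntertwiningMap (btRep ρ' σ') :=
  ⟨btmap f g, fun x => bt_hom_ext fun v w => by
    simp [Representation.IntertwiningMap.isIntertwining]⟩

/-- The bilinear map to functions on `X ×_H Y`. -/
def bisetBilin : (X → k) →ₗ[k] (Y → k) →ₗ[k] (BisetComp G H K X Y → k) :=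
  have := Fintype.ofFinite H
  LinearMap.mk₂ k (fun φ ψ => Quotient.lift
    (fun z : X × Y => ∑ h : H, φ (((1, h) : G × H) • z.1) * ψ (((h, 1) : H × K) • z.2)) (by
      rintro z _ ⟨h, rfl⟩
      rw [← Equiv.sum_comp (Equiv.mulRight h)]
      refine Finset.sum_congr rfl fun h' _ => ?_
      simp only [smul_smul, Equiv.coe_mulRight, Prod.mk_mul_mk, mul_one]))
    (fun φ φ' ψ => funext fun z => by
      induction z using BisetComp.ind with | h x y
      exact (Finset.sum_congr rfl fun _ _ => add_mul _ _ _).trans Finset.sum_add_distrib)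
    (fun c φ ψ => funext fun z => by
      induction z using BisetComp.ind with | h x y
      exact (Finset.sum_congr rfl fun _ _ => mul_assoc _ _ _).trans (Finset.mul_sum _ _ _).symm)
    (fun φ ψ ψ' => funext fun z => by
      induction z using BisetComp.ind with | h x y
      exact (Finset.sum_congr rfl fun _ _ => mul_add _ _ _).trans Finset.sum_add_distrib)
    (fun c φ ψ => funext fun z => by
      induction z using BisetComp.ind with | h x y
      exact (Finset.sum_congr rfl fun _ _ => mul_left_comm _ _ _).trans (Finset.mul_sum _ _ _).symm)

theorem bisetBilin_mk [i : Fintype H] (φ : X → k) (ψ : Y → k) (x : X) (y : Y) :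
    bisetBilin φ ψ (BisetComp.mk x y : BisetComp G H K X Y) =
      ∑ h : H, φ (((1, h) : G × H) • x) * ψ (((h, 1) : H × K) • y) := by
  obtain rfl : i = Fintype.ofFinite H := Subsingleton.elim _ _
  rfl

/-- The map from `kX ⊗_{kH} kY` to functions on `X ×_H Y`. -/
def bisetFun : (btRep (funRep k (G × H) X) (funRep k (H × K) Y)).IntertwiningMap
    (funRep k (G × K) (BisetComp G H K X Y)) :=
  ⟨btlift _ _ bisetBilin fun h φ ψ => funext fun z => by
    have := Fintype.ofFinite H
    induction z using BisetComp.ind with | h x y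
    rw [bisetBilin_mk, bisetBilin_mk, ← Equiv.sum_comp (Equiv.mulLeft h)]
    refine Finset.sum_congr rfl fun h' _ => ?_
    simp only [funRep_apply, smul_smul, Equiv.coe_mulLeft, Prod.inv_mk, Prod.mk_mul_mk, inv_one,
      mul_one, inv_mul_cancel_left], fun g => bt_hom_ext fun φ ψ => funext fun z => by
    have := Fintype.ofFinite H
    induction z using BisetComp.ind with | h x y
    simp only [LinearMap.comp_apply, btRep_btmul, btlift_btmul, funRep_apply]
    rw [bisetBilin_mk, BisetComp.smul_mk, bisetBilin_mk]
    refine Finset.sum_congr rfl fun h' _ => ?_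
    simp only [funRep_apply, smul_smul, Prod.inv_mk, Prod.mk_mul_mk, inv_one,
      mul_one, one_mul, Prod.fst_inv, Prod.snd_inv]⟩

theorem bisetFun_btmul (φ : X → k) (ψ : Y → k) :
    bisetFun (G := G) (K := K) (btmul (funRep k (G × H) X) (funRep k (H × K) Y) φ ψ) = bisetBilin φ ψ := rfl

open Classical in
/-- The element of `kX ⊗_{kH} kY` attached to an element of `X ×_H Y`. -/
def bisetBasis : BisetComp G H K X Y → BalTensor (funRep k (G × H) X) (funRep k (H × K) Y) :=
  Quotient.lift (fun z => btmul _ _ (Pi.single z.1 1) (Pi.single z.2 1)) (by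
    rintro z _ ⟨h, rfl⟩
    have := btmul_balanced (funRep k (G × H) X) (funRep k (H × K) Y) h (Pi.single z.1 1)
      (Pi.single z.2 1)
    rw [funRep_single, funRep_single] at this
    exact this.symm)

open Classical in
theorem bisetBasis_mk (x : X) (y : Y) :
    (bisetBasis (BisetComp.mk x y : BisetComp G H K X Y) : BalTensor (funRep k (G × H) X) _) =
      btmul _ _ (Pi.single x 1) (Pi.single y 1) := rfl

theorem btRep_bisetBasis (g : G × K) (z : BisetComp G H K X Y) :
    btRep (funRep k (G × H) X) (funRep k (H × K) Y) g (bisetBasis z) = bisetBasis (g • z) := by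
  classical
  induction z using BisetComp.ind with | h x y
  rw [BisetComp.smul_mk, bisetBasis_mk, bisetBasis_mk, btRep_btmul, funRep_single, funRep_single]

open Classical in
theorem bisetFun_bisetBasis (hX : ∀ (h : H) (x : X), ((1, h) : G × H) • x = x → h = 1)
    (z : BisetComp G H K X Y) : bisetFun (k := k) (bisetBasis z) = Pi.single z 1 := by
  have := Fintype.ofFinite H
  induction z using BisetComp.ind with | h x y
  rw [bisetBasis_mk, bisetFun_btmul]
  ext z'
  induction z' using BisetComp.ind with | h x' y'
  rw [bisetBilin_mk, Pi.single_apply]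
  simp only [Pi.single_apply, ite_mul, one_mul, zero_mul, ← ite_and]
  split_ifs with h
  · obtain ⟨h, hx, hy⟩ := BisetComp.mk_eq_iff.1 h
    rw [Finset.sum_eq_single h]
    · exact if_pos ⟨hx, hy⟩
    · intro h' _ hne
      refine if_neg fun h1 => hne ?_
      have h2 : ((1, h⁻¹ * h') : G × H) • x' = x' := by
        rw [show ((1, h⁻¹ * h') : G × H) = (1, h)⁻¹ * (1, h') by simp, mul_smul, h1.1,
          inv_smul_eq_iff, hx]
      exact (inv_mul_eq_one.1 (hX _ _ h2)).symm
    · simp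
  · refine Finset.sum_eq_zero fun h' _ => if_neg fun h1 => h ?_
    exact BisetComp.mk_eq_iff.2 ⟨h', h1⟩

variable [Finite X] [Finite Y]

/-- The map from functions on `X ×_H Y` to `kX ⊗_{kH} kY`. -/
def bisetInv : (funRep k (G × K) (BisetComp G H K X Y)).IntertwiningMap
    (btRep (funRep k (G × H) X) (funRep k (H × K) Y)) :=
  have := Fintype.ofFinite (BisetComp G H K X Y)
  ⟨∑ z, (LinearMap.proj z).smulRight (bisetBasis z), fun g => by
    refine LinearMap.ext fun f => ?_
    simp only [LinearMap.comp_apply, LinearMap.sum_apply, LinearMap.smulRight_apply,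
      LinearMap.proj_apply, map_sum, map_smul, funRep_apply, btRep_bisetBasis]
    rw [← Equiv.sum_comp (MulAction.toPerm g)]
    simp⟩

theorem bisetInv_apply [i : Fintype (BisetComp G H K X Y)] (f : BisetComp G H K X Y → k) :
    bisetInv f = ∑ z, f z • bisetBasis z := by
  obtain rfl : i = Fintype.ofFinite _ := Subsingleton.elim _ _
  exact LinearMap.sum_apply _ _ _

open Classical in
theorem bisetInv_single (z : BisetComp G H K X Y) :
    bisetInv (k := k) (Pi.single z 1) = bisetBasis z := by
  have := Fintype.ofFinite (BisetComp G H K X Y)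
  have h : bisetInv (k := k) (Pi.single z 1) =
      ∑ z', (Pi.single z (1 : k) : BisetComp G H K X Y → k) z' • bisetBasis z' := by
    exact bisetInv_apply _
  rw [h, Finset.sum_eq_single z]
  · rw [Pi.single_eq_same, one_smul]
  · intro z' _ hz
    rw [Pi.single_eq_of_ne hz, zero_smul]
  · simp

theorem bisetFun_bisetInv (hX : ∀ (h : H) (x : X), ((1, h) : G × H) • x = x → h = 1)
    (f : BisetComp G H K X Y → k) : bisetFun (bisetInv f) = f := by
  classical
  have := Fintype.ofFinite (BisetComp G H K X Y)
  have h : (bisetFun (k := k) (G := G) (H := H) (K := K) (X := X) (Y := Y)).toLinearMap ∘ₗ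
      bisetInv.toLinearMap = LinearMap.id := by
    refine LinearMap.pi_ext' fun z => LinearMap.ext_ring ?_
    change bisetFun (bisetInv (Pi.single z 1)) = Pi.single z 1
    rw [bisetInv_single, bisetFun_bisetBasis hX]
  exact congrArg (fun q => q f) h

theorem bisetInv_bisetFun (hX : ∀ (h : H) (x : X), ((1, h) : G × H) • x = x → h = 1)
    (y : BalTensor (funRep k (G × H) X) (funRep k (H × K) Y)) : bisetInv (bisetFun y) = y := by
  classical
  have := Fintype.ofFinite X
  have := Fintype.ofFinite Y
  refine bt_eq_iff (f := (bisetInv (k := k) (G := G) (H := H) (K := K) (X := X) (Y := Y)).toLinearMap ∘ₗ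
    bisetFun.toLinearMap) (g := LinearMap.id) (fun φ ψ => ?_) y
  have h : (btmk (funRep k (G × H) X) (funRep k (H × K) Y)).compr₂
      ((bisetInv (k := k) (G := G) (H := H) (K := K) (X := X) (Y := Y)).toLinearMap ∘ₗ
        bisetFun.toLinearMap) = btmk (funRep k (G × H) X) (funRep k (H × K) Y) := by
    refine LinearMap.pi_ext' fun x => LinearMap.ext_ring (LinearMap.pi_ext' fun y =>
      LinearMap.ext_ring ?_)
    change bisetInv (bisetFun (btmul _ _ (Pi.single x 1) (Pi.single y 1))) =
      btmul _ _ (Pi.single x 1) (Pi.single y 1)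
    rw [← bisetBasis_mk, bisetFun_bisetBasis hX, bisetInv_single]
  exact congrArg (fun q => q φ ψ) h

end Linearization

section TauComposition

variable {k : Type u} [Field k] [IsAlgClosed k] {F : Type v} [Field F] {G H K X Y : Type} [Group G]
  [Group H] [Group K] [Finite G] [Finite H] [Finite K] [MulAction (G × H) X] [MulAction (H × K) Y]
  [Finite X] [Finite Y] {n m : ℕ} [NeZero n] [NeZero (n : k)] [NeZero m] [NeZero (m : k)]

theorem diagMul_diagTwist (θ : BrauerLift k F) (a : SetAut (G × H) X n) (hX : IsBifree G H X)
    (b : SetAut (H × K) Y m) (hY : IsBifree H K Y) :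
    diagMul k F G H K (a.diagTwist hX θ) (b.diagTwist hY θ) =
      ∑ i : rootsOfUnity n k × rootsOfUnity m k, (θ.onRoots n i.1 * θ.onRoots m i.2) •
        gcls F (diagTensor k G H K (a.diagEigClass k hX i.1) (b.diagEigClass k hY i.2)) := by
  simp only [SetAut.diagTwist, map_sum, LinearMap.sum_apply, map_smul, LinearMap.smul_apply,
    diagMul_gcls]
  rw [Fintype.sum_prod_type_right]
  refine Finset.sum_congr rfl fun ξ _ => ?_
  rw [Finset.smul_sum]
  refine Finset.sum_congr rfl fun ζ _ => ?_
  rw [smul_smul, mul_comm]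

theorem PPair.tau_diagMul_diagTwist {p : ℕ} [Fact p.Prime] [CharP k p] (θ : BrauerLift k F)
    (a : SetAut (G × H) X n) (hX : IsBifree G H X) (b : SetAut (H × K) Y m) (hY : IsBifree H K Y)
    (c : PPair p (G × K)) :
    c.tau θ (toPPerm (diagMul k F G H K (a.diagTwist hX θ) (b.diagTwist hY θ))) =
      (Nat.card {z : BisetComp G H K X Y // (∀ g ∈ c.Q, g • z = z) ∧
        c.s • z = (a.comp b).perm z} : F) := by
  classical
  have := Fintype.ofFinite (BisetComp G H K X Y)
  have hN : NeZero (n * m) := ⟨mul_ne_zero (NeZero.ne n) (NeZero.ne m)⟩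
  have hNk : NeZero ((n * m : ℕ) : k) := ⟨by
    rw [Nat.cast_mul]
    exact mul_ne_zero (NeZero.ne _) (NeZero.ne _)⟩
  let ι₁ : rootsOfUnity n k → rootsOfUnity (n * m) k :=
    fun ζ => ⟨ζ.1, rootsOfUnity_le_of_dvd (dvd_mul_right n m) ζ.2⟩
  let ι₂ : rootsOfUnity m k → rootsOfUnity (n * m) k :=
    fun ζ => ⟨ζ.1, rootsOfUnity_le_of_dvd (dvd_mul_left m n) ζ.2⟩
  rw [Nat.card_eq_fintype_card]
  refine Eq.trans ?_ (liftTrace_funRep θ (a.comp b) c.isPGroup ⟨c.s, c.mem⟩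
    (cast_ne_zero (k := k) c.coprime))
  rw [← sum_brauerValue c.Q θ
    (σ := fun i : rootsOfUnity n k × rootsOfUnity m k =>
      btRep (a.eigRep k (rootsVal k n i.1)) (b.eigRep k (rootsVal k m i.2)))
    (fun i => bisetFun.comp (btmapHom (a.eigIncl k (rootsVal k n i.1))
      (b.eigIncl k (rootsVal k m i.2))))
    (fun i => (btmapHom (a.eigProj k i.1) (b.eigProj k i.2)).comp bisetInv)
    ?_ ?_ ?_ (fun i => ι₁ i.1 * ι₂ i.2) ((a.comp b).intertwining k) ?_ _
    (cast_ne_zero (k := k) c.coprime)]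
  · rw [diagMul_diagTwist, map_sum, map_sum]
    refine Finset.sum_congr rfl fun i _ => ?_
    rw [map_smul, map_smul, toPPerm_gcls, tau, tau_gcls, map_mul, smul_eq_mul]
    refine congrArg₂ (· * ·) rfl ?_
    change brauerValueHom θ c.Q ⟨c.s, c.mem⟩ (clsTensor (cls _) (cls _)) = _
    rw [clsTensor_cls, brauerValueHom_cls]
  · intro i x
    change btmap _ _ (bisetInv (bisetFun (btmap _ _ x))) = x
    rw [bisetInv_bisetFun hX.right]
    refine bt_eq_iff (f := btmap (a.eigProj k i.1) (b.eigProj k i.2) ∘ₗ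
      btmap (a.eigIncl k (rootsVal k n i.1)) (b.eigIncl k (rootsVal k m i.2))) (g := LinearMap.id)
      (fun φ ψ => ?_) x
    change btmul _ _ (a.eigProj k i.1 (a.eigIncl k _ φ)) (b.eigProj k i.2 (b.eigIncl k _ ψ)) = _
    rw [a.eigProj_eigIncl, b.eigProj_eigIncl]
    rfl
  · intro i l x hil
    change btmap _ _ (bisetInv (bisetFun (btmap _ _ x))) = 0
    rw [bisetInv_bisetFun hX.right]
    refine bt_eq_iff (f := btmap (a.eigProj k i.1) (b.eigProj k i.2) ∘ₗ
      btmap (a.eigIncl k (rootsVal k n l.1)) (b.eigIncl k (rootsVal k m l.2))) (g := 0)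
      (fun φ ψ => ?_) x
    change btmul _ _ (a.eigProj k i.1 (a.eigIncl k _ φ)) (b.eigProj k i.2 (b.eigIncl k _ ψ)) = 0
    by_cases h1 : i.1 = l.1
    · rw [b.eigProj_eigIncl_of_ne fun h2 => hil (Prod.ext h1 h2), btmul_zero]
    · rw [a.eigProj_eigIncl_of_ne h1, zero_btmul]
  · intro f
    rw [← bisetFun_bisetInv hX.right f]
    obtain ⟨y, hy⟩ : ∃ y, y = bisetInv (k := k) f := ⟨_, rfl⟩
    rw [← hy]
    have h1 : ∀ i : rootsOfUnity n k × rootsOfUnity m k,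
        (bisetFun.comp (btmapHom (a.eigIncl k (rootsVal k n i.1)) (b.eigIncl k (rootsVal k m i.2))))
          (((btmapHom (a.eigProj k i.1) (b.eigProj k i.2)).comp bisetInv) (bisetFun y)) =
        bisetFun (btmap (a.eigIncl k (rootsVal k n i.1)) (b.eigIncl k (rootsVal k m i.2))
          (btmap (a.eigProj k i.1) (b.eigProj k i.2) y)) := fun i => by
      change bisetFun (btmap _ _ (btmap _ _ (bisetInv (bisetFun y)))) = _
      rw [bisetInv_bisetFun hX.right]
    rw [Finset.sum_congr rfl fun i _ => h1 i, ← map_sum]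
    refine congrArg _ ?_
    have h2 := bt_eq_iff (f := ∑ i : rootsOfUnity n k × rootsOfUnity m k,
      btmap (a.eigIncl k (rootsVal k n i.1)) (b.eigIncl k (rootsVal k m i.2)) ∘ₗ
        btmap (a.eigProj k i.1) (b.eigProj k i.2)) (g := LinearMap.id) (fun φ ψ => ?_) y
    · rw [LinearMap.sum_apply] at h2
      exact h2
    · rw [LinearMap.sum_apply, Fintype.sum_prod_type]
      change ∑ ζ, ∑ ξ, btmk (funRep k (G × H) X) (funRep k (H × K) Y)
        (a.eigIncl k _ (a.eigProj k ζ φ)) (b.eigIncl k _ (b.eigProj k ξ ψ)) =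
          btmk (funRep k (G × H) X) (funRep k (H × K) Y) φ ψ
      simp only [← map_sum]
      rw [← LinearMap.sum_apply, ← map_sum, a.sum_eigIncl_eigProj, b.sum_eigIncl_eigProj]
  · rintro ⟨ζ, ξ⟩ x
    refine bt_eq_iff (f := ((a.comp b).intertwining k).toLinearMap ∘ₗ (bisetFun.comp (btmapHom
      (a.eigIncl k (rootsVal k n ζ)) (b.eigIncl k (rootsVal k m ξ)))).toLinearMap)
      (g := rootsVal k (n * m) (ι₁ ζ * ι₂ ξ) • (bisetFun.comp (btmapHom
      (a.eigIncl k (rootsVal k n ζ)) (b.eigIncl k (rootsVal k m ξ)))).toLinearMap)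
      (fun φ ψ => ?_) x
    have := Fintype.ofFinite H
    funext z
    induction z using BisetComp.ind with | h x y
    change bisetBilin (φ : X → k) (ψ : Y → k) (BisetComp.mk (a.perm x) (b.perm y)) =
      rootsVal k (n * m) (ι₁ ζ * ι₂ ξ) * bisetBilin (φ : X → k) (ψ : Y → k) (BisetComp.mk x y)
    rw [bisetBilin_mk, bisetBilin_mk, Finset.mul_sum]
    refine Finset.sum_congr rfl fun h _ => ?_
    have h1 : rootsVal k (n * m) (ι₁ ζ * ι₂ ξ) = rootsVal k n ζ * rootsVal k m ξ := map_mul _ _ _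
    rw [← a.smul, ← b.smul, φ.2, ψ.2, h1, mul_mul_mul_comm]

end TauComposition

section Points

theorem IsBifree.eq_of_smul_eq {G H X : Type} [Group G] [Group H] [MulAction (G × H) X]
    (hX : IsBifree G H X) {y : X} {g : G} {h h' : H} (e : (g, h) • y = (g, h') • y) : h = h' := by
  have h1 : ((1, h'⁻¹ * h) : G × H) • y = y := by
    rw [show ((1, h'⁻¹ * h) : G × H) = (g, h')⁻¹ * (g, h) by simp, mul_smul, e, inv_smul_smul]
  exact (inv_mul_eq_one.1 (hX.right _ _ h1)).symm

theorem BisetComp.smul_mk_eq_iff {G H K X Y : Type} [Group G] [Group H] [Group K]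
    [MulAction (G × H) X] [MulAction (H × K) Y] {g : G} {l : K} {x x' : X} {y y' : Y} :
    (g, l) • (BisetComp.mk x y : BisetComp G H K X Y) = .mk x' y' ↔
      ∃ h : H, (g, h) • x = x' ∧ (h, l) • y = y' := by
  rw [BisetComp.smul_mk, BisetComp.mk_eq_iff]
  simp [smul_smul]

/-- An embedding of a `D^Δ`-pair `(L, u)` in `G`: an injective homomorphism `α : L → G` and a
`p'`-element `s` of `G` which acts on the image of `L` as `u`. -/
structure DPair.Pt {p : ℕ} (D : DPair p) (G : Type) [Group G] where
  /-- The homomorphism. -/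
  α : D.L →* G
  /-- The element. -/
  s : G
  inj : ∀ q, α q = 1 → q = 1
  coprime : (orderOf s).Coprime p
  comm : ∀ q, s * α q * s⁻¹ = α (D.u q)

namespace DPair.Pt

variable {p : ℕ} {D : DPair p} {G H K : Type} [Group G] [Group H] [Group K]

theorem ext' {m n : D.Pt G} (h1 : m.α = n.α) (h2 : m.s = n.s) : m = n := by
  cases m; cases n; cases h1; cases h2; rfl

instance [Finite G] : Finite (D.Pt G) :=
  Finite.of_injective (fun m => ((m.α : D.L → G), m.s)) fun _ _ h =>
    ext' (DFunLike.coe_injective (congrArg Prod.fst h)) (congrArg Prod.snd h)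

instance [Finite G] : Fintype (D.Pt G) := Fintype.ofFinite _

/-- The image of an embedding. -/
def toPair (m : D.Pt G) : PPair p G where
  Q := m.α.range
  s := m.s
  isPGroup := D.isPGroup.of_surjective _ m.α.rangeRestrict_surjective
  mem := by
    rw [Subgroup.mem_normalizer_iff]
    refine fun x => ⟨?_, ?_⟩
    · rintro ⟨q, rfl⟩
      exact ⟨D.u q, (m.comm q).symm⟩
    · rintro ⟨q, hq⟩
      refine ⟨D.u⁻¹ q, ?_⟩
      have h1 := m.comm (D.u⁻¹ q)
      rw [MulAut.apply_inv_self, hq] at h1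
      exact mul_left_cancel (mul_right_cancel h1)
  coprime := m.coprime

theorem forall_mem_toPair (m : D.Pt G) (P : G → Prop) :
    (∀ g ∈ m.toPair.Q, P g) ↔ ∀ q, P (m.α q) :=
  ⟨fun h q => h _ ⟨q, rfl⟩, by rintro h _ ⟨q, rfl⟩; exact h q⟩

/-- The diagonal embedding in a product. -/
def prod (m : D.Pt G) (n : D.Pt H) : D.Pt (G × H) where
  α := m.α.prod n.α
  s := (m.s, n.s)
  inj q h := m.inj q (congrArg Prod.fst h)
  coprime := by
    rw [Prod.orderOf_mk]
    exact Nat.Coprime.coprime_dvd_left (Nat.lcm_dvd_mul _ _) (m.coprime.mul_left n.coprime)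
  comm q := Prod.ext (m.comm q) (n.comm q)

theorem isDiag_prod (m : D.Pt G) (n : D.Pt H) : (m.prod n).toPair.IsDiag := by
  refine ⟨?_, ?_⟩
  · rintro g ⟨q, hq⟩
    have h1 := n.inj q (congrArg Prod.snd hq)
    rw [h1, map_one] at hq
    exact (congrArg Prod.fst hq).symm
  · rintro g ⟨q, hq⟩
    have h1 := m.inj q (congrArg Prod.fst hq)
    rw [h1, map_one] at hq
    exact (congrArg Prod.snd hq).symm

/-- The fixed points of an embedding, twisted by an automorphism. -/
def Fix {X : Type} [MulAction G X] {n : ℕ} (m : D.Pt G) (a : SetAut G X n) : Type :=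
  {x : X // (∀ q, m.α q • x = x) ∧ m.s • x = a.perm x}

instance {X : Type} [MulAction G X] [Finite X] {n : ℕ} (m : D.Pt G) (a : SetAut G X n) :
    Finite (m.Fix a) := inferInstanceAs (Finite {x : X // _})

section Comp

variable {X Y : Type} [MulAction (G × H) X] [MulAction (H × K) Y] {i j : ℕ}

theorem smul_pow_eq {Γ : Type} [Group Γ] {Z : Type} [MulAction Γ Z] (a : SetAut Γ Z i) {g : Γ} {x : Z}
    (h : g • x = a.perm x) (e : ℕ) : g ^ e • x = (a.perm ^ e) x := by
  induction e with
  | zero => simp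
  | succ e ih => rw [pow_succ', mul_smul, ih, ← a.pow_smul, h, pow_succ, Equiv.Perm.mul_apply]

theorem exists_pt (hX : IsBifree G H X) (a : SetAut (G × H) X i) (hi : i.Coprime p) (m : D.Pt G)
    (x : X) (hx : ∀ q, ∃ h : H, (m.α q, h) • x = x) {l : H} (hl : (m.s, l) • x = a.perm x) :
    ∃ n : D.Pt H, (∀ q, (m.α q, n.α q) • x = x) ∧ n.s = l := by
  choose β hβ using hx
  have hcomm : ∀ q, l * β q * l⁻¹ = β (D.u q) := by
    intro q
    refine hX.eq_of_smul_eq (y := a.perm x) (g := m.α (D.u q)) ?_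
    have h1 : (m.α (D.u q), β (D.u q)) • a.perm x = a.perm x := by rw [← a.smul, hβ]
    rw [h1, ← m.comm, ← hl]
    rw [show ((m.s * m.α q * m.s⁻¹, l * β q * l⁻¹) : G × H) = (m.s, l) * (m.α q, β q) * (m.s, l)⁻¹
      from rfl, mul_smul, inv_smul_smul, mul_smul, hβ]
  refine ⟨⟨MonoidHom.mk' β fun q q' => hX.eq_of_smul_eq (y := x) (g := m.α (q * q')) ?_, l, fun q hq => ?_, ?_, hcomm⟩,
    hβ, rfl⟩
  · rw [hβ, map_mul, show ((m.α q * m.α q', β q * β q') : G × H) = (m.α q, β q) * (m.α q', β q')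
      from rfl, mul_smul, hβ, hβ]
  · refine m.inj q (hX.left _ x ?_)
    have h1 := hβ q
    rwa [show β q = 1 from hq] at h1
  · have h1 := smul_pow_eq a hl (orderOf m.s * i)
    rw [mul_comm, pow_mul, pow_mul, a.pow_eq, one_pow, ← pow_mul, mul_comm, Prod.pow_mk, pow_mul,
      pow_orderOf_eq_one, one_pow] at h1
    have h2 := hX.right _ x h1
    exact Nat.Coprime.coprime_dvd_left (orderOf_dvd_of_pow_eq_one h2) (m.coprime.mul_left hi)

theorem card_fix_comp [Finite H] [Finite X] [Finite Y] (hX : IsBifree G H X)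
    (a : SetAut (G × H) X i) (b : SetAut (H × K) Y j) (hi : i.Coprime p)
    (m : D.Pt G) (n : D.Pt K) :
    Nat.card ((m.prod n).Fix (a.comp b)) * Nat.card H =
      ∑ l : D.Pt H, Nat.card ((m.prod l).Fix a) * Nat.card ((l.prod n).Fix b) := by
  let A := (m.prod n).Fix (a.comp b)
  let T := {z : X × Y // ((∀ q, (m.prod n).α q • (BisetComp.mk z.1 z.2 : BisetComp G H K X Y) =
    .mk z.1 z.2) ∧ (m.prod n).s • (BisetComp.mk z.1 z.2 : BisetComp G H K X Y) =
      (a.comp b).perm (.mk z.1 z.2))}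
  have hT : Nat.card T = Nat.card A * Nat.card H := by
    rw [← Nat.card_prod]
    let out : BisetComp G H K X Y → X × Y := Quotient.out (s := bisetSetoid G H K X Y)
    have hout : ∀ z, BisetComp.mk (out z).1 (out z).2 = z := fun z =>
      Quotient.out_eq (s := bisetSetoid G H K X Y) z
    have hmk : ∀ z : A × H, (BisetComp.mk (((1, z.2) : G × H) • (out z.1.1).1)
        (((z.2, 1) : H × K) • (out z.1.1).2) : BisetComp G H K X Y) = z.1.1 := fun z =>
      (BisetComp.mk_eq_iff.2 ⟨z.2, rfl, rfl⟩).symm.trans (hout z.1.1)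
    refine (Nat.card_congr (Equiv.ofBijective (fun z : A × H =>
      (⟨(((1, z.2) : G × H) • (out z.1.1).1, ((z.2, 1) : H × K) • (out z.1.1).2), by
        rw [hmk]
        exact z.1.2⟩ : T)) ⟨fun z z' h => ?_, fun t => ?_⟩)).symm
    · have h1 := congrArg (fun t : T => t.1) h
      have h2 : z.1 = z'.1 := Subtype.ext (by
        rw [← hmk z, ← hmk z']
        exact congrArg₂ BisetComp.mk (congrArg Prod.fst h1) (congrArg Prod.snd h1))
      refine Prod.ext h2 ?_
      have h3 : ((1, z.2) : G × H) • (out z.1.1).1 = ((1, z'.2) : G × H) • (out z'.1.1).1 :=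
        congrArg Prod.fst h1
      rw [← h2] at h3
      exact hX.eq_of_smul_eq h3
    · obtain ⟨h, h1, h2⟩ := BisetComp.mk_eq_iff.1 (hout (.mk t.1.1 t.1.2))
      exact ⟨(⟨.mk t.1.1 t.1.2, t.2⟩, h), Subtype.ext (Prod.ext h1 h2)⟩
  rw [← hT]
  have hsig : Nat.card (Σ l : D.Pt H, (m.prod l).Fix a × (l.prod n).Fix b) =
      ∑ l : D.Pt H, Nat.card ((m.prod l).Fix a) * Nat.card ((l.prod n).Fix b) := by
    rw [Nat.card_sigma]
    exact Finset.sum_congr rfl fun l _ => Nat.card_prod _ _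
  rw [← hsig]
  refine (Nat.card_congr (Equiv.ofBijective
    (fun z : Σ l : D.Pt H, (m.prod l).Fix a × (l.prod n).Fix b =>
      (⟨(z.2.1.1, z.2.2.1), fun q => ?_, ?_⟩ : T)) ⟨fun z z' h => ?_, fun t => ?_⟩)).symm
  · exact BisetComp.smul_mk_eq_iff.2 ⟨z.1.α q, z.2.1.2.1 q, z.2.2.2.1 q⟩
  · exact BisetComp.smul_mk_eq_iff.2 ⟨z.1.s, z.2.1.2.2, z.2.2.2.2⟩
  · obtain ⟨l, ⟨x, hx⟩, ⟨y, hy⟩⟩ := z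
    obtain ⟨l', ⟨x', hx'⟩, ⟨y', hy'⟩⟩ := z'
    have h1 := congrArg (fun t : T => t.1) h
    obtain rfl : x = x' := congrArg Prod.fst h1
    obtain rfl : y = y' := congrArg Prod.snd h1
    obtain rfl : l = l' := ext' (MonoidHom.ext fun q => hX.eq_of_smul_eq (y := x) (g := m.α q)
      ((hx.1 q).trans (hx'.1 q).symm)) (hX.eq_of_smul_eq (y := x) (g := m.s)
      (hx.2.trans hx'.2.symm))
    rfl
  · obtain ⟨⟨x, y⟩, h1, h2⟩ := t
    have h3 : ∀ q, ∃ h : H, (m.α q, h) • x = x ∧ (h, n.α q) • y = y := fun q =>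
      BisetComp.smul_mk_eq_iff.1 (h1 q)
    obtain ⟨l, hl1, hl2⟩ : ∃ l : H, (m.s, l) • x = a.perm x ∧ (l, n.s) • y = b.perm y :=
      BisetComp.smul_mk_eq_iff.1 h2
    obtain ⟨l, hl, rfl⟩ := exists_pt hX a hi m x (fun q => (h3 q).imp fun _ h => h.1) hl1
    refine ⟨⟨l, ⟨x, hl, hl1⟩, ⟨y, fun q => ?_, hl2⟩⟩, rfl⟩
    obtain ⟨h, hh1, hh2⟩ := h3 q
    obtain rfl := hX.eq_of_smul_eq (hh1.trans (hl q).symm)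
    exact hh2

end Comp

end DPair.Pt

end Points

section Chi

variable {k : Type u} [Field k] [IsAlgClosed k] {F : Type v} [Field F] {p : ℕ} [Fact p.Prime]
  [CharP k p] (θ : BrauerLift k F)

namespace DPair.Pt

variable {D : DPair p} {G H K : Type} [Group G] [Group H] [Group K] [Finite G] [Finite H] [Finite K]

theorem tau_twist {X : Type} [MulAction G X] [Finite X] {n : ℕ} [NeZero n] [NeZero (n : k)]
    (m : D.Pt G) (a : SetAut G X n) : m.toPair.tau θ (a.twist θ 1) = (Nat.card (m.Fix a) : F) := by
  rw [PPair.tau_twist]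
  refine congrArg _ (Nat.card_congr (Equiv.subtypeEquivRight fun x => ?_))
  rw [m.forall_mem_toPair fun g => g • x = x]
  rfl

/-- The linear form on `F T^Δ(G, H)` attached to embeddings of a `D^Δ`-pair in `G` and in `H`. -/
def chi (m : D.Pt G) (n : D.Pt H) : DiagGroup k F G H →ₗ[F] F :=
  (m.prod n).toPair.tau θ ∘ₗ toPPerm

theorem chi_diagTwist {X : Type} [MulAction (G × H) X] [Finite X] {i : ℕ} [NeZero i]
    [NeZero (i : k)] (m : D.Pt G) (n : D.Pt H) (a : SetAut (G × H) X i) (hX : IsBifree G H X) :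
    chi θ m n (a.diagTwist hX θ) = (Nat.card ((m.prod n).Fix a) : F) := by
  rw [chi, LinearMap.comp_apply, SetAut.toPPerm_diagTwist, tau_twist]

variable [CharZero F]

/-- The linear forms `chi` are multiplicative. -/
theorem chi_diagMul (m : D.Pt G) (n : D.Pt K) (x : DiagGroup k F G H) (y : DiagGroup k F H K) :
    chi θ m n (diagMul k F G H K x y) =
      (Nat.card H : F)⁻¹ * ∑ l : D.Pt H, chi θ m l x * chi θ l n y := by
  have hx : x ∈ Submodule.span F (Set.range fun c : {c : PPair p (G × H) // c.IsDiag} =>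
      c.1.diagTwist θ c.2) := by rw [PPair.span_diagTwist]; trivial
  have hy : y ∈ Submodule.span F (Set.range fun c : {c : PPair p (H × K) // c.IsDiag} =>
      c.1.diagTwist θ c.2) := by rw [PPair.span_diagTwist]; trivial
  induction hx using Submodule.span_induction with
  | zero => simp
  | add x x' _ _ h h' => simp only [map_add, LinearMap.add_apply, h, h', add_mul, mul_add,
      Finset.sum_add_distrib]
  | smul r x _ h =>
    simp only [map_smul, LinearMap.smul_apply, h, smul_eq_mul, mul_assoc, ← Finset.mul_sum]
    rw [mul_left_comm]
  | mem x hx =>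
    induction hy using Submodule.span_induction with
    | zero => simp
    | add x x' _ _ h h' => simp only [map_add, h, h', mul_add, Finset.sum_add_distrib]
    | smul r x _ h =>
      simp only [map_smul, h, smul_eq_mul, mul_left_comm _ r, ← Finset.mul_sum]
    | mem y hy =>
      obtain ⟨c, rfl⟩ := hx
      obtain ⟨d, rfl⟩ := hy
      have h1 := card_fix_comp c.2.isBifree (cosetAut c.1.Q c.1.s c.1.mem)
        (cosetAut d.1.Q d.1.s d.1.mem) c.1.coprime m n
      have hH : (Nat.card H : F) ≠ 0 := Nat.cast_ne_zero.2 Nat.card_pos.ne'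
      rw [eq_inv_mul_iff_mul_eq₀ hH]
      have h2 := congrArg (fun i : ℕ => (i : F)) h1
      simp only [Nat.cast_mul, Nat.cast_sum] at h2
      refine Eq.trans ?_ (h2.trans ?_)
      · rw [mul_comm]
        refine congrArg₂ (· * ·) ?_ rfl
        refine (PPair.tau_diagMul_diagTwist θ _ c.2.isBifree _ d.2.isBifree _).trans ?_
        refine congrArg _ (Nat.card_congr (Equiv.subtypeEquivRight fun z => ?_))
        rw [(m.prod n).forall_mem_toPair fun g => g • z = z]
        rfl
      · refine Finset.sum_congr rfl fun l _ => ?_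
        exact congrArg₂ (· * ·) (chi_diagTwist θ m l _ c.2.isBifree).symm
          (chi_diagTwist θ l n _ d.2.isBifree).symm

theorem exists_toPair_eq (c : PPair p G) : ∃ (D : DPair p) (m : D.Pt G), m.toPair = c := by
  let u : MulAut c.Q := Subgroup.normalizerMonoidHom c.Q ⟨c.s, c.mem⟩
  let D : DPair p := ⟨c.Q, c.isPGroup, u, by
    refine Nat.Coprime.coprime_dvd_left (orderOf_map_dvd _ _) ?_
    rw [← Subgroup.orderOf_coe]
    exact c.coprime⟩
  let m : D.Pt G := ⟨c.Q.subtype, c.s, fun q h => Subtype.ext h, c.coprime, fun q => rfl⟩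
  exact ⟨D, m, PPair.ext' c.Q.range_subtype rfl⟩

theorem exists_prod_toPair_eq {c : PPair p (G × H)} (hc : c.IsDiag) :
    ∃ (D : DPair p) (m : D.Pt G) (n : D.Pt H), (m.prod n).toPair = c := by
  obtain ⟨D, m, rfl⟩ := exists_toPair_eq c
  refine ⟨D, ⟨(MonoidHom.fst G H).comp m.α, m.s.1, fun q h => m.inj q (Prod.ext h ?_),
    Nat.Coprime.coprime_dvd_left (orderOf_map_dvd (MonoidHom.fst G H) m.s) m.coprime,
      fun q => congrArg Prod.fst (m.comm q)⟩,
    ⟨(MonoidHom.snd G H).comp m.α, m.s.2, fun q h => m.inj q (Prod.ext ?_ h),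
    Nat.Coprime.coprime_dvd_left (orderOf_map_dvd (MonoidHom.snd G H) m.s) m.coprime,
      fun q => congrArg Prod.snd (m.comm q)⟩, rfl⟩
  · exact hc.2 _ ⟨q, Prod.ext h rfl⟩
  · exact hc.1 _ ⟨q, Prod.ext rfl h⟩

/-- The linear forms `chi` separate the elements of `F T^Δ(G, H)`. -/
theorem ext_chi {x y : DiagGroup k F G H}
    (h : ∀ (D : DPair p) (m : D.Pt G) (n : D.Pt H), chi θ m n x = chi θ m n y) : x = y := by
  refine PPair.ext_tau_toPPerm θ fun c hc => ?_
  obtain ⟨D, m, n, rfl⟩ := exists_prod_toPair_eq hc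
  exact h D m n

end DPair.Pt

end Chi

section Symmetries

namespace DPair.Pt

variable {p : ℕ} {D D' D'' : DPair p} {G H K : Type} [Group G] [Group H] [Group K]

/-- Transport of embeddings along an injective homomorphism. -/
def map (f : G ≃* H) (m : D.Pt G) : D.Pt H where
  α := f.toMonoidHom.comp m.α
  s := f m.s
  inj q h := m.inj q (f.injective (h.trans (map_one f).symm))
  coprime := by rw [MulEquiv.orderOf_eq]; exact m.coprime
  comm q := by
    change f m.s * f (m.α q) * (f m.s)⁻¹ = f (m.α (D.u q))
    rw [← m.comm, map_mul, map_mul, map_inv]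

theorem map_map (g : H ≃* K) (f : G ≃* H) (m : D.Pt G) : (m.map f).map g = m.map (f.trans g) := rfl

instance : MulAction G (D.Pt G) where
  smul g m := m.map (MulAut.conj g)
  one_smul m := ext' (MonoidHom.ext fun q => by change 1 * m.α q * 1⁻¹ = m.α q; simp)
    (by change 1 * m.s * 1⁻¹ = m.s; simp)
  mul_smul g h m := ext'
    (MonoidHom.ext fun q => by
      change (g * h) * m.α q * (g * h)⁻¹ = g * (h * m.α q * h⁻¹) * g⁻¹
      group)
    (by
      change (g * h) * m.s * (g * h)⁻¹ = g * (h * m.s * h⁻¹) * g⁻¹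
      group)

theorem eq_iff {m n : D.Pt G} : m = n ↔ (∀ q, m.α q = n.α q) ∧ m.s = n.s :=
  ⟨fun h => by rw [h]; exact ⟨fun _ => rfl, rfl⟩, fun h => ext' (MonoidHom.ext h.1) h.2⟩

theorem map_smul (f : G ≃* H) (g : G) (m : D.Pt G) : (g • m).map f = f g • m.map f :=
  eq_iff.2 ⟨fun q => by
    change f (g * m.α q * g⁻¹) = f g * f (m.α q) * (f g)⁻¹
    simp, by
    change f (g * m.s * g⁻¹) = f g * f m.s * (f g)⁻¹
    simp⟩

/-- Restriction of embeddings along an isomorphism of `D^Δ`-pairs. -/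
def comp (φ : D'.L ≃* D.L) (hφ : ∀ q, φ (D'.u q) = D.u (φ q)) (m : D.Pt G) : D'.Pt G where
  α := m.α.comp φ.toMonoidHom
  s := m.s
  inj q h := (map_eq_one_iff φ φ.injective).1 (m.inj _ h)
  coprime := m.coprime
  comm q := by
    change m.s * m.α (φ q) * m.s⁻¹ = m.α (φ (D'.u q))
    rw [m.comm, hφ]

theorem toPair_comp (φ : D'.L ≃* D.L) (hφ : ∀ q, φ (D'.u q) = D.u (φ q)) (m : D.Pt G) :
    (m.comp φ hφ).toPair = m.toPair :=
  PPair.ext' (by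
    ext x
    refine ⟨?_, ?_⟩
    · rintro ⟨q, rfl⟩
      exact ⟨φ q, rfl⟩
    · rintro ⟨q, rfl⟩
      exact ⟨φ.symm q, congrArg m.α (φ.apply_symm_apply q)⟩) rfl

theorem toPair_smul (g : G) (m : D.Pt G) : m.toPair ≈ (g • m).toPair := by
  refine ⟨g, ?_, rfl⟩
  ext x
  refine ⟨?_, ?_⟩
  · rintro ⟨_, ⟨q, rfl⟩, rfl⟩
    exact ⟨q, rfl⟩
  · rintro ⟨q, rfl⟩
    exact ⟨_, ⟨q, rfl⟩, rfl⟩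

/-- Embeddings whose images are conjugate differ by an isomorphism of `D^Δ`-pairs, up to
conjugation. -/
theorem exists_comp_of_equiv {m : D.Pt G} {n : D'.Pt G} (h : n.toPair ≈ m.toPair) :
    ∃ (φ : D'.L ≃* D.L) (hφ : ∀ q, φ (D'.u q) = D.u (φ q)) (g : G), g • n = m.comp φ hφ := by
  obtain ⟨g, h1, h2⟩ := h
  have hinj : Function.Injective m.α := (injective_iff_map_eq_one _).2 m.inj
  have hinj' : Function.Injective (g • n).α := (injective_iff_map_eq_one _).2 (g • n).inj
  have hr : (g • n).α.range = m.α.range := by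
    rw [← show _ = m.α.range from h1]
    exact (MonoidHom.map_range (MulAut.conj g).toMonoidHom n.α).symm
  let φ : D'.L ≃* D.L := ((MonoidHom.ofInjective hinj').trans (MulEquiv.subgroupCongr hr)).trans
    (MonoidHom.ofInjective hinj).symm
  have hφ : ∀ q, m.α (φ q) = (g • n).α q := fun q =>
    congrArg Subtype.val ((MonoidHom.ofInjective hinj).apply_symm_apply
      (MulEquiv.subgroupCongr hr (MonoidHom.ofInjective hinj' q)))
  have h3 : (g • n).s = m.s := h2
  exact ⟨φ, fun q => hinj (by rw [hφ, ← (g • n).comm, ← m.comm, hφ, h3]), g,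
    eq_iff.2 ⟨fun q => (hφ q).symm, h3⟩⟩

variable {k : Type u} [Field k] [IsAlgClosed k] {F : Type v} [Field F] [CharZero F] [Fact p.Prime]
  [CharP k p] (θ : BrauerLift k F) [Finite G] [Finite H]

theorem chi_smul_smul (g : G) (h : H) (m : D.Pt G) (n : D.Pt H) (x : DiagGroup k F G H) :
    chi θ (g • m) (h • n) x = chi θ m n x :=
  (PPair.tau_eq_of_equiv θ (toPair_smul (g, h) (m.prod n)) _).symm

theorem chi_comp_comp (φ : D'.L ≃* D.L) (hφ : ∀ q, φ (D'.u q) = D.u (φ q)) (m : D.Pt G)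
    (n : D.Pt H) (x : DiagGroup k F G H) : chi θ (m.comp φ hφ) (n.comp φ hφ) x = chi θ m n x := by
  change ((m.prod n).comp φ hφ).toPair.tau θ _ = _
  rw [toPair_comp]
  rfl

end DPair.Pt

end Symmetries

section IsoBisets

variable {G H K : Type} [Group G] [Group H] [Group K]

/-- The `(G, H)`-biset attached to an isomorphism `f : H → G`: the set `G`, where `(g, h)` acts by
`x ↦ g x f(h)⁻¹`. -/
def IsoBiset (_f : H ≃* G) : Type := G

instance [h : Finite G] (f : H ≃* G) : Finite (IsoBiset f) := h

instance (f : H ≃* G) : MulAction (G × H) (IsoBiset f) where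
  smul a x := (a.1 * (show G from x) * (f a.2)⁻¹ : G)
  one_smul := show ∀ x : G, 1 * x * (f 1)⁻¹ = x by simp
  mul_smul a b := show ∀ x : G, (a.1 * b.1) * x * (f (a.2 * b.2))⁻¹ =
      a.1 * (b.1 * x * (f b.2)⁻¹) * (f a.2)⁻¹ by simp [mul_assoc]

theorem isBifree_isoBiset (f : H ≃* G) : IsBifree G H (IsoBiset f) := by
  refine ⟨fun g => show ∀ x : G, g * x * (f 1)⁻¹ = x → g = 1 by simp,
    fun g => show ∀ x : G, 1 * x * (f g)⁻¹ = x → g = 1 by simp⟩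

/-- The trivial automorphism. -/
def SetAut.refl (Γ X : Type) [Group Γ] [MulAction Γ X] : SetAut Γ X 1 :=
  ⟨1, fun _ _ => rfl, one_pow 1⟩

namespace DPair.Pt

variable {p : ℕ} {D : DPair p}

/-- The number of elements of `G` which conjugate `f ∘ n` to `m`. -/
def isoCount (f : H ≃* G) (m : D.Pt G) (n : D.Pt H) : ℕ := Nat.card {x : G // x • n.map f = m}

theorem card_fix_isoBiset (f : H ≃* G) (m : D.Pt G) (n : D.Pt H) :
    Nat.card ((m.prod n).Fix (SetAut.refl (G × H) (IsoBiset f))) = isoCount f m n := by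
  refine Nat.card_congr (Equiv.subtypeEquivRight fun x => ?_)
  rw [eq_iff]
  refine and_congr (forall_congr' fun q => ?_) ?_
  · change m.α q * (show G from x) * (f (n.α q))⁻¹ = (show G from x) ↔
      (show G from x) * f (n.α q) * (show G from x)⁻¹ = m.α q
    rw [mul_inv_eq_iff_eq_mul, mul_inv_eq_iff_eq_mul, eq_comm]
  · change m.s * (show G from x) * (f n.s)⁻¹ = (show G from x) ↔
      (show G from x) * f n.s * (show G from x)⁻¹ = m.s
    rw [mul_inv_eq_iff_eq_mul, mul_inv_eq_iff_eq_mul, eq_comm]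

theorem sum_isoCount_mul [Finite G] [Finite H] (f : H ≃* G) (g : K ≃* H) (m : D.Pt G) (n : D.Pt K) :
    ∑ l : D.Pt H, isoCount f m l * isoCount g l n = Nat.card H * isoCount (g.trans f) m n := by
  have h1 : ∑ l : D.Pt H, isoCount f m l * isoCount g l n =
      Nat.card (Σ l : D.Pt H, {x : G // x • l.map f = m} × {y : H // y • n.map g = l}) := by
    rw [Nat.card_sigma]
    exact Finset.sum_congr rfl fun l _ => (Nat.card_prod _ _).symm
  rw [h1, isoCount, ← Nat.card_prod]
  refine Nat.card_congr
    { toFun := fun z => (z.2.2.1, ⟨z.2.1.1 * f z.2.2.1, ?_⟩)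
      invFun := fun z => ⟨z.1 • n.map g, ⟨z.2.1 * (f z.1)⁻¹, ?_⟩, ⟨z.1, rfl⟩⟩
      left_inv := ?_
      right_inv := fun z => Prod.ext rfl (Subtype.ext (inv_mul_cancel_right _ _)) }
  · obtain ⟨l, ⟨x, hx⟩, ⟨y, rfl⟩⟩ := z
    change (x * f y) • (n.map g).map f = m
    rw [mul_smul, ← map_smul, hx]
  · rw [map_smul, smul_smul, inv_mul_cancel_right]
    exact z.2.2
  · rintro ⟨l, ⟨x, hx⟩, ⟨y, rfl⟩⟩
    refine congrArg (fun w => (⟨y • n.map g, w, ⟨y, rfl⟩⟩ :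
      Σ l : D.Pt H, {x : G // x • l.map f = m} × {y : H // y • n.map g = l})) (Subtype.ext ?_)
    exact mul_inv_cancel_right x (f y)

end DPair.Pt

end IsoBisets

section IsoClasses

variable {k : Type u} [Field k] [IsAlgClosed k] {F : Type v} [Field F] (θ : BrauerLift k F)
  {G H K : Type} [Group G] [Group H] [Group K] [Finite G] [Finite H] [Finite K]

instance : NeZero ((1 : ℕ) : k) := ⟨by simp⟩

/-- The class of the bimodule attached to an isomorphism. -/
def isoClass (f : H ≃* G) : DiagGroup k F G H :=
  (SetAut.refl (G × H) (IsoBiset f)).diagTwist (isBifree_isoBiset f) θ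

variable {p : ℕ} [Fact p.Prime] [CharP k p] {D : DPair p} 

theorem DPair.Pt.chi_isoClass (f : H ≃* G) (m : D.Pt G) (n : D.Pt H) :
    chi θ m n (isoClass θ f) = (isoCount f m n : F) := by
  rw [isoClass, chi_diagTwist, card_fix_isoBiset]

theorem diagMul_isoClass (p : ℕ) [Fact p.Prime] [CharP k p] [CharZero F] (f : H ≃* G) (g : K ≃* H) :
    diagMul k F G H K (isoClass θ f) (isoClass θ g) = isoClass θ (g.trans f) := by
  refine DPair.Pt.ext_chi (p := p) θ fun D m n => ?_
  rw [DPair.Pt.chi_diagMul]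
  simp only [DPair.Pt.chi_isoClass]
  have hH : (Nat.card H : F) ≠ 0 := Nat.cast_ne_zero.2 Nat.card_pos.ne'
  rw [inv_mul_eq_iff_eq_mul₀ hH]
  exact_mod_cast DPair.Pt.sum_isoCount_mul f g m n

theorem isoClass_eq_autClass (γ : MulAut G) : isoClass θ γ = autClass k F γ := by
  have h1 : Subsingleton (rootsOfUnity 1 k) := ⟨fun a b => by
    have ha := a.2
    have hb := b.2
    rw [mem_rootsOfUnity, pow_one] at ha hb
    exact Subtype.ext (ha.trans hb.symm)⟩
  rw [isoClass, SetAut.diagTwist, Fintype.sum_subsingleton _ (1 : rootsOfUnity 1 k), map_one,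
    one_smul, autClass]
  refine congrArg _ (Subtype.ext ((cls_eq_iff _ _).2 ⟨?_⟩))
  let A := SetAut.refl (G × G) (IsoBiset γ)
  have h2 : ∀ f : IsoBiset γ → k, f ∈ A.eig k (rootsVal k 1 1) := fun f x => by
    rw [map_one, one_mul]
    rfl
  let e : k[G] ≃ₗ[k] A.eig k (rootsVal k 1 1) :=
    { toFun := fun y => ⟨fun x => y.coeff x, h2 _⟩
      map_add' := fun _ _ => rfl
      map_smul' := fun _ _ => rfl
      invFun := fun f => (MonoidAlgebra.coeffLinearEquiv k).symm
        ((Finsupp.linearEquivFunOnFinite k k G).symm f.1)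
      left_inv := fun y => by ext; rfl
      right_inv := fun f => rfl }
  refine (Representation.Equiv.mk e fun a => ?_).symm
  refine MonoidAlgebra.lhom_ext' fun g => LinearMap.ext_ring (Subtype.ext (funext fun x => ?_))
  have h3 : ∀ x : G, (autRep k γ a (MonoidAlgebra.single g 1)).coeff x =
      (MonoidAlgebra.single g (1 : k)).coeff (a.1⁻¹ * x * (γ a.2⁻¹)⁻¹) := by
    classical
    intro x
    rw [autRep_single, MonoidAlgebra.coeff_single, MonoidAlgebra.coeff_single,
      Finsupp.single_apply, Finsupp.single_apply]
    refine if_congr ?_ rfl rfl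
    rw [map_inv, inv_inv, mul_inv_eq_iff_eq_mul, mul_assoc, eq_inv_mul_iff_mul_eq]
  exact h3 x

end IsoClasses

section Tilde

variable {G : Type} [Group G]

/-- The `(G, G)`-biset induced from a `G`-set along the diagonal. -/
def DiagBiset (G X : Type) : Type := G × X

instance (X : Type) [Finite G] [Finite X] : Finite (DiagBiset G X) :=
  inferInstanceAs (Finite (G × X))

instance (X : Type) [MulAction G X] : MulAction (G × G) (DiagBiset G X) where
  smul a y := (a.1 * y.1 * a.2⁻¹, a.1 • y.2)
  one_smul := show ∀ y : G × X, (1 * y.1 * 1⁻¹, (1 : G) • y.2) = y by simp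
  mul_smul a b y := by
    change ((a.1 * b.1) * y.1 * (a.2 * b.2)⁻¹, (a.1 * b.1) • y.2) =
      (a.1 * (b.1 * y.1 * b.2⁻¹) * a.2⁻¹, a.1 • b.1 • y.2)
    simp [mul_assoc, mul_smul]

theorem isBifree_diagBiset (X : Type) [MulAction G X] : IsBifree G G (DiagBiset G X) := by
  refine ⟨fun g x h => ?_, fun g x h => ?_⟩
  · have h1 : g * x.1 * 1⁻¹ = x.1 := congrArg Prod.fst h
    simpa using h1
  · have h1 : 1 * x.1 * g⁻¹ = x.1 := congrArg Prod.fst h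
    simpa using h1

/-- The automorphism induced on the induced biset. -/
def SetAut.diag {X : Type} [MulAction G X] {n : ℕ} (a : SetAut G X n) :
    SetAut (G × G) (DiagBiset G X) n where
  perm := Equiv.prodCongr (Equiv.refl G) a.perm
  smul g y := Prod.ext rfl (a.smul g.1 y.2)
  pow_eq := by
    have h : ∀ (A : Equiv.Perm (DiagBiset G X)), (∀ y, A y = (y.1, a.perm y.2)) →
        ∀ (j : ℕ) y, (A ^ j) y = (y.1, (a.perm ^ j) y.2) := by
      intro A hA j y
      induction j with
      | zero => rfl
      | succ j ih => rw [pow_succ', Equiv.Perm.mul_apply, ih, pow_succ']; exact hA _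
    ext1 y
    rw [h (Equiv.prodCongr (Equiv.refl G) a.perm) fun _ => rfl, a.pow_eq]
    rfl

theorem DPair.Pt.card_fix_diag {p : ℕ} {D : DPair p} {X : Type} [MulAction G X] {i : ℕ}
    (a : SetAut G X i) (m n : D.Pt G) :
    Nat.card ((m.prod n).Fix a.diag) = isoCount (MulEquiv.refl G) m n * Nat.card (m.Fix a) := by
  rw [isoCount, ← Nat.card_prod]
  refine Nat.card_congr
    { toFun := fun z => (⟨z.1.1, ?_⟩, ⟨z.1.2, fun q => congrArg Prod.snd (z.2.1 q),
        congrArg Prod.snd z.2.2⟩)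
      invFun := fun z => ⟨(z.1.1, z.2.1), fun q => Prod.ext ?_ (z.2.2.1 q), Prod.ext ?_ z.2.2.2⟩
      left_inv := fun z => rfl
      right_inv := fun z => rfl }
  · refine eq_iff.2 ⟨fun q => ?_, ?_⟩
    · have h1 : m.α q * z.1.1 * (n.α q)⁻¹ = z.1.1 := congrArg Prod.fst (z.2.1 q)
      change z.1.1 * n.α q * z.1.1⁻¹ = m.α q
      rw [mul_inv_eq_iff_eq_mul] at h1 ⊢
      exact h1.symm
    · have h1 : m.s * z.1.1 * (n.s)⁻¹ = z.1.1 := congrArg Prod.fst z.2.2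
      change z.1.1 * n.s * z.1.1⁻¹ = m.s
      rw [mul_inv_eq_iff_eq_mul] at h1 ⊢
      exact h1.symm
  · have h1 : z.1.1 * n.α q * z.1.1⁻¹ = m.α q := (eq_iff.1 z.1.2).1 q
    change m.α q * z.1.1 * (n.α q)⁻¹ = z.1.1
    rw [mul_inv_eq_iff_eq_mul] at h1 ⊢
    exact h1.symm
  · have h1 : z.1.1 * n.s * z.1.1⁻¹ = m.s := (eq_iff.1 z.1.2).2
    change m.s * z.1.1 * (n.s)⁻¹ = z.1.1
    rw [mul_inv_eq_iff_eq_mul] at h1 ⊢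
    exact h1.symm

variable {k : Type u} [Field k] [IsAlgClosed k] {F : Type v} [Field F] (θ : BrauerLift k F) [Finite G]

theorem tilde_gcls (x : ppermClasses k G) : tilde F (gcls F x) = gcls F (indClass k G x) :=
  extend_gcls _ _

/-- The eigenspaces of the induced automorphism are the induced eigenspaces. -/
def SetAut.diagEigEquiv {X : Type} [MulAction G X] {n : ℕ} (a : SetAut G X n) (c : k) :
    (indDiag (a.eigRep k c)).Equiv (a.diag.eigRep k c) :=
  .mk
    { toFun := fun f => ⟨fun y => (f y.1 : X → k) y.2, fun y => (f y.1).2 y.2⟩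
      map_add' := fun _ _ => rfl
      map_smul' := fun _ _ => rfl
      invFun := fun f => fun g => ⟨fun x => (f : DiagBiset G X → k) (g, x), fun x => f.2 (g, x)⟩
      left_inv := fun _ => rfl
      right_inv := fun _ => rfl } fun b => by
    refine LinearMap.ext fun f => Subtype.ext (funext fun y => ?_)
    change (f (b.1⁻¹ * y.1 * b.2) : X → k) (b.1⁻¹ • y.2) =
      (f (b.1⁻¹ * y.1 * (b.2⁻¹)⁻¹) : X → k) (b.1⁻¹ • y.2)
    rw [inv_inv]

theorem indClass_cls {V : Type w} [AddCommGroup V] [Module k V] [Module.Finite k V]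
    (ρ : Representation k G V) (h : cls ρ ∈ ppermClasses k G) :
    (indClass k G ⟨cls ρ, h⟩ : IsoClass k (G × G)) = cls (indDiag ρ) :=
  (cls_eq_iff _ _).2 ⟨indDiagCongr (transportEquiv _ _).symm⟩

theorem tilde_twist {X : Type} [MulAction G X] [Finite X] {n : ℕ} [NeZero n] [NeZero (n : k)]
    (a : SetAut G X n) : tilde F (a.twist θ 1) = a.diag.diagTwist (isBifree_diagBiset X) θ := by
  rw [SetAut.twist, map_sum, SetAut.diagTwist]
  refine Finset.sum_congr rfl fun ζ _ => ?_
  rw [_root_.map_smul, tilde_gcls, pow_one]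
  refine congrArg _ (congrArg _ (Subtype.ext ?_))
  exact (indClass_cls _ _).trans ((cls_eq_iff _ _).2 ⟨a.diagEigEquiv _⟩)

theorem DPair.Pt.chi_tilde {p : ℕ} [Fact p.Prime] [CharP k p] [CharZero F] {D : DPair p}
    (m n : D.Pt G) (x : PPermGroup k F G) :
    chi θ m n (tilde F x) = (isoCount (MulEquiv.refl G) m n : F) * m.toPair.tau θ x := by
  have hx : x ∈ Submodule.span F (Set.range fun c : PPair p G => c.twist θ) := by
    rw [PPair.span_twist]; trivial
  induction hx using Submodule.span_induction with
  | zero => simp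
  | add x y _ _ hx hy => simp only [map_add, hx, hy, mul_add]
  | smul r x _ hx => simp only [_root_.map_smul, hx, smul_eq_mul, mul_left_comm]
  | mem x hx =>
    obtain ⟨c, rfl⟩ := hx
    change chi θ m n (tilde F ((cosetAut c.Q c.s c.mem).twist θ 1)) =
      _ * m.toPair.tau θ ((cosetAut c.Q c.s c.mem).twist θ 1)
    rw [tilde_twist, chi_diagTwist, card_fix_diag, tau_twist, Nat.cast_mul]

end Tilde

section Averages

namespace DPair.Pt

variable {p : ℕ} {D : DPair p} {G H K : Type} [Group G] [Group H] [Group K]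

open Classical in
theorem isoCount_eq_sum [Fintype G] (f : H ≃* G) (m : D.Pt G) (n : D.Pt H) :
    isoCount f m n = ∑ y : G, if y • n.map f = m then 1 else 0 := by
  rw [isoCount, Nat.card_eq_fintype_card, Fintype.card_subtype, Finset.card_filter]

theorem sum_isoCount_left {F : Type v} [Field F] [Finite G] [Finite H] (f : H ≃* G) (m : D.Pt G)
    (c : D.Pt H → F) (hc : ∀ (h : H) l, c (h • l) = c l) :
    ∑ l : D.Pt H, (isoCount f m l : F) * c l = Nat.card G * c (m.map f.symm) := by
  classical
  have := Fintype.ofFinite G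
  simp only [isoCount_eq_sum, Nat.cast_sum, Finset.sum_mul]
  rw [Finset.sum_comm, Nat.card_eq_fintype_card, ← nsmul_eq_mul, ← Finset.card_univ, ← Finset.sum_const]
  refine Finset.sum_congr rfl fun y _ => ?_
  rw [Finset.sum_eq_single (f.symm y⁻¹ • m.map f.symm)]
  · rw [hc, if_pos ?_, Nat.cast_one, one_mul]
    rw [map_smul, map_map, f.apply_symm_apply, smul_smul, mul_inv_cancel, one_smul]
    exact eq_iff.2 ⟨fun q => f.apply_symm_apply _, f.apply_symm_apply _⟩
  · intro l _ hl
    rw [if_neg, Nat.cast_zero, zero_mul]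
    rintro rfl
    refine hl ?_
    rw [map_smul, smul_smul, ← map_mul, inv_mul_cancel, map_one, one_smul]
    exact eq_iff.2 ⟨fun q => (f.symm_apply_apply _).symm, (f.symm_apply_apply _).symm⟩
  · simp

theorem sum_isoCount_right {F : Type v} [Field F] [Finite G] (f : H ≃* G) (n : D.Pt H)
    (c : D.Pt G → F) (hc : ∀ (g : G) l, c (g • l) = c l) :
    ∑ l : D.Pt G, c l * (isoCount f l n : F) = Nat.card G * c (n.map f) := by
  classical
  have := Fintype.ofFinite G
  simp only [isoCount_eq_sum, Nat.cast_sum, Finset.mul_sum]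
  rw [Finset.sum_comm, Nat.card_eq_fintype_card, ← nsmul_eq_mul, ← Finset.card_univ, ← Finset.sum_const]
  refine Finset.sum_congr rfl fun y _ => ?_
  rw [Finset.sum_eq_single (y • n.map f)]
  · rw [hc, if_pos rfl, Nat.cast_one, mul_one]
  · intro l _ hl
    rw [if_neg hl.symm, Nat.cast_zero, mul_zero]
  · simp

variable {k : Type u} [Field k] [IsAlgClosed k] {F : Type v} [Field F] [CharZero F] [Fact p.Prime]
  [CharP k p] (θ : BrauerLift k F) [Finite G] [Finite H] [Finite K]

theorem chi_smul_left (g : G) (m : D.Pt G) (n : D.Pt H) (x : DiagGroup k F G H) :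
    chi θ (g • m) n x = chi θ m n x := by
  simpa using chi_smul_smul θ g (1 : H) m n x

theorem chi_smul_right (h : H) (m : D.Pt G) (n : D.Pt H) (x : DiagGroup k F G H) :
    chi θ m (h • n) x = chi θ m n x := by
  simpa using chi_smul_smul θ (1 : G) h m n x

theorem chi_tilde_mul (y : PPermGroup k F G) (x : DiagGroup k F G H) (m : D.Pt G) (n : D.Pt H) :
    chi θ m n (diagMul k F G G H (tilde F y) x) = m.toPair.tau θ y * chi θ m n x := by
  have hH : (Nat.card G : F) ≠ 0 := Nat.cast_ne_zero.2 Nat.card_pos.ne'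
  rw [chi_diagMul]
  simp only [chi_tilde, mul_assoc]
  rw [sum_isoCount_left (.refl G) m (fun l => m.toPair.tau θ y * chi θ l n x)
    fun h l => by rw [chi_smul_left], inv_mul_cancel_left₀ hH]
  rfl

theorem chi_mul_tilde (y : PPermGroup k F H) (x : DiagGroup k F G H) (m : D.Pt G) (n : D.Pt H) :
    chi θ m n (diagMul k F G H H x (tilde F y)) = chi θ m n x * n.toPair.tau θ y := by
  have hH : (Nat.card H : F) ≠ 0 := Nat.cast_ne_zero.2 Nat.card_pos.ne'
  rw [chi_diagMul]
  have h1 : ∑ l : D.Pt H, chi θ m l x * chi θ l n (tilde F y) =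
      ∑ l : D.Pt H, chi θ m l x * l.toPair.tau θ y * (isoCount (.refl H) l n : F) :=
    Finset.sum_congr rfl fun l _ => by rw [chi_tilde, mul_assoc, mul_comm (isoCount _ _ _ : F)]
  rw [h1, sum_isoCount_right (.refl H) n (fun l => chi θ m l x * l.toPair.tau θ y)
    fun h l => by rw [chi_smul_right, PPair.tau_eq_of_equiv θ (toPair_smul h l)],
    inv_mul_cancel_left₀ hH]
  rfl

end DPair.Pt

theorem isoClass_conj {k : Type u} [Field k] [IsAlgClosed k] {F : Type v} [Field F] [CharZero F]
    (p : ℕ) [Fact p.Prime] [CharP k p] (θ : BrauerLift k F) {G : Type} [Group G] [Finite G] (g : G) :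
    isoClass θ (MulAut.conj g : MulAut G) = isoClass θ (1 : MulAut G) := by
  refine DPair.Pt.ext_chi (p := p) θ fun D m n => ?_
  rw [DPair.Pt.chi_isoClass, DPair.Pt.chi_isoClass]
  refine congrArg _ (Nat.card_congr ((Equiv.mulRight g).subtypeEquiv fun x => ?_))
  rw [Equiv.coe_mulRight, mul_smul]
  rfl

end Averages

section Idempotents

namespace DPair

variable {p : ℕ} (D : DPair p)

/-- The tautological embedding of `(L, u)` in `L⟨u⟩`. -/
def pt : D.Pt D.grp where
  α := SemidirectProduct.inl
  s := D.gen
  inj q h := SemidirectProduct.inl_injective (h.trans (map_one _).symm)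
  coprime := by
    refine Nat.Coprime.coprime_dvd_left (orderOf_map_dvd SemidirectProduct.inr _) ?_
    rw [← Subgroup.orderOf_coe]
    exact D.coprime
  comm q := by
    change SemidirectProduct.inr _ * SemidirectProduct.inl q * (SemidirectProduct.inr _)⁻¹ = _
    rw [← map_inv, ← SemidirectProduct.inl_aut]
    rfl

variable {D}

theorem hom_ext {M : Type*} [Group M] {f g : D.grp →* M}
    (h1 : ∀ q, f (D.pt.α q) = g (D.pt.α q)) (h2 : f D.gen = g D.gen) : f = g := by
  refine SemidirectProduct.hom_ext (MonoidHom.ext fun q => h1 q) ?_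
  refine MonoidHom.ext fun ⟨x, hx⟩ => ?_
  obtain ⟨j, rfl⟩ := (mem_powers_iff_mem_zpowers (x := D.u)).2 hx
  have h3 : (⟨D.u ^ j, hx⟩ : Subgroup.zpowers D.u) = ⟨D.u, Subgroup.mem_zpowers D.u⟩ ^ j := rfl
  change f (SemidirectProduct.inr _) = g (SemidirectProduct.inr _)
  rw [h3, map_pow, map_pow, map_pow]
  exact congrArg (· ^ j) h2

theorem mem_sub_iff [Fact p.Prime] (x : D.grp) : x ∈ D.sub ↔ ∃ j, orderOf x = p ^ j := by
  constructor
  · rintro ⟨q, rfl⟩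
    rw [orderOf_injective _ SemidirectProduct.inl_injective]
    exact IsPGroup.iff_orderOf.1 D.isPGroup q
  · rintro ⟨j, hj⟩
    have h1 : (orderOf (SemidirectProduct.rightHom x)).Coprime p :=
      Nat.Coprime.coprime_dvd_left ((orderOf_dvd_natCard _).trans (by rw [Nat.card_zpowers]))
        D.coprime
    have h2 : orderOf (SemidirectProduct.rightHom x) ∣ p ^ j := hj ▸ orderOf_map_dvd _ x
    have h3 := Nat.Coprime.eq_one_of_dvd (h1.pow_right j) h2
    rw [sub, SemidirectProduct.range_inl_eq_ker_rightHom]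
    exact orderOf_eq_one_iff.1 h3

theorem map_pt_equiv [Fact p.Prime] {D' : DPair p} (f : D.grp ≃* D'.grp) (h : IsConj (f D.gen) D'.gen) :
    (D.pt.map f).toPair ≈ D'.pt.toPair := by
  obtain ⟨g, hg⟩ := isConj_iff.1 h
  refine ⟨g, ?_, hg⟩
  ext x
  change x ∈ Subgroup.map _ _ ↔ x ∈ D'.sub
  rw [mem_sub_iff]
  constructor
  · rintro ⟨_, ⟨q, rfl⟩, rfl⟩
    obtain ⟨j, hj⟩ := (mem_sub_iff (D.pt.α q)).1 ⟨q, rfl⟩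
    refine ⟨j, ?_⟩
    rw [← hj, ← f.orderOf_eq]
    exact MulEquiv.orderOf_eq (MulAut.conj g) _
  · intro hx
    rw [← ((MulAut.conj g)⁻¹ : MulAut D'.grp).orderOf_eq, ← f.symm.orderOf_eq, ← mem_sub_iff] at hx
    obtain ⟨q, hq⟩ := hx
    refine ⟨f (D.pt.α q), ⟨q, rfl⟩, ?_⟩
    change MulAut.conj g (f (SemidirectProduct.inl q)) = x
    rw [hq, f.apply_symm_apply]
    exact MulAut.apply_inv_self _ _ _

/-- Isomorphism of `D^Δ`-pairs. -/
def Iso (D D' : DPair p) : Prop := ∃ φ : D.L ≃* D'.L, ∀ q, φ (D.u q) = D'.u (φ q)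

variable {k : Type u} [Field k] [IsAlgClosed k] {F : Type v} [Field F] [CharZero F] [Fact p.Prime]
  [CharP k p] (θ : BrauerLift k F) {G H : Type} [Group G] [Group H] [Finite G] [Finite H]

variable (D) in
/-- The idempotent of `F T^Δ(L⟨u⟩, L⟨u⟩)` attached to `(L, u)`. -/
def idem : DiagGroup k F D.grp D.grp := tilde F (pairIdempotent p θ D.sub D.gen)

end DPair

end Idempotents

section Idempotents

namespace DPair

variable {p : ℕ} {D D' : DPair p}

theorem Pt.map_equiv_map {G H : Type} [Group G] [Group H] (f : G ≃* H) {m : D.Pt G} {n : D'.Pt G}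
    (h : m.toPair ≈ n.toPair) : (m.map f).toPair ≈ (n.map f).toPair := by
  obtain ⟨g, h1, h2⟩ := h
  refine ⟨f g, ?_, ?_⟩
  · change (f.toMonoidHom.comp m.α).range.map _ = (f.toMonoidHom.comp n.α).range
    have h3 : m.α.range.map (MulAut.conj g).toMonoidHom = n.α.range := h1
    rw [MonoidHom.range_comp, MonoidHom.range_comp, ← h3, Subgroup.map_map, Subgroup.map_map]
    refine congrArg (fun e => Subgroup.map e m.α.range) (MonoidHom.ext fun x => ?_)
    change f g * f x * (f g)⁻¹ = f (g * x * g⁻¹)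
    simp
  · change f g * f m.s * (f g)⁻¹ = f n.s
    rw [← map_inv, ← map_mul, ← map_mul]
    exact congrArg f h2

theorem exists_mulEquiv (φ : D.L ≃* D'.L) (hφ : ∀ q, φ (D.u q) = D'.u (φ q)) :
    ∃ f : D.grp ≃* D'.grp, D.pt.map f = D'.pt.comp φ hφ := by
  have h1 : MulAut.congr φ D.u = D'.u := MulEquiv.ext fun q => by
    change φ (D.u (φ.symm q)) = _
    rw [hφ, φ.apply_symm_apply]
  have h2 : (Subgroup.zpowers D.u).map (MulAut.congr φ).toMonoidHom = Subgroup.zpowers D'.u := by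
    rw [MonoidHom.map_zpowers]
    exact congrArg _ h1
  let e : Subgroup.zpowers D.u ≃* Subgroup.zpowers D'.u :=
    ((MulAut.congr φ).subgroupMap (Subgroup.zpowers D.u)).trans (MulEquiv.subgroupCongr h2)
  refine ⟨SemidirectProduct.congr φ e fun g => ?_, ?_⟩
  · ext q
    change φ (g.1 q) = φ (g.1 (φ.symm (φ q)))
    rw [φ.symm_apply_apply]
  · refine Pt.eq_iff.2 ⟨fun q => ?_, ?_⟩
    · exact SemidirectProduct.ext rfl (map_one e)
    · exact SemidirectProduct.ext (map_one φ) (Subtype.ext h1)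

/-- The group of automorphisms of a `D^Δ`-pair. -/
abbrev autPair (D : DPair p) : Subgroup (MulAut D.L) := Subgroup.centralizer {D.u}

theorem autPair_comm (ρ : D.autPair) (q : D.L) : (ρ : MulAut D.L) (D.u q) = D.u ((ρ : MulAut D.L) q) :=
  (DFunLike.congr_fun (Subgroup.mem_centralizer_iff.1 ρ.2 D.u rfl) q).symm

/-- The tautological embedding, composed with an automorphism. -/
def ptComp (ρ : D.autPair) : D.Pt D.grp := D.pt.comp ρ.1 (autPair_comm ρ)

theorem exists_aut (ρ : D.autPair) : ∃ γ : D.aut, D.pt.map γ.1 = ptComp ρ := by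
  obtain ⟨f, hf⟩ := exists_mulEquiv ρ.1 (autPair_comm ρ)
  have h1 : f D.gen = D.gen := congrArg Pt.s hf
  exact ⟨⟨f, by
    change IsConj _ (f D.gen)
    rw [h1]⟩, hf⟩

variable {k : Type u} [Field k] [IsAlgClosed k] {F : Type v} [Field F] [CharZero F] [Fact p.Prime]
  [CharP k p] (θ : BrauerLift k F) {G H : Type} [Group G] [Group H] [Finite G] [Finite H]
  {D'' : DPair p}

open Classical in
theorem chi_idem_mul (x : DiagGroup k F D.grp H) (m : D'.Pt D.grp) (n : D'.Pt H) :
    Pt.chi θ m n (diagMul k F D.grp D.grp H (D.idem θ) x) =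
      if m.toPair ≈ D.pt.toPair then Pt.chi θ m n x else 0 := by
  rw [idem, Pt.chi_tilde_mul]
  refine (congrArg (· * _) (PPair.tau_pairIdempotent θ D.pt.toPair m.toPair)).trans ?_
  rw [ite_mul, one_mul, zero_mul]

open Classical in
theorem chi_mul_idem (x : DiagGroup k F H D.grp) (m : D'.Pt H) (n : D'.Pt D.grp) :
    Pt.chi θ m n (diagMul k F H D.grp D.grp x (D.idem θ)) =
      if n.toPair ≈ D.pt.toPair then Pt.chi θ m n x else 0 := by
  rw [idem, Pt.chi_mul_tilde]
  refine (congrArg (_ * ·) (PPair.tau_pairIdempotent θ D.pt.toPair n.toPair)).trans ?_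
  rw [mul_ite, mul_one, mul_zero]

open Classical in
theorem chi_idem_mul_mul_idem (x : DiagGroup k F D.grp D'.grp) (m : D''.Pt D.grp)
    (n : D''.Pt D'.grp) :
    Pt.chi θ m n (diagMul k F D.grp D.grp D'.grp (D.idem θ) (diagMul k F D.grp D'.grp D'.grp x (D'.idem θ))) =
      if m.toPair ≈ D.pt.toPair ∧ n.toPair ≈ D'.pt.toPair then Pt.chi θ m n x else 0 := by
  rw [chi_idem_mul, chi_mul_idem, ite_and]

theorem idem_mul_idem_mul (x : DiagGroup k F D.grp H) :
    diagMul k F D.grp D.grp H (D.idem θ) (diagMul k F D.grp D.grp H (D.idem θ) x) =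
      diagMul k F D.grp D.grp H (D.idem θ) x := by
  refine Pt.ext_chi θ fun _ m n => ?_
  rw [chi_idem_mul θ (diagMul k F D.grp D.grp H (D.idem θ) x)]
  split_ifs with h
  · rfl
  · rw [chi_idem_mul, if_neg h]

theorem idem_mul_idem : diagMul k F D.grp D.grp D.grp (D.idem θ) (D.idem θ) = D.idem θ := by
  have h := idem_mul_idem_mul θ (autClass k F (1 : MulAut D.grp))
  rwa [diagMul_one] at h

theorem idem_mul_mul_idem_eq_zero (h : ¬ D.Iso D') (x : DiagGroup k F D.grp D'.grp) :
    diagMul k F D.grp D.grp D'.grp (D.idem θ) (diagMul k F D.grp D'.grp D'.grp x (D'.idem θ)) = 0 := by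
  refine Pt.ext_chi θ fun D'' m n => ?_
  rw [chi_idem_mul_mul_idem, map_zero]
  split_ifs with h1
  · obtain ⟨φ, hφ, -⟩ := Pt.exists_comp_of_equiv h1.1
    obtain ⟨ψ, hψ, -⟩ := Pt.exists_comp_of_equiv h1.2
    refine (h ⟨φ.symm.trans ψ, fun q => ?_⟩).elim
    obtain ⟨q, rfl⟩ := φ.surjective q
    change ψ (φ.symm (D.u (φ q))) = D'.u (ψ (φ.symm (φ q)))
    rw [← hφ, φ.symm_apply_apply, φ.symm_apply_apply, hψ]
  · rfl

theorem isoClass_mul_idem (f : D.grp ≃* D'.grp) (hf : IsConj (f D.gen) D'.gen) :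
    diagMul k F D'.grp D.grp D.grp (isoClass θ f) (D.idem θ) = diagMul k F D'.grp D'.grp D.grp (D'.idem θ) (isoClass θ f) := by
  refine Pt.ext_chi θ fun D'' m n => ?_
  classical
  rw [chi_idem_mul, chi_mul_idem, Pt.chi_isoClass]
  by_cases h0 : Pt.isoCount f m n = 0
  · rw [h0, Nat.cast_zero, ite_self, ite_self]
  · obtain ⟨⟨⟨g, rfl⟩⟩, -⟩ := Nat.card_ne_zero.1 h0
    refine if_congr ⟨fun h => ?_, fun h => ?_⟩ rfl rfl
    · exact Setoid.trans (Setoid.symm (Pt.toPair_smul g (n.map f))) (Setoid.trans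
        (Pt.map_equiv_map f h) (map_pt_equiv f hf))
    · have h1 : (n.map f).toPair ≈ (D.pt.map f).toPair := Setoid.trans (Pt.toPair_smul g _)
        (Setoid.trans h (Setoid.symm (map_pt_equiv f hf)))
      have h2 := Pt.map_equiv_map f.symm h1
      have h3 : ∀ {E : DPair p} (l : E.Pt D.grp), (l.map f).map f.symm = l := fun l =>
        Pt.eq_iff.2 ⟨fun q => f.symm_apply_apply _, f.symm_apply_apply _⟩
      rwa [h3, h3] at h2

theorem autClass_mul_idem (γ : D.aut) :
    diagMul k F D.grp D.grp D.grp (autClass k F γ.1) (D.idem θ) =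
      diagMul k F D.grp D.grp D.grp (D.idem θ) (autClass k F γ.1) := by
  rw [← isoClass_eq_autClass θ]
  exact isoClass_mul_idem θ γ.1 (IsConj.symm γ.2)

theorem idem_mul_autClass_mul_idem (γ : D.aut) :
    diagMul k F D.grp D.grp D.grp (D.idem θ) (diagMul k F D.grp D.grp D.grp (autClass k F γ.1) (D.idem θ)) =
      diagMul k F D.grp D.grp D.grp (autClass k F γ.1) (D.idem θ) := by
  rw [autClass_mul_idem, idem_mul_idem_mul]

/-- An element of `e F T^Δ(L⟨u⟩, L⟨u⟩) e` is determined by its values at the automorphisms of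
`(L, u)`. -/
theorem ext_idem {x y : DiagGroup k F D.grp D.grp}
    (h : ∀ σ : D.autPair, Pt.chi θ D.pt (ptComp σ) x = Pt.chi θ D.pt (ptComp σ) y) :
    diagMul k F D.grp D.grp D.grp (D.idem θ) (diagMul k F D.grp D.grp D.grp x (D.idem θ)) =
      diagMul k F D.grp D.grp D.grp (D.idem θ) (diagMul k F D.grp D.grp D.grp y (D.idem θ)) := by
  refine Pt.ext_chi θ fun D'' m n => ?_
  refine (chi_idem_mul_mul_idem θ x m n).trans (Eq.trans ?_ (chi_idem_mul_mul_idem θ y m n).symm)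
  split_ifs with h1
  · obtain ⟨φ, hφ, g, hg⟩ := Pt.exists_comp_of_equiv h1.1
    obtain ⟨ψ, hψ, g', hg'⟩ := Pt.exists_comp_of_equiv h1.2
    let σ : D.autPair := ⟨φ.symm.trans ψ, by
      rw [Subgroup.mem_centralizer_iff]
      rintro _ rfl
      refine MulEquiv.ext fun q => ?_
      obtain ⟨q, rfl⟩ := φ.surjective q
      change D.u (ψ (φ.symm (φ q))) = ψ (φ.symm (D.u (φ q)))
      rw [← hφ, φ.symm_apply_apply, φ.symm_apply_apply, hψ]⟩
    have h3 : D.pt.comp ψ hψ = (ptComp σ).comp φ hφ := Pt.eq_iff.2 ⟨fun q => by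
      change D.pt.α (ψ q) = D.pt.α (ψ (φ.symm (φ q)))
      rw [φ.symm_apply_apply], rfl⟩
    have h4 : ∀ z : DiagGroup k F D.grp D.grp, Pt.chi θ m n z = Pt.chi θ D.pt (ptComp σ) z := by
      intro z
      rw [← Pt.chi_smul_smul θ g g', hg, hg', h3, Pt.chi_comp_comp]
    exact (h4 x).trans ((h σ).trans (h4 y).symm)
  · rfl

theorem chi_autClass (γ : MulAut G) (m n : D.Pt G) :
    Pt.chi θ m n (autClass k F γ) = (Pt.isoCount γ m n : F) := by
  rw [← isoClass_eq_autClass θ, Pt.chi_isoClass]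

theorem mem_span_of_chi {x : DiagGroup k F D.grp D.grp} (y : DiagGroup k F D.grp D.grp)
    (hy : y ∈ Submodule.span F (Set.range fun γ : D.aut => autClass k F γ.1))
    (h : ∀ σ : D.autPair, Pt.chi θ D.pt (ptComp σ) x = Pt.chi θ D.pt (ptComp σ) y) :
    diagMul k F D.grp D.grp D.grp (D.idem θ) (diagMul k F D.grp D.grp D.grp x (D.idem θ)) ∈ Submodule.span F
      (Set.range fun γ : D.aut => diagMul k F D.grp D.grp D.grp (autClass k F γ.1) (D.idem θ)) := by
  rw [ext_idem θ h]
  let A : DiagGroup k F D.grp D.grp →ₗ[F] DiagGroup k F D.grp D.grp :=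
    diagMul k F D.grp D.grp D.grp (D.idem θ) ∘ₗ (diagMul k F D.grp D.grp D.grp).flip (D.idem θ)
  have h1 : Submodule.span F (Set.range fun γ : D.aut => autClass k F γ.1) ≤
      (Submodule.span F (Set.range fun γ : D.aut =>
        diagMul k F D.grp D.grp D.grp (autClass k F γ.1) (D.idem θ))).comap A := by
    refine Submodule.span_le.2 ?_
    rintro _ ⟨γ, rfl⟩
    exact Submodule.subset_span ⟨γ, (idem_mul_autClass_mul_idem θ γ).symm⟩
  exact h1 hy

theorem idem_mul_mul_idem_mem_span (x : DiagGroup k F D.grp D.grp) :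
    diagMul k F D.grp D.grp D.grp (D.idem θ) (diagMul k F D.grp D.grp D.grp x (D.idem θ)) ∈ Submodule.span F
      (Set.range fun γ : D.aut => diagMul k F D.grp D.grp D.grp (autClass k F γ.1) (D.idem θ)) := by
  choose γ hγ using exists_aut (D := D)
  have : Fintype D.autPair := Fintype.ofFinite _
  let c : D.autPair → F := fun ρ => Pt.chi θ D.pt (ptComp ρ) x
  let N : D.autPair → ℕ := fun τ => Pt.isoCount (MulEquiv.refl _) D.pt (ptComp τ)
  have h1 : ∀ ρ σ, Pt.isoCount (γ ρ).1 D.pt (ptComp σ) = N (ρ * σ) := by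
    intro ρ σ
    have h2 : (ptComp σ).map (γ ρ).1 = ptComp (ρ * σ) :=
      (congrArg (fun m : D.Pt D.grp => m.comp σ.1 (autPair_comm σ)) (hγ ρ))
    change Nat.card {x : D.grp // x • (ptComp σ).map (γ ρ).1 = D.pt} = _
    rw [h2]
    rfl
  have h2 : ∀ σ τ, c (σ * τ⁻¹) * N τ = c σ * N τ := by
    intro σ τ
    by_cases h : N τ = 0
    · rw [h, Nat.cast_zero, mul_zero, mul_zero]
    · obtain ⟨⟨g, hg⟩, -⟩ := Nat.card_ne_zero.1 h
      refine congrArg (· * _) ?_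
      have hg' : g • ptComp τ = D.pt := hg
      have h3 : (ptComp (σ * τ⁻¹)).comp τ.1 (autPair_comm τ) = ptComp σ := Pt.eq_iff.2
        ⟨fun q => congrArg (fun z => D.pt.α (σ.1 z)) (MulAut.inv_apply_self _ τ.1 q), rfl⟩
      refine (Pt.chi_comp_comp θ τ.1 (autPair_comm τ) D.pt (ptComp (σ * τ⁻¹)) x).symm.trans ?_
      rw [h3]
      change Pt.chi θ (ptComp τ) (ptComp σ) x = Pt.chi θ D.pt (ptComp σ) x
      rw [← hg', Pt.chi_smul_left]
  have h3 : (∑ τ, (N τ : F)) ≠ 0 := by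
    rw [← Nat.cast_sum]
    refine Nat.cast_ne_zero.2 fun h => ?_
    have h4 := (Finset.sum_eq_zero_iff.1 h) 1 (Finset.mem_univ _)
    refine (Nat.card_ne_zero.2 ⟨⟨(1 : D.grp), ?_⟩, inferInstance⟩) h4
    exact (one_smul _ _).trans rfl
  refine mem_span_of_chi θ (((∑ τ, (N τ : F))⁻¹) • ∑ ρ, c ρ⁻¹ • autClass k F (γ ρ).1)
    (Submodule.smul_mem _ _ (Submodule.sum_mem _ fun ρ _ => Submodule.smul_mem _ _
      (Submodule.subset_span ⟨γ ρ, rfl⟩))) fun σ => ?_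
  rw [_root_.map_smul, map_sum, smul_eq_mul, eq_inv_mul_iff_mul_eq₀ h3]
  simp only [_root_.map_smul, smul_eq_mul]
  rw [Finset.sum_mul]
  refine Eq.trans (Finset.sum_congr rfl fun τ _ => ?_) (Equiv.sum_comp (Equiv.mulRight σ⁻¹) _)
  have h5 := chi_autClass θ (γ (τ * σ⁻¹)).1 D.pt (ptComp σ)
  rw [h1, inv_mul_cancel_right] at h5
  rw [Equiv.coe_mulRight]
  refine Eq.trans ?_ (congrArg (_ * ·) h5.symm)
  rw [mul_inv_rev, inv_inv, h2, mul_comm]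

end DPair

end Idempotents

section Idempotents

namespace DPair

variable {p : ℕ} {D D' : DPair p} {k : Type u} [Field k] [IsAlgClosed k] {F : Type v} [Field F]
  [CharZero F] [Fact p.Prime] [CharP k p] (θ : BrauerLift k F) {G H : Type} [Group G] [Group H]
  [Finite G] [Finite H]

theorem autClass_conj (θ : BrauerLift k F) (p : ℕ) [Fact p.Prime] [CharP k p] (g : G) :
    autClass k F (MulAut.conj g) = autClass k F 1 := by
  rw [← isoClass_eq_autClass θ, ← isoClass_eq_autClass θ, isoClass_conj p]

theorem autClass_mul (θ : BrauerLift k F) (p : ℕ) [Fact p.Prime] [CharP k p] (γ δ : MulAut G) :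
    autClass k F (γ * δ) = diagMul k F G G G (autClass k F γ) (autClass k F δ) := by
  rw [← isoClass_eq_autClass θ, ← isoClass_eq_autClass θ, ← isoClass_eq_autClass θ,
    diagMul_isoClass θ p]
  rfl

/-- The elements `e γ`, for representatives `γ` of `Out(L, u)`, are linearly independent. -/
theorem linearIndependent_idem_mul_autClass : LinearIndependent F fun o : D.Out =>
    diagMul k F D.grp D.grp D.grp (D.idem θ) (autClass k F o.out.1) := by
  classical
  have : Fintype D.Out := Fintype.ofFinite _
  rw [Fintype.linearIndependent_iff]
  intro r hr o
  have h1 : ∀ γ : D.aut, Pt.chi θ D.pt (D.pt.map o.out.1.symm)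
      (diagMul k F D.grp D.grp D.grp (D.idem θ) (autClass k F γ.1)) =
      (Pt.isoCount γ.1 D.pt (D.pt.map o.out.1.symm) : F) := by
    intro γ
    rw [chi_idem_mul, if_pos (Setoid.refl _), chi_autClass]
  have h2 := congrArg (Pt.chi θ D.pt (D.pt.map o.out.1.symm)) hr
  rw [map_sum, map_zero, Finset.sum_eq_single o] at h2
  · rw [_root_.map_smul, h1, smul_eq_mul, mul_eq_zero, Nat.cast_eq_zero] at h2
    refine h2.resolve_right (Nat.card_ne_zero.2 ⟨⟨⟨(1 : D.grp), ?_⟩⟩, inferInstance⟩)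
    rw [one_smul]
    exact Pt.eq_iff.2 ⟨fun q => MulEquiv.apply_symm_apply _ _, MulEquiv.apply_symm_apply _ _⟩
  · intro o' _ ho
    rw [_root_.map_smul, h1, smul_eq_mul, mul_eq_zero, Nat.cast_eq_zero]
    right
    by_contra h
    obtain ⟨⟨⟨g, hg⟩⟩, -⟩ := Nat.card_ne_zero.1 h
    refine ho ?_
    rw [← o.out_eq', ← o'.out_eq', eq_comm]
    refine Quotient.sound' ?_
    rw [QuotientGroup.leftRel_apply]
    have h3 := Pt.eq_iff.1 hg
    have h4 : (MulAut.conj g * o'.out.1 * o.out.1⁻¹).toMonoidHom = MonoidHom.id D.grp :=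
      hom_ext h3.1 h3.2
    have h5 : ∀ x, MulAut.conj g (o'.out.1 (o.out.1⁻¹ x)) = x := DFunLike.congr_fun h4
    refine ⟨o.out.1⁻¹ g⁻¹, MulEquiv.ext fun x => ?_⟩
    have h6 := h5 (o.out.1 x)
    rw [MulAut.inv_apply_self] at h6
    have h7 : g * o'.out.1 x * g⁻¹ = o.out.1 x := h6
    change o.out.1⁻¹ g⁻¹ * x * (o.out.1⁻¹ g⁻¹)⁻¹ = o.out.1⁻¹ (o'.out.1 x)
    apply o.out.1.injective
    have h8 : o.out.1 (o.out.1⁻¹ g⁻¹) = g⁻¹ := MulAut.apply_inv_self _ _ _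
    rw [MulAut.apply_inv_self]
    generalize o.out.1⁻¹ g⁻¹ = y at h8 ⊢
    rw [map_mul, map_mul, map_inv, h8, ← h7]
    group
  · simp

theorem exists_smul_comp_eq (n : D.Pt H) (φ ψ : D'.L ≃* D.L) (hφ : ∀ q, φ (D'.u q) = D.u (φ q))
    (hψ : ∀ q, ψ (D'.u q) = D.u (ψ q)) (w : D.grp) (hw : w • D.pt.comp φ hφ = D.pt.comp ψ hψ) :
    ∃ z : H, z • n.comp φ hφ = n.comp ψ hψ := by
  obtain ⟨h1, h2⟩ := Pt.eq_iff.1 hw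
  obtain ⟨j, hj⟩ := (mem_powers_iff_mem_zpowers (x := D.u)).2 w.right.2
  have hj' : D.u ^ j = w.right.1 := hj
  have hs : ∀ q, n.s ^ j * n.α q * (n.s ^ j)⁻¹ = n.α (w.right.1 q) := by
    rw [← hj']
    clear hj hj'
    induction j with
    | zero => simp
    | succ j ih =>
      intro q
      rw [pow_succ (n.s), pow_succ, MulAut.mul_apply, ← ih, ← n.comm]
      group
  have hfix : D.u w.left = w.left := by
    have h3 : w * D.gen * w⁻¹ = D.gen := h2
    rw [mul_inv_eq_iff_eq_mul] at h3
    have h4 : w.left * w.right.1 1 = 1 * D.u w.left := congrArg SemidirectProduct.left h3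
    rw [map_one, mul_one, one_mul] at h4
    exact h4.symm
  refine ⟨n.α w.left * n.s ^ j, Pt.eq_iff.2 ⟨fun q => ?_, ?_⟩⟩
  · have h3 : w * SemidirectProduct.inl (φ q) * w⁻¹ = SemidirectProduct.inl (ψ q) := h1 q
    have h4 : w.left * w.right.1 (φ q) * w.left⁻¹ = ψ q := by
      refine SemidirectProduct.inl_injective (φ := (Subgroup.zpowers D.u).subtype) ?_
      rw [← h3, map_mul, map_mul, map_inv]
      conv_rhs => rw [← SemidirectProduct.inl_left_mul_inr_right w]
      have h5 := SemidirectProduct.inl_aut (φ := (Subgroup.zpowers D.u).subtype) w.right (φ q)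
      change SemidirectProduct.inl w.left * SemidirectProduct.inl
        ((Subgroup.zpowers D.u).subtype w.right (φ q)) * _ = _
      rw [h5, map_inv]
      group
    change (n.α w.left * n.s ^ j) * n.α (φ q) * (n.α w.left * n.s ^ j)⁻¹ = n.α (ψ q)
    rw [← h4, map_mul, map_mul, ← hs, map_inv]
    group
  · change (n.α w.left * n.s ^ j) * n.s * (n.α w.left * n.s ^ j)⁻¹ = n.s
    have h3 : n.s * n.α w.left * n.s⁻¹ = n.α w.left := by rw [n.comm, hfix]
    rw [mul_inv_eq_iff_eq_mul] at h3 ⊢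
    rw [mul_assoc, ← pow_succ, pow_succ', ← mul_assoc, ← mul_assoc, h3]

theorem prod_equiv_prod {m : D.Pt G} {n : D.Pt H} {m' : D'.Pt G} {n' : D'.Pt H} {l : D'.Pt D.grp}
    (h1 : (m'.prod l).toPair ≈ (m.prod D.pt).toPair)
    (h2 : (l.prod n').toPair ≈ (D.pt.prod n).toPair) :
    (m'.prod n').toPair ≈ (m.prod n).toPair := by
  obtain ⟨φ, hφ, ⟨g, x⟩, h3⟩ := Pt.exists_comp_of_equiv h1
  obtain ⟨ψ, hψ, ⟨x', h⟩, h4⟩ := Pt.exists_comp_of_equiv h2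
  obtain ⟨h5, h6⟩ := Pt.eq_iff.1 h3
  obtain ⟨h7, h8⟩ := Pt.eq_iff.1 h4
  have h9 : g • m' = m.comp φ hφ :=
    Pt.eq_iff.2 ⟨fun q => congrArg Prod.fst (h5 q), congrArg Prod.fst h6⟩
  have h10 : x • l = D.pt.comp φ hφ :=
    Pt.eq_iff.2 ⟨fun q => congrArg Prod.snd (h5 q), congrArg Prod.snd h6⟩
  have h11 : x' • l = D.pt.comp ψ hψ :=
    Pt.eq_iff.2 ⟨fun q => congrArg Prod.fst (h7 q), congrArg Prod.fst h8⟩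
  have h12 : h • n' = n.comp ψ hψ :=
    Pt.eq_iff.2 ⟨fun q => congrArg Prod.snd (h7 q), congrArg Prod.snd h8⟩
  obtain ⟨z, hz⟩ := exists_smul_comp_eq n φ ψ hφ hψ (x' * x⁻¹) (by
    rw [← h10, smul_smul, inv_mul_cancel_right, h11])
  have h13 : ((g, z⁻¹ * h) : G × H) • m'.prod n' = (m.prod n).comp φ hφ := by
    have h14 : (z⁻¹ * h) • n' = n.comp φ hφ := by rw [mul_smul, h12, ← hz, inv_smul_smul]
    obtain ⟨h15, h16⟩ := Pt.eq_iff.1 h9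
    obtain ⟨h17, h18⟩ := Pt.eq_iff.1 h14
    exact Pt.eq_iff.2 ⟨fun q => Prod.ext (h15 q) (h17 q), Prod.ext h16 h18⟩
  have h14 := Pt.toPair_smul ((g, z⁻¹ * h) : G × H) (m'.prod n')
  rwa [h13, Pt.toPair_comp] at h14

open Classical in
theorem card_subtype_eq_sum {F : Type v} [Field F] {X : Type*} [Fintype X] (P : X → Prop) :
    (Nat.card {x // P x} : F) = ∑ x, if P x then 1 else 0 := by
  rw [Nat.card_eq_fintype_card, Fintype.card_subtype, Finset.card_filter, Nat.cast_sum]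
  exact Finset.sum_congr rfl fun x _ => by rw [Nat.cast_ite, Nat.cast_one, Nat.cast_zero]

open Classical in
theorem chi_mul_idem_mul (a : DiagGroup k F G D.grp) (b : DiagGroup k F D.grp H) (m : D'.Pt G)
    (n : D'.Pt H) (P Q : D'.Pt D.grp → Prop)
    (ha : ∀ l, Pt.chi θ m l a = if P l then 1 else 0)
    (hb : ∀ l, Pt.chi θ l n b = if Q l then 1 else 0) :
    Pt.chi θ m n (diagMul k F _ _ _ a (diagMul k F _ _ _ (D.idem θ) b)) =
      (Nat.card D.grp : F)⁻¹ *
        (Nat.card {l : D'.Pt D.grp // P l ∧ l.toPair ≈ D.pt.toPair ∧ Q l} : F) := by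
  rw [Pt.chi_diagMul, card_subtype_eq_sum]
  refine congrArg _ (Finset.sum_congr rfl fun l _ => ?_)
  rw [chi_idem_mul, ha, hb]
  by_cases h1 : P l <;> by_cases h2 : l.toPair ≈ D.pt.toPair <;> simp [h1, h2]

theorem exists_mul_idem_mul {c : PPair p (G × H)} (hc : c.IsDiag) :
    ∃ (D : DPair p) (a : DiagGroup k F G D.grp) (b : DiagGroup k F D.grp H) (r : F), r ≠ 0 ∧
      ∀ e : PPair p (G × H), e.tau θ (toPPerm (diagMul k F G D.grp H a
        (diagMul k F D.grp D.grp H (D.idem θ) b))) = open Classical in if e ≈ c then r else 0 := by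
  classical
  obtain ⟨D, m, n, rfl⟩ := Pt.exists_prod_toPair_eq hc
  obtain ⟨a, ha⟩ := PPair.exists_prim θ _ (Pt.isDiag_prod m D.pt)
  obtain ⟨b, hb⟩ := PPair.exists_prim θ _ (Pt.isDiag_prod D.pt n)
  refine ⟨D, a, b, ?_⟩
  have h1 := fun (D' : DPair p) (m' : D'.Pt G) (n' : D'.Pt H) =>
    chi_mul_idem_mul θ a b m' n' (fun l => (m'.prod l).toPair ≈ (m.prod D.pt).toPair)
      (fun l => (l.prod n').toPair ≈ (D.pt.prod n).toPair) (fun l => ha (m'.prod l).toPair)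
      (fun l => hb (l.prod n').toPair)
  generalize diagMul k F G D.grp H a (diagMul k F D.grp D.grp H (D.idem θ) b) = y at h1 ⊢
  refine ⟨Pt.chi θ m n y, ?_, fun e => ?_⟩
  · rw [h1]
    refine mul_ne_zero (inv_ne_zero (Nat.cast_ne_zero.2 Nat.card_pos.ne')) (Nat.cast_ne_zero.2 ?_)
    exact Nat.card_ne_zero.2 ⟨⟨⟨D.pt, Setoid.refl _, Setoid.refl _, Setoid.refl _⟩⟩, inferInstance⟩
  · split_ifs with he
    · exact PPair.tau_eq_of_equiv θ he _
    · by_cases hd : e.IsDiag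
      · obtain ⟨D', m', n', rfl⟩ := Pt.exists_prod_toPair_eq hd
        refine (h1 D' m' n').trans (mul_eq_zero_of_right _ (Nat.cast_eq_zero.2 ?_))
        refine Nat.card_eq_zero.2 (Or.inl ⟨fun l => he ?_⟩)
        exact prod_equiv_prod l.2.1 l.2.2.2
      · exact PPair.tau_toPPerm_of_not_isDiag θ hd _

/-- Every element of `F T^Δ(G, H)` factors through the idempotents attached to `D^Δ`-pairs. -/
theorem mem_span_mul_idem_mul (x : DiagGroup k F G H) : x ∈ Submodule.span F
    {y | ∃ (D : DPair p) (a : DiagGroup k F G D.grp) (b : DiagGroup k F D.grp H),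
      diagMul k F G D.grp H a (diagMul k F D.grp D.grp H (D.idem θ) b) = y} := by
  classical
  have hex : ∀ c : PPair p (G × H), ∃ y : DiagGroup k F G H, c.IsDiag →
      (∃ (D : DPair p) (a : DiagGroup k F G D.grp) (b : DiagGroup k F D.grp H),
        diagMul k F G D.grp H a (diagMul k F D.grp D.grp H (D.idem θ) b) = y) ∧
      ∃ r : F, r ≠ 0 ∧ ∀ e : PPair p (G × H), e.tau θ (toPPerm y) = if e ≈ c then r else 0 := by
    intro c
    by_cases hc : c.IsDiag
    · obtain ⟨D, a, b, r, hr, h⟩ := exists_mul_idem_mul θ hc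
      exact ⟨_, fun _ => ⟨⟨D, a, b, rfl⟩, r, hr, h⟩⟩
    · exact ⟨0, fun h => (hc h).elim⟩
  choose c hc using hex
  refine Submodule.span_mono ?_ (PPair.mem_span_of_prim θ c (fun d hd => (hc d hd).2) x)
  rintro _ ⟨d, hd, rfl⟩
  exact (hc d hd).1

end DPair

end Idempotents

section AbelianFunctors

variable {k : Type u} [Field k] {F : Type v} [Field F]

theorem isLinearFunctor_iff {S : PPCat k F ⥤ ModuleCat.{max u v} F} :
    isLinearFunctor k F S ↔ (∀ {X Y : PPCat k F} (f g : X ⟶ Y), S.map (f + g) = S.map f + S.map g) ∧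
      ∀ {X Y : PPCat k F} (f : X ⟶ Y) (r : F), S.map (r • f) = r • S.map f :=
  ⟨fun ⟨h1, h2⟩ => ⟨fun _ _ => h1.map_add, fun _ _ => h2.map_smul _ _⟩,
    fun ⟨h1, h2⟩ => ⟨⟨h1 _ _⟩, ⟨h2⟩⟩⟩

instance : (isLinearFunctor k F).IsClosedUnderSubobjects where
  prop_of_mono {S T} i _ h := by
    rw [isLinearFunctor_iff] at h ⊢
    refine ⟨fun f g => ?_, fun f r => ?_⟩
    · rw [← cancel_mono (i.app _), i.naturality, h.1, Preadditive.comp_add, Preadditive.add_comp,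
        i.naturality, i.naturality]
    · rw [← cancel_mono (i.app _), i.naturality, h.2, Linear.comp_smul, Linear.smul_comp,
        i.naturality]

instance : (isLinearFunctor k F).IsClosedUnderQuotients where
  prop_of_epi {S T} i _ h := by
    rw [isLinearFunctor_iff] at h ⊢
    refine ⟨fun f g => ?_, fun f r => ?_⟩
    · rw [← cancel_epi (i.app _), ← i.naturality, h.1, Preadditive.comp_add, Preadditive.add_comp,
        i.naturality, i.naturality]
    · rw [← cancel_epi (i.app _), ← i.naturality, h.2, Linear.comp_smul, Linear.smul_comp,
        i.naturality]

instance (J : Type) [Finite J] : (isLinearFunctor k F).IsClosedUnderLimitsOfShape (Discrete J) where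
  limitsOfShape_le := by
    rintro S ⟨L⟩
    have hL : ∀ j, isLinearFunctor k F (L.diag.obj j) := L.prop_diag_obj
    simp only [isLinearFunctor_iff] at hL
    rw [isLinearFunctor_iff]
    have hext : ∀ {X Y : PPCat k F} {a b : S.obj X ⟶ S.obj Y},
        (∀ j, a ≫ (L.π.app j).app Y = b ≫ (L.π.app j).app Y) → a = b := fun h =>
      (Limits.isLimitOfPreserves ((evaluation _ _).obj _) L.isLimit).hom_ext h
    let i : ∀ j, S ⟶ L.diag.obj j := fun j => L.π.app j
    refine ⟨fun f g => hext fun j => ?_, fun f r => hext fun j => ?_⟩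
    · refine ((i j).naturality _).trans (Eq.trans ?_ (Preadditive.add_comp _ _ _ _ _ ((i j).app _)).symm)
      rw [(hL j).1, (i j).naturality, (i j).naturality, Preadditive.comp_add]
    · refine ((i j).naturality _).trans (Eq.trans ?_ (Linear.smul_comp _ _ _ _ _ ((i j).app _)).symm)
      rw [(hL j).2, (i j).naturality, Linear.comp_smul]

instance : (isLinearFunctor k F).IsClosedUnderFiniteProducts := ⟨fun _ => inferInstance⟩

instance : (isLinearFunctor k F).ContainsZero where
  exists_zero := by
    obtain ⟨Z, hZ⟩ := Limits.HasZeroObject.zero (C := PPCat k F ⥤ ModuleCat.{max u v} F)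
    exact ⟨Z, hZ, (isLinearFunctor k F).prop_of_isTerminal Z hZ.isTerminal⟩

theorem exists_abelian : ∃ a : Abelian (DiagPPermFunctor k F),
    a.toPreadditive = (inferInstance : Preadditive (DiagPPermFunctor k F)) :=
  ⟨inferInstanceAs (Abelian (isLinearFunctor k F).FullSubcategory), rfl⟩

end AbelianFunctors

section Subfunctors

variable {k : Type u} [Field k] {F : Type v} [Field F]

namespace DiagPPermFunctor

/-- The action of a morphism on the values of a functor. -/
def act (S : DiagPPermFunctor k F) {X Y : PPCat k F} :
    DiagGroup k F Y.carrier X.carrier →ₗ[F] S.obj.obj X →ₗ[F] S.obj.obj Y where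
  toFun f := (S.obj.map (show X ⟶ Y from f)).hom
  map_add' f g := by
    refine (congrArg ModuleCat.Hom.hom ((isLinearFunctor_iff.1 S.property).1 _ _)).trans ?_
    rfl
  map_smul' r f := by
    refine (congrArg ModuleCat.Hom.hom ((isLinearFunctor_iff.1 S.property).2 _ _)).trans ?_
    rfl

variable (S : DiagPPermFunctor k F) {X Y Z : PPCat k F}

theorem act_mul (f : DiagGroup k F Z.carrier Y.carrier) (g : DiagGroup k F Y.carrier X.carrier)
    (x : S.obj.obj X) : S.act (diagMul k F _ _ _ f g) x = S.act f (S.act g x) :=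
  congrArg (fun h => h.hom x) (S.obj.map_comp (show X ⟶ Y from g) (show Y ⟶ Z from f))

theorem act_one (x : S.obj.obj X) : S.act (autClass k F (1 : MulAut X.carrier)) x = x :=
  congrArg (fun h => h.hom x) (S.obj.map_id X)

/-- The components of a natural transformation. -/
def appₗ {S T : DiagPPermFunctor k F} (i : S ⟶ T) (X : PPCat k F) : S.obj.obj X →ₗ[F] T.obj.obj X :=
  (i.hom.app X).hom

theorem appₗ_act {S T : DiagPPermFunctor k F} (i : S ⟶ T) (f : DiagGroup k F Y.carrier X.carrier)
    (x : S.obj.obj X) : appₗ i Y (S.act f x) = T.act f (appₗ i X x) :=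
  congrArg (fun h => h.hom x) (i.hom.naturality (show X ⟶ Y from f))

theorem hom_ext {S T : DiagPPermFunctor k F} {i j : S ⟶ T}
    (h : ∀ X x, appₗ i X x = appₗ j X x) : i = j := by
  refine ObjectProperty.hom_ext _ (NatTrans.ext (funext fun X => ?_))
  exact ModuleCat.hom_ext (LinearMap.ext (h X))

/-- A natural transformation from its components. -/
def ofApp {S T : DiagPPermFunctor k F} (i : ∀ X, S.obj.obj X →ₗ[F] T.obj.obj X)
    (h : ∀ {X Y : PPCat k F} (f : DiagGroup k F Y.carrier X.carrier) x,
      i Y (S.act f x) = T.act f (i X x)) : S ⟶ T :=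
  ObjectProperty.homMk
    { app := fun X => ModuleCat.ofHom (i X)
      naturality := fun _ _ f => ModuleCat.hom_ext (LinearMap.ext fun x => h f x) }

theorem appₗ_comp {S T U : DiagPPermFunctor k F} (i : S ⟶ T) (j : T ⟶ U) (x : S.obj.obj X) :
    appₗ (i ≫ j) X x = appₗ j X (appₗ i X x) := rfl

/-- A diagonal `p`-permutation functor from its values and the action of morphisms. -/
def mk' (V : PPCat k F → Type (max u v)) [∀ X, AddCommGroup (V X)] [∀ X, Module F (V X)]
    (a : ∀ {X Y : PPCat k F}, DiagGroup k F Y.carrier X.carrier →ₗ[F] V X →ₗ[F] V Y)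
    (h1 : ∀ (X : PPCat k F) (x : V X), a (autClass k F (1 : MulAut X.carrier)) x = x)
    (h2 : ∀ {X Y Z : PPCat k F} (f : DiagGroup k F Z.carrier Y.carrier)
      (g : DiagGroup k F Y.carrier X.carrier) (x : V X), a (diagMul k F _ _ _ f g) x = a f (a g x)) :
    DiagPPermFunctor k F where
  obj :=
    { obj := fun X => ModuleCat.of F (V X)
      map := fun f => ModuleCat.ofHom (a f)
      map_id := fun X => ModuleCat.hom_ext (LinearMap.ext (h1 _))
      map_comp := fun f g => ModuleCat.hom_ext (LinearMap.ext (h2 g f)) }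
  property := isLinearFunctor_iff.2
    ⟨fun f g => ModuleCat.hom_ext (a.map_add f g), fun f r => ModuleCat.hom_ext (a.map_smul r f)⟩

theorem isIso_of_bijective {S T : DiagPPermFunctor k F} (i : S ⟶ T)
    (h : ∀ X, Function.Bijective (appₗ i X)) : IsIso i := by
  let e : ∀ X, S.obj.obj X ≃ₗ[F] T.obj.obj X := fun X => LinearEquiv.ofBijective (appₗ i X) (h X)
  have he : ∀ X x, e X x = appₗ i X x := fun _ _ => rfl
  refine ⟨ofApp (fun X => (e X).symm.toLinearMap) fun f x => ?_, ?_, ?_⟩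
  · refine (LinearEquiv.symm_apply_eq _).2 ?_
    rw [he, appₗ_act, ← he]
    exact congrArg _ ((e _).apply_symm_apply x).symm
  · exact hom_ext fun X x => (e X).symm_apply_apply x
  · exact hom_ext fun X x => (e X).apply_symm_apply x

/-- Subfunctors of a diagonal `p`-permutation functor. -/
structure Sub (S : DiagPPermFunctor k F) where
  /-- The values. -/
  val : ∀ X : PPCat k F, Submodule F (S.obj.obj X)
  act_mem : ∀ {X Y : PPCat k F} (f : DiagGroup k F Y.carrier X.carrier) {x : S.obj.obj X},
    x ∈ val X → S.act f x ∈ val Y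

namespace Sub

variable {S} (N : Sub S)

/-- The functor underlying a subfunctor. -/
def toFunctor : DiagPPermFunctor k F :=
  mk' (fun X => N.val X)
    (fun {X Y} =>
      { toFun := fun f => (S.act f).restrict fun _ hx => N.act_mem f hx
        map_add' := fun f g => LinearMap.ext fun x => Subtype.ext (by simp)
        map_smul' := fun r f => LinearMap.ext fun x => Subtype.ext (by simp) })
    (fun _ x => Subtype.ext (S.act_one x.1)) (fun f g x => Subtype.ext (S.act_mul f g x.1))

/-- The inclusion. -/
def incl : N.toFunctor ⟶ S := ofApp (fun X => (N.val X).subtype) fun _ _ => rfl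

theorem appₗ_incl (x : N.val X) : appₗ N.incl X x = x.1 := rfl

theorem incl_injective (X : PPCat k F) : Function.Injective (appₗ N.incl X) :=
  Subtype.val_injective

end Sub

theorem mono_of_injective {S T : DiagPPermFunctor k F} (i : S ⟶ T)
    (h : ∀ X, Function.Injective (appₗ i X)) : Mono i :=
  ⟨fun f g e => hom_ext fun X x => h X (by rw [← appₗ_comp, ← appₗ_comp, e])⟩

theorem injective_of_mono {S T : DiagPPermFunctor k F} (i : S ⟶ T) [Mono i] (X : PPCat k F) :
    Function.Injective (appₗ i X) := by
  let N : Sub S := ⟨fun X => LinearMap.ker (appₗ i X), fun f x hx => by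
    rw [LinearMap.mem_ker] at hx ⊢
    rw [appₗ_act, hx, map_zero]⟩
  have h1 : N.incl = 0 := by
    rw [← cancel_mono i, Limits.zero_comp]
    exact hom_ext fun X x => x.2
  rw [injective_iff_map_eq_zero]
  intro x hx
  have h2 : appₗ N.incl X ⟨x, hx⟩ = 0 := by rw [h1]; rfl
  exact h2

/-- A functor is simple if and only if it is nonzero and has no proper nonzero subfunctor. -/
theorem simple_iff : Simple S ↔ (∃ X, ∃ x : S.obj.obj X, x ≠ 0) ∧
    ∀ N : Sub S, (∃ X, ∃ x ∈ N.val X, x ≠ 0) → ∀ X, N.val X = ⊤ := by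
  constructor
  · intro h
    refine ⟨?_, fun N ⟨X, x, hx, hx0⟩ Y => ?_⟩
    · by_contra! h1
      refine id_nonzero S (hom_ext fun X x => h1 X _)
    · have h1 : Mono N.incl := mono_of_injective _ N.incl_injective
      have h2 : N.incl ≠ 0 := fun h3 => hx0 ((N.appₗ_incl ⟨x, hx⟩).symm.trans (by
        rw [h3]
        rfl))
      have h3 : IsIso N.incl := isIso_of_mono_of_nonzero h2
      rw [eq_top_iff]
      rintro y -
      have h4 : appₗ N.incl Y (appₗ (inv N.incl) Y y) = y := by
        rw [← appₗ_comp, IsIso.inv_hom_id]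
        rfl
      rw [← h4]
      exact (appₗ (inv N.incl) Y y).2
  · rintro ⟨⟨X, x, hx⟩, h⟩
    refine ⟨fun {T} i _ => ⟨fun h1 h2 => ?_, fun h1 => ?_⟩⟩
    · obtain ⟨j, -, hj⟩ := h1
      refine hx ?_
      have h3 : appₗ (j ≫ i) X x = x := by rw [hj]; rfl
      rw [← h3, h2, Limits.comp_zero]
      rfl
    · let N : Sub S := ⟨fun X => LinearMap.range (appₗ i X), by
        rintro X Y f _ ⟨y, rfl⟩
        exact ⟨T.act f y, appₗ_act i f y⟩⟩
      have h2 : ∃ X, ∃ x ∈ N.val X, x ≠ 0 := by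
        by_contra! h2
        exact h1 (hom_ext fun X x => h2 X _ ⟨x, rfl⟩)
      exact isIso_of_bijective i fun X => ⟨injective_of_mono i X,
        LinearMap.range_eq_top.1 (h N h2 X)⟩

/-- A morphism between simple functors which does not vanish is an isomorphism. -/
theorem isIso_of_simple {S T : DiagPPermFunctor k F} (hS : Simple S) (hT : Simple T) (i : S ⟶ T)
    {X : PPCat k F} {x : S.obj.obj X} (hx : appₗ i X x ≠ 0) : IsIso i := by
  rw [simple_iff] at hS hT
  refine isIso_of_bijective i fun Y => ⟨?_, ?_⟩
  · let N : Sub S := ⟨fun X => LinearMap.ker (appₗ i X), fun f x hx => by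
      rw [LinearMap.mem_ker] at hx ⊢
      rw [appₗ_act, hx, map_zero]⟩
    rw [injective_iff_map_eq_zero]
    intro y hy
    by_contra hy0
    have h1 : x ∈ N.val X := by
      rw [hS.2 N ⟨Y, y, hy, hy0⟩]
      trivial
    exact hx h1
  · let N : Sub T := ⟨fun X => LinearMap.range (appₗ i X), by
      rintro X Y f _ ⟨y, rfl⟩
      exact ⟨S.act f y, appₗ_act i f y⟩⟩
    exact LinearMap.range_eq_top.1 (hT.2 N ⟨X, _, ⟨x, rfl⟩, hx⟩ Y)

end DiagPPermFunctor

end Subfunctors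

section Components

variable {k : Type u} [Field k] [IsAlgClosed k] {p : ℕ} [Fact p.Prime] [CharP k p]
  {F : Type v} [Field F] [CharZero F] (θ : BrauerLift k F)

theorem DPair.Iso.symm {D D' : DPair p} (h : D.Iso D') : D'.Iso D := by
  obtain ⟨φ, hφ⟩ := h
  refine ⟨φ.symm, fun q => ?_⟩
  rw [MulEquiv.symm_apply_eq, hφ, φ.apply_symm_apply]

theorem DPair.Iso.trans {D D' D'' : DPair p} (h : D.Iso D') (h' : D'.Iso D'') : D.Iso D'' := by
  obtain ⟨φ, hφ⟩ := h
  obtain ⟨ψ, hψ⟩ := h'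
  exact ⟨φ.trans ψ, fun q => (congrArg ψ (hφ q)).trans (hψ _)⟩

namespace DiagPPermFunctor

variable {S : DiagPPermFunctor k F} {D D' : DPair p} {X Y : PPCat k F}

theorem act_congr {f g : DiagGroup k F Y.carrier X.carrier} (h : f = g) (x : S.obj.obj X) :
    S.act f x = S.act g x := by rw [h]

theorem mem_component {x : S.obj.obj ⟨D.grp⟩} :
    x ∈ component θ S D ↔ S.act (X := ⟨D.grp⟩) (Y := ⟨D.grp⟩) (D.idem θ) x = x := by
  constructor
  · rintro ⟨y, rfl⟩
    have h1 := S.act_mul (X := ⟨D.grp⟩) (Y := ⟨D.grp⟩) (Z := ⟨D.grp⟩) (D.idem θ) (D.idem θ) y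
    rw [DPair.idem_mul_idem] at h1
    exact h1.symm
  · intro h
    exact ⟨x, h⟩

theorem act_idem_mem_component (x : S.obj.obj ⟨D.grp⟩) :
    S.act (X := ⟨D.grp⟩) (Y := ⟨D.grp⟩) (D.idem θ) x ∈ component θ S D := ⟨x, rfl⟩

theorem act_isoClass (f : D.grp ≃* D'.grp) (hf : IsConj (f D.gen) D'.gen) (x : S.obj.obj ⟨D.grp⟩) :
    S.act (X := ⟨D.grp⟩) (Y := ⟨D'.grp⟩) (isoClass θ f)
        (S.act (X := ⟨D.grp⟩) (Y := ⟨D.grp⟩) (D.idem θ) x) =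
      S.act (X := ⟨D'.grp⟩) (Y := ⟨D'.grp⟩) (D'.idem θ)
        (S.act (X := ⟨D.grp⟩) (Y := ⟨D'.grp⟩) (isoClass θ f) x) :=
  ((S.act_mul (X := ⟨D.grp⟩) (Y := ⟨D.grp⟩) (Z := ⟨D'.grp⟩) _ _ x).symm.trans
    (act_congr (DPair.isoClass_mul_idem θ f hf) x)).trans
      (S.act_mul (X := ⟨D.grp⟩) (Y := ⟨D'.grp⟩) (Z := ⟨D'.grp⟩) _ _ x)

theorem act_isoClass_symm {G H : Type} [Group G] [Group H] [Finite G] [Finite H] (p : ℕ)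
    [Fact p.Prime] [CharP k p] (f : G ≃* H) (x : S.obj.obj ⟨G⟩) :
    S.act (X := ⟨H⟩) (Y := ⟨G⟩) (isoClass θ f.symm)
      (S.act (X := ⟨G⟩) (Y := ⟨H⟩) (isoClass θ f) x) = x := by
  have h1 : diagMul k F G H G (isoClass θ f.symm) (isoClass θ f) = autClass k F (1 : MulAut G) := by
    rw [diagMul_isoClass θ p, f.self_trans_symm]
    exact isoClass_eq_autClass θ (1 : MulAut G)
  rw [← act_mul]
  refine (congrArg (fun z => S.act (X := ⟨G⟩) (Y := ⟨G⟩) z x) h1).trans ?_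
  exact S.act_one (X := ⟨G⟩) x

/-- A submodule of the component at `(L, u)` which is stable under `Aut(L, u)`. -/
abbrev IsStable (S : DiagPPermFunctor k F) (D : DPair p) (W : Submodule F (S.obj.obj ⟨D.grp⟩)) :
    Prop :=
  W ≤ component θ S D ∧ ∀ (γ : D.aut) {x}, x ∈ W →
    S.act (X := ⟨D.grp⟩) (Y := ⟨D.grp⟩) (autClass k F γ.1) x ∈ W

variable {θ}

theorem IsStable.le {W : Submodule F (S.obj.obj ⟨D.grp⟩)} (hW : IsStable θ S D W) :
    W ≤ component θ S D := hW.1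

theorem IsStable.act_mem {W : Submodule F (S.obj.obj ⟨D.grp⟩)} (hW : IsStable θ S D W) (γ : D.aut)
    {x : S.obj.obj ⟨D.grp⟩} (hx : x ∈ W) :
    S.act (X := ⟨D.grp⟩) (Y := ⟨D.grp⟩) (autClass k F γ.1) x ∈ W := hW.2 γ hx

theorem isStable_component : IsStable θ S D (component θ S D) := by
  refine ⟨le_rfl, fun γ x hx => ?_⟩
  rw [mem_component] at hx ⊢
  exact ((S.act_mul (X := ⟨D.grp⟩) (Y := ⟨D.grp⟩) (Z := ⟨D.grp⟩) _ _ x).symm.trans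
    (act_congr (DPair.autClass_mul_idem θ γ).symm x)).trans
      ((S.act_mul (X := ⟨D.grp⟩) (Y := ⟨D.grp⟩) (Z := ⟨D.grp⟩) _ _ x).trans (congrArg _ hx))

theorem IsStable.act_idem_mem {W : Submodule F (S.obj.obj ⟨D.grp⟩)} (hW : IsStable θ S D W)
    (f : DiagGroup k F D.grp D.grp) {x : S.obj.obj ⟨D.grp⟩} (hx : x ∈ W) :
    S.act (X := ⟨D.grp⟩) (Y := ⟨D.grp⟩) (D.idem θ) (S.act (X := ⟨D.grp⟩) (Y := ⟨D.grp⟩) f x) ∈ W := by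
  have hx1 := (mem_component θ).1 (hW.le hx)
  have h1 : S.act (X := ⟨D.grp⟩) (Y := ⟨D.grp⟩) (D.idem θ)
      (S.act (X := ⟨D.grp⟩) (Y := ⟨D.grp⟩) f x) = S.act (X := ⟨D.grp⟩) (Y := ⟨D.grp⟩)
        (diagMul k F D.grp D.grp D.grp (D.idem θ) (diagMul k F D.grp D.grp D.grp f (D.idem θ))) x :=
    ((S.act_mul (X := ⟨D.grp⟩) (Y := ⟨D.grp⟩) (Z := ⟨D.grp⟩) _ _ x).trans (congrArg _
      ((S.act_mul (X := ⟨D.grp⟩) (Y := ⟨D.grp⟩) (Z := ⟨D.grp⟩) _ _ x).trans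
        (congrArg _ hx1)))).symm
  rw [h1]
  have h2 : Submodule.span F (Set.range fun γ : D.aut =>
      diagMul k F D.grp D.grp D.grp (autClass k F γ.1) (D.idem θ)) ≤
      W.comap ((S.act (X := ⟨D.grp⟩) (Y := ⟨D.grp⟩)).flip x) := by
    refine Submodule.span_le.2 ?_
    rintro _ ⟨γ, rfl⟩
    have h3 : S.act (X := ⟨D.grp⟩) (Y := ⟨D.grp⟩)
        (diagMul k F D.grp D.grp D.grp (autClass k F γ.1) (D.idem θ)) x =
          S.act (X := ⟨D.grp⟩) (Y := ⟨D.grp⟩) (autClass k F γ.1) x :=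
      (S.act_mul (X := ⟨D.grp⟩) (Y := ⟨D.grp⟩) (Z := ⟨D.grp⟩) _ _ x).trans (congrArg _ hx1)
    have h4 := hW.act_mem γ hx
    rw [← h3] at h4
    exact h4
  exact h2 (DPair.idem_mul_mul_idem_mem_span θ f)

theorem act_idem_eq_zero (h : ¬ D'.Iso D) (f : DiagGroup k F D'.grp D.grp)
    {x : S.obj.obj ⟨D.grp⟩} (hx : x ∈ component θ S D) :
    S.act (X := ⟨D'.grp⟩) (Y := ⟨D'.grp⟩) (D'.idem θ)
      (S.act (X := ⟨D.grp⟩) (Y := ⟨D'.grp⟩) f x) = 0 := by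
  rw [mem_component] at hx
  rw [← hx, ← act_mul (X := ⟨D.grp⟩) (Y := ⟨D.grp⟩) (Z := ⟨D'.grp⟩),
    ← act_mul (X := ⟨D.grp⟩) (Y := ⟨D'.grp⟩) (Z := ⟨D'.grp⟩)]
  refine (congrArg (fun z => S.act (X := ⟨D.grp⟩) (Y := ⟨D'.grp⟩) z x)
    (DPair.idem_mul_mul_idem_eq_zero θ h f)).trans ?_
  simp

variable (θ)

/-- Membership in a subfunctor is detected by the idempotents attached to `D^Δ`-pairs. -/
theorem Sub.mem_of_forall (N : Sub S) {x : S.obj.obj X}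
    (h : ∀ (D : DPair p) (f : DiagGroup k F D.grp X.carrier),
      S.act (X := ⟨D.grp⟩) (Y := ⟨D.grp⟩) (D.idem θ) (S.act (Y := ⟨D.grp⟩) f x) ∈ N.val ⟨D.grp⟩) :
    x ∈ N.val X := by
  have h1 : Submodule.span F {y | ∃ (D : DPair p) (a : DiagGroup k F X.carrier D.grp)
      (b : DiagGroup k F D.grp X.carrier), diagMul k F X.carrier D.grp X.carrier a
        (diagMul k F D.grp D.grp X.carrier (D.idem θ) b) = y} ≤
      (N.val X).comap ((S.act (X := X) (Y := X)).flip x) := by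
    refine Submodule.span_le.2 ?_
    rintro _ ⟨D, a, b, rfl⟩
    change S.act (X := X) (Y := X) _ x ∈ N.val X
    rw [act_mul (X := X) (Y := ⟨D.grp⟩) (Z := X), act_mul (X := X) (Y := ⟨D.grp⟩) (Z := ⟨D.grp⟩)]
    exact N.act_mem (X := ⟨D.grp⟩) a (h D b)
  have h2 := h1 (DPair.mem_span_mul_idem_mul θ (autClass k F (1 : MulAut X.carrier)))
  have h3 : S.act (X := X) (Y := X) (autClass k F (1 : MulAut X.carrier)) x ∈ N.val X := h2
  rwa [act_one] at h3

theorem Sub.act_idem_mem_of_iso (N : Sub S) (h : D'.Iso D) {x : S.obj.obj ⟨D'.grp⟩}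
    (hx : ∀ f : DiagGroup k F D.grp D'.grp, S.act (X := ⟨D.grp⟩) (Y := ⟨D.grp⟩) (D.idem θ)
      (S.act (X := ⟨D'.grp⟩) (Y := ⟨D.grp⟩) f x) ∈ N.val ⟨D.grp⟩) :
    S.act (X := ⟨D'.grp⟩) (Y := ⟨D'.grp⟩) (D'.idem θ) x ∈ N.val ⟨D'.grp⟩ := by
  obtain ⟨φ, hφ⟩ := h
  obtain ⟨f, hf⟩ := DPair.exists_mulEquiv φ hφ
  have h1 : f D'.gen = D.gen := congrArg DPair.Pt.s hf
  have h2 := N.act_mem (X := ⟨D.grp⟩) (Y := ⟨D'.grp⟩) (isoClass θ f.symm) (hx (isoClass θ f))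
  rwa [← act_isoClass θ f (h1 ▸ IsConj.refl _), act_isoClass_symm θ p] at h2

/-- The zero subfunctor. -/
def Sub.bot (S : DiagPPermFunctor k F) : Sub S :=
  ⟨fun _ => ⊥, fun f x hx => by rw [Submodule.mem_bot] at hx ⊢; rw [hx, map_zero]⟩

variable {θ} in
/-- The subfunctor generated by a subspace of a value. -/
def Sub.gen (W : Submodule F (S.obj.obj X)) : Sub S where
  val Y := Submodule.span F {y | ∃ (f : DiagGroup k F Y.carrier X.carrier) (x : S.obj.obj X),
    x ∈ W ∧ S.act f x = y}
  act_mem {Y Z} g {y} hy := by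
    have h1 : Submodule.span F {y | ∃ (f : DiagGroup k F Y.carrier X.carrier) (x : S.obj.obj X),
        x ∈ W ∧ S.act f x = y} ≤ (Submodule.span F
          {y | ∃ (f : DiagGroup k F Z.carrier X.carrier) (x : S.obj.obj X),
        x ∈ W ∧ S.act f x = y}).comap (S.act g) := by
      refine Submodule.span_le.2 ?_
      rintro _ ⟨f, x, hx, rfl⟩
      exact Submodule.subset_span ⟨diagMul k F _ _ _ g f, x, hx, S.act_mul g f x⟩
    exact h1 hy

theorem Sub.le_gen (W : Submodule F (S.obj.obj X)) : W ≤ (Sub.gen W).val X := fun x hx =>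
  Submodule.subset_span ⟨_, x, hx, S.act_one x⟩

theorem Sub.gen_le {W : Submodule F (S.obj.obj X)} {N : Sub S} (h : W ≤ N.val X) (Y : PPCat k F) :
    (Sub.gen W).val Y ≤ N.val Y := by
  refine Submodule.span_le.2 ?_
  rintro _ ⟨f, x, hx, rfl⟩
  exact N.act_mem f (h hx)

variable {θ}

theorem IsStable.act_idem_mem_of_mem_gen {W : Submodule F (S.obj.obj ⟨D.grp⟩)}
    (hW : IsStable θ S D W) {x : S.obj.obj ⟨D.grp⟩} (hx : x ∈ (Sub.gen W).val ⟨D.grp⟩) :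
    S.act (X := ⟨D.grp⟩) (Y := ⟨D.grp⟩) (D.idem θ) x ∈ W := by
  have h1 : (Sub.gen W).val ⟨D.grp⟩ ≤ W.comap (S.act (X := ⟨D.grp⟩) (Y := ⟨D.grp⟩) (D.idem θ)) := by
    refine Submodule.span_le.2 ?_
    rintro _ ⟨f, x, hx, rfl⟩
    exact hW.act_idem_mem f hx
  exact h1 hx

theorem IsStable.act_idem_eq_zero_of_mem_gen {W : Submodule F (S.obj.obj ⟨D.grp⟩)}
    (hW : IsStable θ S D W) (h : ¬ D'.Iso D) {x : S.obj.obj ⟨D'.grp⟩}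
    (hx : x ∈ (Sub.gen W).val ⟨D'.grp⟩) :
    S.act (X := ⟨D'.grp⟩) (Y := ⟨D'.grp⟩) (D'.idem θ) x = 0 := by
  have h1 : (Sub.gen W).val ⟨D'.grp⟩ ≤
      LinearMap.ker (S.act (X := ⟨D'.grp⟩) (Y := ⟨D'.grp⟩) (D'.idem θ)) := by
    refine Submodule.span_le.2 ?_
    rintro _ ⟨f, x, hx, rfl⟩
    exact act_idem_eq_zero h f (hW.le hx)
  exact h1 hx

theorem Sub.simple_toFunctor {M : Sub S} (h0 : ∃ X, ∃ x ∈ M.val X, x ≠ 0)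
    (h : ∀ N : Sub S, (∀ X, N.val X ≤ M.val X) → (∃ X, ∃ x ∈ N.val X, x ≠ 0) →
      ∀ X, M.val X ≤ N.val X) : Simple M.toFunctor := by
  rw [simple_iff]
  refine ⟨?_, fun N hN X => ?_⟩
  · obtain ⟨X, x, hx, hx0⟩ := h0
    exact ⟨X, ⟨x, hx⟩, fun h1 => hx0 (congrArg Subtype.val h1)⟩
  · let N' : Sub S := ⟨fun X => (N.val X).map (M.val X).subtype, by
      rintro X Y f _ ⟨x, hx, rfl⟩
      exact ⟨_, N.act_mem f hx, rfl⟩⟩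
    obtain ⟨Y, y, hy, hy0⟩ := hN
    have h1 := h N' (fun X => by
      rintro _ ⟨x, -, rfl⟩
      exact x.2) ⟨Y, y.1, ⟨y, hy, rfl⟩, fun h1 => hy0 (Subtype.ext h1)⟩ X
    rw [eq_top_iff]
    rintro x -
    obtain ⟨x', hx', h2⟩ := h1 x.2
    rwa [← Subtype.ext h2]

/-- A stable submodule is irreducible. -/
abbrev IsIrred (θ : BrauerLift k F) (S : DiagPPermFunctor k F) (D : DPair p)
    (W : Submodule F (S.obj.obj ⟨D.grp⟩)) : Prop :=
  IsStable θ S D W ∧ W ≠ ⊥ ∧ ∀ W', IsStable θ S D W' → W' ≤ W → W' ≠ ⊥ → W' = W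

section

variable {W W' : Submodule F (S.obj.obj ⟨D.grp⟩)}

theorem IsIrred.isStable (hW : IsIrred θ S D W) : IsStable θ S D W := hW.1

theorem IsIrred.ne_bot (hW : IsIrred θ S D W) : W ≠ ⊥ := hW.2.1

theorem IsIrred.eq_of_le (hW : IsIrred θ S D W) (W' : Submodule F (S.obj.obj ⟨D.grp⟩))
    (h : IsStable θ S D W') (hle : W' ≤ W) (h0 : W' ≠ ⊥) : W' = W := hW.2.2 W' h hle h0

end

theorem Sub.isStable_inf (N : Sub S) {W : Submodule F (S.obj.obj ⟨D.grp⟩)} (hW : IsStable θ S D W) :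
    IsStable θ S D (W ⊓ N.val ⟨D.grp⟩) :=
  ⟨inf_le_left.trans hW.le, fun γ _ hx => ⟨hW.act_mem γ hx.1, N.act_mem _ hx.2⟩⟩

/-- The subfunctor generated by an irreducible submodule is simple. -/
theorem IsIrred.simple_gen {W : Submodule F (S.obj.obj ⟨D.grp⟩)} (hW : IsIrred θ S D W) :
    Simple (Sub.gen W).toFunctor := by
  refine Sub.simple_toFunctor ?_ fun N hN hN0 Y => ?_
  · obtain ⟨x, hx, hx0⟩ := (Submodule.ne_bot_iff _).1 hW.ne_bot
    exact ⟨_, x, Sub.le_gen W hx, hx0⟩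
  · by_cases h1 : W ⊓ N.val ⟨D.grp⟩ = ⊥
    · obtain ⟨X, x, hx, hx0⟩ := hN0
      refine (hx0 ?_).elim
      refine Sub.mem_of_forall θ (Sub.bot S) fun D' f => ?_
      by_cases h2 : D'.Iso D
      · refine Sub.act_idem_mem_of_iso θ (Sub.bot S) h2 fun g => ?_
        refine h1.le ⟨?_, ?_⟩
        · exact hW.isStable.act_idem_mem_of_mem_gen ((Sub.gen W).act_mem _ ((Sub.gen W).act_mem _ (hN _ hx)))
        · exact N.act_mem _ (N.act_mem _ (N.act_mem _ hx))
      · exact hW.isStable.act_idem_eq_zero_of_mem_gen h2 ((Sub.gen W).act_mem _ (hN _ hx))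
    · exact Sub.gen_le ((hW.eq_of_le _ (N.isStable_inf hW.isStable) inf_le_left h1) ▸ inf_le_right) Y

end DiagPPermFunctor

end Components

section Triples

variable {k : Type u} [Field k] [IsAlgClosed k] {p : ℕ} [Fact p.Prime] [CharP k p]
  {F : Type v} [Field F] [CharZero F] (θ : BrauerLift k F)

namespace DiagPPermFunctor

variable {S T : DiagPPermFunctor k F} {D D' : DPair p}

variable (S) in
/-- The action of an automorphism on the value at `L⟨u⟩`. -/
def actAut (γ : D.aut) : S.obj.obj ⟨D.grp⟩ →ₗ[F] S.obj.obj ⟨D.grp⟩ :=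
  S.act (X := ⟨D.grp⟩) (Y := ⟨D.grp⟩) (autClass k F γ.1)

theorem actAut_one (x : S.obj.obj ⟨D.grp⟩) : S.actAut (1 : D.aut) x = x :=
  S.act_one (X := ⟨D.grp⟩) x

theorem actAut_mul (θ : BrauerLift k F) (γ δ : D.aut) (x : S.obj.obj ⟨D.grp⟩) :
    S.actAut (γ * δ) x = S.actAut γ (S.actAut δ x) :=
  (act_congr (X := ⟨D.grp⟩) (Y := ⟨D.grp⟩) (DPair.autClass_mul θ p γ.1 δ.1) x).trans
    (S.act_mul (X := ⟨D.grp⟩) (Y := ⟨D.grp⟩) (Z := ⟨D.grp⟩) _ _ x)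

variable (S) in
/-- The representation of `Aut(L, u)` on the component at `(L, u)`. -/
def componentRep (D : DPair p) : Representation F D.aut (component θ S D) where
  toFun γ := (S.actAut γ).restrict fun _ hx => isStable_component.act_mem γ hx
  map_one' := LinearMap.ext fun x => Subtype.ext (actAut_one x.1)
  map_mul' γ δ := LinearMap.ext fun x => Subtype.ext (actAut_mul θ γ δ x.1)

variable (S) in
/-- The representation of `Out(L, u)` on the component at `(L, u)`. -/
def outRep (D : DPair p) : Representation F D.Out (component θ S D) :=
  QuotientGroup.lift D.inn (componentRep θ S D) (by
    rintro γ ⟨g, hg⟩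
    refine LinearMap.ext fun x => Subtype.ext ?_
    have h1 : γ.1 = MulAut.conj g := hg.symm
    have h2 : autClass k F γ.1 = autClass k F 1 := by rw [h1, DPair.autClass_conj θ p]
    exact (act_congr (X := ⟨D.grp⟩) (Y := ⟨D.grp⟩) h2 x.1).trans (S.act_one (X := ⟨D.grp⟩) x.1))

section Irreducible

variable {V : Type w} [AddCommGroup V] [Module F V] {ρ : Representation F D.Out V}
  {f : V →ₗ[F] S.obj.obj ⟨D.grp⟩}

variable {θ}

theorem isIrred_range (hρ : ρ.IsIrreducible) (hinj : Function.Injective f)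
    (hmem : ∀ x, f x ∈ component θ S D) (hf : ∀ (γ : D.aut) x, f (ρ γ x) = S.actAut γ (f x)) :
    IsIrred θ S D (LinearMap.range f) := by
  refine ⟨⟨?_, ?_⟩, ?_, fun W hW hle hne => le_antisymm hle ?_⟩
  · rintro _ ⟨x, rfl⟩
    exact hmem x
  · rintro γ _ ⟨x, rfl⟩
    exact ⟨ρ γ x, hf γ x⟩
  · intro h
    obtain ⟨N, N', hN⟩ := hρ.exists_pair_ne
    have h1 : ∀ x : V, x = 0 := fun x => hinj
      ((show f x = 0 from h.le ⟨x, rfl⟩).trans (map_zero f).symm)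
    refine hN (SetLike.ext fun x => ?_)
    rw [h1 x]
    exact ⟨fun _ => zero_mem N'.toSubmodule, fun _ => zero_mem N.toSubmodule⟩
  · let N : Subrepresentation ρ := ⟨W.comap f, fun g x hx => by
      obtain ⟨γ, rfl⟩ := QuotientGroup.mk_surjective g
      rw [Submodule.mem_comap, hf]
      exact hW.act_mem γ hx⟩
    obtain ⟨_, hx, hx0⟩ := (Submodule.ne_bot_iff _).1 hne
    obtain ⟨x, rfl⟩ := hle hx
    rcases hρ.eq_bot_or_eq_top N with h | h
    · have h1 : x ∈ N := hx
      rw [h] at h1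
      have h2 : x = 0 := h1
      rw [h2, map_zero] at hx0
      exact (hx0 rfl).elim
    · rintro _ ⟨y, rfl⟩
      have h1 : y ∈ N := by rw [h]; trivial
      exact h1

theorem isIrreducible_of_isIrred_range (h : IsIrred θ S D (LinearMap.range f))
    (hinj : Function.Injective f) (hf : ∀ (γ : D.aut) x, f (ρ γ x) = S.actAut γ (f x)) :
    ρ.IsIrreducible := by
  obtain ⟨_, ⟨x, rfl⟩, hx0⟩ := (Submodule.ne_bot_iff _).1 h.ne_bot
  have hx : x ≠ 0 := fun h => hx0 (by rw [h, map_zero])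
  refine { exists_pair_ne := ⟨⊥, ⊤, fun h1 => hx ?_⟩, eq_bot_or_eq_top := fun N => ?_ }
  · have h2 : x ∈ (⊤ : Subrepresentation ρ) := trivial
    rw [← h1] at h2
    exact h2
  · by_cases h1 : N.toSubmodule.map f = ⊥
    · left
      refine SetLike.ext fun y => ⟨fun hy => ?_, fun hy => ?_⟩
      · have h2 : f y ∈ N.toSubmodule.map f := ⟨y, hy, rfl⟩
        rw [h1] at h2
        exact hinj (h2.trans (map_zero f).symm)
      · have h2 : y = 0 := hy
        rw [h2]
        exact zero_mem N.toSubmodule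
    · right
      have h2 := h.eq_of_le (N.toSubmodule.map f) ⟨?_, ?_⟩ (LinearMap.map_le_range) h1
      · refine SetLike.ext fun y => ⟨fun _ => trivial, fun _ => ?_⟩
        obtain ⟨z, hz, hzy⟩ := h2.ge ⟨y, rfl⟩
        rw [← hinj hzy]
        exact hz
      · exact LinearMap.map_le_range.trans h.isStable.le
      · rintro γ _ ⟨y, hy, rfl⟩
        exact ⟨ρ γ y, N.apply_mem_toSubmodule _ hy, hf γ y⟩

end Irreducible

variable {θ}

theorem isStable_span (x : S.obj.obj ⟨D.grp⟩) (hx : x ∈ component θ S D) :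
    IsStable θ S D (Submodule.span F (Set.range fun γ : D.aut => S.actAut γ x)) := by
  refine ⟨Submodule.span_le.2 ?_, fun γ y hy => ?_⟩
  · rintro _ ⟨γ, rfl⟩
    exact isStable_component.act_mem γ hx
  · change S.actAut γ y ∈ _
    induction hy using Submodule.span_induction with
    | zero => rw [map_zero]; exact Submodule.zero_mem _
    | add y z _ _ hy hz => rw [map_add]; exact Submodule.add_mem _ hy hz
    | smul r y _ hy => rw [map_smul]; exact Submodule.smul_mem _ _ hy
    | mem y hy =>
      obtain ⟨δ, rfl⟩ := hy
      rw [← actAut_mul θ]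
      exact Submodule.subset_span ⟨γ * δ, rfl⟩

theorem IsIrred.finite {W : Submodule F (S.obj.obj ⟨D.grp⟩)} (hW : IsIrred θ S D W) :
    Module.Finite F W := by
  obtain ⟨x, hx, hx0⟩ := (Submodule.ne_bot_iff _).1 hW.ne_bot
  have h1 : Submodule.span F (Set.range fun γ : D.aut => S.actAut γ x) ≤ W :=
    Submodule.span_le.2 (by
      rintro _ ⟨γ, rfl⟩
      exact hW.isStable.act_mem γ hx)
  have h2 : x ∈ Submodule.span F (Set.range fun γ : D.aut => S.actAut γ x) :=
    Submodule.subset_span ⟨1, actAut_one x⟩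
  have h3 := hW.eq_of_le _ (isStable_span x (hW.isStable.le hx)) h1 fun h3 => hx0 (by
    rw [h3] at h2
    exact h2)
  have h4 : Module.Finite F (Submodule.span F (Set.range fun γ : D.aut => S.actAut γ x)) :=
    Module.Finite.span_of_finite F (Set.finite_range _)
  rwa [h3] at h4

theorem corresponds_iff {t : Triple p F} : Corresponds θ t S ↔
    ∃ e : t.V ≃ₗ[F] component θ S t.pair, ∀ (γ : t.pair.aut) (x : t.V),
      (e (t.rep γ x) : S.obj.obj ⟨t.pair.grp⟩) = S.actAut γ (e x) := Iff.rfl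

theorem isIrred_of_corresponds {t : Triple p F} (h : Corresponds θ t S) :
    IsIrred θ S t.pair (component θ S t.pair) := by
  obtain ⟨e, he⟩ := corresponds_iff.1 h
  have h1 := isIrred_range (θ := θ) (f := (component θ S t.pair).subtype ∘ₗ e.toLinearMap) t.simple
    (Subtype.val_injective.comp e.injective) (fun x => (e x).2) he
  rwa [LinearMap.range_comp, LinearEquiv.range, Submodule.map_top, Submodule.range_subtype] at h1

theorem exists_corresponds (h : IsIrred θ S D (component θ S D)) :
    ∃ t : Triple p F, Corresponds θ t S := by
  have := h.finite
  let e := (Module.finBasis F (component θ S D)).equivFun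
  let ρ := outRep θ S D
  have hρ : ρ.IsIrreducible := isIrreducible_of_isIrred_range (θ := θ)
    (f := (component θ S D).subtype) (by rwa [Submodule.range_subtype]) Subtype.val_injective
    fun γ x => rfl
  let t : Triple p F := 
    { pair := D
      V := Fin (Module.finrank F (component θ S D)) → F
      rep := transport e ρ
      simple := isIrreducible_of_isIrred_range (θ := θ)
        (f := (component θ S D).subtype ∘ₗ e.symm.toLinearMap)
        (by rwa [LinearMap.range_comp, LinearEquiv.range, Submodule.map_top, Submodule.range_subtype])
        (Subtype.val_injective.comp e.symm.injective) fun γ x => by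
          exact congrArg Subtype.val (e.symm_apply_apply (ρ γ (e.symm x))) }
  refine ⟨t, e.symm, fun γ x => ?_⟩
  exact congrArg Subtype.val (e.symm_apply_apply (ρ γ (e.symm x)))

end DiagPPermFunctor

end Triples

section Correspondence

variable {k : Type u} [Field k] [IsAlgClosed k] {p : ℕ} [Fact p.Prime] [CharP k p]
  {F : Type v} [Field F] [CharZero F] {θ : BrauerLift k F}

namespace DiagPPermFunctor

variable {S T : DiagPPermFunctor k F} {D D' : DPair p}

theorem appₗ_mem_component (i : S ⟶ T) {x : S.obj.obj ⟨D.grp⟩} (hx : x ∈ component θ S D) :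
    appₗ i ⟨D.grp⟩ x ∈ component θ T D := by
  rw [mem_component] at hx ⊢
  rw [← appₗ_act, hx]

theorem corresponds_of_iso {t : Triple p F} (i : S ≅ T) (h : Corresponds θ t S) :
    Corresponds θ t T := by
  obtain ⟨e, he⟩ := corresponds_iff.1 h
  have h1 : ∀ X x, appₗ i.inv X (appₗ i.hom X x) = x := fun X x => by
    rw [← appₗ_comp, i.hom_inv_id]
    rfl
  have h2 : ∀ X x, appₗ i.hom X (appₗ i.inv X x) = x := fun X x => by
    rw [← appₗ_comp, i.inv_hom_id]
    rfl
  let E : component θ S t.pair ≃ₗ[F] component θ T t.pair := .ofLinearMap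
    ((appₗ i.hom ⟨t.pair.grp⟩).restrict fun _ hx => appₗ_mem_component i.hom hx)
    ((appₗ i.inv ⟨t.pair.grp⟩).restrict fun _ hx => appₗ_mem_component i.inv hx)
    (LinearMap.ext fun x => Subtype.ext (h2 _ _)) (LinearMap.ext fun x => Subtype.ext (h1 _ _))
  refine corresponds_iff.2 ⟨e.trans E, fun γ x => ?_⟩
  refine (congrArg (appₗ i.hom ⟨t.pair.grp⟩) (he γ x)).trans ?_
  exact appₗ_act (X := ⟨t.pair.grp⟩) (Y := ⟨t.pair.grp⟩) i.hom _ _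

theorem act_isoClass_actAut {f : D.grp ≃* D'.grp} {γ : D.aut} {γ' : D'.aut}
    (h : ∀ x, (γ' : MulAut D'.grp) (f x) = f ((γ : MulAut D.grp) x)) (x : S.obj.obj ⟨D.grp⟩) :
    S.act (X := ⟨D.grp⟩) (Y := ⟨D'.grp⟩) (isoClass θ f) (S.actAut γ x) =
      S.actAut γ' (S.act (X := ⟨D.grp⟩) (Y := ⟨D'.grp⟩) (isoClass θ f) x) := by
  have h1 : diagMul k F D'.grp D.grp D.grp (isoClass θ f) (autClass k F γ.1) =
      diagMul k F D'.grp D'.grp D.grp (autClass k F γ'.1) (isoClass θ f) := by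
    have h2 : (γ.1 : D.grp ≃* D.grp).trans f = f.trans γ'.1 := MulEquiv.ext fun x => (h x).symm
    refine (congrArg (diagMul k F D'.grp D.grp D.grp (isoClass θ f))
      (isoClass_eq_autClass θ γ.1).symm).trans ((diagMul_isoClass θ p f γ.1).trans ?_)
    rw [h2]
    exact (diagMul_isoClass θ p γ'.1 f).symm.trans (congrArg
      (fun z => diagMul k F D'.grp D'.grp D.grp z (isoClass θ f)) (isoClass_eq_autClass θ γ'.1))
  exact ((S.act_mul (X := ⟨D.grp⟩) (Y := ⟨D.grp⟩) (Z := ⟨D'.grp⟩) _ _ x).symm.trans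
    (act_congr h1 x)).trans (S.act_mul (X := ⟨D.grp⟩) (Y := ⟨D'.grp⟩) (Z := ⟨D'.grp⟩) _ _ x)

theorem act_isoClass_mem_component {f : D.grp ≃* D'.grp} (hf : IsConj (f D.gen) D'.gen)
    {x : S.obj.obj ⟨D.grp⟩} (hx : x ∈ component θ S D) :
    S.act (X := ⟨D.grp⟩) (Y := ⟨D'.grp⟩) (isoClass θ f) x ∈ component θ S D' := by
  rw [mem_component] at hx ⊢
  rw [← act_isoClass θ f hf, hx]

variable (θ S) in
/-- Isomorphic `D^Δ`-pairs have isomorphic components. -/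
def componentEquiv (f : D.grp ≃* D'.grp) (hf : IsConj (f D.gen) D'.gen) :
    component θ S D ≃ₗ[F] component θ S D' :=
  .ofLinearMap
    ((S.act (X := ⟨D.grp⟩) (Y := ⟨D'.grp⟩) (isoClass θ f)).restrict
      fun _ hx => act_isoClass_mem_component hf hx)
    ((S.act (X := ⟨D'.grp⟩) (Y := ⟨D.grp⟩) (isoClass θ f.symm)).restrict
      fun _ hx => act_isoClass_mem_component (by simpa using isConj_map f.symm hf.symm) hx)
    (LinearMap.ext fun x => Subtype.ext (act_isoClass_symm θ p f.symm x.1))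
    (LinearMap.ext fun x => Subtype.ext (act_isoClass_symm θ p f x.1))

theorem componentEquiv_rep {f : D.grp ≃* D'.grp} (hf : IsConj (f D.gen) D'.gen) {γ : D.aut}
    {γ' : D'.aut} (h : ∀ x, (γ' : MulAut D'.grp) (f x) = f ((γ : MulAut D.grp) x))
    (x : component θ S D) : componentEquiv θ S f hf (componentRep θ S D γ x) =
      componentRep θ S D' γ' (componentEquiv θ S f hf x) :=
  Subtype.ext (act_isoClass_actAut h x.1)

theorem corresponds_iff' {t : Triple p F} : Corresponds θ t S ↔
    ∃ e : t.V ≃ₗ[F] component θ S t.pair, ∀ (γ : t.pair.aut) (x : t.V),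
      e (t.rep γ x) = componentRep θ S t.pair γ (e x) :=
  ⟨fun ⟨e, he⟩ => ⟨e, fun γ x => Subtype.ext (he γ x)⟩,
    fun ⟨e, he⟩ => ⟨e, fun γ x => congrArg Subtype.val (he γ x)⟩⟩

theorem corresponds_of_equiv {t t' : Triple p F} (h : t ≈ t') (ht : Corresponds θ t S) :
    Corresponds θ t' S := by
  obtain ⟨f, e, hf, he⟩ := h
  obtain ⟨e₁, he₁⟩ := corresponds_iff'.1 ht
  refine corresponds_iff'.2 ⟨(e.symm.trans e₁).trans (componentEquiv θ S f hf), fun γ' x => ?_⟩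
  obtain ⟨γ, hγ⟩ := exists_conj f.symm (by simpa using isConj_map f.symm hf.symm) γ'
  have h1 : ∀ x, (γ' : MulAut t'.pair.grp) (f x) = f ((γ : MulAut t.pair.grp) x) := fun x => by
    have h2 := congrArg f (hγ (f x))
    rw [f.symm_apply_apply, f.apply_symm_apply] at h2
    exact h2.symm
  have h2 : e.symm (t'.rep γ' x) = t.rep γ (e.symm x) := by
    rw [LinearEquiv.symm_apply_eq, he γ γ' h1, e.apply_symm_apply]
  simp only [LinearEquiv.trans_apply]
  rw [h2, he₁, componentEquiv_rep hf h1]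

theorem eq_top_of_simple (hS : Simple S) {N : Sub S} {X : PPCat k F} {x : S.obj.obj X}
    (hx : x ∈ N.val X) (hx0 : x ≠ 0) (Y : PPCat k F) (y : S.obj.obj Y) : y ∈ N.val Y := by
  rw [((simple_iff S).1 hS).2 N ⟨X, x, hx, hx0⟩ Y]
  trivial

theorem equiv_of_corresponds {t t' : Triple p F} (hS : Simple S) (ht : Corresponds θ t S)
    (ht' : Corresponds θ t' S) : t ≈ t' := by
  have h1 := isIrred_of_corresponds ht
  have h2 := isIrred_of_corresponds ht'
  obtain ⟨x, hx, hx0⟩ := (Submodule.ne_bot_iff _).1 h1.ne_bot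
  obtain ⟨y, hy, hy0⟩ := (Submodule.ne_bot_iff _).1 h2.ne_bot
  have h3 : t'.pair.Iso t.pair := by
    by_contra h3
    have h4 := h1.isStable.act_idem_eq_zero_of_mem_gen h3 (eq_top_of_simple hS (Sub.le_gen _ hx) hx0 _ y)
    rw [(mem_component θ).1 hy] at h4
    exact hy0 h4
  obtain ⟨φ, hφ⟩ := h3.symm
  obtain ⟨f, hf⟩ := DPair.exists_mulEquiv φ hφ
  have hf' : IsConj (f t.pair.gen) t'.pair.gen := by
    rw [show f t.pair.gen = t'.pair.gen from congrArg DPair.Pt.s hf]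
  obtain ⟨e, he⟩ := corresponds_iff'.1 ht
  obtain ⟨e', he'⟩ := corresponds_iff'.1 ht'
  refine ⟨f, (e.trans (componentEquiv θ S f hf')).trans e'.symm, hf', fun γ γ' h x => ?_⟩
  simp only [LinearEquiv.trans_apply]
  rw [LinearEquiv.symm_apply_eq, he, componentEquiv_rep hf' h, he', e'.apply_symm_apply]

theorem exists_isIrred (θ : BrauerLift k F) (hS : Simple S) :
    ∃ D : DPair p, IsIrred θ S D (component θ S D) := by
  obtain ⟨X, x, hx0⟩ := ((simple_iff S).1 hS).1
  obtain ⟨D, f, hf⟩ : ∃ (D : DPair p) (f : DiagGroup k F D.grp X.carrier),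
      S.act (X := ⟨D.grp⟩) (Y := ⟨D.grp⟩) (D.idem θ) (S.act (Y := ⟨D.grp⟩) f x) ≠ 0 := by
    by_contra! h
    exact hx0 (Sub.mem_of_forall θ (Sub.bot S) h)
  refine ⟨D, isStable_component, fun h => hf (h.le (act_idem_mem_component θ _)),
    fun W hW hle hne => le_antisymm hle fun y hy => ?_⟩
  obtain ⟨z, hz, hz0⟩ := (Submodule.ne_bot_iff _).1 hne
  rw [← (mem_component θ).1 hy]
  exact hW.act_idem_mem_of_mem_gen (eq_top_of_simple hS (Sub.le_gen _ hz) hz0 _ y)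

variable (S T) in
/-- The direct sum of two functors. -/
def prod : DiagPPermFunctor k F :=
  mk' (fun X => S.obj.obj X × T.obj.obj X)
    (fun {X Y} =>
      { toFun := fun f => (S.act f).prodMap (T.act f)
        map_add' := fun f g => by rw [map_add, map_add, LinearMap.prodMap_add]
        map_smul' := fun r f => by
          rw [map_smul, map_smul, LinearMap.prodMap_smul]; rfl })
    (fun _ x => Prod.ext (S.act_one x.1) (T.act_one x.2))
    (fun f g x => Prod.ext (S.act_mul f g x.1) (T.act_mul f g x.2))

variable (S T) in
/-- The first projection. -/
def fst : prod S T ⟶ S := ofApp (fun _ => LinearMap.fst F _ _) fun _ _ => rfl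

variable (S T) in
/-- The second projection. -/
def snd : prod S T ⟶ T := ofApp (fun _ => LinearMap.snd F _ _) fun _ _ => rfl

theorem iso_of_corresponds {t : Triple p F} (hS : Simple S) (hT : Simple T)
    (h : Corresponds θ t S) (h' : Corresponds θ t T) : Nonempty (S ≅ T) := by
  obtain ⟨e, he⟩ := corresponds_iff.1 h
  obtain ⟨e', he'⟩ := corresponds_iff.1 h'
  let f : t.V →ₗ[F] (prod S T).obj.obj ⟨t.pair.grp⟩ :=
    ((component θ S t.pair).subtype ∘ₗ e.toLinearMap).prod
      ((component θ T t.pair).subtype ∘ₗ e'.toLinearMap)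
  have hinj : Function.Injective f := fun x y hxy =>
    e.injective (Subtype.ext (congrArg Prod.fst hxy))
  have hW : IsIrred θ (prod S T) t.pair (LinearMap.range f) := by
    refine isIrred_range t.simple hinj (fun x => ?_) fun γ x => Prod.ext (he γ x) (he' γ x)
    exact (mem_component θ).2
      (Prod.ext ((mem_component θ).1 (e x).2) ((mem_component θ).1 (e' x).2))
  obtain ⟨_, ⟨x, rfl⟩, hx0⟩ := (Submodule.ne_bot_iff _).1 hW.ne_bot
  have hx : x ≠ 0 := fun h => hx0 (by rw [h, map_zero])
  let y : (Sub.gen (LinearMap.range f)).toFunctor.obj.obj ⟨t.pair.grp⟩ := ⟨f x, Sub.le_gen _ ⟨x, rfl⟩⟩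
  have h1 : IsIso ((Sub.gen (LinearMap.range f)).incl ≫ fst S T) := by
    refine isIso_of_simple hW.simple_gen hS _ (x := y) fun h => hx (e.injective (Subtype.ext ?_))
    rw [map_zero]
    exact h
  have h2 : IsIso ((Sub.gen (LinearMap.range f)).incl ≫ snd S T) := by
    refine isIso_of_simple hW.simple_gen hT _ (x := y) fun h => hx (e'.injective (Subtype.ext ?_))
    rw [map_zero]
    exact h
  exact ⟨(asIso ((Sub.gen (LinearMap.range f)).incl ≫ fst S T)).symm.trans (asIso ((Sub.gen (LinearMap.range f)).incl ≫ snd S T))⟩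

variable (k F) in
/-- The representable functor attached to a group. -/
def representable (G : Type) [Group G] [Finite G] : DiagPPermFunctor k F :=
  mk' (fun X => DiagGroup k F X.carrier G) (fun {X Y} => diagMul k F Y.carrier X.carrier G)
    (fun _ x => one_diagMul x) (fun f g x => diagMul_assoc f g x)

theorem autClass_eq_of_mk_eq (θ : BrauerLift k F) {γ δ : D.aut} (h : (γ : D.Out) = δ) :
    autClass k F γ.1 = autClass k F δ.1 := by
  obtain ⟨g, hg⟩ := QuotientGroup.eq.1 h
  have h1 : δ.1 = γ.1 * MulAut.conj g := by
    have h2 : MulAut.conj g = γ.1⁻¹ * δ.1 := hg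
    rw [h2, mul_inv_cancel_left]
  rw [h1, DPair.autClass_mul θ p, DPair.autClass_conj θ p, diagMul_one]

/-- Every simple `F Out(L, u)`-module embeds in the component at `(L, u)` of a representable
functor. -/
theorem exists_embedding (θ : BrauerLift k F) {V : Type w} [AddCommGroup V] [Module F V]
    {ρ : Representation F D.Out V} (hρ : ρ.IsIrreducible) :
    ∃ f : V →ₗ[F] (representable k F D.grp).obj.obj ⟨D.grp⟩, Function.Injective f ∧
      (∀ x, f x ∈ component θ (representable k F D.grp) D) ∧
      ∀ (γ : D.aut) x, f (ρ γ x) = (representable k F D.grp).actAut γ (f x) := by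
  have := Fintype.ofFinite D.Out
  obtain ⟨v, hv⟩ : ∃ v : V, v ≠ 0 := by
    by_contra! h
    obtain ⟨N, N', hN⟩ := hρ.exists_pair_ne
    refine hN (SetLike.ext fun x => ?_)
    rw [h x]
    exact ⟨fun _ => zero_mem N'.toSubmodule, fun _ => zero_mem N.toSubmodule⟩
  obtain ⟨l, hl⟩ : ∃ l : Module.Dual F V, l v ≠ 0 := by
    by_contra! h
    exact hv ((Module.forall_dual_apply_eq_zero_iff F v).1 h)
  let b : D.Out → DiagGroup k F D.grp D.grp := fun o =>
    diagMul k F D.grp D.grp D.grp (D.idem θ) (autClass k F o.out.1)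
  have hb : ∀ (γ : D.aut) (o : D.Out),
      diagMul k F D.grp D.grp D.grp (autClass k F γ.1) (b o) = b (γ * o) := by
    intro γ o
    have h1 : autClass k F (γ * o.out).1 = autClass k F ((γ : D.Out) * o).out.1 :=
      autClass_eq_of_mk_eq θ (by rw [QuotientGroup.mk_mul, QuotientGroup.out_eq', QuotientGroup.out_eq'])
    refine (diagMul_assoc _ _ _).symm.trans ?_
    refine (congrArg (fun z => diagMul k F D.grp D.grp D.grp z (autClass k F o.out.1))
      (DPair.autClass_mul_idem θ γ)).trans ((diagMul_assoc _ _ _).trans ?_)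
    exact congrArg (diagMul k F D.grp D.grp D.grp (D.idem θ))
      ((DPair.autClass_mul θ p γ.1 o.out.1).symm.trans h1)
  let f : V →ₗ[F] (representable k F D.grp).obj.obj ⟨D.grp⟩ :=
    ∑ o : D.Out, (l ∘ₗ ρ o⁻¹).smulRight (b o)
  have hf : ∀ x, f x = (∑ o : D.Out, l (ρ o⁻¹ x) • b o : DiagGroup k F D.grp D.grp) := fun x =>
    LinearMap.sum_apply _ _ _
  have heq : ∀ (γ : D.aut) x, f (ρ γ x) = (representable k F D.grp).actAut γ (f x) := fun γ x => by
    have h1 : (∑ o : D.Out, l (ρ o⁻¹ (ρ γ x)) • b o : DiagGroup k F D.grp D.grp) =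
        diagMul k F D.grp D.grp D.grp (autClass k F γ.1) (∑ o : D.Out, l (ρ o⁻¹ x) • b o) := by
      rw [map_sum]
      refine (Fintype.sum_equiv (Equiv.mulLeft (γ : D.Out)) _ _ fun o => ?_).symm
      refine ((diagMul k F D.grp D.grp D.grp (autClass k F γ.1)).map_smul _ _).trans ?_
      rw [hb]
      have h3 : ρ o⁻¹ x = ρ (Equiv.mulLeft (γ : D.Out) o)⁻¹ (ρ γ x) := by
        rw [Equiv.coe_mulLeft, ← Module.End.mul_apply, ← _root_.map_mul, mul_inv_rev,
          inv_mul_cancel_right]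
      exact congrArg (fun z => l z • b ((γ : D.Out) * o)) h3
    refine (hf _).trans (h1.trans ?_)
    rw [← hf]
    rfl
  refine ⟨f, ?_, fun x => ?_, heq⟩
  · let N : Subrepresentation ρ := ⟨LinearMap.ker f, fun g x hx => by
      obtain ⟨γ, rfl⟩ := QuotientGroup.mk_surjective g
      refine LinearMap.mem_ker.2 ((heq γ x).trans ?_)
      rw [LinearMap.mem_ker.1 hx, map_zero]⟩
    rcases hρ.eq_bot_or_eq_top N with h | h
    · rw [injective_iff_map_eq_zero]
      intro x hx
      have h1 : x ∈ N := hx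
      rw [h] at h1
      exact h1
    · have h1 : v ∈ N := by rw [h]; trivial
      have h2 : (∑ o : D.Out, l (ρ o⁻¹ v) • b o : DiagGroup k F D.grp D.grp) = 0 :=
        (hf v).symm.trans h1
      have h3 := Fintype.linearIndependent_iff.1
        (DPair.linearIndependent_idem_mul_autClass (k := k) θ) _ h2 1
      rw [inv_one, map_one] at h3
      exact (hl h3).elim
  · refine (mem_component θ).2 ?_
    have h1 : diagMul k F D.grp D.grp D.grp (D.idem θ) (∑ o : D.Out, l (ρ o⁻¹ x) • b o) =
        ∑ o : D.Out, l (ρ o⁻¹ x) • b o := by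
      rw [map_sum]
      refine Finset.sum_congr rfl fun o _ => ?_
      refine ((diagMul k F D.grp D.grp D.grp (D.idem θ)).map_smul _ _).trans ?_
      rw [DPair.idem_mul_idem_mul]
    rw [hf]
    exact h1

theorem exists_simple (t : Triple p F) (θ : BrauerLift k F) :
    ∃ S : DiagPPermFunctor k F, Simple S ∧ Corresponds θ t S := by
  obtain ⟨f, hinj, hmem, hf⟩ := exists_embedding (k := k) θ t.simple
  have hW := isIrred_range t.simple hinj hmem hf
  let M := (Sub.gen (LinearMap.range f)).toFunctor
  let e : t.V →ₗ[F] component θ M t.pair :=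
    { toFun := fun x => ⟨⟨f x, Sub.le_gen _ ⟨x, rfl⟩⟩,
        (mem_component θ).2 (Subtype.ext ((mem_component θ).1 (hmem x)))⟩
      map_add' := fun x y => Subtype.ext (Subtype.ext (f.map_add x y))
      map_smul' := fun r x => Subtype.ext (Subtype.ext (f.map_smul r x)) }
  refine ⟨M, hW.simple_gen, corresponds_iff.2 ⟨LinearEquiv.ofBijective e ⟨fun x y h => ?_, fun y => ?_⟩,
    fun γ x => Subtype.ext (hf γ x)⟩⟩
  · exact hinj (congrArg (fun z => z.1.1) h)
  · have h1 := hW.isStable.act_idem_mem_of_mem_gen y.1.2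
    obtain ⟨x, hx⟩ := h1
    have h2 := congrArg Subtype.val ((mem_component θ).1 y.2)
    exact ⟨x, Subtype.ext (Subtype.ext (hx.trans h2))⟩

end DiagPPermFunctor

end Correspondence

/-- Maschke's theorem: a representation of a finite group is a direct sum of irreducible
subrepresentations. -/
theorem exists_subrepresentation_decomposition {F : Type v} [Field F] [CharZero F] {G : Type w'}
    [Group G] [Finite G] {V : Type w} [AddCommGroup V] [Module F V] (ρ : Representation F G V) :
    ∃ (ι : Type w) (N : ι → Subrepresentation ρ), iSupIndep (fun i => (N i).toSubmodule) ∧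
      ⨆ i, (N i).toSubmodule = ⊤ ∧ ∀ i, (∃ x ∈ N i, x ≠ 0) ∧
        ∀ N' : Subrepresentation ρ, N' ≤ N i → (∃ x ∈ N', x ≠ 0) → N' = N i := by
  obtain ⟨s, h1, h2, h3⟩ :=
    IsSemisimpleModule.exists_sSupIndep_sSup_simples_eq_top F[G] ρ.asModule
  have hmem : ∀ (m : Submodule F[G] ρ.asModule) (x : V),
      x ∈ (Subrepresentation.ofSubmodule' m).toSubmodule ↔ ρ.asModuleEquiv.symm x ∈ m :=
    fun _ _ => Iff.rfl
  have hmono : ∀ {m m' : Submodule F[G] ρ.asModule}, m ≤ m' →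
      (Subrepresentation.ofSubmodule' m).toSubmodule ≤
        (Subrepresentation.ofSubmodule' m').toSubmodule := fun h x hx => h hx
  refine ⟨s, fun m => Subrepresentation.ofSubmodule' m.1, ?_, ?_, fun m => ⟨?_, fun N' hle h => ?_⟩⟩
  · rw [iSupIndep_def]
    intro i
    rw [Submodule.disjoint_def]
    intro x hx hx'
    refine (Submodule.disjoint_def.1 (h1 i.2)) (ρ.asModuleEquiv.symm x) hx ?_
    have h4 : (⨆ (j : s) (_ : j ≠ i), (Subrepresentation.ofSubmodule' j.1).toSubmodule) ≤
        (Subrepresentation.ofSubmodule' (sSup (s \ {i.1}))).toSubmodule :=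
      iSup₂_le fun j hj => hmono (le_sSup ⟨j.2, fun h => hj (Subtype.ext h)⟩)
    exact h4 hx'
  · rw [eq_top_iff]
    rintro x -
    have h4 : ρ.asModuleEquiv.symm x ∈ ⨆ m : s, m.1 := by
      rw [← sSup_eq_iSup', h2]
      trivial
    have h5 : ∀ y : ρ.asModule, y ∈ ⨆ m : s, m.1 →
        ρ.asModuleEquiv y ∈ ⨆ m : s, (Subrepresentation.ofSubmodule' m.1).toSubmodule := by
      intro y hy
      induction hy using Submodule.iSup_induction' with
      | mem i y hy => exact Submodule.mem_iSup_of_mem i ((hmem _ _).2 hy)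
      | zero => rw [map_zero]; exact zero_mem _
      | add y z _ _ hy hz => rw [map_add]; exact add_mem hy hz
    exact h5 _ h4
  · have h4 := (isSimpleModule_iff_isAtom.1 (h3 m.1 m.2)).1
    obtain ⟨x, hx, hx0⟩ := (Submodule.ne_bot_iff _).1 h4
    exact ⟨x, hx, hx0⟩
  · have h4 := isSimpleModule_iff_isAtom.1 (h3 m.1 m.2)
    obtain ⟨x, hx, hx0⟩ := h
    have h5 : Subrepresentation.asSubmodule N' ≤ m.1 := fun x hx => hle hx
    rcases h4.le_iff.1 h5 with h6 | h6
    · have h7 : ρ.asModuleEquiv.symm x ∈ (⊥ : Submodule F[G] ρ.asModule) := by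
        rw [← h6]
        exact hx
      rw [Submodule.mem_bot] at h7
      exact (hx0 h7).elim
    exact SetLike.ext fun y => ⟨fun hy => hle hy, fun hy => by
      have h7 : ρ.asModuleEquiv.symm y ∈ m.1 := hy
      rw [← h6] at h7
      exact h7⟩

section Decomposition

variable {k : Type u} [Field k] [IsAlgClosed k] {p : ℕ} [Fact p.Prime] [CharP k p]
  {F : Type v} [Field F] [CharZero F]

namespace DiagPPermFunctor

variable (θ : BrauerLift k F) (S : DiagPPermFunctor k F)

/-- The components of a functor are direct sums of irreducible stable subspaces. -/
theorem exists_isIrred_decomposition (D : DPair p) :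
    ∃ (ι : Type (max u v)) (W : ι → Submodule F (S.obj.obj ⟨D.grp⟩)), iSupIndep W ∧
      ⨆ i, W i = component θ S D ∧ ∀ i, IsIrred θ S D (W i) := by
  obtain ⟨ι, N, h1, h2, h3⟩ := exists_subrepresentation_decomposition (componentRep θ S D)
  refine ⟨ι, fun i => (N i).toSubmodule.map (component θ S D).subtype,
    LinearMap.iSupIndep_map _ Subtype.val_injective h1, ?_, fun i => ⟨⟨?_, ?_⟩, ?_, ?_⟩⟩
  · rw [← Submodule.map_iSup, h2, Submodule.map_top, Submodule.range_subtype]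
  · rintro _ ⟨x, -, rfl⟩
    exact x.2
  · rintro γ _ ⟨x, hx, rfl⟩
    exact ⟨componentRep θ S D γ x, (N i).apply_mem_toSubmodule γ hx, rfl⟩
  · obtain ⟨x, hx, hx0⟩ := (h3 i).1
    exact (Submodule.ne_bot_iff _).2 ⟨x, ⟨x, hx, rfl⟩, fun h => hx0 (Subtype.ext h)⟩
  · intro W hW hle hne
    let N' : Subrepresentation (componentRep θ S D) :=
      ⟨W.comap (component θ S D).subtype, fun γ x hx => hW.act_mem γ hx⟩
    obtain ⟨x, hx, hx0⟩ := (Submodule.ne_bot_iff _).1 hne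
    have h4 := (h3 i).2 N' (fun x hx => by
      obtain ⟨y, hy, hyx⟩ := hle hx
      rwa [← Subtype.ext hyx]) ⟨⟨x, hW.le hx⟩, hx, fun h => hx0 (congrArg Subtype.val h)⟩
    refine le_antisymm hle ?_
    rintro _ ⟨y, hy, rfl⟩
    have h5 : y ∈ N' := by rw [h4]; exact hy
    exact h5

end DiagPPermFunctor

theorem DPair.Iso.refl {p : ℕ} (D : DPair p) : D.Iso D := ⟨MulEquiv.refl D.L, fun _ => rfl⟩

/-- Representatives of the isomorphism classes of `D^Δ`-pairs. -/
theorem DPair.exists_representatives (p : ℕ) [Fact p.Prime] : ∃ (J : Type) (D : J → DPair p),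
    (∀ i j, (D i).Iso (D j) → i = j) ∧ ∀ D' : DPair p, ∃ j, D'.Iso (D j) := by
  let J' := Σ (A : Set ℕ) (_ : Group A),
    {u : MulAut A // Finite A ∧ IsPGroup p A ∧ (orderOf u).Coprime p}
  let E : J' → DPair p := fun j =>
    let _ := j.2.1
    let _ := j.2.2.2.1
    ⟨j.1, j.2.2.2.2.1, j.2.2.1, j.2.2.2.2.2⟩
  let s : Setoid J' := ⟨fun i j => (E i).Iso (E j),
    ⟨fun i => DPair.Iso.refl (E i), fun h => DPair.Iso.symm h, fun h => DPair.Iso.trans h⟩⟩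
  refine ⟨Quotient s, fun j => E j.out, fun i j h => ?_, fun D' => ?_⟩
  · rw [← i.out_eq, ← j.out_eq]
    exact Quotient.sound h
  · obtain ⟨f, hf⟩ := Countable.exists_injective_nat D'.L
    let e := Equiv.ofInjective f hf
    let g : Group (Set.range f) := e.symm.group
    let φ : D'.L ≃* Set.range f := e.symm.mulEquiv.symm
    let j : J' := ⟨Set.range f, g, MulAut.congr φ D'.u, Set.finite_range f,
      D'.isPGroup.of_equiv φ, by
        rw [MulEquiv.orderOf_eq]
        exact D'.coprime⟩
    refine ⟨Quotient.mk s j, DPair.Iso.trans (D' := E j) ⟨φ, fun q => ?_⟩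
      (s.symm (Quotient.mk_out j))⟩
    exact congrArg (fun z => φ (D'.u z)) (φ.symm_apply_apply q).symm

end Decomposition

section Semisimple

variable {k : Type u} [Field k] {F : Type v} [Field F]

namespace DiagPPermFunctor

variable {S : DiagPPermFunctor k F}

/-- The sum of a family of subfunctors. -/
def Sub.iSup {ι : Type w} (N : ι → Sub S) : Sub S where
  val X := ⨆ i, (N i).val X
  act_mem {X Y} f {x} hx := by
    have h1 : (⨆ i, (N i).val X) ≤ (⨆ i, (N i).val Y).comap (S.act f) :=
      iSup_le fun i x hx => Submodule.mem_iSup_of_mem i ((N i).act_mem f hx)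
    exact h1 hx

/-- A functor is the coproduct of subfunctors whose values are direct sums decompositions. -/
theorem isColimit_of_decomposition {ι : Type w} (N : ι → Sub S)
    (h : ∀ X, iSupIndep (fun i => (N i).val X) ∧ ⨆ i, (N i).val X = ⊤) :
    Nonempty (Limits.IsColimit (Limits.Cofan.mk S fun i => (N i).incl)) := by
  classical
  have hi : ∀ X, DirectSum.IsInternal fun i => (N i).val X := fun X =>
    DirectSum.isInternal_submodule_of_iSupIndep_of_iSup_eq_top (h X).1 (h X).2
  let e : ∀ X, (DirectSum ι fun i => (N i).val X) ≃ₗ[F] S.obj.obj X := fun X =>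
    LinearEquiv.ofBijective (DirectSum.coeLinearMap fun i => (N i).val X) (hi X)
  let a : ∀ (c : Limits.Cofan fun i => (N i).toFunctor) X i, (N i).val X →ₗ[F] c.pt.obj.obj X :=
    fun c X i => appₗ (c.inj i) X
  let d : ∀ (c : Limits.Cofan fun i => (N i).toFunctor) X, S.obj.obj X →ₗ[F] c.pt.obj.obj X :=
    fun c X => DirectSum.toModule F ι _ (a c X) ∘ₗ (e X).symm.toLinearMap
  have hd : ∀ c X i (x : (N i).val X), d c X x = a c X i x := fun c X i x => by
    have h1 : (e X).symm (x : S.obj.obj X) = DirectSum.lof F ι (fun i => (N i).val X) i x := by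
      rw [LinearEquiv.symm_apply_eq]
      exact (DirectSum.coeLinearMap_lof (fun i => (N i).val X) i x).symm
    change DirectSum.toModule F ι _ (a c X) ((e X).symm (x : S.obj.obj X)) = _
    rw [h1, DirectSum.toModule_lof]
  have hext : ∀ {X} {V : Type (max u v)} [AddCommGroup V] [Module F V]
      (a b : S.obj.obj X →ₗ[F] V), (∀ i, ∀ x ∈ (N i).val X, a x = b x) → a = b := by
    intro X V _ _ a b hab
    refine LinearMap.ext fun x => ?_
    have h1 : (⨆ i, (N i).val X) ≤ LinearMap.eqLocus a b := iSup_le fun i x hx => hab i x hx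
    rw [(h X).2] at h1
    exact h1 trivial
  refine ⟨Limits.Cofan.IsColimit.mk _ (fun c => ofApp (d c) fun {X Y} f x => ?_) (fun c i => ?_)
    fun c m hm => ?_⟩
  · refine LinearMap.congr_fun (hext (d c Y ∘ₗ S.act f) (c.pt.act f ∘ₗ d c X) fun i x hx => ?_) x
    refine (hd c Y i ⟨S.act f x, (N i).act_mem f hx⟩).trans ?_
    refine Eq.trans ?_ (congrArg (c.pt.act f) (hd c X i ⟨x, hx⟩)).symm
    exact appₗ_act (c.inj i) f (⟨x, hx⟩ : (N i).val X)
  · exact hom_ext fun X x => hd c X i x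
  · refine hom_ext fun X x => LinearMap.congr_fun (hext (appₗ m X) (d c X) fun i x hx => ?_) x
    refine Eq.trans ?_ (hd c X i ⟨x, hx⟩).symm
    exact congrArg (fun l : (N i).toFunctor ⟶ c.pt =>
      appₗ l X (⟨x, hx⟩ : (N i).val X)) (hm i)

variable {p : ℕ} [Fact p.Prime] [CharP k p] [IsAlgClosed k] [CharZero F]

/-- Every functor is the direct sum of simple subfunctors. -/
theorem exists_decomposition (p : ℕ) [Fact p.Prime] [CharP k p] (θ : BrauerLift k F)
    (S : DiagPPermFunctor k F) :
    ∃ (ι : Type (max u v)) (N : ι → Sub S), (∀ i, Simple (N i).toFunctor) ∧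
      ∀ X, iSupIndep (fun i => (N i).val X) ∧ ⨆ i, (N i).val X = ⊤ := by
  obtain ⟨J, D, hD, hD'⟩ := DPair.exists_representatives p
  choose ι W hind hsup hirr using fun j => exists_isIrred_decomposition θ S (D j)
  refine ⟨Σ j, ι j, fun i => Sub.gen (W i.1 i.2), fun i => (hirr i.1 i.2).simple_gen,
    fun X => ⟨?_, ?_⟩⟩
  · rw [iSupIndep_def]
    rintro ⟨j, a⟩
    rw [Submodule.disjoint_def]
    intro x hx hx'
    let M : Sub S := Sub.iSup fun i : {i : Σ j, ι j // i ≠ ⟨j, a⟩} => Sub.gen (W i.1.1 i.1.2)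
    have hxM : x ∈ M.val X := by
      rw [iSup_subtype'] at hx'
      exact hx'
    refine Sub.mem_of_forall θ (Sub.bot S) fun D' f => ?_
    obtain ⟨j', h1⟩ := hD' D'
    refine Sub.act_idem_mem_of_iso θ (Sub.bot S) h1 fun g => ?_
    have hz := (Sub.gen (W j a)).act_mem (X := ⟨D'.grp⟩) (Y := ⟨(D j').grp⟩) g ((Sub.gen (W j a)).act_mem (Y := ⟨D'.grp⟩) f hx)
    have hzM := M.act_mem (X := ⟨D'.grp⟩) (Y := ⟨(D j').grp⟩) g (M.act_mem (Y := ⟨D'.grp⟩) f hxM)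
    generalize S.act (X := ⟨D'.grp⟩) (Y := ⟨(D j').grp⟩) g (S.act (Y := ⟨D'.grp⟩) f x) = z at hz hzM
    by_cases h2 : j' = j
    · subst h2
      refine Submodule.disjoint_def.1 (hind j' a) _ ((hirr j' a).isStable.act_idem_mem_of_mem_gen hz) ?_
      have h3 : M.val ⟨(D j').grp⟩ ≤ (⨆ (b) (_ : b ≠ a), W j' b).comap
          (S.act (X := ⟨(D j').grp⟩) (Y := ⟨(D j').grp⟩) ((D j').idem θ)) := by
        refine iSup_le ?_
        rintro ⟨⟨j'', b⟩, hb⟩ y hy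
        rw [Submodule.mem_comap]
        by_cases h4 : j' = j''
        · subst h4
          refine Submodule.mem_iSup_of_mem b (Submodule.mem_iSup_of_mem (fun h5 => hb ?_)
            ((hirr j' b).isStable.act_idem_mem_of_mem_gen hy))
          rw [h5]
        · have h5 := (hirr j'' b).isStable.act_idem_eq_zero_of_mem_gen (fun h => h4 (hD _ _ h)) hy
          rw [h5]
          exact zero_mem _
      exact h3 hzM
    · exact (hirr j a).isStable.act_idem_eq_zero_of_mem_gen (fun h => h2 (hD _ _ h)) hz
  · rw [eq_top_iff]
    rintro x -
    let M : Sub S := Sub.iSup fun i : (Σ j, ι j) => Sub.gen (W i.1 i.2)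
    refine Sub.mem_of_forall θ M fun D' f => ?_
    obtain ⟨j, h1⟩ := hD' D'
    refine Sub.act_idem_mem_of_iso θ M h1 fun g => ?_
    have h2 := act_idem_mem_component θ (S := S) (S.act (X := ⟨D'.grp⟩) (Y := ⟨(D j).grp⟩) g
      (S.act (Y := ⟨D'.grp⟩) f x))
    rw [← hsup] at h2
    have h3 : (⨆ b, W j b) ≤ M.val ⟨(D j).grp⟩ := iSup_le fun b =>
      (Sub.le_gen _).trans (le_iSup (fun i : (Σ j, ι j) =>
        (Sub.gen (W i.1 i.2)).val ⟨(D j).grp⟩) ⟨j, b⟩)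
    exact h3 h2

/-- Diagonal `p`-permutation functors form a semisimple category. -/
theorem isSemisimpleCat (p : ℕ) [Fact p.Prime] [CharP k p] (θ : BrauerLift k F) :
    IsSemisimpleCat.{max u v} (DiagPPermFunctor k F) := by
  refine ⟨exists_abelian, fun S => ?_⟩
  obtain ⟨ι, N, h1, h2⟩ := exists_decomposition p θ S
  exact ⟨ι, fun i => (N i).toFunctor, Limits.Cofan.mk S fun i => (N i).incl, h1, rfl,
    isColimit_of_decomposition N h2⟩

end DiagPPermFunctor

/-- A relation between two types with equivalence relations which is invariant, total and unique on
both sides induces a bijection between the quotients. -/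
theorem exists_quotient_equiv {α : Type w} {β : Type w'} (r : Setoid α) (s : Setoid β)
    (R : α → β → Prop) (hr : ∀ {a a' b}, r a a' → R a b → R a' b)
    (hs : ∀ {a b b'}, s b b' → R a b → R a b') (h1 : ∀ a, ∃ b, R a b) (h2 : ∀ b, ∃ a, R a b)
    (h3 : ∀ {a a' b}, R a b → R a' b → r a a') (h4 : ∀ {a b b'}, R a b → R a b' → s b b') :
    ∃ Φ : Quotient r ≃ Quotient s, ∀ a b, Φ (Quotient.mk r a) = Quotient.mk s b ↔ R a b := by
  choose f hf using h1
  choose g hg using h2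
  let Φ : Quotient r ≃ Quotient s :=
    { toFun := Quotient.map f fun a a' h => h4 (hr h (hf a)) (hf a')
      invFun := Quotient.map g fun b b' h => h3 (hs h (hg b)) (hg b')
      left_inv := by
        rintro ⟨a⟩
        exact Quotient.sound (h3 (hg (f a)) (hf a))
      right_inv := by
        rintro ⟨b⟩
        exact Quotient.sound (h4 (hf (g b)) (hg b)) }
  refine ⟨Φ, fun a b => ⟨fun h => hs (Quotient.exact h) (hf a), fun h => Quotient.sound
    (h4 (hf a) h)⟩⟩

end Semisimple

end DiagPPerm

end

theorem mainTheorem1 (k : Type u) [Field k] [IsAlgClosed k] (p : ℕ) [Fact p.Prime] [CharP k p]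
    (F : Type v) [Field F] [IsAlgClosed F] [CharZero F] :
    DiagPPerm.IsSemisimpleCat.{max u v} (DiagPPerm.DiagPPermFunctor k F) ∧
    ∀ θ : DiagPPerm.BrauerLift k F,
      ∃ Φ : DiagPPerm.TripleClass p F ≃ DiagPPerm.SimpleClass k F,
        ∀ (t : DiagPPerm.Triple p F) (S : DiagPPerm.SimpleFunctor k F),
          Φ (Quotient.mk _ t) = Quotient.mk _ S ↔ DiagPPerm.Corresponds θ t S.1 := by
  refine ⟨?_, fun θ => ?_⟩
  · obtain ⟨θ⟩ := DiagPPerm.BrauerLift.nonempty k p F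
    exact DiagPPerm.DiagPPermFunctor.isSemisimpleCat p θ
  · refine DiagPPerm.exists_quotient_equiv _ _
      (fun (t : DiagPPerm.Triple p F) (S : DiagPPerm.SimpleFunctor k F) =>
        DiagPPerm.Corresponds θ t S.1)
      (fun h => DiagPPerm.DiagPPermFunctor.corresponds_of_equiv h)
      (fun ⟨i⟩ => DiagPPerm.DiagPPermFunctor.corresponds_of_iso i) (fun t => ?_) (fun S => ?_)
      (fun {_ _ S} => DiagPPerm.DiagPPermFunctor.equiv_of_corresponds S.2)
      (fun {_ S T} => DiagPPerm.DiagPPermFunctor.iso_of_corresponds S.2 T.2)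
    · obtain ⟨S, hS, h⟩ := DiagPPerm.DiagPPermFunctor.exists_simple t θ
      exact ⟨⟨S, hS⟩, h⟩
    · obtain ⟨D, hD⟩ := DiagPPerm.DiagPPermFunctor.exists_isIrred θ S.2
      exact DiagPPerm.DiagPPermFunctor.exists_corresponds hD
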